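/- **Setting.** All fields are real-valued on $\mathbb R^3$. For $T>0$, $1\le r\le\infty$, let $X_r$ (resp. $Y_r$) be the space of vector fields $u$ (resp. scalar functions $\theta$) in $L^1_{\rm loc}((0,T),L^r(\mathbb R^3))$ with $$\|u\|_{X_r}=\sup_{0<t<T}t^{\frac12(1-\frac3r)}\|u(t)\|_r<\infty,\qquad \|\theta\|_{Y_r}=\sup_{0<t<T}t^{\frac32(1-\frac1r)}\|\theta(t)\|_r<\infty$$ (essential suprema). Let $X$ be the space of divergence-free $u\in C([0,T],L^3)$ with $\sup_{[0,T]}\|u(t)\|_3+\sup_{(0,T]}\sqrt t\,\|u(t)\|_\infty<\infty$ and $\sqrt t\,\|u(t)\|_\infty\to0$ as $t\to0$, and $Y$ the space of $\theta\in C([0,T],L^1)$ with $\sup_{[0,T]}\|\theta(t)\|_1+\sup_{(0,T]}t^{3/2}\|\theta(t)\|_\infty<\infty$ and $t^{3/2}\|\theta(t)\|_\infty\to0$ as $t\to0$. For $\sigma>0$, the inhomogeneous Besov space $B^{-\sigma}_{r,\infty}(\mathbb R^3)$ consists of the tempered distributions $f$ with $\|f\|_{B^{-\sigma}_{r,\infty}}=\sup_{0<t<1}t^{\sigma/2}\|e^{t\Delta}f\|_r<\infty$.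 A mild solution on $(0,T)$ of the Boussinesq system with data $(u_0,\theta_0)$ is a pair $(u,\theta)$ such that $\nabla\cdot u_0=0$ and, for almost every $(t,x)\in(0,T)\times\mathbb R^3$, with absolutely convergent integrals, $$\theta(t)=e^{t\Delta}\theta_0-\int_0^te^{(t-s)\Delta}\nabla\cdot(\theta u)(s)\,ds,$$ $$u(t)=e^{t\Delta}u_0-\int_0^te^{(t-s)\Delta}\mathbb P\nabla\cdot(u\otimes u)(s)\,ds+\int_0^te^{(t-s)\Delta}\mathbb P\,\theta(s)e_3\,ds,$$ where $e_3=(0,0,1)$ and $\mathbb P$ is the Leray projector onto divergence-free fields, the operators $e^{t\Delta}\nabla\cdot$, $e^{t\Delta}\mathbb P\nabla\cdot$ and $e^{t\Delta}\mathbb P$ acting by convolution with their kernels. **Theorem.** Let $\frac32<q<3$ and $p>3$ with $\frac23<\frac1p+\frac1q$. There is $R>0$, depending only on $p$ and $q$, such that the following holds. Let $\theta_0$ be in the closure of the Schwartz class in $B^{-3(1-1/q)}_{q,\infty}(\mathbb R^3)$, and let $u_0$ be a divergence-free vector field in the closure of the Schwartz class in $B^{-(1-3/p)}_{p,\infty}(\mathbb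 R^3)$. Then there are $T>0$ and a mild solution $(u,\theta)$ on $(0,T)$ with data $(u_0,\theta_0)$ such that: 1. $(u,\theta)\in X_p\times Y_q$, and the norms of $u$ and $\theta$ in $X_p$ and $Y_q$ over $(0,S)$ tend to $0$ as $S\to0$. Moreover $\|u\|_{X_p}<R$ and $\|\theta\|_{Y_q}<R$, and for every $0<S\le T$, any mild solution $(v,\eta)$ on $(0,S)$ with data $(u_0,\theta_0)$ in $X_p\times Y_q$ whose norms over $(0,S)$ satisfy $\|v\|_{X_p}<R$ and $\|\eta\|_{Y_q}<R$ coincides with $(u,\theta)$ on $(0,S)$. 2. $u\in X_p\cap X_\infty$ and $\theta\in Y_q\cap Y_\infty$, and the norms of $u$ and $\theta$ in $X_\infty$ and $Y_\infty$ over $(0,S)$ tend to $0$ as $S\to0$. 3. If moreover $u_0\in L^3(\mathbb R^3)$, then $u\in X\cap X_3$ and $u(0)=u_0$. If moreover $\theta_0\in L^1(\mathbb R^3)$, then $\theta\in Y\cap Y_1$ and $\theta(0)=\theta_0$. (Here $u$, $\theta$ are identified with their representatives that are continuous in time.) -/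

import Mathlib

open MeasureTheory Set Filter Topology
open scoped ENNReal SchwartzMap FourierTransform LineDeriv

noncomputable section

namespace Boussinesq

/-- Physical space `ℝ³` with its Euclidean norm. -/
abbrev E3 : Type := EuclideanSpace ℝ (Fin 3)

/-- The `l`-th vector of the canonical basis of `ℝ³`. -/
def basisVec (l : Fin 3) : E3 := EuclideanSpace.single l (1 : ℝ)

/-- The classical partial derivative `∂_l f (x)`. -/
def pderiv (l : Fin 3) (f : E3 → ℝ) (x : E3) : ℝ := fderiv ℝ f x (basisVec l)

/-! ### Kernels -/

/-- The heat kernel `(4πt)^{-3/2} exp(-|x|²/(4t))`, the kernel of `e^{tΔ}`. -/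
def heatKernel (t : ℝ) (x : E3) : ℝ :=
  (4 * Real.pi * t) ^ (-(3 / 2) : ℝ) * Real.exp (-(1 / (4 * t)) * ‖x‖ ^ 2)

/-- The Fourier symbol `exp(-4π²t|ξ|²) (δ_{jk} - ξ_j ξ_k / |ξ|²)` of the entry `(j,k)` of `e^{tΔ}ℙ`,
where `ℙ` is the Leray projector. Mathlib's Fourier transform has the phase `exp(-2πi⟨x,ξ⟩)`, so
that `Δ` has the symbol `-4π²|ξ|²`. -/
def heatLeraySymbol (t : ℝ) (j k : Fin 3) (ξ : E3) : ℝ :=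
  Real.exp (-(4 * Real.pi ^ 2 * t * ‖ξ‖ ^ 2)) *
    ((if j = k then 1 else 0) - ξ j * ξ k / ‖ξ‖ ^ 2)

/-- The entry `(j,k)` of the kernel of `e^{tΔ}ℙ`: the inverse Fourier transform of its symbol
(which is integrable for `t > 0`; the transform is real since the symbol is real and even). -/
def heatLerayKernel (t : ℝ) (j k : Fin 3) (x : E3) : ℝ :=
  (𝓕⁻ (fun ξ : E3 => (heatLeraySymbol t j k ξ : ℂ)) x).re

/-! ### The heat kernel is a Schwartz function -/

section Gaussian

variable {F : Type} [NormedAddCommGroup F] [NormedSpace ℝ F]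

lemma one_add_pow_mul_exp_le {a : ℝ} (ha : 0 < a) (N : ℕ) {r : ℝ} (hr : 0 ≤ r) :
    (1 + r) ^ N * Real.exp (-a * r ^ 2) ≤ N.factorial * Real.exp (1 + 1 / (4 * a)) := by
  have h1 : (1 + r) ^ N ≤ N.factorial * Real.exp (1 + r) := by
    have := Real.pow_div_factorial_le_exp (x := 1 + r) (by positivity) N
    rw [div_le_iff₀ (by positivity)] at this
    linarith
  have h2 : (1 + r) + (-a * r ^ 2) ≤ 1 + 1 / (4 * a) := by
    have h3 : 1 / (4 * a) - r + a * r ^ 2 = (2 * a * r - 1) ^ 2 / (4 * a) := by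
      field_simp
      ring
    have h4 : 0 ≤ (2 * a * r - 1) ^ 2 / (4 * a) := by positivity
    linarith
  calc (1 + r) ^ N * Real.exp (-a * r ^ 2)
      ≤ (N.factorial * Real.exp (1 + r)) * Real.exp (-a * r ^ 2) := by gcongr
    _ = N.factorial * Real.exp ((1 + r) + (-a * r ^ 2)) := by
        rw [Real.exp_add (1 + r), mul_assoc]
    _ ≤ _ := by gcongr

lemma hasFDerivAt_gauss (a : ℝ) (x : E3) :
    HasFDerivAt (fun y : E3 => Real.exp (-a * ‖y‖ ^ 2))
      (Real.exp (-a * ‖x‖ ^ 2) • ((-a) • (2 • (innerSL ℝ x)))) x := by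
  have h := (hasStrictFDerivAt_norm_sq x).hasFDerivAt
  exact (h.const_mul (-a)).exp

/-- A function of temperate growth times a Gaussian decays rapidly with all its derivatives. -/
lemma decay_smul_gauss {a : ℝ} (ha : 0 < a) (k n : ℕ) :
    ∀ {F : Type} [NormedAddCommGroup F] [NormedSpace ℝ F] (g : E3 → F),
      g.HasTemperateGrowth →
      ∃ C, ∀ x, ‖x‖ ^ k * ‖iteratedFDeriv ℝ n (fun y => Real.exp (-a * ‖y‖ ^ 2) • g y) x‖ ≤ C := by
  induction n with
  | zero =>
    intro F _ _ g hg
    obtain ⟨m, C, hC⟩ := hg.2 0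
    refine ⟨|C| * ((k + m).factorial * Real.exp (1 + 1 / (4 * a))), fun x => ?_⟩
    have hx := hC x
    simp only [norm_iteratedFDeriv_zero] at hx ⊢
    rw [norm_smul, Real.norm_of_nonneg (Real.exp_pos _).le]
    have hx' : ‖g x‖ ≤ |C| * (1 + ‖x‖) ^ m := hx.trans (by gcongr; exact le_abs_self C)
    have hk : ‖x‖ ^ k ≤ (1 + ‖x‖) ^ k := by gcongr; linarith
    calc ‖x‖ ^ k * (Real.exp (-a * ‖x‖ ^ 2) * ‖g x‖)
        ≤ (1 + ‖x‖) ^ k * (Real.exp (-a * ‖x‖ ^ 2) * (|C| * (1 + ‖x‖) ^ m)) := by gcongr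
      _ = |C| * ((1 + ‖x‖) ^ (k + m) * Real.exp (-a * ‖x‖ ^ 2)) := by ring
      _ ≤ _ := by
        refine mul_le_mul_of_nonneg_left ?_ (abs_nonneg C)
        exact one_add_pow_mul_exp_le ha (k + m) (norm_nonneg x)
  | succ n ih =>
    intro F _ _ g hg
    have hgd : Differentiable ℝ g := hg.1.differentiable (by simp)
    have hgf : (fderiv ℝ g).HasTemperateGrowth := by
      refine ⟨hg.1.fderiv_right (by simp), fun n => ?_⟩
      obtain ⟨k, C, h⟩ := hg.2 (n + 1)
      refine ⟨k, C, fun x => ?_⟩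
      have := h x
      rwa [← norm_iteratedFDeriv_fderiv] at this
    let S : E3 → (E3 →L[ℝ] F) := fun y => ((-a) • (2 • (innerSL ℝ y))).smulRight (g y)
    have hS : S.HasTemperateGrowth := by
      have h1 : (fun y : E3 => (-a) • (2 • (innerSL ℝ y))).HasTemperateGrowth := by
        have : (fun y : E3 => (-a) • (2 • (innerSL ℝ y))) =
            (((-a) • (2 • (innerSL ℝ : E3 →L[ℝ] E3 →L[ℝ] ℝ))) : E3 →L[ℝ] E3 →L[ℝ] ℝ) := by
          ext
          simp [innerSL_apply_apply]
          exact Or.inl rfl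
        rw [this]
        exact ContinuousLinearMap.hasTemperateGrowth _
      exact (ContinuousLinearMap.smulRightL ℝ E3 F).bilinear_hasTemperateGrowth h1 hg
    have hfd : fderiv ℝ (fun y => Real.exp (-a * ‖y‖ ^ 2) • g y) =
        fun y => Real.exp (-a * ‖y‖ ^ 2) • (fderiv ℝ g y + S y) := by
      funext x
      have h := ((hasFDerivAt_gauss a x).smul (hgd x).hasFDerivAt).fderiv
      refine Eq.trans h ?_
      ext v
      simp [S, smul_smul, mul_assoc]
    obtain ⟨C, hC⟩ := ih _ (hgf.add hS)
    refine ⟨C, fun x => ?_⟩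
    rw [← norm_iteratedFDeriv_fderiv, hfd]
    exact hC x

/-- The Gaussian `y ↦ exp(-a|y|²)` as a Schwartz function. -/
def gaussSchwartz (a : ℝ) (ha : 0 < a) : 𝓢(E3, ℝ) where
  toFun y := Real.exp (-a * ‖y‖ ^ 2)
  smooth' := by
    have : ContDiff ℝ (⊤ : ℕ∞) (fun y : E3 => ‖y‖ ^ 2) := contDiff_norm_sq ℝ
    fun_prop
  decay' k n := by
    have := decay_smul_gauss ha k n (fun _ : E3 => (1 : ℝ)) (by fun_prop)
    simpa using this

end Gaussian

/-- For `t > 0`, the Schwartz function `y ↦ heatKernel t (x - y)`. -/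
def heatKernelAt (t : ℝ) (ht : 0 < t) (x : E3) : 𝓢(E3, ℝ) :=
  (4 * Real.pi * t) ^ (-(3 / 2) : ℝ) •
    SchwartzMap.compSubConstCLM ℝ x (gaussSchwartz (1 / (4 * t)) (by positivity))

lemma heatKernelAt_apply (t : ℝ) (ht : 0 < t) (x y : E3) :
    heatKernelAt t ht x y = heatKernel t (x - y) := by
  rw [heatKernel, norm_sub_rev x y]
  rfl

/-! ### Real tempered distributions and Besov spaces of negative order -/

section Distributions

variable {F : Type} [NormedAddCommGroup F] [NormedSpace ℝ F]

variable (F) in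
/-- Tempered distributions on `ℝ³` with values in the real space `F` (scalar or vector valued). -/
abbrev TDist : Type := 𝓢(E3, ℝ) →L[ℝ] F

/-- The tempered distribution defined by a Schwartz function: `φ ↦ ∫ φ(x) ψ(x) dx`. -/
def ofSchwartz [CompleteSpace F] (ψ : 𝓢(E3, F)) : TDist F :=
  (SchwartzMap.integralCLM ℝ (volume : Measure E3)) ∘L
    (SchwartzMap.pairing (ContinuousLinearMap.lsmul ℝ ℝ : ℝ →L[ℝ] F →L[ℝ] F).flip ψ)

lemma ofSchwartz_apply [CompleteSpace F] (ψ : 𝓢(E3, F)) (φ : 𝓢(E3, ℝ)) :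
    ofSchwartz ψ φ = ∫ x, φ x • ψ x := rfl

/-- The distribution `f` is the function `g` (used for `g` in a Lebesgue space). -/
def IsFunction (f : TDist F) (g : E3 → F) : Prop :=
  ∀ φ : 𝓢(E3, ℝ), f φ = ∫ x, φ x • g x

/-- The heat flow of a tempered distribution for `t > 0`: the function
`(e^{tΔ} f)(x) = ⟨f, heatKernel t (x - ·)⟩`. (The value for `t ≤ 0` is never used.) -/
def heatFlow (t : ℝ) (f : TDist F) (x : E3) : F :=
  if ht : 0 < t then f (heatKernelAt t ht x) else 0

/-- The norm of the inhomogeneous Besov space `B^{-σ}_{r,∞}(ℝ³)`, `σ > 0`, in its heat kernel form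
`sup_{0<t<1} t^{σ/2} ‖e^{tΔ} f‖_r`. -/
def besovNorm (σ : ℝ) (r : ℝ≥0∞) (f : TDist F) : ℝ≥0∞ :=
  ⨆ t ∈ Ioo (0 : ℝ) 1, ENNReal.ofReal (t ^ (σ / 2)) * eLpNorm (heatFlow t f) r volume

/-- `f` belongs to the closure of the Schwartz class in `B^{-σ}_{r,∞}(ℝ³)`. -/
def MemBesovClosure [CompleteSpace F] (σ : ℝ) (r : ℝ≥0∞) (f : TDist F) : Prop :=
  besovNorm σ r f < ∞ ∧
    ∀ ε : ℝ≥0∞, 0 < ε → ∃ ψ : 𝓢(E3, F), besovNorm σ r (f - ofSchwartz ψ) < ε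

end Distributions

/-- `∇ · f = 0` for a tempered vector field. -/
def DivFreeDist (f : TDist E3) : Prop :=
  ∀ φ : 𝓢(E3, ℝ), ∑ l : Fin 3, f (∂_{basisVec l} φ) l = 0

/-- `∇ · v = 0` in the sense of distributions for a vector field in a Lebesgue space. -/
def DivFree (v : E3 → E3) : Prop :=
  ∀ φ : 𝓢(E3, ℝ), ∫ x, ∑ l : Fin 3, v x l * pderiv l φ x = 0

/-! ### Function spaces on `(0,T) × ℝ³`

A time-dependent field is a function of `t` and `x`; fields that agree for almost every `t` and
almost every `x` are the same element of the spaces below, and only the values for `0 < t < T`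
matter. -/

section Spaces

variable {F : Type} [NormedAddCommGroup F]

/-- `v ∈ L¹_loc((0,T), L^r(ℝ³))`, with `1 ≤ r ≤ ∞`, in the sense of Bochner. -/
def MemL1loc [NormedSpace ℝ F] (T : ℝ) (r : ℝ≥0∞) (v : ℝ → E3 → F) : Prop :=
  ∃ _ : Fact (1 ≤ r), ∃ V : ℝ → Lp F r (volume : Measure E3),
    LocallyIntegrableOn V (Ioo 0 T) volume ∧
      ∀ᵐ t ∂(volume.restrict (Ioo 0 T)), ∀ᵐ x ∂(volume : Measure E3), V t x = v t x

/-- `sup_{t∈(0,T)} t^{(1-3/r)/2} ‖v(t)‖_r`. -/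
def normX (T : ℝ) (r : ℝ≥0∞) (v : ℝ → E3 → F) : ℝ≥0∞ :=
  essSup (fun t => ENNReal.ofReal (t ^ ((1 - 3 * (r⁻¹).toReal) / 2)) * eLpNorm (v t) r volume)
    (volume.restrict (Ioo 0 T))

/-- `sup_{t∈(0,T)} t^{(3/2)(1-1/r)} ‖v(t)‖_r`. -/
def normY (T : ℝ) (r : ℝ≥0∞) (v : ℝ → E3 → F) : ℝ≥0∞ :=
  essSup (fun t => ENNReal.ofReal (t ^ ((3 / 2) * (1 - (r⁻¹).toReal))) * eLpNorm (v t) r volume)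
    (volume.restrict (Ioo 0 T))

/-- `v ∈ C([0,T], L^r(ℝ³))`. -/
def ContinuousInto (T : ℝ) (r : ℝ≥0∞) (v : ℝ → E3 → F) : Prop :=
  (∀ t ∈ Icc 0 T, MemLp (v t) r volume) ∧
    ∀ t ∈ Icc 0 T, Tendsto (fun s => eLpNorm (v s - v t) r volume) (𝓝[Icc 0 T] t) (𝓝 0)

end Spaces

/-- The space `X_r` of velocities on `(0,T)`. -/
def MemXr (T : ℝ) (r : ℝ≥0∞) (u : ℝ → E3 → E3) : Prop :=
  MemL1loc T r u ∧ normX T r u < ∞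

/-- The space `Y_r` of temperatures on `(0,T)`. -/
def MemYr (T : ℝ) (r : ℝ≥0∞) (θ : ℝ → E3 → ℝ) : Prop :=
  MemL1loc T r θ ∧ normY T r θ < ∞

/-- The space `X`: divergence-free `u ∈ C([0,T], L³)` with
`sup_{[0,T]} ‖u(t)‖_3 + sup_{(0,T]} √t ‖u(t)‖_∞ < ∞` and `√t ‖u(t)‖_∞ → 0` as `t → 0`. -/
def MemX (T : ℝ) (u : ℝ → E3 → E3) : Prop :=
  ContinuousInto T 3 u ∧ (∀ t ∈ Icc 0 T, DivFree (u t)) ∧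
    (⨆ t ∈ Icc 0 T, eLpNorm (u t) 3 volume) +
      (⨆ t ∈ Ioc 0 T, ENNReal.ofReal (√t) * eLpNorm (u t) ∞ volume) < ∞ ∧
    Tendsto (fun t => ENNReal.ofReal (√t) * eLpNorm (u t) ∞ volume) (𝓝[>] 0) (𝓝 0)

/-- The space `Y`: `θ ∈ C([0,T], L¹)` with
`sup_{[0,T]} ‖θ(t)‖_1 + sup_{(0,T]} t^{3/2} ‖θ(t)‖_∞ < ∞` and `t^{3/2} ‖θ(t)‖_∞ → 0` as `t → 0`. -/
def MemY (T : ℝ) (θ : ℝ → E3 → ℝ) : Prop :=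
  ContinuousInto T 1 θ ∧
    (⨆ t ∈ Icc 0 T, eLpNorm (θ t) 1 volume) +
      (⨆ t ∈ Ioc 0 T, ENNReal.ofReal (t ^ (3 / 2 : ℝ)) * eLpNorm (θ t) ∞ volume) < ∞ ∧
    Tendsto (fun t => ENNReal.ofReal (t ^ (3 / 2 : ℝ)) * eLpNorm (θ t) ∞ volume) (𝓝[>] 0) (𝓝 0)

/-! ### Mild solutions -/

/-- Lebesgue measure on `(0,t) × ℝ³`. -/
def slab (t : ℝ) : Measure (ℝ × E3) := (volume.restrict (Ioo 0 t)).prod volume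

/-- The integrand in `(s,y)` of `∫₀ᵗ e^{(t-s)Δ} ∇·(θu)(s) ds` at the point `x`. -/
def heatFlux (u : ℝ → E3 → E3) (θ : ℝ → E3 → ℝ) (t : ℝ) (x : E3) (z : ℝ × E3) : ℝ :=
  ∑ l : Fin 3, pderiv l (heatKernel (t - z.1)) (x - z.2) * (θ z.1 z.2 * u z.1 z.2 l)

/-- The integrand in `(s,y)` of the `j`-th component of `∫₀ᵗ e^{(t-s)Δ} ℙ∇·(u⊗u)(s) ds` at `x`. -/
def momentumFlux (u : ℝ → E3 → E3) (j : Fin 3) (t : ℝ) (x : E3) (z : ℝ × E3) : ℝ :=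
  ∑ k : Fin 3, ∑ l : Fin 3,
    pderiv l (heatLerayKernel (t - z.1) j k) (x - z.2) * (u z.1 z.2 k * u z.1 z.2 l)

/-- The integrand in `(s,y)` of the `j`-th component of `∫₀ᵗ e^{(t-s)Δ} ℙ θ(s)e₃ ds` at `x`
(`e₃` has index `2`). -/
def buoyancy (θ : ℝ → E3 → ℝ) (j : Fin 3) (t : ℝ) (x : E3) (z : ℝ × E3) : ℝ :=
  heatLerayKernel (t - z.1) j 2 (x - z.2) * θ z.1 z.2

/-- `(u,θ)` is a mild solution of the Boussinesq system on `(0,T)` with data `(u₀,θ₀)`: the integral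
equations hold for almost every `(t,x)`, with absolutely convergent integrals. -/
structure IsMildSolution (T : ℝ) (u₀ : TDist E3) (θ₀ : TDist ℝ)
    (u : ℝ → E3 → E3) (θ : ℝ → E3 → ℝ) : Prop where
  divFree : DivFreeDist u₀
  measurable_u : AEStronglyMeasurable (fun z : ℝ × E3 => u z.1 z.2) (slab T)
  measurable_θ : AEStronglyMeasurable (fun z : ℝ × E3 => θ z.1 z.2) (slab T)
  temperature : ∀ᵐ t ∂(volume.restrict (Ioo 0 T)), ∀ᵐ x ∂(volume : Measure E3),
    Integrable (heatFlux u θ t x) (slab t) ∧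
    θ t x = heatFlow t θ₀ x - ∫ z, heatFlux u θ t x z ∂(slab t)
  velocity : ∀ᵐ t ∂(volume.restrict (Ioo 0 T)), ∀ᵐ x ∂(volume : Measure E3), ∀ j : Fin 3,
    Integrable (momentumFlux u j t x) (slab t) ∧ Integrable (buoyancy θ j t x) (slab t) ∧
    u t x j = heatFlow t u₀ x j - (∫ z, momentumFlux u j t x z ∂(slab t))
      + ∫ z, buoyancy θ j t x z ∂(slab t)

end Boussinesq

end

open Boussinesq

noncomputable section

namespace Boussinesq

/-! ### Minkowski's integral inequality for nonnegative functions. -/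

section Minkowski

variable {X Y : Type*} [MeasurableSpace X] [MeasurableSpace Y]

/-! The system is solved by contraction in spaces whose norms are invariant under the parabolic
scaling. In dimension three, `e^{tΔ}` composed with `m` derivatives, `m = 0` or `1`, with or without
`ℙ`, maps `L^c` to `L^b` with norm at most a constant times `t^{-γ}`, where `γ = m/2 + (3/2)(1/c -
1/b)`. For a velocity in `X_a` and a second factor bounded by `s^{-ν}` in `L^b`, Hölder's inequality
and this estimate bound the Duhamel integral by the integral of `(t-s)^{-1/2-3/(2a)}
s^{-(1/2-3/(2a))-ν}` over `(0,t)`. This is a Beta integral equal to a constant times `t^{-ν}`, so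
the norm of the second factor is reproduced (`exists_flux_le`). It converges at `s = t` because `a >
3`, and at `s = 0` if the two weights add up to less than `1`; for the pair `X_p`, `Y_q` the latter
says exactly `2/3 < 1/p + 1/q`. The buoyancy integral sends `Y_q` to `X_b` for `b ≥ 3` by the same
computation, and this is where `3/2 < q < 3` is used (`exists_buoyancy_le`).

The singular symbol of `ℙ` is never estimated. Since `e^{-t|ξ|²}/|ξ|²` is the integral of
`e^{-s|ξ|²}` over `s > t`, the kernel of `e^{tΔ}ℙ` is an integral over `s > t` of second derivatives
of the heat kernel (`heatPot_densityLeray`), each at most a constant times `s^{-1}` times the heat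
kernel at time `2s`. Every Duhamel integral is thus dominated by a positive superposition `heatSup`
of heat averages, over the region `regA t` of pairs `(s,σ)` with `0 < s < t < s + σ`, and
Minkowski's inequality with the smoothing of the heat semigroup gives its norms
(`eLpNorm_heatSup_le`). Changing `t` only changes the region, so continuity in time is the same
estimate over the symmetric difference `regB`, where a small power of the time increment can be
gained.

Convection is quadratic, but buoyancy is linear in the temperature and carries no small factor. The
maps contract for the norm `‖u‖_{X_p} + 4K‖θ‖_{Y_q}` as soon as both norms are at most `R =
1/(16K²)`, where `K` bounds all the estimates (`contraction_arith`, `energy_maps_sub_le`). This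
gives uniqueness in the ball of radius `R` and convergence of the successive approximations
(`exists_isFixedPoint`). No smallness of the data is needed: the free evolution of a distribution in
the closure of the Schwartz class has norms over `(0,S)` that vanish as `S → 0`
(`exists_heatFlow_small`), so a short time suffices.

The remaining norms come from the same iteration. The norms in `X_3` and `X_∞` satisfy affine
recursions with factor `1/2` once the `X_p` norm is small. For `Y_∞` the weight `s^{-3/2}` is not
integrable at `0`, so the flux is split at `t/2`, with the `Y_q` norm in the distant past and the
`Y_∞` norm in the recent past (`exists_flux_top_le`). For `Y_1` the factor `1/2` comes from
smallness of the velocity in `X_∞`. Fatou's lemma passes the bounds to the limit, for every `S ≤ T`,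
whence the vanishing as `S → 0`. For data in `L³` or `L¹` the weights of `X_3` and `Y_1` are zero,
so the vanishing of the Duhamel terms is strong convergence to the data. -/

lemma lintegral_rpow_le_of_pos_weight {ν : Measure Y} {g w : Y → ℝ≥0∞} {r : ℝ} (hr : 1 < r)
    (hg : Measurable g) (hw : Measurable w) (hw0 : ∀ y, 0 < w y) (hwi : ∀ᵐ y ∂ν, w y < ∞) :
    (∫⁻ y, g y ∂ν) ^ r ≤ (∫⁻ y, g y ^ r * w y ^ (-(r - 1)) ∂ν) * (∫⁻ y, w y ∂ν) ^ (r - 1) := by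
  have hc : r.HolderConjugate (r / (r - 1)) := Real.HolderConjugate.conjExponent hr
  have hr0 : 0 < r := by linarith
  have hr1 : 0 < r - 1 := by linarith
  -- Hölder's inequality is applied to `g = (g w^{-c}) w^c`; this `c` makes the conjugate power of
  -- `w^c` equal to `w`, and the `r`-th power of `w^{-c}` equal to `w^{-(r-1)}`.
  set c : ℝ := (r - 1) / r with hcdef
  have h1 : ∫⁻ y, g y ∂ν = ∫⁻ y, ((fun y => g y * w y ^ (-c)) * fun y => w y ^ c) y ∂ν := by
    refine lintegral_congr_ae ?_
    filter_upwards [hwi] with y hy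
    have : w y ^ (-c) * w y ^ c = 1 := by
      rw [← ENNReal.rpow_add _ _ (hw0 y).ne' hy.ne]; simp
    simp only [Pi.mul_apply]
    rw [mul_assoc, this, mul_one]
  have h2 := ENNReal.lintegral_mul_le_Lp_mul_Lq ν hc
    (f := fun y => g y * w y ^ (-c)) (g := fun y => w y ^ c)
    (hg.mul (hw.pow_const _)).aemeasurable (hw.pow_const _).aemeasurable
  rw [← h1] at h2
  have h3 := ENNReal.rpow_le_rpow h2 hr0.le
  rw [ENNReal.mul_rpow_of_nonneg _ _ hr0.le, ← ENNReal.rpow_mul, ← ENNReal.rpow_mul] at h3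
  have e1 : 1 / r * r = 1 := by field_simp
  have e2 : 1 / (r / (r - 1)) * r = r - 1 := by field_simp
  rw [e1, e2, ENNReal.rpow_one] at h3
  refine h3.trans (le_of_eq ?_)
  congr 1
  · refine lintegral_congr fun y => ?_
    rw [ENNReal.mul_rpow_of_nonneg _ _ hr0.le, ← ENNReal.rpow_mul]
    congr 2
    rw [hcdef]; field_simp
  · congr 1
    refine lintegral_congr fun y => ?_
    rw [← ENNReal.rpow_mul]
    have : c * (r / (r - 1)) = 1 := by rw [hcdef]; field_simp
    rw [this, ENNReal.rpow_one]

/-- Minkowski's integral inequality, with a measurable bound for the norms of the slices. -/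
theorem eLpNorm_lintegral_le {μ : Measure X} {ν : Measure Y} [SFinite μ] [SigmaFinite ν]
    {f : X → Y → ℝ≥0∞} (hf : Measurable (Function.uncurry f)) {b : ℝ≥0∞} (hb : 1 ≤ b)
    {w : Y → ℝ≥0∞} (hw : Measurable w)
    (h : ∀ᵐ y ∂ν, eLpNorm (fun x => f x y) b μ ≤ w y) :
    eLpNorm (fun x => ∫⁻ y, f x y ∂ν) b μ ≤ ∫⁻ y, w y ∂ν := by
  rcases eq_or_ne b ∞ with rfl | hbt
  · rw [eLpNorm_exponent_top]
    refine eLpNormEssSup_le_of_ae_enorm_bound ?_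
    have h1 : ∀ᵐ y ∂ν, ∀ᵐ x ∂μ, f x y ≤ w y := by
      filter_upwards [h] with y hy
      rw [eLpNorm_exponent_top] at hy
      filter_upwards [enorm_ae_le_eLpNormEssSup (fun x => f x y) μ] with x hx
      exact hx.trans hy
    have hm : MeasurableSet {z : X × Y | f z.1 z.2 ≤ w z.2} :=
      measurableSet_le hf (hw.comp measurable_snd)
    rw [← Measure.ae_ae_comm hm] at h1
    filter_upwards [h1] with x hx
    rw [enorm_eq_self]
    exact lintegral_mono_ae hx
  have hb0 : b ≠ 0 := (zero_lt_one.trans_le hb).ne'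
  set r := b.toReal with hrdef
  have hr : 1 ≤ r := by
    rw [hrdef]
    simpa using (ENNReal.toReal_le_toReal ENNReal.one_ne_top hbt).2 hb
  have hr0 : 0 < r := by linarith
  rw [eLpNorm_eq_lintegral_rpow_enorm_toReal hb0 hbt, ← hrdef, one_div,
    ENNReal.rpow_inv_le_iff hr0]
  simp only [enorm_eq_self]
  have hs : ∀ᵐ y ∂ν, ∫⁻ x, f x y ^ r ∂μ ≤ w y ^ r := by
    filter_upwards [h] with y hy
    rw [eLpNorm_eq_lintegral_rpow_enorm_toReal hb0 hbt, ← hrdef, one_div,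
      ENNReal.rpow_inv_le_iff hr0] at hy
    simpa only [enorm_eq_self] using hy
  rcases eq_or_lt_of_le hr with hr1 | hr1
  · rw [← hr1] at hs ⊢
    simp only [ENNReal.rpow_one] at hs ⊢
    rw [lintegral_lintegral_swap hf.aemeasurable]
    exact lintegral_mono_ae hs
  rcases eq_or_ne (∫⁻ y, w y ∂ν) ∞ with hwt | hwt
  · rw [hwt, ENNReal.top_rpow_of_pos hr0]; exact le_top
  -- The weighted Hölder inequality divides by the weight, which may vanish. The weight is therefore
  -- increased by a strictly positive function of integral less than `ε`, which exists by
  -- σ-finiteness, and `ε` tends to zero at the end.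
  suffices H : ∀ ε : ℝ≥0∞, ε ≠ 0 → ε ≠ ∞ →
      ∫⁻ x, (∫⁻ y, f x y ∂ν) ^ r ∂μ ≤ (∫⁻ y, w y ∂ν + ε) ^ r by
    rw [← ENNReal.rpow_inv_le_iff hr0]
    refine ENNReal.le_of_forall_pos_le_add fun ε hε _ => ?_
    rw [ENNReal.rpow_inv_le_iff hr0]
    exact H ε (by exact_mod_cast hε.ne') ENNReal.coe_ne_top
  intro ε hε hεt
  obtain ⟨v, hv0, hvm, hvi⟩ := exists_pos_lintegral_lt_of_sigmaFinite ν hε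
  set w' : Y → ℝ≥0∞ := fun y => w y + v y with hw'
  have hw'm : Measurable w' := hw.add (measurable_coe_nnreal_ennreal.comp hvm)
  have hw'i : ∫⁻ y, w' y ∂ν ≤ ∫⁻ y, w y ∂ν + ε := by
    rw [hw', lintegral_add_left hw]; gcongr
  have hw't : ∀ᵐ y ∂ν, w' y < ∞ :=
    ae_lt_top hw'm (hw'i.trans_lt (by simp [hwt, hεt, lt_top_iff_ne_top])).ne
  have hw'0 : ∀ y, 0 < w' y := fun y =>
    lt_of_lt_of_le (by exact_mod_cast hv0 y) (le_add_self : (v y : ℝ≥0∞) ≤ _)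
  have hfr : Measurable (Function.uncurry fun x y => f x y ^ r * w' y ^ (-(r - 1))) :=
    (hf.pow_const r).mul ((hw'm.comp measurable_snd).pow_const _)
  calc ∫⁻ x, (∫⁻ y, f x y ∂ν) ^ r ∂μ
      ≤ ∫⁻ x, (∫⁻ y, f x y ^ r * w' y ^ (-(r - 1)) ∂ν) * (∫⁻ y, w' y ∂ν) ^ (r - 1) ∂μ :=
        lintegral_mono fun x => lintegral_rpow_le_of_pos_weight hr1
          (hf.comp measurable_prodMk_left) hw'm hw'0 hw't
    _ = (∫⁻ x, ∫⁻ y, f x y ^ r * w' y ^ (-(r - 1)) ∂ν ∂μ) * (∫⁻ y, w' y ∂ν) ^ (r - 1) :=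
        lintegral_mul_const _ hfr.lintegral_prod_right
    _ = (∫⁻ y, (∫⁻ x, f x y ^ r ∂μ) * w' y ^ (-(r - 1)) ∂ν) * (∫⁻ y, w' y ∂ν) ^ (r - 1) := by
        rw [lintegral_lintegral_swap hfr.aemeasurable]
        congr 1
        refine lintegral_congr fun y => ?_
        exact lintegral_mul_const _ ((hf.comp measurable_prodMk_right).pow_const r)
    _ ≤ (∫⁻ y, w' y ∂ν) * (∫⁻ y, w' y ∂ν) ^ (r - 1) := by
        gcongr ?_ * _
        refine lintegral_mono_ae ?_
        filter_upwards [hs, hw't] with y hy hyt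
        have : w' y = w' y ^ r * w' y ^ (-(r - 1)) := by
          rw [← ENNReal.rpow_add _ _ (hw'0 y).ne' hyt.ne]
          simp
        exact (mul_le_mul_left (hy.trans (ENNReal.rpow_le_rpow le_self_add hr0.le)) _).trans
          this.symm.le
    _ = (∫⁻ y, w' y ∂ν) ^ r := by
        conv_rhs => rw [show r = 1 + (r - 1) by ring]
        rw [ENNReal.rpow_add_of_nonneg _ _ zero_le_one (by linarith), ENNReal.rpow_one]
    _ ≤ _ := ENNReal.rpow_le_rpow hw'i hr0.le

end Minkowski

/-! ### Convolution with the heat kernel -/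

lemma heatKernel_nonneg (s : ℝ) (hs : 0 < s) (x : E3) : 0 ≤ heatKernel s x := by
  unfold heatKernel; positivity

lemma measurable_heatKernel : Measurable (fun z : ℝ × E3 => heatKernel z.1 z.2) := by
  unfold heatKernel; fun_prop

lemma continuous_heatKernel (s : ℝ) : Continuous (heatKernel s) := by
  unfold heatKernel; fun_prop

lemma integrable_heatKernel (s : ℝ) (hs : 0 < s) : Integrable (heatKernel s) := by
  unfold heatKernel
  exact (gaussSchwartz (1 / (4 * s)) (by positivity)).integrable.const_mul _

lemma integral_heatKernel (s : ℝ) (hs : 0 < s) : ∫ x, heatKernel s x = 1 := by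
  unfold heatKernel
  rw [integral_const_mul, GaussianFourier.integral_rexp_neg_mul_sq_norm (by positivity)]
  rw [finrank_euclideanSpace_fin]
  rw [show Real.pi / (1 / (4 * s)) = 4 * Real.pi * s by field_simp]
  rw [← Real.rpow_add (by positivity)]
  norm_num

lemma lintegral_heatKernel (s : ℝ) (hs : 0 < s) : ∫⁻ x, ENNReal.ofReal (heatKernel s x) = 1 := by
  rw [← ofReal_integral_eq_lintegral_ofReal (integrable_heatKernel s hs)
    (ae_of_all _ (heatKernel_nonneg s hs)), integral_heatKernel s hs, ENNReal.ofReal_one]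

lemma lintegral_heatKernel_sub (s : ℝ) (hs : 0 < s) (x : E3) :
    ∫⁻ y, ENNReal.ofReal (heatKernel s (x - y)) = 1 := by
  rw [lintegral_sub_left_eq_self (fun y => ENNReal.ofReal (heatKernel s y)) x,
    lintegral_heatKernel s hs]

lemma heatKernel_le (s : ℝ) (hs : 0 < s) (x : E3) : heatKernel s x ≤ s ^ (-(3 / 2) : ℝ) := by
  unfold heatKernel
  have h1 : (4 * Real.pi * s) ^ (-(3 / 2) : ℝ) ≤ s ^ (-(3 / 2) : ℝ) :=
    Real.rpow_le_rpow_of_nonpos hs (by nlinarith [Real.pi_gt_three]) (by norm_num)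
  have h2 : Real.exp (-(1 / (4 * s)) * ‖x‖ ^ 2) ≤ 1 := by
    rw [Real.exp_le_one_iff]
    have : 0 ≤ 1 / (4 * s) * ‖x‖ ^ 2 := by positivity
    linarith
  calc _ ≤ s ^ (-(3 / 2) : ℝ) * 1 := by gcongr
    _ = _ := mul_one _

/-- The average `∫ heatKernel s (x - y) f y dy` of a nonnegative function. -/
def heatAvg (s : ℝ) (f : E3 → ℝ≥0∞) (x : E3) : ℝ≥0∞ :=
  ∫⁻ y, ENNReal.ofReal (heatKernel s (x - y)) * f y

lemma measurable_heatAvg_kernel (s : ℝ) :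
    Measurable (fun z : E3 × E3 => ENNReal.ofReal (heatKernel s (z.1 - z.2))) :=
  ((continuous_heatKernel s).comp (continuous_fst.sub continuous_snd)).measurable.ennreal_ofReal

@[fun_prop]
lemma measurable_heatKernel_const (s : ℝ) : Measurable (heatKernel s) :=
  (continuous_heatKernel s).measurable

lemma measurable_ofReal_heatKernel_sub (s : ℝ) (x : E3) :
    Measurable fun y => ENNReal.ofReal (heatKernel s (x - y)) := by
  fun_prop

lemma measurable_ofReal_heatKernel_sub_right (s : ℝ) (y : E3) :
    Measurable fun x => ENNReal.ofReal (heatKernel s (x - y)) := by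
  fun_prop

lemma measurable_heatAvg (s : ℝ) {f : E3 → ℝ≥0∞} (hf : Measurable f) :
    Measurable (heatAvg s f) :=
  ((measurable_heatAvg_kernel s).mul (hf.comp measurable_snd)).lintegral_prod_right'

lemma heatAvg_le_mul_lintegral {s : ℝ} (hs : 0 < s) {f : E3 → ℝ≥0∞} (hf : Measurable f) (x : E3) :
    heatAvg s f x ≤ ENNReal.ofReal (s ^ (-(3 / 2) : ℝ)) * ∫⁻ y, f y := by
  rw [heatAvg, ← lintegral_const_mul _ hf]
  refine lintegral_mono fun y => ?_
  gcongr
  exact heatKernel_le s hs _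

lemma lintegral_heatAvg {s : ℝ} (hs : 0 < s) {f : E3 → ℝ≥0∞} (hf : Measurable f) :
    ∫⁻ x, heatAvg s f x = ∫⁻ y, f y := by
  unfold heatAvg
  rw [lintegral_lintegral_swap
    ((measurable_heatAvg_kernel s).mul (hf.comp measurable_snd)).aemeasurable]
  refine lintegral_congr fun y => ?_
  rw [lintegral_mul_const _ (measurable_ofReal_heatKernel_sub_right s y),
    lintegral_sub_right_eq_self (fun x => ENNReal.ofReal (heatKernel s x)) y,
    lintegral_heatKernel s hs, one_mul]

/-- Jensen's inequality for a probability density. -/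
lemma lintegral_mul_rpow_le {Y : Type*} [MeasurableSpace Y] {ν : Measure Y} {k f : Y → ℝ≥0∞}
    (hkm : Measurable k) (hk1 : ∫⁻ y, k y ∂ν = 1) (hf : Measurable f) {r : ℝ} (hr : 1 ≤ r) :
    (∫⁻ y, k y * f y ∂ν) ^ r ≤ ∫⁻ y, k y * f y ^ r ∂ν := by
  rcases eq_or_lt_of_le hr with rfl | hr
  · simp
  have hc : r.HolderConjugate (r / (r - 1)) := Real.HolderConjugate.conjExponent hr
  have hr0 : 0 < r := by linarith
  have hr1 : 0 < r - 1 := by linarith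
  have h2 := ENNReal.lintegral_mul_le_Lp_mul_Lq ν hc
    (f := fun y => k y ^ (1 / r) * f y) (g := fun y => k y ^ ((r - 1) / r))
    ((hkm.pow_const _).mul hf).aemeasurable (hkm.pow_const _).aemeasurable
  have e0 : ∫⁻ y, k y * f y ∂ν = ∫⁻ y, ((fun y => k y ^ (1 / r) * f y) *
      fun y => k y ^ ((r - 1) / r)) y ∂ν := by
    refine lintegral_congr fun y => ?_
    simp only [Pi.mul_apply]
    have : k y ^ (1 / r) * k y ^ ((r - 1) / r) = k y := by
      rw [← ENNReal.rpow_add_of_nonneg _ _ (by positivity) (by positivity)]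
      rw [show 1 / r + (r - 1) / r = 1 by field_simp; ring, ENNReal.rpow_one]
    rw [mul_right_comm, this]
  have e2 : ∫⁻ y, (k y ^ ((r - 1) / r)) ^ (r / (r - 1)) ∂ν = 1 := by
    rw [← hk1]
    refine lintegral_congr fun y => ?_
    rw [← ENNReal.rpow_mul, show (r - 1) / r * (r / (r - 1)) = 1 by field_simp, ENNReal.rpow_one]
  rw [← e0, e2, ENNReal.one_rpow, mul_one] at h2
  have h3 := ENNReal.rpow_le_rpow h2 hr0.le
  rw [← ENNReal.rpow_mul, one_div_mul_cancel hr0.ne', ENNReal.rpow_one] at h3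
  refine h3.trans (le_of_eq (lintegral_congr fun y => ?_))
  rw [ENNReal.mul_rpow_of_nonneg _ _ hr0.le, ← ENNReal.rpow_mul, one_div_mul_cancel hr0.ne',
    ENNReal.rpow_one]

lemma heatAvg_rpow_le {s : ℝ} (hs : 0 < s) {f : E3 → ℝ≥0∞} (hf : Measurable f) {r : ℝ}
    (hr : 1 ≤ r) (x : E3) : heatAvg s f x ^ r ≤ heatAvg s (fun y => f y ^ r) x :=
  lintegral_mul_rpow_le (measurable_ofReal_heatKernel_sub s x) (lintegral_heatKernel_sub s hs x)
    hf hr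

/-- The smoothing effect of the heat semigroup between Lebesgue spaces. -/
theorem eLpNorm_heatAvg_le {s : ℝ} (hs : 0 < s) {f : E3 → ℝ≥0∞} (hf : Measurable f)
    {a b : ℝ≥0∞} (ha : 1 ≤ a) (hab : a ≤ b) :
    eLpNorm (heatAvg s f) b volume ≤
      ENNReal.ofReal (s ^ (-(3 / 2 * (a⁻¹.toReal - b⁻¹.toReal)))) * eLpNorm f a volume := by
  have ha0 : a ≠ 0 := (zero_lt_one.trans_le ha).ne'
  have hb0 : b ≠ 0 := (zero_lt_one.trans_le (ha.trans hab)).ne'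
  rcases eq_or_ne a ∞ with rfl | hat
  · obtain rfl : b = ∞ := top_le_iff.1 hab
    simp only [sub_self, mul_zero, neg_zero, Real.rpow_zero, ENNReal.ofReal_one, one_mul]
    rw [eLpNorm_exponent_top, eLpNorm_exponent_top]
    refine eLpNormEssSup_le_of_ae_enorm_bound (ae_of_all _ fun x => ?_)
    rw [enorm_eq_self]
    calc heatAvg s f x
        ≤ ∫⁻ y, ENNReal.ofReal (heatKernel s (x - y)) * eLpNormEssSup f volume := by
          refine lintegral_mono_ae ?_
          filter_upwards [enorm_ae_le_eLpNormEssSup f volume] with y hy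
          gcongr
          exact hy
      _ = eLpNormEssSup f volume := by
          rw [lintegral_mul_const _ (measurable_ofReal_heatKernel_sub s x),
            lintegral_heatKernel_sub s hs, one_mul]
  set r := a.toReal with hr
  have hr1 : 1 ≤ r := by simpa using (ENNReal.toReal_le_toReal ENNReal.one_ne_top hat).2 ha
  have hr0 : 0 < r := by linarith
  set I : ℝ≥0∞ := ∫⁻ y, f y ^ r with hI
  have hfa : eLpNorm f a volume = I ^ (1 / r) := by
    rw [eLpNorm_eq_lintegral_rpow_enorm_toReal ha0 hat]; rfl
  set g : E3 → ℝ≥0∞ := heatAvg s (fun y => f y ^ r) with hg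
  have hgm : Measurable g := measurable_heatAvg s (hf.pow_const r)
  have h1 : ∀ x, heatAvg s f x ≤ g x ^ (1 / r) := fun x => by
    have := heatAvg_rpow_le hs hf hr1 x
    rwa [← ENNReal.le_rpow_inv_iff hr0, ← one_div] at this
  set M : ℝ≥0∞ := ENNReal.ofReal (s ^ (-(3 / 2) : ℝ)) with hM
  have hMpow : ∀ c : ℝ, M ^ c = ENNReal.ofReal (s ^ (-(3 / 2 * c))) := fun c => by
    rw [hM, ENNReal.ofReal_rpow_of_pos (by positivity), ← Real.rpow_mul hs.le]
    congr 2; ring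
  have h2 : ∀ x, g x ≤ M * I := heatAvg_le_mul_lintegral hs (hf.pow_const r)
  have hinv : a⁻¹.toReal = 1 / r := by rw [ENNReal.toReal_inv, one_div]
  rw [hfa, hinv, ← hMpow]
  rcases eq_or_ne b ∞ with rfl | hbt
  · rw [eLpNorm_exponent_top]
    refine eLpNormEssSup_le_of_ae_enorm_bound (ae_of_all _ fun x => ?_)
    rw [enorm_eq_self]
    simp only [ENNReal.inv_top, ENNReal.toReal_zero, sub_zero]
    rw [← ENNReal.mul_rpow_of_nonneg _ _ (by positivity)]
    exact (h1 x).trans (ENNReal.rpow_le_rpow (h2 x) (by positivity))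
  set ρ := b.toReal with hρ
  have hrρ : r ≤ ρ := (ENNReal.toReal_le_toReal hat hbt).2 hab
  have hρ0 : 0 < ρ := by linarith
  have hq : 1 ≤ ρ / r := by rwa [le_div_iff₀ hr0, one_mul]
  have hinv' : b⁻¹.toReal = 1 / ρ := by rw [ENNReal.toReal_inv, one_div]
  rw [eLpNorm_eq_lintegral_rpow_enorm_toReal hb0 hbt, ← hρ, hinv']
  -- Interpolation between `L^1` and `L^∞`: by Jensen, the `r`-th power of the average is at most
  -- `g`, whose integral is `I` and whose supremum is at most `M * I`, so all but one power of `g`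
  -- can be taken out of the integral of `g^{ρ/r}`.
  have h3 : ∫⁻ x, ‖heatAvg s f x‖ₑ ^ ρ ≤ M ^ (ρ / r - 1) * I ^ (ρ / r) := by
    calc ∫⁻ x, ‖heatAvg s f x‖ₑ ^ ρ ≤ ∫⁻ x, (M * I) ^ (ρ / r - 1) * g x := by
          refine lintegral_mono fun x => ?_
          rw [enorm_eq_self]
          calc heatAvg s f x ^ ρ ≤ (g x ^ (1 / r)) ^ ρ := ENNReal.rpow_le_rpow (h1 x) hρ0.le
            _ = g x ^ (ρ / r - 1) * g x := by
                conv_rhs => rw [← ENNReal.rpow_one (g x), ← ENNReal.rpow_mul]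
                rw [← ENNReal.rpow_mul, one_mul,
                  ← ENNReal.rpow_add_of_nonneg _ _ (by linarith) zero_le_one]
                congr 1; ring
            _ ≤ _ := by gcongr; exact h2 x
      _ = (M * I) ^ (ρ / r - 1) * I := by
          rw [lintegral_const_mul _ hgm, hg, lintegral_heatAvg hs (hf.pow_const r)]
      _ = M ^ (ρ / r - 1) * I ^ (ρ / r) := by
          rw [ENNReal.mul_rpow_of_nonneg _ _ (by linarith), mul_assoc]
          congr 1
          conv_lhs => rw [← ENNReal.rpow_one I, ← ENNReal.rpow_mul]
          rw [← ENNReal.rpow_add_of_nonneg _ _ (by linarith) zero_le_one]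
          congr 1; ring
  calc _ ≤ (M ^ (ρ / r - 1) * I ^ (ρ / r)) ^ (1 / ρ) := ENNReal.rpow_le_rpow h3 (by positivity)
    _ = _ := by
        rw [ENNReal.mul_rpow_of_nonneg _ _ (by positivity), ← ENNReal.rpow_mul,
          ← ENNReal.rpow_mul]
        congr 2 <;> field_simp

/-! ### Integrals in time -/

lemma lintegral_Ioi_rpow {τ γ : ℝ} (hτ : 0 < τ) (hγ : 0 < γ) :
    ∫⁻ σ in Ioi τ, ENNReal.ofReal (σ ^ (-1 - γ)) = ENNReal.ofReal (τ ^ (-γ) / γ) := by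
  rw [← ofReal_integral_eq_lintegral_ofReal (integrableOn_Ioi_rpow_of_lt (by linarith) hτ)]
  · rw [integral_Ioi_rpow_of_lt (by linarith) hτ]
    rw [show -1 - γ + 1 = -γ by ring, neg_div_neg_eq]
  · filter_upwards [ae_restrict_mem measurableSet_Ioi] with σ hσ
    exact Real.rpow_nonneg (hτ.trans hσ).le _

lemma lintegral_Ioo_rpow {t δ : ℝ} (ht : 0 ≤ t) (hδ : δ < 1) :
    ∫⁻ s in Ioo 0 t, ENNReal.ofReal (s ^ (-δ)) = ENNReal.ofReal (t ^ (1 - δ) / (1 - δ)) := by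
  have hi : IntervalIntegrable (fun s : ℝ => s ^ (-δ)) volume 0 t :=
    intervalIntegral.intervalIntegrable_rpow' (by linarith)
  rw [← ofReal_integral_eq_lintegral_ofReal]
  · rw [← integral_Ioc_eq_integral_Ioo, ← intervalIntegral.integral_of_le ht,
      integral_rpow (Or.inl (by linarith)), Real.zero_rpow (by linarith)]
    congr 1; ring_nf
  · exact ((intervalIntegrable_iff_integrableOn_Ioc_of_le ht).1 hi).mono_set Ioo_subset_Ioc_self
  · filter_upwards [ae_restrict_mem measurableSet_Ioo] with s hs
    exact Real.rpow_nonneg hs.1.le _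

lemma lintegral_Ioo_sub_rpow {r t δ : ℝ} (ht : r ≤ t) (hδ : δ < 1) :
    ∫⁻ s in Ioo r t, ENNReal.ofReal ((t - s) ^ (-δ)) =
      ENNReal.ofReal ((t - r) ^ (1 - δ) / (1 - δ)) := by
  rw [← lintegral_Ioo_rpow (sub_nonneg.2 ht) hδ, ← lintegral_indicator measurableSet_Ioo,
    ← lintegral_indicator measurableSet_Ioo,
    ← lintegral_sub_left_eq_self _ t]
  refine lintegral_congr fun s => ?_
  simp only [indicator, mem_Ioo, sub_sub_cancel]
  congr 1
  simp only [eq_iff_iff]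
  constructor <;> rintro ⟨h1, h2⟩ <;> constructor <;> linarith

/-- The Beta integral, up to a constant. -/
lemma exists_lintegral_beta_le {γ δ : ℝ} (hγ0 : 0 ≤ γ) (hγ : γ < 1) (hδ0 : 0 ≤ δ) (hδ : δ < 1) :
    ∃ C : ℝ, 0 < C ∧ ∀ t : ℝ, 0 < t →
      ∫⁻ s in Ioo 0 t, ENNReal.ofReal ((t - s) ^ (-γ)) * ENNReal.ofReal (s ^ (-δ)) ≤
        ENNReal.ofReal (C * t ^ (1 - γ - δ)) := by
  refine ⟨2 ^ γ / (1 - δ) + 2 ^ δ / (1 - γ), ?_, fun t ht => ?_⟩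
  · have : 0 < 1 - γ := by linarith
    have : 0 < 1 - δ := by linarith
    positivity
  have h1 : 0 < 1 - γ := by linarith
  have h2 : 0 < 1 - δ := by linarith
  -- Each of the two powers is singular at one endpoint only, so on either half of the interval one
  -- of them is at most its value at `t / 2`.
  have key : ∀ s ∈ Ioo 0 t, ENNReal.ofReal ((t - s) ^ (-γ)) * ENNReal.ofReal (s ^ (-δ)) ≤
      ENNReal.ofReal ((t / 2) ^ (-γ)) * ENNReal.ofReal (s ^ (-δ)) +
      ENNReal.ofReal ((t / 2) ^ (-δ)) * ENNReal.ofReal ((t - s) ^ (-γ)) := by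
    intro s hs
    rcases le_total s (t / 2) with h | h
    · refine le_trans ?_ le_self_add
      gcongr ENNReal.ofReal ?_ * _
      exact Real.rpow_le_rpow_of_nonpos (by linarith) (by linarith) (by linarith)
    · refine le_trans ?_ le_add_self
      rw [mul_comm]
      gcongr ENNReal.ofReal ?_ * _
      exact Real.rpow_le_rpow_of_nonpos (by linarith) (by linarith) (by linarith)
  refine (setLIntegral_mono (by fun_prop) key).trans ?_
  rw [lintegral_add_left (by fun_prop), lintegral_const_mul _ (by fun_prop),
    lintegral_const_mul _ (by fun_prop), lintegral_Ioo_rpow ht.le hδ,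
    lintegral_Ioo_sub_rpow ht.le hγ, sub_zero, ← ENNReal.ofReal_mul (by positivity),
    ← ENNReal.ofReal_mul (by positivity), ← ENNReal.ofReal_add (by positivity) (by positivity)]
  refine ENNReal.ofReal_le_ofReal (le_of_eq ?_)
  have e1 : (t / 2) ^ (-γ) = 2 ^ γ * t ^ (-γ) := by
    rw [Real.div_rpow ht.le (by norm_num), Real.rpow_neg (by norm_num : (0:ℝ) ≤ 2), div_inv_eq_mul,
      mul_comm]
  have e2 : (t / 2) ^ (-δ) = 2 ^ δ * t ^ (-δ) := by
    rw [Real.div_rpow ht.le (by norm_num), Real.rpow_neg (by norm_num : (0:ℝ) ≤ 2), div_inv_eq_mul,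
      mul_comm]
  have e3 : t ^ (-γ) * t ^ (1 - δ) = t ^ (1 - γ - δ) := by
    rw [← Real.rpow_add ht]; congr 1; ring
  have e4 : t ^ (-δ) * t ^ (1 - γ) = t ^ (1 - γ - δ) := by
    rw [← Real.rpow_add ht]; congr 1; ring
  rw [e1, e2]
  calc _ = 2 ^ γ / (1 - δ) * (t ^ (-γ) * t ^ (1 - δ)) + 2 ^ δ / (1 - γ) * (t ^ (-δ) * t ^ (1 - γ))
      := by
        ring
    _ = _ := by rw [e3, e4]; ring

/-! ### Derivatives of the heat kernel -/

/-- The second derivative `∂_j ∂_k` of the heat kernel. -/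
def heatKernelD2 (s : ℝ) (j k : Fin 3) (x : E3) : ℝ :=
  (x j * x k / (4 * s ^ 2) - (if j = k then 1 / (2 * s) else 0)) * heatKernel s x

/-- The third derivative `∂_l ∂_j ∂_k` of the heat kernel. -/
def heatKernelD3 (s : ℝ) (l j k : Fin 3) (x : E3) : ℝ :=
  (-(x l * x j * x k) / (8 * s ^ 3) + ((if l = j then x k else 0) + (if l = k then x j else 0) +
    (if j = k then x l else 0)) / (4 * s ^ 2)) * heatKernel s x

lemma hasFDerivAt_heatKernel (s : ℝ) (x : E3) :
    HasFDerivAt (heatKernel s) ((-(1 / (2 * s)) * heatKernel s x) • innerSL ℝ x) x := by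
  have h := (hasFDerivAt_gauss (1 / (4 * s)) x).const_mul ((4 * Real.pi * s) ^ (-(3 / 2) : ℝ))
  refine h.congr_fderiv ?_
  ext v
  simp [heatKernel]
  ring

lemma inner_basisVec (x : E3) (l : Fin 3) : inner ℝ x (basisVec l) = x l := by
  simp [basisVec, EuclideanSpace.inner_single_right]

lemma pderiv_heatKernel (l : Fin 3) (s : ℝ) (x : E3) :
    pderiv l (heatKernel s) x = -(x l / (2 * s)) * heatKernel s x := by
  rw [pderiv, (hasFDerivAt_heatKernel s x).fderiv]
  simp [innerSL_apply_apply, inner_basisVec]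
  ring

lemma hasFDerivAt_coord (x : E3) (l : Fin 3) :
    HasFDerivAt (fun y : E3 => y l) (EuclideanSpace.proj l : E3 →L[ℝ] ℝ) x :=
  (EuclideanSpace.proj l : E3 →L[ℝ] ℝ).hasFDerivAt

lemma proj_basisVec (l i : Fin 3) : (basisVec i) l = if l = i then 1 else 0 := by
  simp [basisVec]

lemma clm_eq_sum_proj (L : E3 →L[ℝ] ℝ) :
    L = ∑ l : Fin 3, L (basisVec l) • (EuclideanSpace.proj l : E3 →L[ℝ] ℝ) := by
  ext v
  have hv : v = ∑ l : Fin 3, v l • basisVec l := by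
    ext i
    simp [proj_basisVec]
  conv_lhs => rw [hv]
  simp [mul_comm]

lemma hasFDerivAt_heatKernelD1 (s : ℝ) (k : Fin 3) (x : E3) :
    HasFDerivAt (fun y => -(y k / (2 * s)) * heatKernel s y)
      (∑ l : Fin 3, heatKernelD2 s l k x • (EuclideanSpace.proj l : E3 →L[ℝ] ℝ)) x := by
  have h := (((hasFDerivAt_coord x k).mul_const (1 / (2 * s))).neg).mul (hasFDerivAt_heatKernel s x)
  have h2 : HasFDerivAt (fun y => -(y k / (2 * s)) * heatKernel s y) _ x :=
    h.congr_of_eventuallyEq (Eventually.of_forall fun y => by simp; ring_nf; simp)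
  refine h2.congr_fderiv ?_
  rw [clm_eq_sum_proj (_ + _)]
  refine Finset.sum_congr rfl fun l _ => ?_
  congr 1
  simp [innerSL_apply_apply, inner_basisVec, proj_basisVec, heatKernelD2]
  by_cases hkl : k = l
  · subst hkl; simp; ring
  · simp [hkl, Ne.symm hkl]; ring

lemma hasFDerivAt_heatKernelD2 (s : ℝ) (j k : Fin 3) (x : E3) :
    HasFDerivAt (heatKernelD2 s j k)
      (∑ l : Fin 3, heatKernelD3 s l j k x • (EuclideanSpace.proj l : E3 →L[ℝ] ℝ)) x := by
  have h := ((((hasFDerivAt_coord x j).mul (hasFDerivAt_coord x k)).mul_const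
    (1 / (4 * s ^ 2))).sub_const (if j = k then 1 / (2 * s) else 0)).mul
      (hasFDerivAt_heatKernel s x)
  have h2 : HasFDerivAt (heatKernelD2 s j k) _ x :=
    h.congr_of_eventuallyEq (Eventually.of_forall fun y => by simp [heatKernelD2]; ring_nf; simp)
  refine h2.congr_fderiv ?_
  rw [clm_eq_sum_proj (_ + _)]
  refine Finset.sum_congr rfl fun l _ => ?_
  congr 1
  simp [innerSL_apply_apply, inner_basisVec, proj_basisVec, heatKernelD3]
  rcases eq_or_ne s 0 with rfl | hs
  · simp
  rcases eq_or_ne l j with rfl | hlj <;> rcases eq_or_ne l k with rfl | hlk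
  · simp; field_simp; ring
  · simp [hlk, hlk.symm]; field_simp; ring
  · simp [hlj, hlj.symm]; field_simp; ring
  · rcases eq_or_ne j k with rfl | hjk
    · simp [hlj, hlj.symm]; field_simp; ring
    · simp [hlj, hlk, hjk, hlj.symm, hlk.symm]; field_simp; ring

lemma norm_sq_eq_sum (x : E3) : ‖x‖ ^ 2 = ∑ i : Fin 3, x i * x i := by
  rw [EuclideanSpace.norm_sq_eq]; simp [pow_two]

lemma sum_heatKernelD2 (s : ℝ) (x : E3) :
    ∑ i : Fin 3, heatKernelD2 s i i x = (‖x‖ ^ 2 / (4 * s ^ 2) - 3 / (2 * s)) * heatKernel s x := by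
  simp only [heatKernelD2, norm_sq_eq_sum, ← Finset.sum_mul, Fin.sum_univ_three, if_true]
  ring

lemma sum_heatKernelD3 (s : ℝ) (l : Fin 3) (x : E3) :
    ∑ i : Fin 3, heatKernelD3 s l i i x =
      x l * (-(‖x‖ ^ 2) / (8 * s ^ 3) + 5 / (4 * s ^ 2)) * heatKernel s x := by
  simp only [heatKernelD3, norm_sq_eq_sum, ← Finset.sum_mul]
  congr 1
  fin_cases l <;> simp [Fin.sum_univ_three] <;> ring

/-- This is the heat equation, with the Laplacian written as the sum of the pure second derivatives.
It is what makes the heat kernel itself an integral over later times, in `heatPot_densityHeat`. -/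
lemma hasDerivAt_heatKernel_time {s : ℝ} (hs : 0 < s) (x : E3) :
    HasDerivAt (fun s => heatKernel s x) (∑ i : Fin 3, heatKernelD2 s i i x) s := by
  rw [sum_heatKernelD2]
  unfold heatKernel
  have h1 : HasDerivAt (fun s : ℝ => (4 * Real.pi * s) ^ (-(3 / 2) : ℝ))
      (4 * Real.pi * (-(3 / 2)) * (4 * Real.pi * s) ^ (-(3 / 2) - 1 : ℝ)) s := by
    have := (((hasDerivAt_id s).const_mul (4 * Real.pi)).rpow_const (p := -(3 / 2))
      (Or.inl (by simp; positivity)))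
    simpa using this
  have h2 : HasDerivAt (fun s : ℝ => Real.exp (-(1 / (4 * s)) * ‖x‖ ^ 2))
      (Real.exp (-(1 / (4 * s)) * ‖x‖ ^ 2) * (‖x‖ ^ 2 / (4 * s ^ 2))) s := by
    have h3 : HasDerivAt (fun s : ℝ => -(1 / (4 * s)) * ‖x‖ ^ 2) (‖x‖ ^ 2 / (4 * s ^ 2)) s := by
      have h4 := (((hasDerivAt_inv hs.ne').const_mul (-(1 / 4))).mul_const (‖x‖ ^ 2))
      refine (h4.congr_deriv (by field_simp)).congr_of_eventuallyEq
        (Eventually.of_forall fun y => by simp; ring_nf; simp)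
    exact h3.exp
  refine (h1.mul h2).congr_deriv ?_
  rw [Real.rpow_sub_one (by positivity)]
  field_simp
  ring

lemma hasDerivAt_heatKernelD1_time {s : ℝ} (hs : 0 < s) (l : Fin 3) (x : E3) :
    HasDerivAt (fun s => -(x l / (2 * s)) * heatKernel s x) (∑ i : Fin 3, heatKernelD3 s l i i x)
      s := by
  have h1 : HasDerivAt (fun s : ℝ => -(x l / (2 * s))) (x l / (2 * s ^ 2)) s := by
    have h4 := (hasDerivAt_inv hs.ne').const_mul (-(x l / 2))
    refine (h4.congr_deriv (by field_simp)).congr_of_eventuallyEq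
      (Eventually.of_forall fun y => by simp; ring)
  refine (h1.mul (hasDerivAt_heatKernel_time hs x)).congr_deriv ?_
  rw [sum_heatKernelD2, sum_heatKernelD3]
  field_simp
  ring

/-! ### Gaussian bounds -/

/-- The constant in the Gaussian bounds for the derivatives of the heat kernel. -/
def gaussBound : ℝ := 2 ^ (3 / 2 : ℝ) * ((3 : ℕ).factorial * Real.exp (1 + 1 / (4 * (1 / 8))))

lemma gaussBound_pos : 0 < gaussBound := by unfold gaussBound; positivity

/-- Half of the Gaussian exponent absorbs the polynomial factor and the other half is the heat
kernel at the doubled time, up to the factor `2^{3/2}`. The power `3` covers the cubic polynomial in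
the third derivatives. -/
lemma one_add_pow_mul_heatKernel_le {s : ℝ} (hs : 0 < s) (x : E3) :
    (1 + ‖x‖ / √s) ^ 3 * heatKernel s x ≤ gaussBound * heatKernel (2 * s) x := by
  have h := one_add_pow_mul_exp_le (a := 1 / 8) (by norm_num) 3 (r := ‖x‖ / √s) (by positivity)
  have e1 : heatKernel s x =
      2 ^ (3 / 2 : ℝ) * Real.exp (-(1 / 8) * (‖x‖ / √s) ^ 2) * heatKernel (2 * s) x := by
    unfold heatKernel
    have e2 : (4 * Real.pi * (2 * s)) ^ (-(3 / 2) : ℝ) =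
        (4 * Real.pi * s) ^ (-(3 / 2) : ℝ) * (2 ^ (3 / 2 : ℝ))⁻¹ := by
      rw [← Real.rpow_neg (by norm_num), ← Real.mul_rpow (by positivity) (by norm_num)]
      congr 1; ring
    have e3 : Real.exp (-(1 / (4 * s)) * ‖x‖ ^ 2) =
        Real.exp (-(1 / 8) * (‖x‖ / √s) ^ 2) * Real.exp (-(1 / (4 * (2 * s))) * ‖x‖ ^ 2) := by
      rw [← Real.exp_add, div_pow, Real.sq_sqrt hs.le]
      congr 1; field_simp; ring
    rw [e2, e3]
    field_simp
  have hp := heatKernel_nonneg (2 * s) (by positivity) x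
  calc (1 + ‖x‖ / √s) ^ 3 * heatKernel s x
      = 2 ^ (3 / 2 : ℝ) * ((1 + ‖x‖ / √s) ^ 3 * Real.exp (-(1 / 8) * (‖x‖ / √s) ^ 2)) *
          heatKernel (2 * s) x := by rw [e1]; ring
    _ ≤ 2 ^ (3 / 2 : ℝ) * ((3 : ℕ).factorial * Real.exp (1 + 1 / (4 * (1 / 8)))) *
          heatKernel (2 * s) x := by gcongr
    _ = _ := rfl

lemma abs_coord_le (x : E3) (i : Fin 3) : |x i| ≤ ‖x‖ := by
  simpa using PiLp.norm_apply_le x i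

lemma abs_heatKernelD2_le {s : ℝ} (hs : 0 < s) (j k : Fin 3) (x : E3) :
    |heatKernelD2 s j k x| ≤ gaussBound * s⁻¹ * heatKernel (2 * s) x := by
  have hp := heatKernel_nonneg s hs x
  set r := ‖x‖ / √s with hr
  have hr0 : 0 ≤ r := by positivity
  have hsq : ‖x‖ ^ 2 = r ^ 2 * s := by
    rw [hr, div_pow, Real.sq_sqrt hs.le]; field_simp
  have h1 : |x j * x k / (4 * s ^ 2) - (if j = k then 1 / (2 * s) else 0)| ≤
      s⁻¹ * (1 + r) ^ 3 := by
    have h2 : |x j * x k| ≤ r ^ 2 * s := by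
      rw [abs_mul, ← hsq, pow_two]
      exact mul_le_mul (abs_coord_le x j) (abs_coord_le x k) (abs_nonneg _) (norm_nonneg _)
    have h3 : |if j = k then 1 / (2 * s) else 0| ≤ 1 / (2 * s) := by
      split_ifs
      · rw [abs_of_pos (by positivity)]
      · simp; positivity
    refine (abs_sub _ _).trans ?_
    rw [abs_div, abs_of_pos (by positivity : 0 < 4 * s ^ 2)]
    calc |x j * x k| / (4 * s ^ 2) + |if j = k then 1 / (2 * s) else 0|
        ≤ r ^ 2 * s / (4 * s ^ 2) + 1 / (2 * s) := by gcongr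
      _ = s⁻¹ * (r ^ 2 / 4 + 1 / 2) := by field_simp
      _ ≤ s⁻¹ * (1 + r) ^ 3 := by gcongr; nlinarith [pow_nonneg hr0 2, pow_nonneg hr0 3]
  rw [heatKernelD2, abs_mul, abs_of_nonneg hp]
  calc _ ≤ s⁻¹ * (1 + r) ^ 3 * heatKernel s x := by gcongr
    _ = s⁻¹ * ((1 + r) ^ 3 * heatKernel s x) := by ring
    _ ≤ s⁻¹ * (gaussBound * heatKernel (2 * s) x) :=
        mul_le_mul_of_nonneg_left (one_add_pow_mul_heatKernel_le hs x) (by positivity)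
    _ = _ := by ring

lemma abs_heatKernelD3_le {s : ℝ} (hs : 0 < s) (l j k : Fin 3) (x : E3) :
    |heatKernelD3 s l j k x| ≤ gaussBound * (s⁻¹ * (√s)⁻¹) * heatKernel (2 * s) x := by
  have hp := heatKernel_nonneg s hs x
  have hq : 0 < √s := Real.sqrt_pos.2 hs
  obtain ⟨q, hqd⟩ : ∃ q, q = √s := ⟨_, rfl⟩
  rw [← hqd] at hq
  have hsq : s = q ^ 2 := by rw [hqd, Real.sq_sqrt hs.le]
  set r := ‖x‖ / q with hr
  have hr0 : 0 ≤ r := by positivity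
  have hx : ‖x‖ = r * q := by rw [hr]; field_simp
  have hc : ∀ i, |x i| ≤ r * q := fun i => by rw [← hx]; exact abs_coord_le x i
  have h1 : |-(x l * x j * x k) / (8 * s ^ 3) + ((if l = j then x k else 0) +
      (if l = k then x j else 0) + (if j = k then x l else 0)) / (4 * s ^ 2)| ≤
      s⁻¹ * q⁻¹ * (1 + r) ^ 3 := by
    have h2 : |-(x l * x j * x k)| ≤ (r * q) * (r * q) * (r * q) := by
      rw [abs_neg, abs_mul, abs_mul]
      have := hc l; have := hc j; have := hc k
      gcongr
    have h3 : ∀ (P : Prop) [Decidable P] (i : Fin 3), |if P then x i else 0| ≤ r * q := by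
      intro P _ i
      split_ifs
      · exact hc i
      · simp; positivity
    have h4 : |(if l = j then x k else 0) + (if l = k then x j else 0) +
        (if j = k then x l else 0)| ≤ r * q + r * q + r * q :=
      (abs_add_le _ _).trans (add_le_add ((abs_add_le _ _).trans (add_le_add (h3 _ _) (h3 _ _)))
        (h3 _ _))
    refine (abs_add_le _ _).trans ?_
    rw [abs_div, abs_div, abs_of_pos (by positivity : 0 < 4 * s ^ 2),
      abs_of_pos (by positivity : 0 < 8 * s ^ 3)]
    calc _ ≤ (r * q) * (r * q) * (r * q) / (8 * s ^ 3) + (r * q + r * q + r * q) / (4 * s ^ 2) := by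
          gcongr
      _ = s⁻¹ * q⁻¹ * (r ^ 3 / 8 + 3 / 4 * r) := by rw [hsq]; field_simp; ring
      _ ≤ s⁻¹ * q⁻¹ * (1 + r) ^ 3 := by
          gcongr; nlinarith [pow_nonneg hr0 2, pow_nonneg hr0 3]
  rw [heatKernelD3, abs_mul, abs_of_nonneg hp, ← hqd]
  calc _ ≤ s⁻¹ * q⁻¹ * (1 + r) ^ 3 * heatKernel s x := by gcongr
    _ = s⁻¹ * q⁻¹ * ((1 + r) ^ 3 * heatKernel s x) := by ring
    _ ≤ s⁻¹ * q⁻¹ * (gaussBound * heatKernel (2 * s) x) :=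
        mul_le_mul_of_nonneg_left
          (by rw [hr, hqd]; exact one_add_pow_mul_heatKernel_le hs x) (by positivity)
    _ = _ := by ring

/-! ### Kernels that are superpositions of derivatives of the heat kernel -/

/-- `h` has the Gaussian bounds of a derivative of the heat kernel of order `2 + m`. -/
structure IsHeatDensity (m C : ℝ) (h : ℝ → E3 → ℝ) : Prop where
  measurable : Measurable (fun z : ℝ × E3 => h z.1 z.2)
  nonneg : 0 ≤ C
  abs_le : ∀ s, 0 < s → ∀ x, |h s x| ≤ C * s ^ (-1 - m / 2) * heatKernel (2 * s) x

/-- The kernel `∫_t^∞ h_s(x) ds`. -/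
def heatPot (h : ℝ → E3 → ℝ) (t : ℝ) (x : E3) : ℝ := ∫ s in Ioi t, h s x

lemma measurable_coord (i : Fin 3) : Measurable (fun x : E3 => x i) :=
  (EuclideanSpace.proj i : E3 →L[ℝ] ℝ).continuous.measurable

lemma measurable_heatKernelD2 (j k : Fin 3) :
    Measurable (fun z : ℝ × E3 => heatKernelD2 z.1 j k z.2) := by
  unfold heatKernelD2
  have := measurable_heatKernel
  have hj := (measurable_coord j).comp (measurable_snd : Measurable (Prod.snd : ℝ × E3 → E3))
  have hk := (measurable_coord k).comp (measurable_snd : Measurable (Prod.snd : ℝ × E3 → E3))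
  simp only [Function.comp_def] at hj hk
  split_ifs <;> fun_prop

lemma measurable_heatKernelD3 (l j k : Fin 3) :
    Measurable (fun z : ℝ × E3 => heatKernelD3 z.1 l j k z.2) := by
  unfold heatKernelD3
  have := measurable_heatKernel
  have hj := (measurable_coord j).comp (measurable_snd : Measurable (Prod.snd : ℝ × E3 → E3))
  have hk := (measurable_coord k).comp (measurable_snd : Measurable (Prod.snd : ℝ × E3 → E3))
  have hl := (measurable_coord l).comp (measurable_snd : Measurable (Prod.snd : ℝ × E3 → E3))
  simp only [Function.comp_def] at hj hk hl
  split_ifs <;> fun_prop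

lemma isHeatDensity_D2 (j k : Fin 3) : IsHeatDensity 0 gaussBound fun s => heatKernelD2 s j k where
  measurable := measurable_heatKernelD2 j k
  nonneg := gaussBound_pos.le
  abs_le s hs x := by
    refine (abs_heatKernelD2_le hs j k x).trans_eq ?_
    rw [zero_div, sub_zero, Real.rpow_neg_one]

lemma isHeatDensity_D3 (l j k : Fin 3) :
    IsHeatDensity 1 gaussBound fun s => heatKernelD3 s l j k where
  measurable := measurable_heatKernelD3 l j k
  nonneg := gaussBound_pos.le
  abs_le s hs x := by
    refine (abs_heatKernelD3_le hs l j k x).trans_eq ?_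
    rw [Real.sqrt_eq_rpow, ← Real.rpow_neg_one s, ← Real.rpow_neg hs.le, ← Real.rpow_add hs]
    norm_num

lemma IsHeatDensity.add {m C C' : ℝ} {h h' : ℝ → E3 → ℝ} (hh : IsHeatDensity m C h)
    (hh' : IsHeatDensity m C' h') : IsHeatDensity m (C + C') fun s x => h s x + h' s x where
  measurable := hh.measurable.add hh'.measurable
  nonneg := add_nonneg hh.nonneg hh'.nonneg
  abs_le s hs x := by
    refine (abs_add_le _ _).trans ((add_le_add (hh.abs_le s hs x) (hh'.abs_le s hs x)).trans_eq ?_)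
    ring

lemma IsHeatDensity.neg {m C : ℝ} {h : ℝ → E3 → ℝ} (hh : IsHeatDensity m C h) :
    IsHeatDensity m C fun s x => -h s x where
  measurable := hh.measurable.neg
  nonneg := hh.nonneg
  abs_le s hs x := by rw [abs_neg]; exact hh.abs_le s hs x

lemma IsHeatDensity.mono {m C C' : ℝ} {h : ℝ → E3 → ℝ} (hh : IsHeatDensity m C h) (hC : C ≤ C') :
    IsHeatDensity m C' h where
  measurable := hh.measurable
  nonneg := hh.nonneg.trans hC
  abs_le s hs x := by
    refine (hh.abs_le s hs x).trans ?_
    have := heatKernel_nonneg (2 * s) (by positivity) x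
    gcongr

/-- The density of the heat kernel. -/
def densityHeat (s : ℝ) (x : E3) : ℝ := -∑ i : Fin 3, heatKernelD2 s i i x

/-- The density of the derivative `∂_l` of the heat kernel. -/
def densityHeatD (l : Fin 3) (s : ℝ) (x : E3) : ℝ := -∑ i : Fin 3, heatKernelD3 s l i i x

/-- The density of the kernel of `e^{tΔ}ℙ`. -/
def densityLeray (j k : Fin 3) (s : ℝ) (x : E3) : ℝ :=
  heatKernelD2 s j k x + if j = k then densityHeat s x else 0

/-- The density of the derivative `∂_l` of the kernel of `e^{tΔ}ℙ`. -/
def densityLerayD (l j k : Fin 3) (s : ℝ) (x : E3) : ℝ :=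
  heatKernelD3 s l j k x + if j = k then densityHeatD l s x else 0

lemma isHeatDensity_heat : IsHeatDensity 0 (4 * gaussBound) densityHeat := by
  have h := (((isHeatDensity_D2 0 0).add (isHeatDensity_D2 1 1)).add (isHeatDensity_D2 2 2)).neg
  have e : densityHeat = fun s x => -(heatKernelD2 s 0 0 x + heatKernelD2 s 1 1 x +
      heatKernelD2 s 2 2 x) := by
    ext s x; simp [densityHeat, Fin.sum_univ_three]
  rw [e]
  exact h.mono (by linarith [gaussBound_pos])

lemma isHeatDensity_heatD (l : Fin 3) : IsHeatDensity 1 (4 * gaussBound) (densityHeatD l) := by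
  have h := (((isHeatDensity_D3 l 0 0).add (isHeatDensity_D3 l 1 1)).add
    (isHeatDensity_D3 l 2 2)).neg
  have e : densityHeatD l = fun s x => -(heatKernelD3 s l 0 0 x + heatKernelD3 s l 1 1 x +
      heatKernelD3 s l 2 2 x) := by
    ext s x; simp [densityHeatD, Fin.sum_univ_three]
  rw [e]
  exact h.mono (by linarith [gaussBound_pos])

lemma isHeatDensity_leray (j k : Fin 3) : IsHeatDensity 0 (5 * gaussBound) (densityLeray j k) := by
  by_cases hjk : j = k
  · have e : densityLeray j k = fun s x => heatKernelD2 s j k x + densityHeat s x := by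
      ext s x; simp [densityLeray, hjk]
    rw [e]
    exact ((isHeatDensity_D2 j k).add isHeatDensity_heat).mono (by linarith [gaussBound_pos])
  · have e : densityLeray j k = fun s x => heatKernelD2 s j k x := by
      ext s x; simp [densityLeray, hjk]
    rw [e]
    exact (isHeatDensity_D2 j k).mono (by linarith [gaussBound_pos])

lemma isHeatDensity_lerayD (l j k : Fin 3) :
    IsHeatDensity 1 (5 * gaussBound) (densityLerayD l j k) := by
  by_cases hjk : j = k
  · have e : densityLerayD l j k = fun s x => heatKernelD3 s l j k x + densityHeatD l s x := by
      ext s x; simp [densityLerayD, hjk]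
    rw [e]
    exact ((isHeatDensity_D3 l j k).add (isHeatDensity_heatD l)).mono
      (by linarith [gaussBound_pos])
  · have e : densityLerayD l j k = fun s x => heatKernelD3 s l j k x := by
      ext s x; simp [densityLerayD, hjk]
    rw [e]
    exact (isHeatDensity_D3 l j k).mono (by linarith [gaussBound_pos])

lemma IsHeatDensity.measurable_left {m C : ℝ} {h : ℝ → E3 → ℝ} (hh : IsHeatDensity m C h)
    (x : E3) : Measurable fun s => h s x :=
  hh.measurable.comp (measurable_id.prodMk measurable_const)

/-- The bound is uniform in `x` and its exponent is below `-1` when `m ≥ 0`: the superposition over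
`s > t` then converges absolutely, is bounded in `x`, and can be differentiated under the integral.
-/
lemma IsHeatDensity.abs_le_rpow {m C : ℝ} {h : ℝ → E3 → ℝ} (hh : IsHeatDensity m C h) {s : ℝ}
    (hs : 0 < s) (x : E3) : |h s x| ≤ C * s ^ (-(5 / 2) - m / 2) := by
  refine (hh.abs_le s hs x).trans ?_
  have hC := hh.nonneg
  have h1 : heatKernel (2 * s) x ≤ s ^ (-(3 / 2) : ℝ) :=
    (heatKernel_le (2 * s) (by positivity) x).trans
      (Real.rpow_le_rpow_of_nonpos hs (by linarith) (by norm_num))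
  calc _ ≤ C * s ^ (-1 - m / 2) * s ^ (-(3 / 2) : ℝ) := by gcongr
    _ = _ := by rw [mul_assoc, ← Real.rpow_add hs]; congr 2; ring

lemma IsHeatDensity.integrableOn {m C : ℝ} (hm : 0 ≤ m) {h : ℝ → E3 → ℝ}
    (hh : IsHeatDensity m C h) {t : ℝ} (ht : 0 < t) (x : E3) :
    IntegrableOn (fun s => h s x) (Ioi t) := by
  refine Integrable.mono' ((integrableOn_Ioi_rpow_of_lt
    (by linarith : -(5 / 2) - m / 2 < -1) ht).const_mul C)
    (hh.measurable_left x).aestronglyMeasurable ?_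
  filter_upwards [ae_restrict_mem measurableSet_Ioi] with s hs
  exact hh.abs_le_rpow (ht.trans hs) x

/-- By the heat equation the density is the time derivative of minus the heat kernel, which tends to
zero at infinity. The fundamental theorem of calculus on `(t,∞)` gives the claim. -/
lemma heatPot_densityHeat {t : ℝ} (ht : 0 < t) (x : E3) :
    heatPot densityHeat t x = heatKernel t x := by
  have hlim : Tendsto (fun s => -heatKernel s x) atTop (𝓝 0) := by
    rw [← neg_zero]
    refine Tendsto.neg (squeeze_zero' ?_ ?_ (tendsto_rpow_neg_atTop (y := 3 / 2) (by norm_num)))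
    · filter_upwards [eventually_gt_atTop 0] with s hs using heatKernel_nonneg s hs x
    · filter_upwards [eventually_gt_atTop 0] with s hs using heatKernel_le s hs x
  have := integral_Ioi_of_hasDerivAt_of_tendsto' (a := t) (f := fun s => -heatKernel s x)
    (f' := fun s => densityHeat s x)
    (fun s hs => (hasDerivAt_heatKernel_time (ht.trans_le hs) x).neg)
    (isHeatDensity_heat.integrableOn le_rfl ht x) hlim
  rw [heatPot, this]; ring

lemma heatPot_densityHeatD {t : ℝ} (ht : 0 < t) (l : Fin 3) (x : E3) :
    heatPot (densityHeatD l) t x = pderiv l (heatKernel t) x := by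
  have hlim : Tendsto (fun s => -(-(x l / (2 * s)) * heatKernel s x)) atTop (𝓝 0) := by
    have h1 : Tendsto (fun s : ℝ => heatKernel s x) atTop (𝓝 0) := by
      refine squeeze_zero' ?_ ?_ (tendsto_rpow_neg_atTop (y := 3 / 2) (by norm_num))
      · filter_upwards [eventually_gt_atTop 0] with s hs using heatKernel_nonneg s hs x
      · filter_upwards [eventually_gt_atTop 0] with s hs using heatKernel_le s hs x
    have h2 : Tendsto (fun s : ℝ => x l / (2 * s)) atTop (𝓝 0) :=
      tendsto_const_nhds.div_atTop (tendsto_id.const_mul_atTop (by norm_num))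
    simpa using h2.mul h1
  have := integral_Ioi_of_hasDerivAt_of_tendsto' (a := t)
    (f := fun s => -(-(x l / (2 * s)) * heatKernel s x))
    (f' := fun s => densityHeatD l s x)
    (fun s hs => (hasDerivAt_heatKernelD1_time (ht.trans_le hs) l x).neg)
    ((isHeatDensity_heatD l).integrableOn zero_le_one ht x) hlim
  rw [heatPot, this, pderiv_heatKernel]; ring

/-! ### The kernel of `e^{tΔ}ℙ` as a superposition of Gaussians -/

/-- The Gaussian `ξ ↦ exp(-4π²s|ξ|²)` as a complex Schwartz function. -/
def gaussSymbol (s : ℝ) (hs : 0 < s) : 𝓢(E3, ℂ) :=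
  (gaussSchwartz (4 * Real.pi ^ 2 * s) (by positivity)).postcompCLM Complex.ofRealCLM

lemma gaussSymbol_apply (s : ℝ) (hs : 0 < s) (ξ : E3) :
    gaussSymbol s hs ξ = (Real.exp (-(4 * Real.pi ^ 2 * s) * ‖ξ‖ ^ 2) : ℂ) := rfl

lemma fourierInv_gaussSymbol (s : ℝ) (hs : 0 < s) (x : E3) :
    (𝓕⁻ (gaussSymbol s hs)) x = (heatKernel s x : ℂ) := by
  have hb : (0 : ℝ) < ((4 * Real.pi ^ 2 * s : ℝ) : ℂ).re := by
    rw [Complex.ofReal_re]; positivity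
  have h := fourier_gaussian_innerProductSpace (V := E3) hb (-x)
  rw [SchwartzMap.fourierInv_coe, Real.fourierInv_eq_fourier_neg]
  have e : ((gaussSymbol s hs : 𝓢(E3, ℂ)) : E3 → ℂ) =
      fun v : E3 => Complex.exp (-((4 * Real.pi ^ 2 * s : ℝ) : ℂ) * (‖v‖ : ℂ) ^ 2) := by
    ext v
    rw [gaussSymbol_apply]
    push_cast
    rfl
  rw [e, h, heatKernel, finrank_euclideanSpace_fin, norm_neg]
  push_cast
  have hp : (Real.pi : ℂ) ≠ 0 := by exact_mod_cast Real.pi_ne_zero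
  have hs' : (s : ℂ) ≠ 0 := by exact_mod_cast hs.ne'
  have e1 : (Real.pi : ℂ) / (4 * (Real.pi : ℂ) ^ 2 * s) = ((4 * Real.pi * s : ℝ)⁻¹ : ℝ) := by
    push_cast; field_simp
  rw [e1]
  congr 1
  · rw [show (3 : ℂ) / 2 = ((3 / 2 : ℝ) : ℂ) by push_cast; rfl,
      ← Complex.ofReal_cpow (by positivity), Real.inv_rpow (by positivity),
      ← Real.rpow_neg (by positivity)]
  · congr 1; field_simp

lemma hasTemperateGrowth_inner_basisVec (j : Fin 3) :
    (fun ξ : E3 => inner ℝ ξ (basisVec j)).HasTemperateGrowth := by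
  fun_prop

lemma smulLeftCLM_basisVec_apply {𝕜 F : Type*} [RCLike 𝕜] [NormedAddCommGroup F] [NormedSpace ℝ F]
    [NormedSpace 𝕜 F] [SMulCommClass ℝ 𝕜 F] (j : Fin 3) (f : 𝓢(E3, F)) (ξ : E3) :
    SchwartzMap.smulLeftCLM F (fun ξ : E3 => inner ℝ ξ (basisVec j)) f ξ = ξ j • f ξ := by
  rw [SchwartzMap.smulLeftCLM_apply_apply (hasTemperateGrowth_inner_basisVec _), inner_basisVec]

/-- Each derivative of the inverse transform of the Gaussian multiplies the symbol by `2πi` times a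
coordinate. Two of them give `-4π²ξ_jξ_k`, hence the minus sign. -/
lemma fourierInv_symbolD2 (s : ℝ) (hs : 0 < s) (j k : Fin 3) (x : E3) :
    𝓕⁻ (fun ξ : E3 => ((4 * Real.pi ^ 2 * (ξ j * ξ k) *
      Real.exp (-(4 * Real.pi ^ 2 * s) * ‖ξ‖ ^ 2) : ℝ) : ℂ)) x = ((-heatKernelD2 s j k x : ℝ) : ℂ)
          := by
  set A := gaussSymbol s hs with hA
  have d1 := SchwartzMap.lineDerivOp_fourierInv_eq A (basisVec k)
  have d2 := SchwartzMap.lineDerivOp_fourierInv_eq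
    ((2 * Real.pi * Complex.I) • SchwartzMap.smulLeftCLM ℂ (fun ξ => inner ℝ ξ (basisVec k)) A)
    (basisVec j)
  rw [← d1] at d2
  have e0 : ((𝓕⁻ A : 𝓢(E3, ℂ)) : E3 → ℂ) = fun x => (heatKernel s x : ℂ) := by
    ext x; exact fourierInv_gaussSymbol s hs x
  have e1 : ((∂_{basisVec k} (𝓕⁻ A) : 𝓢(E3, ℂ)) : E3 → ℂ) =
      fun x => ((-(x k / (2 * s)) * heatKernel s x : ℝ) : ℂ) := by
    ext x
    rw [SchwartzMap.lineDerivOp_apply_eq_fderiv, e0]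
    have := (Complex.ofRealCLM.hasFDerivAt.comp x (hasFDerivAt_heatKernel s x)).fderiv
    simp only [Function.comp_def, Complex.ofRealCLM_apply] at this
    rw [this]
    have h2 := pderiv_heatKernel k s x
    rw [pderiv, (hasFDerivAt_heatKernel s x).fderiv] at h2
    rw [← h2]
    rfl
  have e2 : (∂_{basisVec j} (∂_{basisVec k} (𝓕⁻ A)) : 𝓢(E3, ℂ)) x =
      (heatKernelD2 s j k x : ℂ) := by
    rw [SchwartzMap.lineDerivOp_apply_eq_fderiv, e1]
    have := (Complex.ofRealCLM.hasFDerivAt.comp x (hasFDerivAt_heatKernelD1 s k x)).fderiv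
    simp only [Function.comp_def, Complex.ofRealCLM_apply] at this
    rw [this]
    simp [proj_basisVec]
  rw [d2, SchwartzMap.fourierInv_coe] at e2
  have e3 : (((2 * Real.pi * Complex.I) • SchwartzMap.smulLeftCLM ℂ
      (fun ξ => inner ℝ ξ (basisVec j)) ((2 * Real.pi * Complex.I) •
        SchwartzMap.smulLeftCLM ℂ (fun ξ => inner ℝ ξ (basisVec k)) A) : 𝓢(E3, ℂ)) : E3 → ℂ) =
      fun ξ => (-1 : ℂ) • ((4 * Real.pi ^ 2 * (ξ j * ξ k) *
        Real.exp (-(4 * Real.pi ^ 2 * s) * ‖ξ‖ ^ 2) : ℝ) : ℂ) := by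
    ext ξ
    simp only [smul_apply, smulLeftCLM_basisVec_apply (𝕜 := ℂ), smul_eq_mul, Complex.real_smul, hA,
      gaussSymbol_apply]
    push_cast
    linear_combination (4 * (Real.pi : ℂ) ^ 2 * ξ j * ξ k *
      Complex.exp (-(4 * (Real.pi : ℂ) ^ 2 * s) * (‖ξ‖ : ℂ) ^ 2)) * Complex.I_sq
  rw [e3] at e2
  have e4 : 𝓕⁻ (fun ξ : E3 => (-1 : ℂ) • ((4 * Real.pi ^ 2 * (ξ j * ξ k) *
        Real.exp (-(4 * Real.pi ^ 2 * s) * ‖ξ‖ ^ 2) : ℝ) : ℂ)) x =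
      (-1 : ℂ) • 𝓕⁻ (fun ξ : E3 => ((4 * Real.pi ^ 2 * (ξ j * ξ k) *
        Real.exp (-(4 * Real.pi ^ 2 * s) * ‖ξ‖ ^ 2) : ℝ) : ℂ)) x := by
    simp only [Real.fourierInv_eq]
    rw [← integral_smul]
    refine integral_congr_ae (ae_of_all _ fun v => ?_)
    simp only [Circle.smul_def, smul_eq_mul]
    ring
  rw [e4] at e2
  push_cast
  rw [← e2]
  simp

lemma integrable_symbolD2 (s : ℝ) (hs : 0 < s) (j k : Fin 3) :
    Integrable (fun ξ : E3 => ξ j * ξ k * Real.exp (-(4 * Real.pi ^ 2 * s) * ‖ξ‖ ^ 2)) := by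
  have h := (SchwartzMap.smulLeftCLM ℝ (fun ξ => inner ℝ ξ (basisVec j))
    (SchwartzMap.smulLeftCLM ℝ (fun ξ => inner ℝ ξ (basisVec k))
      (gaussSchwartz (4 * Real.pi ^ 2 * s) (by positivity)))).integrable (μ := volume)
  refine h.congr (ae_of_all _ fun ξ => ?_)
  simp only [smulLeftCLM_basisVec_apply (𝕜 := ℝ), smul_eq_mul, mul_assoc]
  rfl

/-- The density in Fourier variables of the symbol of `e^{tΔ}ℙ`. -/
def leraySymbolDensity (j k : Fin 3) (s : ℝ) (ξ : E3) : ℝ :=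
  ((if j = k then ∑ i : Fin 3, 4 * Real.pi ^ 2 * (ξ i * ξ i) *
      Real.exp (-(4 * Real.pi ^ 2 * s) * ‖ξ‖ ^ 2) else 0) -
    4 * Real.pi ^ 2 * (ξ j * ξ k) * Real.exp (-(4 * Real.pi ^ 2 * s) * ‖ξ‖ ^ 2))

lemma fourierInv_leraySymbolDensity (s : ℝ) (hs : 0 < s) (j k : Fin 3) (x : E3) :
    𝓕⁻ (fun ξ : E3 => (leraySymbolDensity j k s ξ : ℂ)) x = (densityLeray j k s x : ℂ) := by
  have hi : ∀ j k : Fin 3, Integrable (fun v : E3 => (Real.fourierChar (inner ℝ v x) : Circle) •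
      ((4 * Real.pi ^ 2 * (v j * v k) *
        Real.exp (-(4 * Real.pi ^ 2 * s) * ‖v‖ ^ 2) : ℝ) : ℂ)) := by
    intro j k
    have h1 : Integrable (fun v : E3 => ((4 * Real.pi ^ 2 * (v j * v k) *
        Real.exp (-(4 * Real.pi ^ 2 * s) * ‖v‖ ^ 2) : ℝ) : ℂ)) := by
      have h0 : Integrable (fun v : E3 => 4 * Real.pi ^ 2 * (v j * v k) *
          Real.exp (-(4 * Real.pi ^ 2 * s) * ‖v‖ ^ 2)) := by
        refine ((integrable_symbolD2 s hs j k).const_mul (4 * Real.pi ^ 2)).congr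
          (ae_of_all _ fun v => ?_)
        simp only [mul_assoc]
      exact h0.ofReal
    have := (Real.fourierIntegral_convergent_iff (-x)).2 h1
    refine this.congr (ae_of_all _ fun v => ?_)
    simp [inner_neg_right]
  have hf : ∀ j k : Fin 3, ∫ v : E3, (Real.fourierChar (inner ℝ v x) : Circle) •
      ((4 * Real.pi ^ 2 * (v j * v k) *
        Real.exp (-(4 * Real.pi ^ 2 * s) * ‖v‖ ^ 2) : ℝ) : ℂ) = ((-heatKernelD2 s j k x : ℝ) : ℂ)
            := by
    intro j k
    rw [← fourierInv_symbolD2 s hs j k x, Real.fourierInv_eq]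
  rw [Real.fourierInv_eq]
  by_cases hjk : j = k
  · simp only [leraySymbolDensity, hjk, if_true, Complex.ofReal_sub, Complex.ofReal_sum,
      smul_sub, Finset.smul_sum, densityLeray, densityHeat]
    rw [integral_sub (integrable_finsetSum _ fun i _ => hi i i) (hi k k),
      integral_finsetSum _ fun i _ => hi i i, hf k k]
    simp only [hf]
    push_cast
    rw [Finset.sum_neg_distrib]
    ring
  · simp only [leraySymbolDensity, hjk, if_false, zero_sub, Complex.ofReal_neg,
      smul_neg, densityLeray, add_zero]
    rw [integral_neg, hf j k]
    push_cast
    ring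

/-- Integrating the exponential in `s` over `(t,∞)` produces the division by `|ξ|²` in the symbol of
`ℙ`. The origin has to be excluded: there the density vanishes identically, while the symbol as
defined takes the value `1` on the diagonal, since the quotient by zero is zero. -/
lemma heatLeraySymbol_eq_integral {t : ℝ} (j k : Fin 3) {ξ : E3} (hξ : ξ ≠ 0) :
    IntegrableOn (fun s => leraySymbolDensity j k s ξ) (Ioi t) ∧
    ∫ s in Ioi t, leraySymbolDensity j k s ξ = heatLeraySymbol t j k ξ := by
  have hn : 0 < ‖ξ‖ := norm_pos_iff.2 hξ
  have hc : 0 < 4 * Real.pi ^ 2 * ‖ξ‖ ^ 2 := by positivity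
  have e : ∀ s, leraySymbolDensity j k s ξ =
      (4 * Real.pi ^ 2 * ((if j = k then ‖ξ‖ ^ 2 else 0) - ξ j * ξ k)) *
        Real.exp (-(4 * Real.pi ^ 2 * ‖ξ‖ ^ 2) * s) := by
    intro s
    have e1 : -(4 * Real.pi ^ 2 * ‖ξ‖ ^ 2) * s = -(4 * Real.pi ^ 2 * s) * ‖ξ‖ ^ 2 := by ring
    rw [leraySymbolDensity, e1, ← Finset.sum_mul, ← Finset.mul_sum, ← norm_sq_eq_sum]
    split_ifs <;> ring
  simp only [e]
  constructor
  · exact (integrableOn_exp_mul_Ioi (by linarith) t).const_mul _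
  · rw [integral_const_mul, integral_exp_mul_Ioi (by linarith), heatLeraySymbol]
    have e1 : -(4 * Real.pi ^ 2 * ‖ξ‖ ^ 2) * t = -(4 * Real.pi ^ 2 * t * ‖ξ‖ ^ 2) := by ring
    rw [e1]
    split_ifs <;> (field_simp; try ring)

lemma abs_leraySymbolDensity_le (j k : Fin 3) (s : ℝ) (ξ : E3) :
    |leraySymbolDensity j k s ξ| ≤
      8 * Real.pi ^ 2 * ‖ξ‖ ^ 2 * Real.exp (-(4 * Real.pi ^ 2 * ‖ξ‖ ^ 2) * s) := by
  have e1 : -(4 * Real.pi ^ 2 * ‖ξ‖ ^ 2) * s = -(4 * Real.pi ^ 2 * s) * ‖ξ‖ ^ 2 := by ring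
  rw [leraySymbolDensity, e1, ← Finset.sum_mul, ← Finset.mul_sum, ← norm_sq_eq_sum]
  set E := Real.exp (-(4 * Real.pi ^ 2 * s) * ‖ξ‖ ^ 2) with hE
  have hE0 : 0 < E := Real.exp_pos _
  have h2 : |ξ j * ξ k| ≤ ‖ξ‖ ^ 2 := by
    rw [abs_mul, pow_two]
    exact mul_le_mul (abs_coord_le ξ j) (abs_coord_le ξ k) (abs_nonneg _) (norm_nonneg _)
  have h3 : |4 * Real.pi ^ 2 * (ξ j * ξ k) * E| ≤ 4 * Real.pi ^ 2 * ‖ξ‖ ^ 2 * E := by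
    rw [abs_mul, abs_mul, abs_of_pos hE0, abs_of_pos (by positivity : 0 < 4 * Real.pi ^ 2)]
    gcongr
  have h4 : |if j = k then 4 * Real.pi ^ 2 * ‖ξ‖ ^ 2 * E else 0| ≤ 4 * Real.pi ^ 2 * ‖ξ‖ ^ 2 * E
      := by
    split_ifs
    · rw [abs_of_nonneg (by positivity)]
    · simp; positivity
  calc _ ≤ _ := abs_sub _ _
    _ ≤ _ := add_le_add h4 h3
    _ = _ := by ring

lemma measurable_leraySymbolDensity (j k : Fin 3) :
    Measurable (fun z : ℝ × E3 => leraySymbolDensity j k z.1 z.2) := by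
  unfold leraySymbolDensity
  have hc : ∀ i : Fin 3, Measurable fun z : ℝ × E3 => z.2 i :=
    fun i => (measurable_coord i).comp measurable_snd
  have h : ∀ i i' : Fin 3, Measurable fun z : ℝ × E3 => 4 * Real.pi ^ 2 * (z.2 i * z.2 i') *
      Real.exp (-(4 * Real.pi ^ 2 * z.1) * ‖z.2‖ ^ 2) := by
    intro i i'
    have := hc i
    have := hc i'
    fun_prop
  split_ifs
  · exact (Finset.measurable_fun_sum _ fun i _ => h i i).sub (h j k)
  · exact measurable_const.sub (h j k)

lemma measurable_flip {X Y Z : Type*} [MeasurableSpace X] [MeasurableSpace Y] [MeasurableSpace Z]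
    {g : X → Y → Z} (hg : Measurable fun z : X × Y => g z.1 z.2) :
    Measurable fun z : Y × X => g z.2 z.1 :=
  hg.comp measurable_swap

/-- The absolute convergence needed to exchange the Fourier and time integrals: the density is at
most `8π²|ξ|²` times an exponential in `s`, whose integral over `s > t` is the Gaussian `2
exp(-4π²t|ξ|²)`, integrable in `ξ`. -/
lemma integrable_leraySymbolDensity {t : ℝ} (ht : 0 < t) (j k : Fin 3) :
    Integrable (fun z : E3 × ℝ => leraySymbolDensity j k z.2 z.1)
      (volume.prod (volume.restrict (Ioi t))) := by
  have hm : Measurable (fun z : E3 × ℝ => leraySymbolDensity j k z.2 z.1) :=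
    measurable_flip (measurable_leraySymbolDensity j k)
  have hg : Integrable (fun ξ : E3 => 2 * Real.exp (-(4 * Real.pi ^ 2 * t) * ‖ξ‖ ^ 2)) :=
    ((gaussSchwartz (4 * Real.pi ^ 2 * t) (by positivity)).integrable (μ := volume)).const_mul 2
  have hne : ∀ᵐ ξ : E3, ξ ≠ 0 := by simp [ae_iff, measure_singleton]
  have h1 : ∀ᵐ ξ : E3, Integrable (fun s => leraySymbolDensity j k s ξ) (volume.restrict (Ioi t))
      := by
    filter_upwards [hne] with ξ hξ
    exact (heatLeraySymbol_eq_integral j k hξ).1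
  have h2 : ∀ᵐ ξ : E3, ‖∫ s in Ioi t, ‖leraySymbolDensity j k s ξ‖‖ ≤
      2 * Real.exp (-(4 * Real.pi ^ 2 * t) * ‖ξ‖ ^ 2) := by
    filter_upwards [hne] with ξ hξ
    have hn : 0 < ‖ξ‖ := norm_pos_iff.2 hξ
    have hc : 0 < 4 * Real.pi ^ 2 * ‖ξ‖ ^ 2 := by positivity
    rw [Real.norm_of_nonneg (integral_nonneg fun _ => norm_nonneg _)]
    calc ∫ s in Ioi t, ‖leraySymbolDensity j k s ξ‖
        ≤ ∫ s in Ioi t, 8 * Real.pi ^ 2 * ‖ξ‖ ^ 2 * Real.exp (-(4 * Real.pi ^ 2 * ‖ξ‖ ^ 2) * s) :=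
            by
          refine integral_mono_of_nonneg (ae_of_all _ fun _ => norm_nonneg _)
            ((integrableOn_exp_mul_Ioi (by linarith) t).const_mul _) (ae_of_all _ fun s => ?_)
          exact abs_leraySymbolDensity_le j k s ξ
      _ = 2 * Real.exp (-(4 * Real.pi ^ 2 * t) * ‖ξ‖ ^ 2) := by
          rw [integral_const_mul, integral_exp_mul_Ioi (by linarith)]
          have e1 : -(4 * Real.pi ^ 2 * ‖ξ‖ ^ 2) * t = -(4 * Real.pi ^ 2 * t) * ‖ξ‖ ^ 2 := by ring
          rw [e1]
          field_simp
          norm_num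
  have hm2 : StronglyMeasurable (fun ξ : E3 => ∫ s in Ioi t, ‖leraySymbolDensity j k s ξ‖) := by
    generalize leraySymbolDensity j k = g at hm
    exact hm.norm.stronglyMeasurable.integral_prod_right'
  have h3 : Integrable (fun ξ : E3 => ∫ s in Ioi t, ‖leraySymbolDensity j k s ξ‖) :=
    Integrable.mono' hg hm2.aestronglyMeasurable h2
  generalize leraySymbolDensity j k = g at hm h1 h3 ⊢
  exact (integrable_prod_iff hm.aestronglyMeasurable).2 ⟨h1, h3⟩

/-- Fubini's theorem moves the inverse Fourier transform inside the integral over `s`, where only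
derivatives of Gaussians remain. This replaces any direct study of the kernel of `e^{tΔ}ℙ`. -/
theorem heatPot_densityLeray {t : ℝ} (ht : 0 < t) (j k : Fin 3) (x : E3) :
    heatPot (densityLeray j k) t x = heatLerayKernel t j k x := by
  have hne : ∀ᵐ ξ : E3, ξ ≠ 0 := by simp [ae_iff, measure_singleton]
  have hI : Integrable (Function.uncurry fun (ξ : E3) (s : ℝ) =>
      (Real.fourierChar (inner ℝ ξ x) : Circle) • (leraySymbolDensity j k s ξ : ℂ))
      (volume.prod (volume.restrict (Ioi t))) := by
    refine (integrable_leraySymbolDensity ht j k).norm.mono' ?_ (ae_of_all _ fun z => ?_)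
    · refine AEStronglyMeasurable.fun_smul (f := fun z : E3 × ℝ =>
        (Real.fourierChar (inner ℝ z.1 x) : Circle)) ?_ ?_
      · exact (by fun_prop : Continuous fun z : E3 × ℝ =>
          (Real.fourierChar (inner ℝ z.1 x) : Circle)).aestronglyMeasurable
      · exact (Complex.measurable_ofReal.comp
          (measurable_flip (measurable_leraySymbolDensity j k))).aestronglyMeasurable
    · simp [Function.uncurry]
  have h1 : (𝓕⁻ (fun ξ : E3 => (heatLeraySymbol t j k ξ : ℂ)) x) =
      ((heatPot (densityLeray j k) t x : ℝ) : ℂ) := by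
    rw [Real.fourierInv_eq, heatPot, ← integral_complex_ofReal]
    calc ∫ ξ : E3, (Real.fourierChar (inner ℝ ξ x) : Circle) • (heatLeraySymbol t j k ξ : ℂ)
        = ∫ ξ : E3, ∫ s in Ioi t, (Real.fourierChar (inner ℝ ξ x) : Circle) •
            (leraySymbolDensity j k s ξ : ℂ) := by
          refine integral_congr_ae ?_
          filter_upwards [hne] with ξ hξ
          simp only [Circle.smul_def, smul_eq_mul]
          rw [integral_const_mul, integral_complex_ofReal, (heatLeraySymbol_eq_integral j k hξ).2]
      _ = ∫ s in Ioi t, ∫ ξ : E3, (Real.fourierChar (inner ℝ ξ x) : Circle) •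
            (leraySymbolDensity j k s ξ : ℂ) := integral_integral_swap hI
      _ = _ := by
          refine setIntegral_congr_fun measurableSet_Ioi fun s hs => ?_
          have := fourierInv_leraySymbolDensity s (ht.trans hs) j k x
          rw [Real.fourierInv_eq] at this
          exact this
  rw [heatLerayKernel, h1, Complex.ofReal_re]

lemma hasFDerivAt_densityLeray (j k : Fin 3) (s : ℝ) (x : E3) :
    HasFDerivAt (densityLeray j k s)
      (∑ l : Fin 3, densityLerayD l j k s x • (EuclideanSpace.proj l : E3 →L[ℝ] ℝ)) x := by
  by_cases hjk : j = k
  · have h := (hasFDerivAt_heatKernelD2 s j k x).add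
      (HasFDerivAt.fun_sum fun i (_ : i ∈ Finset.univ) => hasFDerivAt_heatKernelD2 s i i x).neg
    refine (h.congr_of_eventuallyEq (Eventually.of_forall fun y => ?_)).congr_fderiv ?_
    · simp [densityLeray, densityHeat, hjk]
    · ext v
      simp only [hjk, densityLerayD, densityHeatD, if_true, add_apply,
        neg_apply, smul_apply, smul_eq_mul, Fin.sum_univ_three]
      ring
  · refine ((hasFDerivAt_heatKernelD2 s j k x).congr_of_eventuallyEq
      (Eventually.of_forall fun y => ?_)).congr_fderiv ?_
    · simp [densityLeray, hjk]
    · simp [hjk, densityLerayD]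

/-- Differentiation under the integral over `s > t`; the bound of order `s^{-3}` on the third
derivatives, uniform in space, is the dominating function. -/
theorem hasFDerivAt_heatPot_densityLeray {t : ℝ} (ht : 0 < t) (j k : Fin 3) (x : E3) :
    HasFDerivAt (heatPot (densityLeray j k) t)
      (∑ l : Fin 3, heatPot (densityLerayD l j k) t x • (EuclideanSpace.proj l : E3 →L[ℝ] ℝ)) x :=
          by
  have hint : ∀ l, IntegrableOn (fun s => densityLerayD l j k s x) (Ioi t) := fun l =>
    (isHeatDensity_lerayD l j k).integrableOn zero_le_one ht x
  have h := hasFDerivAt_integral_of_dominated_of_fderiv_le (𝕜 := ℝ)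
    (μ := volume.restrict (Ioi t)) (s := univ) (x₀ := x)
    (F := fun y s => densityLeray j k s y)
    (F' := fun y s => ∑ l : Fin 3, densityLerayD l j k s y •
      (EuclideanSpace.proj l : E3 →L[ℝ] ℝ))
    (bound := fun s => ∑ l : Fin 3, (5 * gaussBound * s ^ (-(5 / 2) - 1 / 2 : ℝ)) *
      ‖(EuclideanSpace.proj l : E3 →L[ℝ] ℝ)‖)
    univ_mem
    (Eventually.of_forall fun y =>
      ((isHeatDensity_leray j k).measurable_left y).aestronglyMeasurable)
    ((isHeatDensity_leray j k).integrableOn le_rfl ht x)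
    (Finset.aestronglyMeasurable_fun_sum _ fun l _ => AEStronglyMeasurable.smul_const
      ((isHeatDensity_lerayD l j k).measurable_left x).aestronglyMeasurable _)
    (by
      filter_upwards [ae_restrict_mem measurableSet_Ioi] with s hs y _
      refine norm_sum_le_of_le _ fun l _ => ?_
      rw [norm_smul]
      gcongr
      exact (isHeatDensity_lerayD l j k).abs_le_rpow (ht.trans hs) y)
    (integrable_finsetSum _ fun l _ => Integrable.mul_const (Integrable.const_mul
      (integrableOn_Ioi_rpow_of_lt (by norm_num) ht) _) _)
    (ae_of_all _ fun s y _ => hasFDerivAt_densityLeray j k s y)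
  refine h.congr_fderiv ?_
  rw [integral_finsetSum _ fun l _ => (hint l).smul_const _]
  refine Finset.sum_congr rfl fun l _ => ?_
  rw [integral_smul_const]
  rfl

theorem heatPot_densityLerayD {t : ℝ} (ht : 0 < t) (l j k : Fin 3) (x : E3) :
    heatPot (densityLerayD l j k) t x = pderiv l (heatLerayKernel t j k) x := by
  have e : heatLerayKernel t j k = heatPot (densityLeray j k) t := by
    ext x; exact (heatPot_densityLeray ht j k x).symm
  rw [pderiv, e, (hasFDerivAt_heatPot_densityLeray ht j k x).fderiv]
  simp [proj_basisVec]

/-- The columns of the kernel of `e^{tΔ}ℙ` are divergence free. -/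
theorem sum_heatPot_densityLerayD (t : ℝ) (ht : 0 < t) (k : Fin 3) (x : E3) :
    ∑ j : Fin 3, heatPot (densityLerayD j j k) t x = 0 := by
  unfold heatPot
  rw [← integral_finsetSum _ fun j _ =>
    (isHeatDensity_lerayD j j k).integrableOn zero_le_one ht x]
  -- The cancellation already holds in the integrand: summing `∂_j(∂_j∂_k - δ_{jk}Δ)` over `j` gives
  -- `Δ∂_k - ∂_kΔ = 0`.
  have : ∀ s, ∑ j : Fin 3, densityLerayD j j k s x = 0 := by
    intro s
    simp only [densityLerayD, Finset.sum_add_distrib, Finset.sum_ite_eq', Finset.mem_univ,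
      if_true, densityHeatD, heatKernelD3, Fin.sum_univ_three]
    fin_cases k <;> simp <;> ring
  simp [this]

/-! ### Superpositions of heat averages -/

/-- `∫_{(s,σ) ∈ A} σ^{-1-m/2} (e^{2σΔ} f(s))(x) ds dσ`. -/
def heatSup (m : ℝ) (A : Set (ℝ × ℝ)) (f : ℝ → E3 → ℝ≥0∞) (x : E3) : ℝ≥0∞ :=
  ∫⁻ z in A, ENNReal.ofReal (z.2 ^ (-1 - m / 2)) * heatAvg (2 * z.2) (f z.1) x

lemma measurable_heatAvg_param {X : Type*} [MeasurableSpace X] {s : X → ℝ} (hs : Measurable s)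
    {p : X → E3} (hp : Measurable p) {f : X → E3 → ℝ≥0∞}
    (hf : Measurable fun w : X × E3 => f w.1 w.2) :
    Measurable fun w : X => heatAvg (s w) (f w) (p w) := by
  have h : Measurable fun w : X × E3 => heatKernel (s w.1) (p w.1 - w.2) :=
    measurable_heatKernel.comp
      ((hs.comp measurable_fst).prodMk ((hp.comp measurable_fst).sub measurable_snd))
  exact (h.ennreal_ofReal.mul hf).lintegral_prod_right'

lemma measurable_heatSup_integrand (m : ℝ) {f : ℝ → E3 → ℝ≥0∞}
    (hf : Measurable fun w : ℝ × E3 => f w.1 w.2) :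
    Measurable fun w : E3 × (ℝ × ℝ) =>
      ENNReal.ofReal (w.2.2 ^ (-1 - m / 2)) * heatAvg (2 * w.2.2) (f w.2.1) w.1 := by
  refine Measurable.mul (by fun_prop) (measurable_heatAvg_param (by fun_prop) (by fun_prop) ?_)
  exact hf.comp (by fun_prop : Measurable fun w : (E3 × (ℝ × ℝ)) × E3 => (w.1.2.1, w.2))

lemma measurable_heatSup (m : ℝ) (A : Set (ℝ × ℝ)) {f : ℝ → E3 → ℝ≥0∞}
    (hf : Measurable fun w : ℝ × E3 => f w.1 w.2) : Measurable (heatSup m A f) :=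
  (measurable_heatSup_integrand m hf).lintegral_prod_right'

lemma heatSup_split {m : ℝ} (A : Set (ℝ × ℝ)) {B : Set (ℝ × ℝ)} (hB : MeasurableSet B)
    (f : ℝ → E3 → ℝ≥0∞) (x : E3) :
    heatSup m A f x = heatSup m (A ∩ B) f x + heatSup m (A ∩ Bᶜ) f x := by
  unfold heatSup
  rw [← sdiff_eq, lintegral_inter_add_sdiff _ _ hB]

lemma eLpNorm_const_mul_le_ennreal {X : Type*} [MeasurableSpace X] {μ : Measure X} (c : ℝ≥0∞)
    {f : X → ℝ≥0∞} (hf : Measurable f) (b : ℝ≥0∞) :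
    eLpNorm (fun x => c * f x) b μ ≤ c * eLpNorm f b μ := by
  rcases eq_or_ne b 0 with rfl | hb0
  · simp
  rcases eq_or_ne b ∞ with rfl | hbt
  · rw [eLpNorm_exponent_top, eLpNorm_exponent_top]
    refine eLpNormEssSup_le_of_ae_enorm_bound ?_
    filter_upwards [enorm_ae_le_eLpNormEssSup f μ] with x hx
    rw [enorm_eq_self] at hx ⊢
    gcongr
  · have hr := ENNReal.toReal_pos hb0 hbt
    rw [eLpNorm_eq_lintegral_rpow_enorm_toReal hb0 hbt, eLpNorm_eq_lintegral_rpow_enorm_toReal hb0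
        hbt]
    simp only [enorm_eq_self, ENNReal.mul_rpow_of_nonneg _ _ hr.le]
    rw [lintegral_const_mul _ (hf.pow_const _), ENNReal.mul_rpow_of_nonneg _ _ (by positivity),
      ← ENNReal.rpow_mul, mul_one_div_cancel hr.ne', ENNReal.rpow_one]

/-- Minkowski's inequality in `(s,σ)` reduces to one heat average at time `2σ`, whose smoothing from
`L^a` to `L^b` costs at most `σ^{-(3/2)(1/a-1/b)}`. Together with the factor `σ^{-1-m/2}` this is
`σ^{-1-γ}`. The set `J` contains the source times occurring in `A`, the only ones at which a bound
of the source is needed. -/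
theorem eLpNorm_heatSup_le {m : ℝ} {A : Set (ℝ × ℝ)} (hA : MeasurableSet A) {J : Set ℝ}
    (hA0 : ∀ z ∈ A, 0 < z.2 ∧ z.1 ∈ J) {f : ℝ → E3 → ℝ≥0∞}
    (hf : Measurable fun w : ℝ × E3 => f w.1 w.2) {a b : ℝ≥0∞} (ha : 1 ≤ a) (hab : a ≤ b)
    {φ : ℝ → ℝ≥0∞} (hφ : Measurable φ) (hfφ : ∀ᵐ s, s ∈ J → eLpNorm (f s) a volume ≤ φ s) {γ : ℝ}
    (hγ : γ = m / 2 + 3 / 2 * (a⁻¹.toReal - b⁻¹.toReal)) :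
    eLpNorm (heatSup m A f) b volume ≤
      ∫⁻ z in A, ENNReal.ofReal (z.2 ^ (-1 - γ)) * φ z.1 := by
  refine eLpNorm_lintegral_le (measurable_heatSup_integrand m hf) (ha.trans hab)
    (by fun_prop) ?_
  have h1 : ∀ᵐ z : ℝ × ℝ, z.1 ∈ J → eLpNorm (f z.1) a volume ≤ φ z.1 :=
    Measure.quasiMeasurePreserving_fst.ae hfφ
  filter_upwards [ae_restrict_mem hA, ae_restrict_of_ae h1] with z hz hz1
  obtain ⟨h2, h3⟩ := hA0 z hz
  have hfz : Measurable (f z.1) := hf.comp measurable_prodMk_left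
  refine (eLpNorm_const_mul_le_ennreal _ (measurable_heatAvg _ hfz) b).trans ?_
  have h5 := eLpNorm_heatAvg_le (s := 2 * z.2) (by positivity) hfz ha hab
  have hd : 0 ≤ a⁻¹.toReal - b⁻¹.toReal := by
    rw [sub_nonneg]
    refine ENNReal.toReal_mono ?_ (ENNReal.inv_le_inv.2 hab)
    simpa using (zero_lt_one.trans_le ha).ne'
  have h6 : (2 * z.2) ^ (-(3 / 2 * (a⁻¹.toReal - b⁻¹.toReal))) ≤
      z.2 ^ (-(3 / 2 * (a⁻¹.toReal - b⁻¹.toReal))) :=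
    Real.rpow_le_rpow_of_nonpos h2 (by linarith) (by linarith)
  calc _ ≤ ENNReal.ofReal (z.2 ^ (-1 - m / 2)) *
        (ENNReal.ofReal (z.2 ^ (-(3 / 2 * (a⁻¹.toReal - b⁻¹.toReal)))) * φ z.1) := by
        gcongr
        exact h5.trans (by gcongr; exact hz1 h3)
    _ = _ := by
        rw [← mul_assoc, ← ENNReal.ofReal_mul (by positivity), ← Real.rpow_add h2, hγ]
        congr 3; ring

lemma setLIntegral_fiber {X Y : Type*} [MeasureSpace X] [MeasureSpace Y]
    [SFinite (volume : Measure X)] [SFinite (volume : Measure Y)]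
    {A : Set (X × Y)} (hA : MeasurableSet A) {g : X × Y → ℝ≥0∞} (hg : Measurable g) :
    ∫⁻ z in A, g z = ∫⁻ s, ∫⁻ σ in {σ | (s, σ) ∈ A}, g (s, σ) := by
  rw [← lintegral_indicator hA, Measure.volume_eq_prod, lintegral_prod _
      (hg.indicator hA).aemeasurable]
  refine lintegral_congr fun s => ?_
  have hs : MeasurableSet {σ | (s, σ) ∈ A} := measurable_prodMk_left hA
  rw [← lintegral_indicator hs]
  rfl

/-- A kernel dominated by the integral of a heat density over the fibers of `A`. -/
theorem lintegral_kernel_le {m C : ℝ} {h : ℝ → E3 → ℝ} (hh : IsHeatDensity m C h)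
    {A : Set (ℝ × ℝ)} (hA : MeasurableSet A) (hA0 : ∀ z ∈ A, 0 < z.2) {κ : ℝ → E3 → ℝ}
    (hκ : ∀ s x, ‖κ s x‖ₑ ≤ ∫⁻ σ in {σ | (s, σ) ∈ A}, ‖h σ x‖ₑ) {F : ℝ → E3 → ℝ}
    (hF : Measurable fun w : ℝ × E3 => F w.1 w.2) (x : E3) :
    ∫⁻ z : ℝ × E3, ‖κ z.1 (x - z.2) * F z.1 z.2‖ₑ ≤
      ENNReal.ofReal C * heatSup m A (fun s y => ‖F s y‖ₑ) x := by
  have hmh : Measurable fun w : (ℝ × ℝ) × E3 => heatKernel (2 * w.1.2) (x - w.2) :=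
    measurable_heatKernel.comp (by fun_prop : Measurable fun w : (ℝ × ℝ) × E3 =>
      ((2 * w.1.2 : ℝ), x - w.2))
  set g : ℝ → ℝ → E3 → ℝ≥0∞ := fun s σ y => ENNReal.ofReal (σ ^ (-1 - m / 2)) *
    (ENNReal.ofReal (heatKernel (2 * σ) (x - y)) * ‖F s y‖ₑ) with hg
  have hgm : Measurable fun w : (ℝ × ℝ) × E3 => g w.1.1 w.1.2 w.2 := by
    have hF' : Measurable fun w : (ℝ × ℝ) × E3 => F w.1.1 w.2 :=
      hF.comp (by fun_prop : Measurable fun w : (ℝ × ℝ) × E3 => (w.1.1, w.2))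
    have h1 := hmh.ennreal_ofReal
    have h2 := hF'.enorm
    have h3 : Measurable fun w : (ℝ × ℝ) × E3 => ENNReal.ofReal (w.1.2 ^ (-1 - m / 2)) := by
      fun_prop
    exact h3.mul (h1.mul h2)
  have h1 : ∀ s y, ‖κ s (x - y) * F s y‖ₑ ≤
      ENNReal.ofReal C * ∫⁻ σ in {σ | (s, σ) ∈ A}, g s σ y := by
    intro s y
    have hm1 : Measurable fun σ => g s σ y :=
      hgm.comp (by fun_prop : Measurable fun σ : ℝ => ((s, σ), y))
    rw [enorm_mul, ← lintegral_const_mul _ hm1]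
    calc ‖κ s (x - y)‖ₑ * ‖F s y‖ₑ
        ≤ (∫⁻ σ in {σ | (s, σ) ∈ A}, ‖h σ (x - y)‖ₑ) * ‖F s y‖ₑ := by gcongr; exact hκ s _
      _ = ∫⁻ σ in {σ | (s, σ) ∈ A}, ‖h σ (x - y)‖ₑ * ‖F s y‖ₑ :=
          (lintegral_mul_const _ (hh.measurable_left (x - y)).enorm).symm
      _ ≤ _ := by
          refine setLIntegral_mono' (measurable_prodMk_left hA) fun σ hσ => ?_
          have hσ0 : 0 < σ := hA0 _ hσ
          rw [hg]
          simp only []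
          rw [← mul_assoc, ← mul_assoc]
          gcongr
          rw [← ofReal_norm, ← ENNReal.ofReal_mul hh.nonneg,
            ← ENNReal.ofReal_mul (mul_nonneg hh.nonneg (by positivity))]
          exact ENNReal.ofReal_le_ofReal (hh.abs_le σ hσ0 _)
  have hgm2 : Measurable fun w : (ℝ × E3) × ℝ => g w.1.1 w.2 w.1.2 :=
    hgm.comp (by fun_prop : Measurable fun w : (ℝ × E3) × ℝ => ((w.1.1, w.2), w.1.2))
  have hA2 : MeasurableSet {w : (ℝ × E3) × ℝ | (w.1.1, w.2) ∈ A} :=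
    (by fun_prop : Measurable fun w : (ℝ × E3) × ℝ => (w.1.1, w.2)) hA
  have hm2 : Measurable fun z : ℝ × E3 => ∫⁻ σ in {σ | (z.1, σ) ∈ A}, g z.1 σ z.2 := by
    have e : ∀ z : ℝ × E3, ∫⁻ σ in {σ | (z.1, σ) ∈ A}, g z.1 σ z.2 =
        ∫⁻ σ, {w : (ℝ × E3) × ℝ | (w.1.1, w.2) ∈ A}.indicator
          (fun w => g w.1.1 w.2 w.1.2) (z, σ) := by
      intro z
      have hs : MeasurableSet {σ | (z.1, σ) ∈ A} := measurable_prodMk_left hA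
      rw [← lintegral_indicator hs]
      rfl
    simp only [e]
    exact (hgm2.indicator hA2).lintegral_prod_right'
  -- By Tonelli's theorem the space integral is performed innermost, where it is exactly a heat
  -- average of the source at time `2σ`.
  calc _ ≤ ∫⁻ z : ℝ × E3, ENNReal.ofReal C * ∫⁻ σ in {σ | (z.1, σ) ∈ A}, g z.1 σ z.2 :=
        lintegral_mono fun z => h1 z.1 z.2
    _ = ENNReal.ofReal C * ∫⁻ z : ℝ × E3, ∫⁻ σ in {σ | (z.1, σ) ∈ A}, g z.1 σ z.2 :=
        lintegral_const_mul _ hm2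
    _ = ENNReal.ofReal C * ∫⁻ s, ∫⁻ y, ∫⁻ σ in {σ | (s, σ) ∈ A}, g s σ y := by
        rw [Measure.volume_eq_prod, lintegral_prod _ hm2.aemeasurable]
    _ = ENNReal.ofReal C * ∫⁻ s, ∫⁻ σ in {σ | (s, σ) ∈ A}, ∫⁻ y, g s σ y := by
        congr 1
        refine lintegral_congr fun s => ?_
        refine lintegral_lintegral_swap (f := fun y σ => g s σ y) ?_
        exact (hgm.comp (by fun_prop : Measurable fun w : E3 × ℝ => ((s, w.2), w.1))).aemeasurable
    _ = _ := by
        congr 1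
        unfold heatSup
        rw [setLIntegral_fiber hA]
        · refine lintegral_congr fun s => ?_
          refine lintegral_congr fun σ => ?_
          rw [hg, heatAvg]
          refine lintegral_const_mul _ ?_
          have : Measurable fun y => ‖F s y‖ₑ := (hF.comp measurable_prodMk_left).enorm
          exact ((measurable_ofReal_heatKernel_sub _ _).mul this)
        · exact (measurable_heatSup_integrand m (f := fun s y => ‖F s y‖ₑ) hF.enorm).comp
            measurable_prodMk_left

/-! ### Duhamel integrals -/

/-- The kernel of the Duhamel integral at time `t`. -/
def duhamelKernel (h : ℝ → E3 → ℝ) (t s : ℝ) (x : E3) : ℝ :=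
  if s ∈ Ioo 0 t then heatPot h (t - s) x else 0

/-- The Duhamel integral `∫₀ᵗ ∫ k_{t-s}(x-y) F(s,y) dy ds` with the kernel `k = heatPot h`. -/
def duhamel (h F : ℝ → E3 → ℝ) (t : ℝ) (x : E3) : ℝ :=
  ∫ z : ℝ × E3, duhamelKernel h t z.1 (x - z.2) * F z.1 z.2

/-- The domain of integration `0 < s < t`, `t - s < σ`. -/
def regA (t : ℝ) : Set (ℝ × ℝ) := {z | z.1 ∈ Ioo 0 t ∧ t - z.1 < z.2}

/-- The symmetric difference of `regA t` and `regA t'`, for `t ≤ t'`. -/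
def regB (t t' : ℝ) : Set (ℝ × ℝ) :=
  {z | z.1 ∈ Ioo 0 t ∧ t - z.1 < z.2 ∧ z.2 ≤ t' - z.1} ∪ {z | z.1 ∈ Ico t t' ∧ t' - z.1 < z.2}

lemma measurableSet_regA (t : ℝ) : MeasurableSet (regA t) :=
  (measurable_fst measurableSet_Ioo).inter
    (measurableSet_lt (measurable_const.sub measurable_fst) measurable_snd)

lemma measurableSet_regB (t t' : ℝ) : MeasurableSet (regB t t') :=
  ((measurable_fst measurableSet_Ioo).inter
    ((measurableSet_lt (measurable_const.sub measurable_fst) measurable_snd).inter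
      (measurableSet_le measurable_snd (measurable_const.sub measurable_fst)))).union
    ((measurable_fst measurableSet_Ico).inter
    (measurableSet_lt (measurable_const.sub measurable_fst) measurable_snd))

lemma regA_pos {t : ℝ} {z : ℝ × ℝ} (hz : z ∈ regA t) : 0 < z.2 :=
  (sub_pos.2 hz.1.2).trans hz.2

lemma regB_pos {t t' : ℝ} {z : ℝ × ℝ} (hz : z ∈ regB t t') : 0 < z.2 := by
  rcases hz with hz | hz
  · exact (sub_pos.2 hz.1.2).trans hz.2.1
  · exact (sub_pos.2 hz.1.2).trans hz.2

lemma measurable_heatPot {m C : ℝ} {h : ℝ → E3 → ℝ} (hh : IsHeatDensity m C h) :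
    Measurable fun w : ℝ × E3 => heatPot h w.1 w.2 := by
  have e : ∀ w : ℝ × E3, heatPot h w.1 w.2 =
      ∫ s, {v : (ℝ × E3) × ℝ | v.1.1 < v.2}.indicator (fun v => h v.2 v.1.2) (w, s) := by
    intro w
    rw [heatPot, ← integral_indicator measurableSet_Ioi]
    rfl
  simp only [e]
  have hm : Measurable fun v : (ℝ × E3) × ℝ => h v.2 v.1.2 :=
    hh.measurable.comp (by fun_prop : Measurable fun v : (ℝ × E3) × ℝ => (v.2, v.1.2))
  have hs : MeasurableSet {v : (ℝ × E3) × ℝ | v.1.1 < v.2} :=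
    measurableSet_lt (by fun_prop) (by fun_prop)
  exact ((hm.indicator hs).stronglyMeasurable.integral_prod_right').measurable

lemma measurable_duhamelKernel {m C : ℝ} {h : ℝ → E3 → ℝ} (hh : IsHeatDensity m C h) :
    Measurable fun w : ℝ × ℝ × E3 => duhamelKernel h w.1 w.2.1 w.2.2 := by
  refine Measurable.ite ?_ ?_ measurable_const
  · exact MeasurableSet.inter (s₁ := {w : ℝ × ℝ × E3 | 0 < w.2.1})
      (s₂ := {w : ℝ × ℝ × E3 | w.2.1 < w.1})
      (measurableSet_lt (by fun_prop) (by fun_prop)) (measurableSet_lt (by fun_prop) (by fun_prop))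
  · exact (measurable_heatPot hh).comp
      (by fun_prop : Measurable fun w : ℝ × ℝ × E3 => (w.1 - w.2.1, w.2.2))

lemma measurable_duhamel_integrand {m C : ℝ} {h : ℝ → E3 → ℝ} (hh : IsHeatDensity m C h)
    {F : ℝ → E3 → ℝ} (hF : Measurable fun w : ℝ × E3 => F w.1 w.2) :
    Measurable fun w : (ℝ × E3) × (ℝ × E3) =>
      duhamelKernel h w.1.1 w.2.1 (w.1.2 - w.2.2) * F w.2.1 w.2.2 :=
  ((measurable_duhamelKernel hh).comp
    (by fun_prop : Measurable fun w : (ℝ × E3) × (ℝ × E3) =>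
      (w.1.1, w.2.1, w.1.2 - w.2.2))).mul (hF.comp measurable_snd)

lemma measurable_duhamel {m C : ℝ} {h : ℝ → E3 → ℝ} (hh : IsHeatDensity m C h)
    {F : ℝ → E3 → ℝ} (hF : Measurable fun w : ℝ × E3 => F w.1 w.2) :
    Measurable fun w : ℝ × E3 => duhamel h F w.1 w.2 :=
  ((measurable_duhamel_integrand hh hF).stronglyMeasurable.integral_prod_right').measurable

/-- For `0 < s < t` the fiber of `regA t` over `s` is `(t - s, ∞)`, the interval over which the
kernel is integrated; otherwise the kernel is zero. -/
lemma duhamelKernel_enorm_le (h : ℝ → E3 → ℝ) (t s : ℝ) (x : E3) :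
    ‖duhamelKernel h t s x‖ₑ ≤ ∫⁻ σ in {σ | (s, σ) ∈ regA t}, ‖h σ x‖ₑ := by
  unfold duhamelKernel
  split_ifs with hs
  · have e : {σ | (s, σ) ∈ regA t} = Ioi (t - s) := by
      ext σ; simp only [regA, mem_ofPred_eq, hs, true_and, mem_Ioi]
    rw [e]
    exact enorm_integral_le_lintegral_enorm _
  · simp

/-- The kernels at the two times are integrals of one density over two half-lines. For `s < t` the
difference is an integral over `(t - s, t' - s]`; for `t ≤ s < t'` only the later kernel is present.
These are the two pieces of `regB`, so no separate estimate of a time derivative is needed. -/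
lemma duhamelKernel_sub_enorm_le {m C : ℝ} (hm : 0 ≤ m) {h : ℝ → E3 → ℝ}
    (hh : IsHeatDensity m C h) {t t' : ℝ} (htt : t ≤ t') (s : ℝ) (x : E3) :
    ‖duhamelKernel h t' s x - duhamelKernel h t s x‖ₑ ≤
      ∫⁻ σ in {σ | (s, σ) ∈ regB t t'}, ‖h σ x‖ₑ := by
  by_cases h1 : s ∈ Ioo 0 t
  · have h2 : s ∈ Ioo 0 t' := ⟨h1.1, h1.2.trans_le htt⟩
    have e : {σ | (s, σ) ∈ regB t t'} = Ioc (t - s) (t' - s) := by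
      ext σ
      have : ¬ (t ≤ s) := not_le.2 h1.2
      simp only [regB, mem_union, mem_ofPred_eq, h1, true_and, mem_Ico, this, false_and, or_false,
        mem_Ioc]
    have hts : 0 < t - s := sub_pos.2 h1.2
    have hint := hh.integrableOn hm hts x
    have e2 : duhamelKernel h t' s x - duhamelKernel h t s x =
        -∫ σ in Ioc (t - s) (t' - s), h σ x := by
      rw [duhamelKernel, duhamelKernel, if_pos h1, if_pos h2, heatPot, heatPot,
        ← Ioc_union_Ioi_eq_Ioi (sub_le_sub_right htt s),
        setIntegral_union (Ioc_disjoint_Ioi_same) measurableSet_Ioi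
          (hint.mono_set Ioc_subset_Ioi_self)
          (hint.mono_set (Ioi_subset_Ioi (sub_le_sub_right htt s)))]
      ring
    rw [e, e2, enorm_neg]
    exact enorm_integral_le_lintegral_enorm _
  · have e1 : duhamelKernel h t s x = 0 := if_neg h1
    rw [e1, sub_zero]
    by_cases h2 : s ∈ Ioo 0 t'
    · refine (duhamelKernel_enorm_le h t' s x).trans (lintegral_mono_set ?_)
      intro σ hσ
      refine Or.inr ⟨⟨?_, h2.2⟩, hσ.2⟩
      by_contra hlt
      exact h1 ⟨h2.1, not_le.1 hlt⟩
    · simp [duhamelKernel, h2]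

section Duhamel

variable {m C : ℝ} {h : ℝ → E3 → ℝ} {F F' : ℝ → E3 → ℝ} {t t' : ℝ} {x : E3}

lemma lintegral_duhamel_le (hh : IsHeatDensity m C h)
    (hF : Measurable fun w : ℝ × E3 => F w.1 w.2) (t : ℝ) (x : E3) :
    ∫⁻ z : ℝ × E3, ‖duhamelKernel h t z.1 (x - z.2) * F z.1 z.2‖ₑ ≤
      ENNReal.ofReal C * heatSup m (regA t) (fun s y => ‖F s y‖ₑ) x :=
  lintegral_kernel_le hh (measurableSet_regA t) (fun _ hz => regA_pos hz)
    (fun s x => duhamelKernel_enorm_le h t s x) hF x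

lemma integrable_duhamel (hh : IsHeatDensity m C h)
    (hF : Measurable fun w : ℝ × E3 => F w.1 w.2)
    (hfin : heatSup m (regA t) (fun s y => ‖F s y‖ₑ) x < ∞) :
    Integrable fun z : ℝ × E3 => duhamelKernel h t z.1 (x - z.2) * F z.1 z.2 := by
  refine ⟨((measurable_duhamel_integrand hh hF).comp
    (measurable_prodMk_left (x := (t, x)))).aestronglyMeasurable, ?_⟩
  exact (lintegral_duhamel_le hh hF t x).trans_lt (ENNReal.mul_lt_top ENNReal.ofReal_lt_top hfin)

lemma enorm_duhamel_le (hh : IsHeatDensity m C h)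
    (hF : Measurable fun w : ℝ × E3 => F w.1 w.2) (t : ℝ) (x : E3) :
    ‖duhamel h F t x‖ₑ ≤ ENNReal.ofReal C * heatSup m (regA t) (fun s y => ‖F s y‖ₑ) x :=
  (enorm_integral_le_lintegral_enorm _).trans (lintegral_duhamel_le hh hF t x)

lemma enorm_duhamel_sub_le (hh : IsHeatDensity m C h)
    (hF : Measurable fun w : ℝ × E3 => F w.1 w.2)
    (hF' : Measurable fun w : ℝ × E3 => F' w.1 w.2)
    (hi : Integrable fun z : ℝ × E3 => duhamelKernel h t z.1 (x - z.2) * F z.1 z.2)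
    (hi' : Integrable fun z : ℝ × E3 => duhamelKernel h t z.1 (x - z.2) * F' z.1 z.2) :
    ‖duhamel h F t x - duhamel h F' t x‖ₑ ≤
      ENNReal.ofReal C * heatSup m (regA t) (fun s y => ‖F s y - F' s y‖ₑ) x := by
  have e : duhamel h F t x - duhamel h F' t x = duhamel h (fun s y => F s y - F' s y) t x := by
    unfold duhamel
    rw [← integral_sub hi hi']
    simp only [mul_sub]
  rw [e]
  exact enorm_duhamel_le hh (hF.sub hF') t x

lemma enorm_duhamel_time_sub_le (hm : 0 ≤ m) (hh : IsHeatDensity m C h)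
    (hF : Measurable fun w : ℝ × E3 => F w.1 w.2) (htt : t ≤ t')
    (hi : Integrable fun z : ℝ × E3 => duhamelKernel h t z.1 (x - z.2) * F z.1 z.2)
    (hi' : Integrable fun z : ℝ × E3 => duhamelKernel h t' z.1 (x - z.2) * F z.1 z.2) :
    ‖duhamel h F t' x - duhamel h F t x‖ₑ ≤
      ENNReal.ofReal C * heatSup m (regB t t') (fun s y => ‖F s y‖ₑ) x := by
  have e : duhamel h F t' x - duhamel h F t x =
      ∫ z : ℝ × E3, (duhamelKernel h t' z.1 (x - z.2) - duhamelKernel h t z.1 (x - z.2)) *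
        F z.1 z.2 := by
    unfold duhamel
    rw [← integral_sub hi' hi]
    simp only [sub_mul]
  rw [e]
  refine (enorm_integral_le_lintegral_enorm _).trans ?_
  exact lintegral_kernel_le hh (measurableSet_regB t t') (fun _ hz => regB_pos hz)
    (κ := fun s x => duhamelKernel h t' s x - duhamelKernel h t s x)
    (fun s x => duhamelKernel_sub_enorm_le hm hh htt s x) hF x

end Duhamel

/-! ### Integrals over the domains -/

/-- Integrating first in `σ` over `(t - s, ∞)` gives `(t - s)^{-γ} / γ`. The set `J` allows the
distant and the recent past to be treated separately. -/
lemma lintegral_regA_le {t γ : ℝ} (hγ : 0 < γ) {J : Set ℝ} (hJ : MeasurableSet J) {φ : ℝ → ℝ≥0∞}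
    (hφ : Measurable φ) :
    ∫⁻ z in regA t ∩ (J ×ˢ univ), ENNReal.ofReal (z.2 ^ (-1 - γ)) * φ z.1 =
      ENNReal.ofReal (1 / γ) *
        ∫⁻ s in Ioo 0 t ∩ J, ENNReal.ofReal ((t - s) ^ (-γ)) * φ s := by
  rw [setLIntegral_fiber ((measurableSet_regA t).inter (hJ.prod MeasurableSet.univ))
    (by fun_prop), ← lintegral_const_mul _ (by fun_prop),
    ← lintegral_indicator (measurableSet_Ioo.inter hJ)]
  refine lintegral_congr fun s => ?_
  by_cases hs : s ∈ Ioo 0 t ∩ J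
  · have e : {σ | (s, σ) ∈ regA t ∩ (J ×ˢ univ)} = Ioi (t - s) := by
      ext σ
      simp only [regA, mem_inter_iff, mem_ofPred_eq, hs.1, hs.2, true_and, mem_Ioi, mem_prod,
        mem_univ, and_true]
    rw [indicator_of_mem hs, e]
    simp only []
    rw [lintegral_mul_const _ (by fun_prop), lintegral_Ioi_rpow (sub_pos.2 hs.1.2) hγ,
      ← mul_assoc, ← ENNReal.ofReal_mul (by positivity)]
    congr 2; ring
  · have e : {σ | (s, σ) ∈ regA t ∩ (J ×ˢ univ)} = ∅ := by
      ext σ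
      simp only [regA, mem_inter_iff, mem_ofPred_eq, mem_prod, mem_univ, and_true,
        mem_empty_iff_false, iff_false]
      rintro ⟨⟨h1, -⟩, h2⟩
      exact hs ⟨h1, h2⟩
    rw [indicator_of_notMem hs, e]
    simp

/-- On this interval `σ` is at least `τ` and at least `σ - τ`, so `σ^{-1-γ}` is at most `τ^{-(γ+ε)}
(σ-τ)^{-(1-ε)}`, and the last factor integrates to `h^ε / ε`. A power of the length `h` is gained at
the price of a slightly more singular factor in `τ`. -/
lemma lintegral_Ioc_rpow_le {τ h γ ε : ℝ} (hτ : 0 < τ) (hh : 0 ≤ h) (hγ : 0 ≤ γ) (hε : 0 < ε)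
    (hε1 : ε ≤ 1) :
    ∫⁻ σ in Ioc τ (τ + h), ENNReal.ofReal (σ ^ (-1 - γ)) ≤
      ENNReal.ofReal (1 / ε * h ^ ε) * ENNReal.ofReal (τ ^ (-(γ + ε))) := by
  have h1 : ∀ σ ∈ Ioc τ (τ + h), ENNReal.ofReal (σ ^ (-1 - γ)) ≤
      ENNReal.ofReal (τ ^ (-(γ + ε))) * ENNReal.ofReal ((σ - τ) ^ (-(1 - ε))) := by
    intro σ hσ
    have hσ0 : 0 < σ := hτ.trans hσ.1
    have hστ : 0 < σ - τ := sub_pos.2 hσ.1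
    rw [← ENNReal.ofReal_mul (by positivity)]
    refine ENNReal.ofReal_le_ofReal ?_
    calc σ ^ (-1 - γ) = σ ^ (-(γ + ε)) * σ ^ (-(1 - ε)) := by
          rw [← Real.rpow_add hσ0]; congr 1; ring
      _ ≤ _ := mul_le_mul (Real.rpow_le_rpow_of_nonpos hτ hσ.1.le (by linarith))
          (Real.rpow_le_rpow_of_nonpos hστ (by linarith) (by linarith)) (by positivity)
          (by positivity)
  refine (setLIntegral_mono (by fun_prop) h1).trans ?_
  rw [lintegral_const_mul _ (by fun_prop), mul_comm]
  gcongr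
  have h2 := lintegral_Ioo_rpow hh (by linarith : 1 - ε < 1)
  rw [sub_sub_cancel] at h2
  set g : ℝ → ℝ≥0∞ := fun σ => ENNReal.ofReal (σ ^ (-(1 - ε))) with hg
  have h3 : ∫⁻ σ in Ioc τ (τ + h), g (σ - τ) = ∫⁻ σ in Ioo 0 h, g σ := by
    rw [← restrict_Ioo_eq_restrict_Ioc, ← lintegral_indicator measurableSet_Ioo,
      ← lintegral_indicator measurableSet_Ioo,
      ← lintegral_sub_right_eq_self ((Ioo 0 h).indicator g) τ]
    refine lintegral_congr fun σ => ?_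
    have : (τ < σ ∧ σ < τ + h) ↔ (0 < σ - τ ∧ σ - τ < h) := by
      constructor <;> rintro ⟨h1, h2⟩ <;> constructor <;> linarith
    simp only [indicator, mem_Ioo, this]
  rw [h3, h2, one_div_mul_eq_div]

/-- The bound is Hölder in the increment `t' - t`. The piece with `s < t` is the previous estimate
with `τ = t - s`. On the piece with `t ≤ s < t'` one uses `(t'-s)^{-γ} ≤ (t'-t)^ε (t'-s)^{-(γ+ε)}`.
Both are then absorbed in integrals of the type met for `regA`, with `γ + ε` in place of `γ`. -/
lemma lintegral_regB_le {t t' γ ε : ℝ} (htt : t ≤ t') (hγ : 0 < γ) (hε : 0 < ε) (hε1 : ε ≤ 1)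
    {J : Set ℝ} (hJ : MeasurableSet J) {φ : ℝ → ℝ≥0∞} (hφ : Measurable φ) (ht : 0 < t) :
    ∫⁻ z in regB t t' ∩ (J ×ˢ univ), ENNReal.ofReal (z.2 ^ (-1 - γ)) * φ z.1 ≤
      ENNReal.ofReal ((1 / ε + 1 / γ) * (t' - t) ^ ε) *
        ((∫⁻ s in Ioo 0 t ∩ J, ENNReal.ofReal ((t - s) ^ (-(γ + ε))) * φ s) +
        ∫⁻ s in Ioo 0 t' ∩ J, ENNReal.ofReal ((t' - s) ^ (-(γ + ε))) * φ s) := by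
  set K := ENNReal.ofReal ((1 / ε + 1 / γ) * (t' - t) ^ ε) with hK
  have hd : 0 ≤ t' - t := sub_nonneg.2 htt
  rw [setLIntegral_fiber ((measurableSet_regB t t').inter (hJ.prod MeasurableSet.univ))
    (by fun_prop), mul_add, ← lintegral_const_mul _ (by fun_prop),
    ← lintegral_const_mul _ (by fun_prop),
    ← lintegral_indicator (measurableSet_Ioo.inter hJ),
    ← lintegral_indicator (measurableSet_Ioo.inter hJ), ← lintegral_add_left
      (Measurable.indicator (by fun_prop) (measurableSet_Ioo.inter hJ))]
  refine lintegral_mono fun s => ?_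
  by_cases hs : s ∈ Ioo 0 t ∩ J
  · have e : {σ | (s, σ) ∈ regB t t' ∩ (J ×ˢ univ)} = Ioc (t - s) (t - s + (t' - t)) := by
      ext σ
      have : ¬ (t ≤ s) := not_le.2 hs.1.2
      simp only [regB, mem_inter_iff, mem_union, mem_ofPred_eq, hs.1, hs.2, true_and, mem_Ico, this,
        false_and, or_false, mem_Ioc, mem_prod, mem_univ, and_true]
      rw [show t - s + (t' - t) = t' - s by ring]
    refine le_trans ?_ le_self_add
    rw [indicator_of_mem hs, e]
    simp only []
    rw [lintegral_mul_const _ (by fun_prop), ← mul_assoc]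
    gcongr
    refine (lintegral_Ioc_rpow_le (sub_pos.2 hs.1.2) hd hγ.le hε hε1).trans ?_
    rw [hK]
    gcongr
    have : 0 < 1 / γ := by positivity
    linarith
  by_cases hs' : s ∈ Ico t t' ∩ J
  · have e : {σ | (s, σ) ∈ regB t t' ∩ (J ×ˢ univ)} = Ioi (t' - s) := by
      ext σ
      have : ¬ (s < t) := not_lt.2 hs'.1.1
      simp only [regB, mem_inter_iff, mem_union, mem_ofPred_eq, hs'.1, hs'.2, true_and, mem_Ioo,
        this, and_false, false_and, false_or, mem_Ioi, mem_prod, mem_univ, and_true]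
    have hs2 : s ∈ Ioo 0 t' ∩ J := ⟨⟨ht.trans_le hs'.1.1, hs'.1.2⟩, hs'.2⟩
    refine le_trans ?_ le_add_self
    rw [indicator_of_mem hs2, e]
    simp only []
    have hts : 0 < t' - s := sub_pos.2 hs'.1.2
    rw [lintegral_mul_const _ (by fun_prop), ← mul_assoc]
    gcongr
    rw [lintegral_Ioi_rpow hts hγ, hK, ← ENNReal.ofReal_mul (by positivity)]
    refine ENNReal.ofReal_le_ofReal ?_
    have h1 : (t' - s) ^ (-γ) = (t' - s) ^ ε * (t' - s) ^ (-(γ + ε)) := by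
      rw [← Real.rpow_add hts]; congr 1; ring
    have h2 : (t' - s) ^ ε ≤ (t' - t) ^ ε :=
      Real.rpow_le_rpow hts.le (by linarith [hs'.1.1]) hε.le
    rw [h1]
    calc _ ≤ (t' - t) ^ ε * (t' - s) ^ (-(γ + ε)) / γ := by gcongr
      _ = 1 / γ * (t' - t) ^ ε * (t' - s) ^ (-(γ + ε)) := by ring
      _ ≤ _ := by
        have : 0 < 1 / ε := by positivity
        gcongr
        linarith
  · have e : {σ | (s, σ) ∈ regB t t' ∩ (J ×ˢ univ)} = ∅ := by
      ext σ
      simp only [regB, mem_inter_iff, mem_union, mem_ofPred_eq, mem_prod, mem_univ, and_true,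
        mem_empty_iff_false, iff_false]
      rintro ⟨h1 | h1, h2⟩
      · exact hs ⟨h1.1, h2⟩
      · exact hs' ⟨h1.1, h2⟩
    rw [e]
    simp

/-! ### The heat semigroup on vector-valued functions -/

section HeatConv

lemma exists_measurable_enorm {F : Type} [NormedAddCommGroup F] {f : E3 → F}
    (hf : AEStronglyMeasurable f) :
    ∃ g : E3 → ℝ≥0∞, Measurable g ∧ (fun y => ‖f y‖ₑ) =ᵐ[volume] g :=
  ⟨hf.enorm.mk _, hf.enorm.measurable_mk, hf.enorm.ae_eq_mk⟩


lemma heatAvg_congr_ae (t : ℝ) {f g : E3 → ℝ≥0∞} (h : f =ᵐ[volume] g) : heatAvg t f =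
    heatAvg t g := by
  ext x
  refine lintegral_congr_ae ?_
  filter_upwards [h] with y hy
  rw [hy]

lemma eLpNorm_heatAvg_enorm_le {F : Type} [NormedAddCommGroup F] {s : ℝ} (hs : 0 < s)
    {f : E3 → F} (hf : AEStronglyMeasurable f) {a b : ℝ≥0∞} (ha : 1 ≤ a) (hab : a ≤ b) :
    eLpNorm (heatAvg s fun y => ‖f y‖ₑ) b volume ≤
      ENNReal.ofReal (s ^ (-(3 / 2 * (a⁻¹.toReal - b⁻¹.toReal)))) * eLpNorm f a volume := by
  obtain ⟨g, hg, hfg⟩ := exists_measurable_enorm hf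
  rw [heatAvg_congr_ae s hfg]
  refine (eLpNorm_heatAvg_le hs hg ha hab).trans (le_of_eq ?_)
  rw [← eLpNorm_congr_ae hfg, eLpNorm_enorm]

variable {F : Type} [NormedAddCommGroup F] [NormedSpace ℝ F]

/-- The convolution of `f` with the heat kernel. -/
def heatConv (t : ℝ) (f : E3 → F) (x : E3) : F := ∫ y, heatKernel t (x - y) • f y

lemma enorm_heatKernel_smul {t : ℝ} (ht : 0 < t) (x : E3) (v : F) :
    ‖heatKernel t x • v‖ₑ = ENNReal.ofReal (heatKernel t x) * ‖v‖ₑ := by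
  rw [enorm_smul, Real.enorm_of_nonneg (heatKernel_nonneg t ht x)]

lemma enorm_heatConv_le {t : ℝ} (ht : 0 < t) (f : E3 → F) (x : E3) :
    ‖heatConv t f x‖ₑ ≤ heatAvg t (fun y => ‖f y‖ₑ) x := by
  refine (enorm_integral_le_lintegral_enorm _).trans (le_of_eq ?_)
  simp only [enorm_heatKernel_smul ht]
  rfl

lemma stronglyMeasurable_heatConv {f : E3 → F} (hf : StronglyMeasurable f) :
    StronglyMeasurable fun z : ℝ × E3 => heatConv z.1 f z.2 := by
  have h : Measurable fun w : (ℝ × E3) × E3 => heatKernel w.1.1 (w.1.2 - w.2) :=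
    measurable_heatKernel.comp (by fun_prop : Measurable fun w : (ℝ × E3) × E3 =>
      (w.1.1, w.1.2 - w.2))
  exact (h.stronglyMeasurable.smul (hf.comp_measurable measurable_snd)).integral_prod_right'

lemma integrable_heatConv {t : ℝ} (ht : 0 < t) {f : E3 → F} (hf : AEStronglyMeasurable f) {x : E3}
    (h : heatAvg t (fun y => ‖f y‖ₑ) x < ∞) : Integrable fun y => heatKernel t (x - y) • f y := by
  refine ⟨((continuous_heatKernel t).comp
    (continuous_const.sub continuous_id)).aestronglyMeasurable.smul hf, ?_⟩
  refine lt_of_le_of_lt (le_of_eq ?_) h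
  simp only [enorm_heatKernel_smul ht]
  rfl

lemma heatConv_congr_ae (t : ℝ) {f g : E3 → F} (h : f =ᵐ[volume] g) : heatConv t f =
    heatConv t g := by
  ext x
  refine integral_congr_ae ?_
  filter_upwards [h] with y hy
  rw [hy]

lemma eLpNorm_heatConv_le {s : ℝ} (hs : 0 < s) {f : E3 → F} (hf : AEStronglyMeasurable f)
    {a b : ℝ≥0∞} (ha : 1 ≤ a) (hab : a ≤ b) :
    eLpNorm (heatConv s f) b volume ≤
      ENNReal.ofReal (s ^ (-(3 / 2 * (a⁻¹.toReal - b⁻¹.toReal)))) * eLpNorm f a volume := by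
  refine le_trans ?_ (eLpNorm_heatAvg_enorm_le hs hf ha hab)
  exact eLpNorm_mono_enorm fun x => (enorm_heatConv_le hs f x).trans_eq (enorm_eq_self _).symm

lemma eLpNorm_heatConv_le_self {s : ℝ} (hs : 0 < s) {f : E3 → F} (hf : AEStronglyMeasurable f)
    {a : ℝ≥0∞} (ha : 1 ≤ a) : eLpNorm (heatConv s f) a volume ≤ eLpNorm f a volume := by
  simpa using eLpNorm_heatConv_le hs hf ha le_rfl

lemma heatAvg_lt_top_ae {s : ℝ} (hs : 0 < s) {f : E3 → F} {a : ℝ≥0∞} (ha : 1 ≤ a)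
    (hf : MemLp f a) : ∀ᵐ x, heatAvg s (fun y => ‖f y‖ₑ) x < ∞ := by
  obtain ⟨g, hg, hfg⟩ := exists_measurable_enorm hf.1
  have h := eLpNorm_heatAvg_enorm_le hs hf.1 ha (le_top : a ≤ ∞)
  have h2 : eLpNormEssSup (heatAvg s fun y => ‖f y‖ₑ) volume < ∞ := by
    rw [← eLpNorm_exponent_top]
    exact h.trans_lt (ENNReal.mul_lt_top ENNReal.ofReal_lt_top hf.2)
  filter_upwards [enorm_ae_le_eLpNormEssSup (heatAvg s fun y => ‖f y‖ₑ) volume] with x hx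
  rw [enorm_eq_self] at hx
  exact hx.trans_lt h2

lemma memLp_heatConv {s : ℝ} (hs : 0 < s) {f : E3 → F} {a : ℝ≥0∞} (ha : 1 ≤ a) (hf : MemLp f a) :
    MemLp (heatConv s f) a := by
  refine ⟨?_, (eLpNorm_heatConv_le_self hs hf.1 ha).trans_lt hf.2⟩
  rw [heatConv_congr_ae s hf.1.ae_eq_mk]
  exact ((stronglyMeasurable_heatConv hf.1.stronglyMeasurable_mk).comp_measurable
    (measurable_prodMk_left (x := s))).aestronglyMeasurable

lemma heatConv_sub_ae {s : ℝ} (hs : 0 < s) {f g : E3 → F} {a : ℝ≥0∞} (ha : 1 ≤ a)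
    (hf : MemLp f a) (hg : MemLp g a) :
    heatConv s (f - g) =ᵐ[volume] heatConv s f - heatConv s g := by
  filter_upwards [heatAvg_lt_top_ae hs ha hf, heatAvg_lt_top_ae hs ha hg] with x hx hx'
  simp only [Pi.sub_apply, heatConv, smul_sub]
  exact integral_sub (integrable_heatConv hs hf.1 hx) (integrable_heatConv hs hg.1 hx')

/-- The Gaussian convolution identity. -/
lemma integral_heatKernel_mul_heatKernel {s t : ℝ} (hs : 0 < s) (ht : 0 < t) (x z : E3) :
    ∫ y, heatKernel t (x - y) * heatKernel s (y - z) = heatKernel (t + s) (x - z) := by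
  have hb : 0 < 1 / (4 * t) + 1 / (4 * s) := by positivity
  have key : ∀ w : E3, ∫ y : E3, Real.exp (-(1 / (4 * t)) * ‖w - y‖ ^ 2) *
      Real.exp (-(1 / (4 * s)) * ‖y‖ ^ 2) =
      (Real.pi / (1 / (4 * t) + 1 / (4 * s))) ^ (3 / 2 : ℝ) *
        Real.exp (-(1 / (4 * (t + s))) * ‖w‖ ^ 2) := by
    intro w
    -- Completing the square: the product of the two Gaussians is a Gaussian in `y` centered at
    -- `(s/(t+s)) w`, times a factor depending on `w` only.
    have e1 : ∀ y : E3, Real.exp (-(1 / (4 * t)) * ‖w - y‖ ^ 2) *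
        Real.exp (-(1 / (4 * s)) * ‖y‖ ^ 2) =
        Real.exp (-(1 / (4 * (t + s))) * ‖w‖ ^ 2) *
        Real.exp (-(1 / (4 * t) + 1 / (4 * s)) * ‖y - (s / (t + s)) • w‖ ^ 2) := by
      intro y
      rw [← Real.exp_add, ← Real.exp_add]
      congr 1
      rw [@norm_sub_sq_real, @norm_sub_sq_real, real_inner_smul_right, norm_smul,
        Real.norm_of_nonneg (by positivity), real_inner_comm w y]
      field_simp
      ring
    simp only [e1]
    rw [integral_const_mul, integral_sub_right_eq_self
      (fun y : E3 => Real.exp (-(1 / (4 * t) + 1 / (4 * s)) * ‖y‖ ^ 2)),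
      GaussianFourier.integral_rexp_neg_mul_sq_norm hb, finrank_euclideanSpace_fin, mul_comm]
    norm_num
  have e2 := integral_sub_right_eq_self
    (fun y => heatKernel t (x - z - y) * heatKernel s y) z (μ := (volume : Measure E3))
  have e3 : ∀ y : E3, x - z - (y - z) = x - y := fun y => by abel
  simp only [e3] at e2
  rw [e2]
  unfold heatKernel
  have e4 : ∀ y : E3, (4 * Real.pi * t) ^ (-(3 / 2) : ℝ) *
      Real.exp (-(1 / (4 * t)) * ‖x - z - y‖ ^ 2) *
      ((4 * Real.pi * s) ^ (-(3 / 2) : ℝ) * Real.exp (-(1 / (4 * s)) * ‖y‖ ^ 2)) =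
      ((4 * Real.pi * t) ^ (-(3 / 2) : ℝ) * (4 * Real.pi * s) ^ (-(3 / 2) : ℝ)) *
      (Real.exp (-(1 / (4 * t)) * ‖x - z - y‖ ^ 2) * Real.exp (-(1 / (4 * s)) * ‖y‖ ^ 2)) :=
    fun y => by ring
  simp only [e4]
  rw [integral_const_mul, key, ← mul_assoc]
  congr 1
  rw [← inv_inv (Real.pi / (1 / (4 * t) + 1 / (4 * s))),
    Real.inv_rpow (by positivity), ← Real.rpow_neg (by positivity),
    ← Real.mul_rpow (by positivity) (by positivity),
    ← Real.mul_rpow (by positivity) (by positivity)]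
  congr 1
  field_simp
  ring

lemma integrable_heatKernel_mul_heatKernel {s t : ℝ} (hs : 0 < s) (ht : 0 < t) (x z : E3) :
    Integrable fun y => heatKernel t (x - y) * heatKernel s (y - z) := by
  refine Integrable.bdd_mul (c := t ^ (-(3 / 2) : ℝ))
      ((integrable_heatKernel s hs).comp_sub_right z)
    ((continuous_heatKernel t).comp (continuous_const.sub continuous_id)).aestronglyMeasurable
    (ae_of_all _ fun y => ?_)
  rw [Real.norm_of_nonneg (heatKernel_nonneg t ht _)]
  exact heatKernel_le t ht _

/-- The semigroup property. -/
lemma heatConv_heatConv [CompleteSpace F] {s t : ℝ} (hs : 0 < s) (ht : 0 < t)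
    {f : E3 → F} (hf : Integrable f) (x : E3) :
    heatConv t (heatConv s f) x = heatConv (t + s) f x := by
  have hm : AEStronglyMeasurable (Function.uncurry fun y z =>
      (heatKernel t (x - y) * heatKernel s (y - z)) • f z) (volume.prod volume) := by
    refine AEStronglyMeasurable.smul ?_ hf.1.comp_snd
    exact (((continuous_heatKernel t).comp (continuous_const.sub continuous_fst)).mul
      ((continuous_heatKernel s).comp (continuous_fst.sub continuous_snd))).aestronglyMeasurable
  have hn : ∀ z, ∫ y, ‖(heatKernel t (x - y) * heatKernel s (y - z)) • f z‖ =
      heatKernel (t + s) (x - z) * ‖f z‖ := by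
    intro z
    rw [← integral_heatKernel_mul_heatKernel hs ht, ← integral_mul_const]
    refine integral_congr_ae (ae_of_all _ fun y => ?_)
    simp only []
    rw [norm_smul, Real.norm_of_nonneg
      (mul_nonneg (heatKernel_nonneg t ht _) (heatKernel_nonneg s hs _))]
  have hts : 0 < t + s := by positivity
  have hi : Integrable (Function.uncurry fun y z =>
      (heatKernel t (x - y) * heatKernel s (y - z)) • f z) (volume.prod volume) := by
    refine (integrable_prod_iff' hm).2 ⟨ae_of_all _ fun z => ?_, ?_⟩
    · exact (integrable_heatKernel_mul_heatKernel hs ht x z).smul_const (f z)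
    · simp only [Function.uncurry, hn]
      refine Integrable.bdd_mul (c := (t + s) ^ (-(3 / 2) : ℝ)) hf.norm
        ((continuous_heatKernel _).comp (continuous_const.sub continuous_id)).aestronglyMeasurable
        (ae_of_all _ fun y => ?_)
      rw [Real.norm_of_nonneg (heatKernel_nonneg _ hts _)]
      exact heatKernel_le _ hts _
  calc heatConv t (heatConv s f) x
      = ∫ y, ∫ z, (heatKernel t (x - y) * heatKernel s (y - z)) • f z := by
        refine integral_congr_ae (ae_of_all _ fun y => ?_)
        simp only [heatConv, mul_smul]
        rw [integral_smul]
    _ = ∫ z, ∫ y, (heatKernel t (x - y) * heatKernel s (y - z)) • f z :=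
        integral_integral_swap hi
    _ = _ := by
        refine integral_congr_ae (ae_of_all _ fun z => ?_)
        simp only []
        rw [integral_smul_const, integral_heatKernel_mul_heatKernel hs ht]

/-- The difference of the two heat kernels is minus the integral of the density `densityHeat`
between the two times, and the Gaussian bound of the density turns this into a superposition of heat
averages. -/
lemma enorm_heatConv_sub_le {τ τ' : ℝ} (hτ : 0 < τ) (hττ : τ ≤ τ') {f : E3 → F}
    (hf : AEStronglyMeasurable f) {x : E3} (h : heatAvg τ (fun y => ‖f y‖ₑ) x < ∞)
    (h' : heatAvg τ' (fun y => ‖f y‖ₑ) x < ∞) :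
    ‖heatConv τ' f x - heatConv τ f x‖ₑ ≤ ENNReal.ofReal (4 * gaussBound) *
      ∫⁻ σ in Ioc τ τ', ENNReal.ofReal (σ ^ (-1 : ℝ)) * heatAvg (2 * σ) (fun y => ‖f y‖ₑ) x := by
  obtain ⟨g, hg, hfg⟩ := exists_measurable_enorm hf
  have h1 : ∀ x, ‖heatKernel τ' x - heatKernel τ x‖ₑ ≤ ENNReal.ofReal (4 * gaussBound) *
      ∫⁻ σ in Ioc τ τ', ENNReal.ofReal (σ ^ (-1 : ℝ)) * ENNReal.ofReal (heatKernel (2 * σ) x) := by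
    intro x
    have hint := isHeatDensity_heat.integrableOn le_rfl hτ x
    have e : heatKernel τ' x - heatKernel τ x = -∫ σ in Ioc τ τ', densityHeat σ x := by
      rw [← heatPot_densityHeat hτ, ← heatPot_densityHeat (hτ.trans_le hττ), heatPot, heatPot,
        ← Ioc_union_Ioi_eq_Ioi hττ, setIntegral_union (Ioc_disjoint_Ioi_same) measurableSet_Ioi
          (hint.mono_set Ioc_subset_Ioi_self) (hint.mono_set (Ioi_subset_Ioi hττ))]
      ring
    have hk : Measurable fun σ : ℝ => heatKernel (2 * σ) x :=
      measurable_heatKernel.comp (by fun_prop : Measurable fun σ : ℝ => (2 * σ, x))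
    rw [e, enorm_neg, ← lintegral_const_mul _ (by fun_prop)]
    refine (enorm_integral_le_lintegral_enorm _).trans
      (setLIntegral_mono' measurableSet_Ioc fun σ hσ => ?_)
    have hσ0 : 0 < σ := hτ.trans hσ.1
    have hgb := gaussBound_pos
    rw [← ofReal_norm, ← mul_assoc, ← ENNReal.ofReal_mul (by positivity),
      ← ENNReal.ofReal_mul (by positivity)]
    refine ENNReal.ofReal_le_ofReal ?_
    simpa using isHeatDensity_heat.abs_le σ hσ0 x
  have hk : Measurable fun w : E3 × ℝ => heatKernel (2 * w.2) (x - w.1) :=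
    measurable_heatKernel.comp (by fun_prop : Measurable fun w : E3 × ℝ => (2 * w.2, x - w.1))
  have e : heatConv τ' f x - heatConv τ f x =
      ∫ y, (heatKernel τ' (x - y) - heatKernel τ (x - y)) • f y := by
    simp only [sub_smul]
    exact (integral_sub (integrable_heatConv (hτ.trans_le hττ) hf h')
      (integrable_heatConv hτ hf h)).symm
  have hm1 : Measurable fun w : E3 × ℝ => ENNReal.ofReal (w.2 ^ (-1 : ℝ)) *
      ENNReal.ofReal (heatKernel (2 * w.2) (x - w.1)) := by fun_prop
  rw [e]
  calc _ ≤ ∫⁻ y, ‖(heatKernel τ' (x - y) - heatKernel τ (x - y)) • f y‖ₑ :=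
        enorm_integral_le_lintegral_enorm _
    _ ≤ ∫⁻ y, (ENNReal.ofReal (4 * gaussBound) * ∫⁻ σ in Ioc τ τ', ENNReal.ofReal (σ ^ (-1 : ℝ)) *
          ENNReal.ofReal (heatKernel (2 * σ) (x - y))) * g y := by
        refine lintegral_mono_ae ?_
        filter_upwards [hfg] with y hy
        rw [enorm_smul, ← hy]
        gcongr
        exact h1 _
    _ = ENNReal.ofReal (4 * gaussBound) * ∫⁻ y, ∫⁻ σ in Ioc τ τ', ENNReal.ofReal (σ ^ (-1 : ℝ)) *
          ENNReal.ofReal (heatKernel (2 * σ) (x - y)) * g y := by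
        have hm2 : Measurable fun y => ∫⁻ σ in Ioc τ τ', ENNReal.ofReal (σ ^ (-1 : ℝ)) *
          ENNReal.ofReal (heatKernel (2 * σ) (x - y)) := hm1.lintegral_prod_right'
        simp only [mul_assoc]
        rw [lintegral_const_mul _ (by fun_prop)]
        congr 1
        refine lintegral_congr fun y => ?_
        have hm3 : Measurable fun σ : ℝ => ENNReal.ofReal (σ ^ (-1 : ℝ)) *
          ENNReal.ofReal (heatKernel (2 * σ) (x - y)) := hm1.comp (measurable_prodMk_left (x := y))
        rw [← lintegral_mul_const _ hm3]
        simp only [mul_assoc]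
    _ = ENNReal.ofReal (4 * gaussBound) * ∫⁻ σ in Ioc τ τ', ∫⁻ y, ENNReal.ofReal (σ ^ (-1 : ℝ)) *
          ENNReal.ofReal (heatKernel (2 * σ) (x - y)) * g y := by
        rw [lintegral_lintegral_swap]
        exact (hm1.mul (hg.comp measurable_fst)).aemeasurable
    _ = _ := by
        congr 1
        refine lintegral_congr fun σ => ?_
        simp only [mul_assoc]
        have hm4 : Measurable fun y => ENNReal.ofReal (heatKernel (2 * σ) (x - y)) * g y :=
          (measurable_ofReal_heatKernel_sub _ x).mul hg
        rw [lintegral_const_mul _ hm4, heatAvg_congr_ae _ hfg]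
        rfl

/-- The heat semigroup is Lipschitz in time, away from time zero. -/
theorem eLpNorm_heatConv_sub_le {τ τ' : ℝ} (hτ : 0 < τ) (hττ : τ ≤ τ') {f : E3 → F}
    {a b : ℝ≥0∞} (ha : 1 ≤ a) (hab : a ≤ b) (hf : MemLp f a) :
    eLpNorm (heatConv τ' f - heatConv τ f) b volume ≤
      ENNReal.ofReal (4 * gaussBound * ((τ' - τ) *
        τ ^ (-1 - 3 / 2 * (a⁻¹.toReal - b⁻¹.toReal)))) * eLpNorm f a volume := by
  obtain ⟨g, hg, hfg⟩ := exists_measurable_enorm hf.1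
  have hgb := gaussBound_pos
  have hd : 0 ≤ a⁻¹.toReal - b⁻¹.toReal := by
    rw [sub_nonneg]
    refine ENNReal.toReal_mono ?_ (ENNReal.inv_le_inv.2 hab)
    simpa using (zero_lt_one.trans_le ha).ne'
  set γ := 3 / 2 * (a⁻¹.toReal - b⁻¹.toReal) with hγ
  have hm0 : Measurable fun w : E3 × ℝ =>
      ENNReal.ofReal (w.2 ^ (-1 : ℝ)) * heatAvg (2 * w.2) g w.1 :=
    Measurable.mul (by fun_prop) (measurable_heatAvg_param (f := fun _ => g) (by fun_prop)
      (by fun_prop) (hg.comp measurable_snd))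
  have h1 : eLpNorm (fun x => ∫⁻ σ in Ioc τ τ', ENNReal.ofReal (σ ^ (-1 : ℝ)) *
      heatAvg (2 * σ) g x) b volume ≤
      ∫⁻ σ in Ioc τ τ', ENNReal.ofReal (τ ^ (-1 - γ)) * eLpNorm f a volume := by
    refine eLpNorm_lintegral_le hm0 (ha.trans hab) measurable_const ?_
    filter_upwards [ae_restrict_mem measurableSet_Ioc] with σ hσ
    have hσ0 : 0 < σ := hτ.trans hσ.1
    refine (eLpNorm_const_mul_le_ennreal _ (measurable_heatAvg _ hg) b).trans ?_
    have h5 := eLpNorm_heatAvg_le (s := 2 * σ) (by positivity) hg ha hab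
    have h6 : (2 * σ) ^ (-γ) ≤ σ ^ (-γ) :=
      Real.rpow_le_rpow_of_nonpos hσ0 (by linarith) (by rw [hγ]; linarith)
    have h7 : eLpNorm g a volume = eLpNorm f a volume := by
      rw [← eLpNorm_congr_ae hfg, eLpNorm_enorm]
    rw [h7] at h5
    calc _ ≤ ENNReal.ofReal (σ ^ (-1 : ℝ)) * (ENNReal.ofReal (σ ^ (-γ)) * eLpNorm f a volume) := by
          gcongr
          exact h5.trans (by gcongr)
      _ ≤ _ := by
          rw [← mul_assoc, ← ENNReal.ofReal_mul (by positivity), ← Real.rpow_add hσ0]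
          gcongr ENNReal.ofReal ?_ * _
          exact Real.rpow_le_rpow_of_nonpos hτ hσ.1.le (by rw [hγ]; linarith)
  have h2 : eLpNorm (heatConv τ' f - heatConv τ f) b volume ≤
      eLpNorm (fun x => ENNReal.ofReal (4 * gaussBound) * ∫⁻ σ in Ioc τ τ',
        ENNReal.ofReal (σ ^ (-1 : ℝ)) * heatAvg (2 * σ) g x) b volume := by
    refine eLpNorm_mono_enorm_ae ?_
    filter_upwards [heatAvg_lt_top_ae hτ ha hf, heatAvg_lt_top_ae (hτ.trans_le hττ) ha hf] with x
        hx hx'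
    rw [enorm_eq_self, Pi.sub_apply]
    refine (enorm_heatConv_sub_le hτ hττ hf.1 hx hx').trans (le_of_eq ?_)
    congr 1
    refine lintegral_congr fun σ => ?_
    rw [heatAvg_congr_ae _ hfg]
  refine h2.trans ((eLpNorm_const_mul_le_ennreal _ hm0.lintegral_prod_right' b).trans ?_)
  rw [ENNReal.ofReal_mul (p := 4 * gaussBound) (by positivity), mul_assoc]
  refine mul_le_mul' le_rfl (h1.trans (le_of_eq ?_))
  rw [lintegral_const, Measure.restrict_apply MeasurableSet.univ, univ_inter, Real.volume_Ioc,
    ENNReal.ofReal_mul (sub_nonneg.2 hττ)]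
  ring

end HeatConv

/-! ### Translations of Schwartz functions -/

section Translation

variable {F : Type} [NormedAddCommGroup F] [NormedSpace ℝ F]

/-- The mean value inequality on the segment from `x` to `x - a`. Its points `y` are within distance
one of `x`, so that `‖x‖^k ≤ 2^k (‖y‖^k + 1)` and the weight at `x` is controlled by the seminorms
at `y`. -/
lemma seminorm_translate_sub_le (k n : ℕ) (φ : 𝓢(E3, F)) {a : E3} (ha : ‖a‖ ≤ 1) :
    SchwartzMap.seminorm ℝ k n (SchwartzMap.compSubConstCLM ℝ a φ - φ) ≤
      2 ^ k * (SchwartzMap.seminorm ℝ k (n + 1) φ + SchwartzMap.seminorm ℝ 0 (n + 1) φ) * ‖a‖ := by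
  set S := SchwartzMap.seminorm ℝ k (n + 1) φ + SchwartzMap.seminorm ℝ 0 (n + 1) φ with hS
  have hS0 : 0 ≤ S := add_nonneg (apply_nonneg _ _) (apply_nonneg _ _)
  refine SchwartzMap.seminorm_le_bound ℝ k n _ (by positivity) fun x => ?_
  have e : iteratedFDeriv ℝ n (SchwartzMap.compSubConstCLM ℝ a φ - φ : 𝓢(E3, F)) x =
      iteratedFDeriv ℝ n φ (x - a) - iteratedFDeriv ℝ n φ x := by
    have h1 : ((SchwartzMap.compSubConstCLM ℝ a φ - φ : 𝓢(E3, F)) : E3 → F) =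
        (fun y => φ (y - a)) - φ := rfl
    have hd : ContDiff ℝ n (fun y => φ (y - a)) := (φ.smooth n).comp
        (contDiff_id.sub contDiff_const)
    rw [h1, iteratedFDeriv_sub_apply hd.contDiffAt (φ.smooth n).contDiffAt,
      iteratedFDeriv_comp_sub]
  rw [e]
  have hbound : ∀ y ∈ segment ℝ x (x - a), ‖fderiv ℝ (iteratedFDeriv ℝ n φ) y‖ * ‖x‖ ^ k ≤
      2 ^ k * S := by
    intro y hy
    rw [norm_fderiv_iteratedFDeriv]
    have hxy : ‖x - y‖ ≤ 1 := by
      obtain ⟨θ, hθ, rfl⟩ := (segment_eq_image' ℝ x (x - a)).subset hy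
      have : x - (x + θ • (x - a - x)) = θ • a := by
        rw [show x - a - x = -a by abel, smul_neg]; abel
      simp only [this, norm_smul, Real.norm_of_nonneg hθ.1]
      exact mul_le_one₀ hθ.2 (norm_nonneg _) ha
    have hx : ‖x‖ ≤ ‖y‖ + 1 := by
      have := norm_le_norm_add_norm_sub' x y
      linarith
    have h1 : ‖x‖ ^ k ≤ 2 ^ k * (‖y‖ ^ k + 1) := by
      have h2 : ‖x‖ ≤ 2 * max ‖y‖ 1 := by
        have := le_max_left ‖y‖ 1; have := le_max_right ‖y‖ 1; linarith
      calc ‖x‖ ^ k ≤ (2 * max ‖y‖ 1) ^ k := by gcongr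
        _ = 2 ^ k * (max ‖y‖ 1) ^ k := mul_pow _ _ _
        _ ≤ _ := by
          gcongr
          rcases max_cases ‖y‖ 1 with ⟨h, -⟩ | ⟨h, -⟩ <;> rw [h]
          · linarith
          · rw [one_pow]; linarith [pow_nonneg (norm_nonneg y) k]
    have h3 := SchwartzMap.le_seminorm ℝ k (n + 1) φ y
    have h4 := SchwartzMap.le_seminorm ℝ 0 (n + 1) φ y
    rw [pow_zero, one_mul] at h4
    calc ‖iteratedFDeriv ℝ (n + 1) φ y‖ * ‖x‖ ^ k
        ≤ ‖iteratedFDeriv ℝ (n + 1) φ y‖ * (2 ^ k * (‖y‖ ^ k + 1)) := by gcongr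
      _ = 2 ^ k * (‖y‖ ^ k * ‖iteratedFDeriv ℝ (n + 1) φ y‖ + ‖iteratedFDeriv ℝ (n + 1) φ y‖) := by
          ring
      _ ≤ _ := mul_le_mul_of_nonneg_left (add_le_add h3 h4) (by positivity)
  -- The Lipschitz constant used below is a quotient by this weight; if the weight is zero, there is
  -- nothing to prove.
  rcases eq_or_ne (‖x‖ ^ k) 0 with hx0 | hx0
  · rw [hx0, zero_mul]; positivity
  have hxp : 0 < ‖x‖ ^ k := lt_of_le_of_ne (by positivity) hx0.symm
  have hmv := (convex_segment x (x - a)).norm_image_sub_le_of_norm_fderiv_le (𝕜 := ℝ)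
    (f := iteratedFDeriv ℝ n φ) (C := 2 ^ k * S / ‖x‖ ^ k)
    (fun y _ => ((φ.smooth (n + 1)).differentiable_iteratedFDeriv
        (by exact_mod_cast n.lt_succ_self)) y)
    (fun y hy => by rw [le_div_iff₀ hxp]; exact hbound y hy)
    (left_mem_segment ℝ x (x - a)) (right_mem_segment ℝ x (x - a))
  rw [show x - a - x = -a by abel, norm_neg] at hmv
  calc ‖x‖ ^ k * ‖iteratedFDeriv ℝ n φ (x - a) - iteratedFDeriv ℝ n φ x‖
      ≤ ‖x‖ ^ k * (2 ^ k * S / ‖x‖ ^ k * ‖a‖) := by gcongr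
    _ = _ := by field_simp

/-- The seminorm estimate gives continuity at zero, and the group law of translations carries it to
every point. As a consequence the heat flow of a tempered distribution is continuous in `x`, hence
measurable. -/
lemma continuous_translate (φ : 𝓢(E3, F)) :
    Continuous fun a : E3 => SchwartzMap.compSubConstCLM ℝ a φ := by
  have h0 : Tendsto (fun a : E3 => SchwartzMap.compSubConstCLM ℝ a φ) (𝓝 0) (𝓝 φ) := by
    rw [(schwartz_withSeminorms ℝ E3 F).tendsto_nhds]
    rintro ⟨k, n⟩ ε hε
    set M := 2 ^ k * (SchwartzMap.seminorm ℝ k (n + 1) φ + SchwartzMap.seminorm ℝ 0 (n + 1) φ)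
    have h1 : Tendsto (fun a : E3 => M * ‖a‖) (𝓝 0) (𝓝 0) := by
      have : Continuous fun a : E3 => M * ‖a‖ := by fun_prop
      simpa using this.tendsto 0
    filter_upwards [h1.eventually_lt_const hε, Metric.closedBall_mem_nhds (0 : E3) one_pos]
      with a ha ha1
    exact (seminorm_translate_sub_le k n φ (by simpa using ha1)).trans_lt ha
  rw [continuous_iff_continuousAt]
  intro a
  have h1 : Tendsto (fun b : E3 => b - a) (𝓝 a) (𝓝 0) := by
    have : Continuous fun b : E3 => b - a := by fun_prop
    simpa using this.tendsto a
  have h2 := ((SchwartzMap.compSubConstCLM ℝ a : 𝓢(E3, F) →L[ℝ] 𝓢(E3, F)).continuous.tendsto φ).comp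
    (h0.comp h1)
  refine h2.congr fun b => ?_
  simp only [Function.comp_def, SchwartzMap.compSubConstCLM_comp, sub_add_cancel]

lemma continuous_heatFlow {t : ℝ} (ht : 0 < t) (f : TDist F) : Continuous (heatFlow t f) := by
  have e : heatFlow t f = fun x => f (heatKernelAt t ht x) := by
    ext x; simp [heatFlow, ht]
  have h : Continuous fun x => heatKernelAt t ht x :=
    (continuous_translate (gaussSchwartz (1 / (4 * t)) (by positivity))).const_smul
      ((4 * Real.pi * t) ^ (-(3 / 2) : ℝ))
  rw [e]
  exact f.continuous.comp h

end Translation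

/-! ### Rapidly converging sequences in Lebesgue spaces -/

section Sequences

variable {F : Type} [NormedAddCommGroup F]

lemma eLpNorm_telescope_le {f : ℕ → E3 → F} (hf : ∀ n, AEStronglyMeasurable (f n)) {r : ℝ≥0∞}
    (hr : 1 ≤ r) {c : ℝ≥0∞}
    (h : ∀ n, eLpNorm (f (n + 1) - f n) r volume ≤ c * 2⁻¹ ^ n) (n k : ℕ) :
    eLpNorm (f (n + k) - f n) r volume ≤ 2 * c * 2⁻¹ ^ n := by
  have h1 : eLpNorm (f (n + k) - f n) r volume ≤ ∑ i ∈ Finset.range k, c * 2⁻¹ ^ (n + i) := by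
    induction k with
    | zero => simp
    | succ k ih =>
      rw [Finset.sum_range_succ]
      have e : f (n + (k + 1)) - f n = (f (n + k) - f n) + (f (n + k + 1) - f (n + k)) := by
        rw [← add_assoc]; abel
      rw [e]
      exact (eLpNorm_add_le ((hf _).sub (hf _)) ((hf _).sub (hf _)) hr).trans
        (add_le_add ih (h _))
  refine h1.trans ?_
  calc ∑ i ∈ Finset.range k, c * 2⁻¹ ^ (n + i)
      = c * 2⁻¹ ^ n * ∑ i ∈ Finset.range k, (2⁻¹ : ℝ≥0∞) ^ i := by
        rw [Finset.mul_sum]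
        exact Finset.sum_congr rfl fun i _ => by rw [pow_add, mul_assoc]
    _ ≤ c * 2⁻¹ ^ n * 2 := by
        gcongr
        refine (ENNReal.sum_le_tsum _).trans ?_
        rw [ENNReal.tsum_geometric, ENNReal.one_sub_inv_two, inv_inv]
    _ = _ := by ring

/-- A geometric rate in `L^r` forces convergence almost everywhere of the whole sequence. Taking
`limUnder` at each point avoids choosing a representative time by time, and this is how limits
measurable jointly in time and space are obtained. -/
lemma ae_tendsto_limUnder [CompleteSpace F] {f : ℕ → E3 → F}
    (hf : ∀ n, AEStronglyMeasurable (f n)) {r : ℝ≥0∞} (hr : 1 ≤ r) {c : ℝ≥0∞} (hc : c ≠ ∞)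
    (h : ∀ n, eLpNorm (f (n + 1) - f n) r volume ≤ c * 2⁻¹ ^ n) :
    ∀ᵐ x, Tendsto (fun n => f n x) atTop (𝓝 (limUnder atTop fun n => f n x)) := by
  -- The `1` added to `2 * c` makes the inequality strict, as the summability criterion for almost
  -- everywhere convergence requires.
  have key : ∀ N n m : ℕ, N ≤ n → n ≤ m →
      eLpNorm (f m - f n) r volume < (2 * c + 1) * 2⁻¹ ^ N := by
    intro N n m hNn hnm
    obtain ⟨k, rfl⟩ := Nat.exists_eq_add_of_le hnm
    refine (eLpNorm_telescope_le hf hr h n k).trans_lt ?_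
    have h1 : (2⁻¹ : ℝ≥0∞) ^ n ≤ 2⁻¹ ^ N :=
      pow_le_pow_right_of_le_one' (ENNReal.inv_le_one.2 one_le_two) hNn
    refine (mul_le_mul_right h1 _).trans_lt ?_
    refine ENNReal.mul_lt_mul_left (pow_ne_zero _ (by simp)) (ENNReal.pow_ne_top (by simp)) ?_
    exact ENNReal.lt_add_right (ENNReal.mul_ne_top (by simp) hc) one_ne_zero
  have h2 : ∑' n : ℕ, (2 * c + 1) * (2⁻¹ : ℝ≥0∞) ^ n ≠ ∞ := by
    rw [ENNReal.tsum_mul_left, ENNReal.tsum_geometric, ENNReal.one_sub_inv_two, inv_inv]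
    exact ENNReal.mul_ne_top (ENNReal.add_ne_top.2 ⟨ENNReal.mul_ne_top (by simp) hc, by simp⟩)
      (by simp)
  have h3 := Lp.ae_tendsto_of_cauchy_eLpNorm hf hr h2 fun N n m hn hm => by
    rcases le_total n m with hnm | hnm
    · rw [← eLpNorm_neg, neg_sub]
      exact key N n m hn hnm
    · exact key N m n hm hnm
  filter_upwards [h3] with x hx
  exact tendsto_nhds_limUnder hx

/-- Fatou's lemma applied to the telescoping bound, which is uniform in the later index. -/
lemma eLpNorm_sub_limit_le {f : ℕ → E3 → F}
    (hf : ∀ n, AEStronglyMeasurable (f n)) {r : ℝ≥0∞} (hr : 1 ≤ r) {c : ℝ≥0∞}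
    (h : ∀ n, eLpNorm (f (n + 1) - f n) r volume ≤ c * 2⁻¹ ^ n) {g : E3 → F}
    (hg : ∀ᵐ x, Tendsto (fun n => f n x) atTop (𝓝 (g x))) (n : ℕ) :
    eLpNorm (g - f n) r volume ≤ 2 * c * 2⁻¹ ^ n := by
  have h1 : ∀ᵐ x, Tendsto (fun k => (f (n + k) - f n) x) atTop (𝓝 ((g - f n) x)) := by
    filter_upwards [hg] with x hx
    have h2 := (tendsto_add_atTop_iff_nat n).2 hx
    simp only [add_comm _ n] at h2
    exact h2.sub_const _
  refine (Lp.eLpNorm_lim_le_liminf_eLpNorm (fun k => (hf _).sub (hf _)) _ h1).trans ?_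
  exact liminf_le_of_le (by isBoundedDefault) fun b hb => by
    obtain ⟨k, hk⟩ := hb.exists
    exact hk.trans (eLpNorm_telescope_le hf hr h n k)

lemma eLpNorm_limit_le {f : ℕ → E3 → F} (hf : ∀ n, AEStronglyMeasurable (f n)) {r M : ℝ≥0∞}
    (h : ∀ n, eLpNorm (f n) r volume ≤ M) {g : E3 → F}
    (hg : ∀ᵐ x, Tendsto (fun n => f n x) atTop (𝓝 (g x))) : eLpNorm g r volume ≤ M := by
  refine (Lp.eLpNorm_lim_le_liminf_eLpNorm hf _ hg).trans ?_
  exact liminf_le_of_le (by isBoundedDefault) fun b hb => by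
    obtain ⟨k, hk⟩ := hb.exists
    exact hk.trans (h k)

lemma tendsto_const_mul_inv_two_pow {c : ℝ≥0∞} (hc : c ≠ ∞) :
    Tendsto (fun n : ℕ => c * (2⁻¹ : ℝ≥0∞) ^ n) atTop (𝓝 0) := by
  have := ENNReal.Tendsto.const_mul (a := c)
    (ENNReal.tendsto_pow_atTop_nhds_zero_of_lt_one
      (ENNReal.inv_lt_one.2 ENNReal.one_lt_two)) (Or.inr hc)
  simpa using this

lemma eq_zero_of_forall_le_mul_inv_two_pow {a c : ℝ≥0∞} (hc : c ≠ ∞)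
    (h : ∀ n : ℕ, a ≤ c * 2⁻¹ ^ n) : a = 0 :=
  le_zero_iff.1 (ge_of_tendsto' (tendsto_const_mul_inv_two_pow hc) h)

end Sequences

/-! ### The heat semigroup at time zero -/

section ApproximateIdentity

variable {F : Type} [NormedAddCommGroup F]

/-- Translations act continuously on `L^c` for `c < ∞`. The finiteness of `c` is essential here, and
it is why the convergence to the data is claimed in `L³` and `L¹` only. -/
lemma tendsto_eLpNorm_translate_sub {g : E3 → F} {c : ℝ≥0∞} (hc1 : 1 ≤ c) (hc : c ≠ ∞)
    (hg : MemLp g c) :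
    Tendsto (fun y : E3 => eLpNorm (fun x => g (x - y) - g x) c volume) (𝓝 0) (𝓝 0) := by
  have : Fact (1 ≤ c) := ⟨hc1⟩
  have : Fact (c ≠ ∞) := ⟨hc⟩
  have h1 : Continuous fun y : E3 => (DomAddAct.mk (-y)) +ᵥ hg.toLp g :=
    (DomAddAct.continuous_mk.comp continuous_neg).vadd continuous_const
  have h2 := (h1.tendsto 0).edist (tendsto_const_nhds (x := hg.toLp g))
  have e : ∀ y : E3, edist (DomAddAct.mk (-y) +ᵥ hg.toLp g) (hg.toLp g) =
      eLpNorm (fun x => g (x - y) - g x) c volume := by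
    intro y
    rw [DomAddAct.mk_vadd_toLp, Lp.edist_toLp_toLp]
    congr 1
    ext x
    simp [sub_eq_neg_add]
  simp only [e] at h2
  simpa using h2

/-- Used for the tails: outside a ball the extra exponential is small, and the remaining factor is a
heat kernel of total mass one. -/
lemma heatKernel_eq_mul_exp {t : ℝ} (ht : 0 < t) (x : E3) :
    heatKernel t x = 2 ^ (3 / 2 : ℝ) * Real.exp (-(1 / (8 * t)) * ‖x‖ ^ 2) *
      heatKernel (2 * t) x := by
  unfold heatKernel
  rw [show 4 * Real.pi * (2 * t) = 2 * (4 * Real.pi * t) by ring,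
    Real.mul_rpow (x := 2) (y := 4 * Real.pi * t) (by norm_num) (by positivity)]
  have e1 : Real.exp (-(1 / (4 * t)) * ‖x‖ ^ 2) = Real.exp (-(1 / (8 * t)) * ‖x‖ ^ 2) *
      Real.exp (-(1 / (4 * (2 * t))) * ‖x‖ ^ 2) := by
    rw [← Real.exp_add]; congr 1; field_simp; ring
  have e2 : (2 : ℝ) ^ (3 / 2 : ℝ) * 2 ^ (-(3 / 2) : ℝ) = 1 := by
    rw [← Real.rpow_add (by norm_num)]; norm_num
  rw [e1]
  linear_combination (-(4 * Real.pi * t) ^ (-(3 / 2) : ℝ) * Real.exp (-(1 / (8 * t)) * ‖x‖ ^ 2) *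
    Real.exp (-(1 / (4 * (2 * t))) * ‖x‖ ^ 2)) * e2

lemma lintegral_heatKernel_compl_ball_le {t δ : ℝ} (ht : 0 < t) (hδ : 0 ≤ δ) :
    ∫⁻ y in {y : E3 | δ ≤ ‖y‖}, ENNReal.ofReal (heatKernel t y) ≤
      ENNReal.ofReal (2 ^ (3 / 2 : ℝ) * Real.exp (-(1 / (8 * t)) * δ ^ 2)) := by
  have h2 : (0 : ℝ) < 2 * t := by positivity
  calc _ ≤ ∫⁻ y in {y : E3 | δ ≤ ‖y‖},
        ENNReal.ofReal (2 ^ (3 / 2 : ℝ) * Real.exp (-(1 / (8 * t)) * δ ^ 2)) *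
          ENNReal.ofReal (heatKernel (2 * t) y) := by
        refine setLIntegral_mono (by fun_prop) fun y hy => ?_
        rw [← ENNReal.ofReal_mul (by positivity), heatKernel_eq_mul_exp ht]
        have h3 := heatKernel_nonneg (2 * t) h2 y
        have h4 : δ ^ 2 ≤ ‖y‖ ^ 2 := by
          have : δ ≤ ‖y‖ := hy
          gcongr
        have h5 : -(1 / (8 * t)) * ‖y‖ ^ 2 ≤ -(1 / (8 * t)) * δ ^ 2 :=
          mul_le_mul_of_nonpos_left h4 (by rw [neg_nonpos]; positivity)
        gcongr
    _ ≤ ENNReal.ofReal (2 ^ (3 / 2 : ℝ) * Real.exp (-(1 / (8 * t)) * δ ^ 2)) *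
        ∫⁻ y, ENNReal.ofReal (heatKernel (2 * t) y) := by
        rw [lintegral_const_mul _ (by fun_prop)]
        gcongr
        exact Measure.restrict_le_self
    _ = _ := by rw [lintegral_heatKernel _ h2, mul_one]

variable [NormedSpace ℝ F]

/-- The heat kernel as an approximate identity: the difference is an average over `y` of `g(x - y) -
g(x)`, and Minkowski's inequality takes the norm inside. For `‖y‖ < δ` the modulus of continuity of
translations is used, for `‖y‖ ≥ δ` the crude bound `2‖g‖` times the mass of the tail. -/
lemma eLpNorm_heatConv_sub_self_le [CompleteSpace F] {t : ℝ} (ht : 0 < t) {g : E3 → F}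
    (hgm : StronglyMeasurable g)
    {c : ℝ≥0∞} (hc1 : 1 ≤ c) (hg : MemLp g c) {δ : ℝ} (hδ : 0 ≤ δ) {ε : ℝ≥0∞}
    (hε : ∀ y : E3, ‖y‖ < δ → eLpNorm (fun x => g (x - y) - g x) c volume ≤ ε) :
    eLpNorm (heatConv t g - g) c volume ≤ ε + 2 * eLpNorm g c volume *
      ENNReal.ofReal (2 ^ (3 / 2 : ℝ) * Real.exp (-(1 / (8 * t)) * δ ^ 2)) := by
  set w : E3 → ℝ≥0∞ := fun y => ENNReal.ofReal (heatKernel t y) *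
    (ε + {y : E3 | δ ≤ ‖y‖}.indicator (fun _ => 2 * eLpNorm g c volume) y) with hw
  have hms : MeasurableSet {y : E3 | δ ≤ ‖y‖} := measurableSet_le (by fun_prop) (by fun_prop)
  have hwm : Measurable w := by
    refine Measurable.mul (by fun_prop) (measurable_const.add (measurable_const.indicator hms))
  have hfm : Measurable fun z : E3 × E3 => ENNReal.ofReal (heatKernel t z.2) *
      ‖g (z.1 - z.2) - g z.1‖ₑ := by
    refine Measurable.mul ((measurable_heatKernel_const t).comp measurable_snd).ennreal_ofReal ?_
    exact ((hgm.comp_measurable (measurable_fst.sub measurable_snd)).sub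
      (hgm.comp_measurable measurable_fst)).enorm
  have h1 : eLpNorm (fun x => ∫⁻ y, ENNReal.ofReal (heatKernel t y) * ‖g (x - y) - g x‖ₑ) c volume ≤
      ∫⁻ y, w y := by
    refine eLpNorm_lintegral_le hfm hc1 hwm (ae_of_all _ fun y => ?_)
    have hm1 : Measurable fun x => ‖g (x - y) - g x‖ₑ :=
      ((hgm.comp_measurable (measurable_id.sub_const y)).sub hgm).enorm
    refine (eLpNorm_const_mul_le_ennreal _ hm1 c).trans ?_
    rw [hw]
    refine mul_le_mul' le_rfl ?_
    rw [eLpNorm_enorm]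
    by_cases hy : ‖y‖ < δ
    · exact (hε y hy).trans le_self_add
    · have hy' : y ∈ {y : E3 | δ ≤ ‖y‖} := not_lt.1 hy
      rw [indicator_of_mem hy']
      refine le_trans ?_ le_add_self
      have hmp : MeasurePreserving (fun x : E3 => x - y) volume volume :=
        measurePreserving_sub_right volume y
      refine (eLpNorm_sub_le (f := fun x => g (x - y)) (g := g)
        (hgm.comp_measurable hmp.measurable).aestronglyMeasurable
        hgm.aestronglyMeasurable hc1).trans_eq ?_
      have := eLpNorm_comp_measurePreserving (p := c) hgm.aestronglyMeasurable hmp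
      rw [two_mul]
      congr 1
  have h2 : ∫⁻ y, w y ≤ ε + 2 * eLpNorm g c volume *
      ENNReal.ofReal (2 ^ (3 / 2 : ℝ) * Real.exp (-(1 / (8 * t)) * δ ^ 2)) := by
    have e : ∀ y, w y = ENNReal.ofReal (heatKernel t y) * ε + 2 * eLpNorm g c volume *
        {y : E3 | δ ≤ ‖y‖}.indicator (fun y => ENNReal.ofReal (heatKernel t y)) y := by
      intro y
      simp only [hw, mul_add, indicator]
      split_ifs
      · ring
      · simp
    simp only [e]
    have hm2 : Measurable fun y : E3 => ENNReal.ofReal (heatKernel t y) := by fun_prop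
    rw [lintegral_add_left (hm2.mul_const _), lintegral_mul_const _ hm2, lintegral_heatKernel t ht,
      one_mul, lintegral_const_mul _ (hm2.indicator hms), lintegral_indicator hms]
    gcongr
    exact lintegral_heatKernel_compl_ball_le ht hδ
  refine le_trans ?_ (h1.trans h2)
  refine eLpNorm_mono_enorm_ae ?_
  filter_upwards [heatAvg_lt_top_ae ht hc1 hg] with x hx
  rw [enorm_eq_self]
  have hi := integrable_heatConv ht hg.1 hx
  have e1 : heatConv t g x - g x = ∫ y, heatKernel t (x - y) • (g y - g x) := by
    have hk : Integrable fun y => heatKernel t (x - y) • g x :=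
      ((integrable_heatKernel t ht).comp_sub_left x).smul_const _
    simp only [smul_sub]
    rw [integral_sub hi hk, integral_smul_const,
      integral_sub_left_eq_self (heatKernel t) volume x, integral_heatKernel t ht, one_smul]
    rfl
  rw [Pi.sub_apply, e1]
  refine (enorm_integral_le_lintegral_enorm _).trans (le_of_eq ?_)
  rw [← lintegral_sub_left_eq_self _ x]
  refine lintegral_congr fun y => ?_
  rw [enorm_heatKernel_smul ht, sub_sub_cancel]

theorem tendsto_eLpNorm_heatConv_sub_self [CompleteSpace F] {g : E3 → F} {c : ℝ≥0∞} (hc1 : 1 ≤ c)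
    (hc : c ≠ ∞)
    (hg : MemLp g c) :
    Tendsto (fun t => eLpNorm (heatConv t g - g) c volume) (𝓝[>] 0) (𝓝 0) := by
  wlog hgm : StronglyMeasurable g generalizing g
  · have h1 := this (hg.ae_eq hg.1.ae_eq_mk) hg.1.stronglyMeasurable_mk
    refine h1.congr fun t => eLpNorm_congr_ae ?_
    rw [heatConv_congr_ae t hg.1.ae_eq_mk]
    filter_upwards [hg.1.ae_eq_mk] with x hx
    simp [hx]
  rw [ENNReal.tendsto_nhds_zero]
  intro ε hε
  have hε2 : 0 < ε / 2 := ENNReal.half_pos hε.ne'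
  obtain ⟨δ, hδ, h1⟩ := Metric.eventually_nhds_iff.1
    ((ENNReal.tendsto_nhds_zero.1 (tendsto_eLpNorm_translate_sub hc1 hc hg)) (ε / 2) hε2)
  have h2 : Tendsto (fun t : ℝ => 2 * eLpNorm g c volume *
      ENNReal.ofReal (2 ^ (3 / 2 : ℝ) * Real.exp (-(1 / (8 * t)) * δ ^ 2))) (𝓝[>] 0) (𝓝 0) := by
    have h3 : Tendsto (fun t : ℝ => -(1 / (8 * t)) * δ ^ 2) (𝓝[>] 0) atBot := by
      have h4 : Tendsto (fun t : ℝ => (δ ^ 2 / 8) * t⁻¹) (𝓝[>] 0) atTop :=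
        tendsto_inv_nhdsGT_zero.const_mul_atTop (by positivity)
      refine (tendsto_neg_atTop_atBot.comp h4).congr fun t => ?_
      simp only [Function.comp_apply]
      rw [one_div, mul_inv]
      ring
    have h5 := (Real.tendsto_exp_atBot.comp h3).const_mul ((2 : ℝ) ^ (3 / 2 : ℝ))
    have h6 := ENNReal.Tendsto.const_mul (a := 2 * eLpNorm g c volume)
      (ENNReal.tendsto_ofReal h5) (Or.inr (ENNReal.mul_ne_top (by simp) hg.2.ne))
    simpa using h6
  filter_upwards [self_mem_nhdsWithin, (ENNReal.tendsto_nhds_zero.1 h2) (ε / 2) hε2] with t ht ht2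
  refine (eLpNorm_heatConv_sub_self_le ht hgm hc1 hg hδ.le
    fun y hy => h1 (by simpa using hy)).trans ?_
  calc _ ≤ ε / 2 + ε / 2 := by gcongr
    _ = ε := ENNReal.add_halves ε

end ApproximateIdentity

/-! ### The heat flow of the data -/

section HeatData

variable {F : Type} [NormedAddCommGroup F] [NormedSpace ℝ F]

/-- `a` is a jointly measurable version of the heat flow of `f` on `(0,1) × ℝ³`, for `f` in the
closure of the Schwartz class in `B^{-σ}_{r,∞}`. -/
structure IsHeatData (σ : ℝ) (r : ℝ≥0∞) (f : TDist F) (a : ℝ → E3 → F) : Prop where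
  measurable : StronglyMeasurable fun z : ℝ × E3 => a z.1 z.2
  ae_eq : ∀ t ∈ Ioo (0 : ℝ) 1, a t =ᵐ[volume] heatFlow t f
  semigroup : ∀ s t : ℝ, 0 < s → s < t → t < 1 → a t =ᵐ[volume] heatConv (t - s) (a s)
  eLpNorm_lt_top : ∀ t ∈ Ioo (0 : ℝ) 1, eLpNorm (a t) r volume < ∞
  small : ∀ ε : ℝ≥0∞, 0 < ε → ∃ S : ℝ, 0 < S ∧ ∀ t ∈ Ioo 0 S,
    ENNReal.ofReal (t ^ (σ / 2)) * eLpNorm (a t) r volume ≤ ε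

lemma IsHeatData.measurable_slice {σ : ℝ} {r : ℝ≥0∞} {f : TDist F} {a : ℝ → E3 → F}
    (h : IsHeatData σ r f a) (t : ℝ) : StronglyMeasurable (a t) :=
  h.measurable.comp_measurable (measurable_prodMk_left (x := t))

lemma IsHeatData.memLp {σ : ℝ} {r : ℝ≥0∞} {f : TDist F} {a : ℝ → E3 → F}
    (h : IsHeatData σ r f a) {t : ℝ} (ht : t ∈ Ioo (0 : ℝ) 1) : MemLp (a t) r :=
  ⟨(h.measurable_slice t).aestronglyMeasurable, h.eLpNorm_lt_top t ht⟩

lemma heatFlow_of_isFunction {f : TDist F} {g : E3 → F} (h : IsFunction f g) {t : ℝ} (ht : 0 < t) :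
    heatFlow t f = heatConv t g := by
  ext x
  rw [heatFlow, dif_pos ht, h (heatKernelAt t ht x)]
  simp only [heatKernelAt_apply, heatConv]

lemma isFunction_ofSchwartz [CompleteSpace F] (ψ : 𝓢(E3, F)) : IsFunction (ofSchwartz ψ) ψ :=
  fun φ => ofSchwartz_apply ψ φ

lemma heatFlow_sub_ofSchwartz [CompleteSpace F] (f : TDist F) (ψ : 𝓢(E3, F)) {t : ℝ} (ht : 0 < t) :
    heatFlow t (f - ofSchwartz ψ) = heatFlow t f - heatConv t ψ := by
  rw [← heatFlow_of_isFunction (isFunction_ofSchwartz ψ) ht]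
  ext x
  simp [heatFlow, ht]

lemma ofReal_rpow_mul_le_iff {t ν : ℝ} (ht : 0 < t) {a b : ℝ≥0∞} :
    ENNReal.ofReal (t ^ ν) * a ≤ b ↔ a ≤ ENNReal.ofReal (t ^ (-ν)) * b := by
  have h1 : ENNReal.ofReal (t ^ (-ν)) * ENNReal.ofReal (t ^ ν) = 1 := by
    rw [← ENNReal.ofReal_mul (by positivity), ← Real.rpow_add ht]; simp
  constructor <;> intro h
  · calc a = ENNReal.ofReal (t ^ (-ν)) * (ENNReal.ofReal (t ^ ν) * a) := by
          rw [← mul_assoc, h1, one_mul]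
      _ ≤ _ := by gcongr
  · calc _ ≤ ENNReal.ofReal (t ^ ν) * (ENNReal.ofReal (t ^ (-ν)) * b) := by gcongr
      _ = b := by rw [← mul_assoc, mul_comm (ENNReal.ofReal (t ^ ν)), h1, one_mul]

lemma eLpNorm_heatFlow_sub_le [CompleteSpace F] {σ : ℝ} {r : ℝ≥0∞} {f : TDist F} {ψ : 𝓢(E3, F)}
    {ε : ℝ≥0∞}
    (h : besovNorm σ r (f - ofSchwartz ψ) ≤ ε) {t : ℝ} (ht : t ∈ Ioo (0 : ℝ) 1) :
    eLpNorm (heatFlow t f - heatConv t ψ) r volume ≤ ENNReal.ofReal (t ^ (-(σ / 2))) * ε := by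
  rw [← heatFlow_sub_ofSchwartz f ψ ht.1, ← ofReal_rpow_mul_le_iff ht.1]
  exact (le_iSup₂ (f := fun t (_ : t ∈ Ioo (0 : ℝ) 1) => ENNReal.ofReal (t ^ (σ / 2)) *
    eLpNorm (heatFlow t (f - ofSchwartz ψ)) r volume) t ht).trans h

variable [CompleteSpace F]

/-- This is where the closure of the Schwartz class matters. Up to an error `ε/2` in the Besov norm
the distribution is a Schwartz function, whose heat flow is bounded in `L^r`; multiplied by
`t^{σ/2}` with `σ > 0` it tends to zero. Data of arbitrary size thus become small on short time
intervals. -/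
lemma exists_heatFlow_small {σ : ℝ} (hσ : 0 < σ) {r : ℝ≥0∞} (hr : 1 ≤ r) {f : TDist F}
    (hf : MemBesovClosure σ r f) {ε : ℝ≥0∞} (hε : 0 < ε) : ∃ S : ℝ, 0 < S ∧ S ≤ 1 ∧
      ∀ t ∈ Ioo 0 S, ENNReal.ofReal (t ^ (σ / 2)) * eLpNorm (heatFlow t f) r volume ≤ ε := by
  have hε2 : 0 < ε / 2 := ENNReal.half_pos hε.ne'
  obtain ⟨φ, hφ⟩ := hf.2 (ε / 2) hε2
  have hφm : MemLp φ r volume := φ.memLp r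
  have h7 : Tendsto (fun t : ℝ => ENNReal.ofReal (t ^ (σ / 2)) * eLpNorm φ r volume) (𝓝 0)
      (𝓝 0) := by
    have hN := hφm.2.ne
    generalize eLpNorm φ r volume = N at hN ⊢
    have h8 : Tendsto (fun t : ℝ => t ^ (σ / 2)) (𝓝 0) (𝓝 0) := by
      have := (Real.continuous_rpow_const (by positivity : (0 : ℝ) ≤ σ / 2)).tendsto 0
      rwa [Real.zero_rpow (by positivity)] at this
    have h9 := ENNReal.Tendsto.mul_const (b := N) (ENNReal.tendsto_ofReal h8) (Or.inr hN)
    rwa [ENNReal.ofReal_zero, zero_mul] at h9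
  obtain ⟨δ, hδ, h10⟩ := Metric.eventually_nhds_iff.1
    ((ENNReal.tendsto_nhds_zero.1 h7) (ε / 2) hε2)
  refine ⟨min δ 1, by positivity, min_le_right _ _, fun t ht => ?_⟩
  have ht1 : t ∈ Ioo (0 : ℝ) 1 := ⟨ht.1, ht.2.trans_le (min_le_right _ _)⟩
  have htδ : dist t 0 < δ := by
    rw [Real.dist_0_eq_abs, abs_of_pos ht.1]
    exact ht.2.trans_le (min_le_left _ _)
  have hcm := memLp_heatConv ht.1 hr hφm
  have e : heatFlow t f = (heatFlow t f - heatConv t φ) + heatConv t φ := by abel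
  calc ENNReal.ofReal (t ^ (σ / 2)) * eLpNorm (heatFlow t f) r volume
      ≤ ENNReal.ofReal (t ^ (σ / 2)) * (eLpNorm (heatFlow t f - heatConv t φ) r volume +
        eLpNorm φ r volume) := by
        gcongr
        conv_lhs => rw [e]
        refine (eLpNorm_add_le ((continuous_heatFlow ht.1 f).aestronglyMeasurable.sub hcm.1) hcm.1
            hr).trans ?_
        gcongr
        exact eLpNorm_heatConv_le_self ht.1 hφm.1 hr
    _ ≤ ε / 2 + ε / 2 := by
        rw [mul_add]
        refine add_le_add ?_ (h10 htδ)
        exact (ofReal_rpow_mul_le_iff ht.1).2 (eLpNorm_heatFlow_sub_le hφ.le ht1)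
    _ = ε := ENNReal.add_halves ε

-- The heat flow is defined by duality at each point and time. A version measurable in `(t,x)` is
-- obtained as the pointwise limit of the heat flows of Schwartz approximations converging
-- geometrically in the Besov norm. The semigroup property is inherited from the approximations, for
-- which it follows from the Gaussian convolution identity.
set_option maxHeartbeats 400000 in
theorem exists_isHeatData {σ : ℝ} (hσ : 0 < σ) {r : ℝ≥0∞} (hr : 1 ≤ r) {f : TDist F}
    (hf : MemBesovClosure σ r f) : ∃ a, IsHeatData σ r f a := by
  have h0 : ∀ n : ℕ, (0 : ℝ≥0∞) < 2⁻¹ ^ n := fun n =>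
    pos_iff_ne_zero.2 (pow_ne_zero _ (by simp))
  choose ψ hψ using fun n : ℕ => hf.2 (2⁻¹ ^ n) (h0 n)
  have hψm : ∀ n, StronglyMeasurable (ψ n) := fun n => (ψ n).continuous.stronglyMeasurable
  set a : ℝ → E3 → F := fun t x => limUnder atTop fun n => heatConv t (ψ n) x with ha
  have hmeas : StronglyMeasurable fun z : ℝ × E3 => a z.1 z.2 :=
    StronglyMeasurable.limUnder fun n => stronglyMeasurable_heatConv (hψm n)
  have hflow : ∀ t, 0 < t → AEStronglyMeasurable (heatFlow t f) := fun t ht =>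
    (continuous_heatFlow ht f).aestronglyMeasurable
  have hconv : ∀ t, 0 < t → ∀ n, AEStronglyMeasurable (heatConv t (ψ n)) := fun t ht n =>
    (memLp_heatConv ht hr ((ψ n).memLp r)).1
  have hle : ∀ t ∈ Ioo (0 : ℝ) 1, ∀ n, eLpNorm (heatFlow t f - heatConv t (ψ n)) r volume ≤
      ENNReal.ofReal (t ^ (-(σ / 2))) * 2⁻¹ ^ n := fun t ht n =>
    eLpNorm_heatFlow_sub_le (hψ n).le ht
  have hae : ∀ t ∈ Ioo (0 : ℝ) 1, a t =ᵐ[volume] heatFlow t f := by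
    intro t ht
    set c := ENNReal.ofReal (t ^ (-(σ / 2))) with hc
    have hct : c ≠ ∞ := ENNReal.ofReal_ne_top
    have h1 : ∀ n, eLpNorm (heatConv t (ψ (n + 1)) - heatConv t (ψ n)) r volume ≤
        2 * c * 2⁻¹ ^ n := by
      intro n
      have e : heatConv t (ψ (n + 1)) - heatConv t (ψ n) =
          (heatFlow t f - heatConv t (ψ n)) - (heatFlow t f - heatConv t (ψ (n + 1))) := by abel
      rw [e]
      refine (eLpNorm_sub_le ((hflow t ht.1).sub (hconv t ht.1 n))
        ((hflow t ht.1).sub (hconv t ht.1 _)) hr).trans ?_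
      refine (add_le_add (hle t ht n) (hle t ht (n + 1))).trans ?_
      have h2 : (2⁻¹ : ℝ≥0∞) ^ (n + 1) ≤ 2⁻¹ ^ n :=
        pow_le_pow_right_of_le_one' (ENNReal.inv_le_one.2 one_le_two) n.le_succ
      calc _ ≤ c * 2⁻¹ ^ n + c * 2⁻¹ ^ n := by gcongr
        _ = _ := by ring
    have h2ct : 2 * c ≠ ∞ := ENNReal.mul_ne_top (by simp) hct
    have h3 := ae_tendsto_limUnder (hconv t ht.1) hr h2ct h1
    have h4 := eLpNorm_sub_limit_le (hconv t ht.1) hr h1 (g := a t) h3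
    have ham : AEStronglyMeasurable (a t) :=
      (hmeas.comp_measurable (measurable_prodMk_left (x := t))).aestronglyMeasurable
    -- Both the pointwise limit and the heat flow of `f` are within a constant times `2^{-n}` of the
    -- `n`-th approximation, so they coincide almost everywhere.
    have h5 : eLpNorm (a t - heatFlow t f) r volume = 0 := by
      refine eq_zero_of_forall_le_mul_inv_two_pow (c := 2 * (2 * c) + c)
        (ENNReal.add_ne_top.2 ⟨ENNReal.mul_ne_top (by simp) h2ct, hct⟩) fun n => ?_
      have e : a t - heatFlow t f = (a t - heatConv t (ψ n)) - (heatFlow t f - heatConv t (ψ n))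
          := by
        abel
      rw [e, add_mul]
      exact (eLpNorm_sub_le (ham.sub (hconv t ht.1 n))
        ((hflow t ht.1).sub (hconv t ht.1 _)) hr).trans (add_le_add (h4 n) (hle t ht n))
    rw [eLpNorm_eq_zero_iff (ham.sub (hflow t ht.1)) (zero_lt_one.trans_le hr).ne'] at h5
    filter_upwards [h5] with x hx
    exact sub_eq_zero.1 hx
  have hfin : ∀ t ∈ Ioo (0 : ℝ) 1, MemLp (heatFlow t f) r := by
    intro t ht
    refine ⟨hflow t ht.1, ?_⟩
    have e : heatFlow t f = (heatFlow t f - heatConv t (ψ 0)) + heatConv t (ψ 0) := by abel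
    rw [e]
    refine (eLpNorm_add_le ((hflow t ht.1).sub (hconv t ht.1 0)) (hconv t ht.1 0) hr).trans_lt ?_
    refine ENNReal.add_lt_top.2 ⟨(hle t ht 0).trans_lt (by simp), ?_⟩
    exact (memLp_heatConv ht.1 hr ((ψ 0).memLp r)).2
  refine ⟨a, hmeas, hae, ?_, ?_, ?_⟩
  · intro s t hs hst ht
    have hs' : s ∈ Ioo (0 : ℝ) 1 := ⟨hs, hst.trans ht⟩
    have ht' : t ∈ Ioo (0 : ℝ) 1 := ⟨hs.trans hst, ht⟩
    have hts : 0 < t - s := sub_pos.2 hst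
    refine (hae t ht').trans ?_
    rw [heatConv_congr_ae _ (hae s hs')]
    have hm1 := memLp_heatConv hts hr (hfin s hs')
    -- For the `n`-th approximation the semigroup identity is exact; the errors at times `t` and `s`
    -- are of size `2^{-n}`, and the convolution does not increase the second one.
    have h6 : eLpNorm (heatFlow t f - heatConv (t - s) (heatFlow s f)) r volume = 0 := by
      refine eq_zero_of_forall_le_mul_inv_two_pow
        (c := ENNReal.ofReal (t ^ (-(σ / 2))) + ENNReal.ofReal (s ^ (-(σ / 2))))
        (by simp) fun n => ?_
      have hψn := memLp_heatConv hs hr ((ψ n).memLp r)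
      have e1 := heatConv_sub_ae hts hr (hfin s hs') hψn
      have e2 : heatConv (t - s) (heatConv s (ψ n)) = heatConv t (ψ n) := by
        ext x
        rw [heatConv_heatConv hs hts (ψ n).integrable, sub_add_cancel]
      have e3 : heatFlow t f - heatConv (t - s) (heatFlow s f) =ᵐ[volume]
          (heatFlow t f - heatConv t (ψ n)) - heatConv (t - s) (heatFlow s f - heatConv s (ψ n))
              := by
        filter_upwards [e1] with x hx
        rw [e2] at hx
        simp only [Pi.sub_apply] at hx ⊢
        rw [hx]; abel
      rw [eLpNorm_congr_ae e3, add_mul]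
      have hm2 := (hfin s hs').sub hψn
      refine (eLpNorm_sub_le ((hflow t ht'.1).sub (hconv t ht'.1 n))
        (memLp_heatConv hts hr hm2).1 hr).trans (add_le_add (hle t ht' n) ?_)
      exact (eLpNorm_heatConv_le_self hts hm2.1 hr).trans (hle s hs' n)
    rw [eLpNorm_eq_zero_iff ((hflow t ht'.1).sub hm1.1) (zero_lt_one.trans_le hr).ne'] at h6
    filter_upwards [h6] with x hx
    exact sub_eq_zero.1 hx
  · intro t ht
    rw [eLpNorm_congr_ae (hae t ht)]
    exact (hfin t ht).2
  · intro ε hε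
    obtain ⟨S, hS, hS1, h⟩ := exists_heatFlow_small hσ hr hf hε
    refine ⟨S, hS, fun t ht => ?_⟩
    rw [eLpNorm_congr_ae (hae t ⟨ht.1, ht.2.trans_le hS1⟩)]
    exact h t ht

end HeatData

/-! ### Weighted norms -/

section Weighted

variable {F : Type} [NormedAddCommGroup F]

/-- The weighted norm `sup_{0<t<T} t^ν ‖v(t)‖_r`. -/
def wnorm (ν : ℝ) (r : ℝ≥0∞) (T : ℝ) (v : ℝ → E3 → F) : ℝ≥0∞ :=
  essSup (fun t => ENNReal.ofReal (t ^ ν) * eLpNorm (v t) r volume) (volume.restrict (Ioo 0 T))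

/-- The weight of the spaces `X_r`. -/
def weightX (r : ℝ≥0∞) : ℝ := (1 - 3 * (r⁻¹).toReal) / 2

/-- The weight of the spaces `Y_r`. -/
def weightY (r : ℝ≥0∞) : ℝ := (3 / 2) * (1 - (r⁻¹).toReal)

variable {ν : ℝ} {r : ℝ≥0∞} {S T : ℝ} {v w : ℝ → E3 → F}

lemma wnorm_le_ae {M : ℝ≥0∞}
    (h : ∀ᵐ t ∂(volume.restrict (Ioo 0 T)), ENNReal.ofReal (t ^ ν) * eLpNorm (v t) r volume ≤ M) :
    wnorm ν r T v ≤ M :=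
  essSup_le_of_ae_le M h

lemma wnorm_le {M : ℝ≥0∞}
    (h : ∀ t ∈ Ioo 0 T, ENNReal.ofReal (t ^ ν) * eLpNorm (v t) r volume ≤ M) :
    wnorm ν r T v ≤ M :=
  wnorm_le_ae ((ae_restrict_mem measurableSet_Ioo).mono h)

lemma ae_mul_le_wnorm (ν : ℝ) (r : ℝ≥0∞) (T : ℝ) (v : ℝ → E3 → F) :
    ∀ᵐ t ∂(volume.restrict (Ioo 0 T)),
      ENNReal.ofReal (t ^ ν) * eLpNorm (v t) r volume ≤ wnorm ν r T v :=
  ae_le_essSup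

lemma ae_le_wnorm (ν : ℝ) (r : ℝ≥0∞) (T : ℝ) (v : ℝ → E3 → F) :
    ∀ᵐ t, t ∈ Ioo 0 T → eLpNorm (v t) r volume ≤ ENNReal.ofReal (t ^ (-ν)) * wnorm ν r T v := by
  have h := (ae_restrict_iff' measurableSet_Ioo).1 (ae_mul_le_wnorm ν r T v)
  filter_upwards [h] with t ht hT
  exact (ofReal_rpow_mul_le_iff hT.1).1 (ht hT)

lemma wnorm_mono (h : S ≤ T) : wnorm ν r S v ≤ wnorm ν r T v :=
  essSup_mono_measure' (Measure.restrict_mono (Ioo_subset_Ioo_right h) le_rfl)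

lemma wnorm_congr (h : ∀ᵐ t ∂(volume.restrict (Ioo 0 T)), v t =ᵐ[volume] w t) :
    wnorm ν r T v = wnorm ν r T w := by
  refine essSup_congr_ae ?_
  filter_upwards [h] with t ht
  rw [eLpNorm_congr_ae ht]

lemma wnorm_zero : wnorm ν r T (0 : ℝ → E3 → F) = 0 :=
  le_zero_iff.1 (wnorm_le fun t _ => by simp)

lemma wnorm_sub_le (hr : 1 ≤ r) (hv : ∀ t, AEStronglyMeasurable (v t))
    (hw : ∀ t, AEStronglyMeasurable (w t)) :
    wnorm ν r T (v - w) ≤ wnorm ν r T v + wnorm ν r T w := by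
  refine wnorm_le_ae ?_
  filter_upwards [ae_mul_le_wnorm ν r T v, ae_mul_le_wnorm ν r T w] with t h1 h2
  calc _ ≤ ENNReal.ofReal (t ^ ν) * (eLpNorm (v t) r volume + eLpNorm (w t) r volume) := by
        gcongr
        exact eLpNorm_sub_le (hv t) (hw t) hr
    _ ≤ _ := by rw [mul_add]; exact add_le_add h1 h2

lemma ae_eq_of_wnorm_eq_zero (hr : r ≠ 0) (hv : ∀ t, AEStronglyMeasurable (v t))
    (h : wnorm ν r T v = 0) : ∀ᵐ t ∂(volume.restrict (Ioo 0 T)), v t =ᵐ[volume] 0 := by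
  filter_upwards [ae_mul_le_wnorm ν r T v, ae_restrict_mem measurableSet_Ioo] with t h1 ht
  rw [h, ofReal_rpow_mul_le_iff ht.1, mul_zero, le_zero_iff] at h1
  exact (eLpNorm_eq_zero_iff (hv t) hr).1 h1

end Weighted

/-! ### Regularity of the heat flow of the data -/

section HeatDataRegularity

variable {F : Type} [NormedAddCommGroup F] [NormedSpace ℝ F]

lemma inv_toReal_mono {a b : ℝ≥0∞} (ha : 1 ≤ a) (hab : a ≤ b) : b⁻¹.toReal ≤ a⁻¹.toReal := by
  refine ENNReal.toReal_mono ?_ (ENNReal.inv_le_inv.2 hab)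
  simpa using (zero_lt_one.trans_le ha).ne'

/-- For `t` near `t₀` the time elapsed since `τ` stays above half of `t₀ - τ`, and away from zero
elapsed time the heat semigroup is Lipschitz from `L^a` to `L^b`. It is used with `τ = t₀ / 2` for
Besov data, and with `τ = 0` for data in a Lebesgue space. -/
lemma tendsto_eLpNorm_sub_of_heatConv {a b : ℝ≥0∞} (ha : 1 ≤ a) (hab : a ≤ b) {g : E3 → F}
    (hg : MemLp g a) {v : ℝ → E3 → F} {τ t₀ : ℝ} (hτ : τ < t₀)
    (hv : ∀ᶠ t in 𝓝 t₀, v t =ᵐ[volume] heatConv (t - τ) g) :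
    Tendsto (fun t => eLpNorm (v t - v t₀) b volume) (𝓝 t₀) (𝓝 0) := by
  set d := (t₀ - τ) / 2 with hd
  have hd0 : 0 < d := by rw [hd]; linarith
  have hgb := gaussBound_pos
  have hab' := inv_toReal_mono ha hab
  set e := -1 - 3 / 2 * (a⁻¹.toReal - b⁻¹.toReal) with he
  have he0 : e ≤ 0 := by rw [he]; linarith
  have h1 : Tendsto (fun t => ENNReal.ofReal (4 * gaussBound * (|t - t₀| * d ^ e)) *
      eLpNorm g a volume) (𝓝 t₀) (𝓝 0) := by
    have hN := hg.2.ne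
    generalize eLpNorm g a volume = N at hN ⊢
    have h2 : Tendsto (fun t => 4 * gaussBound * (|t - t₀| * d ^ e)) (𝓝 t₀) (𝓝 0) := by
      have : Continuous fun t : ℝ => 4 * gaussBound * (|t - t₀| * d ^ e) := by fun_prop
      simpa using this.tendsto t₀
    have h9 := ENNReal.Tendsto.mul_const (b := N) (ENNReal.tendsto_ofReal h2) (Or.inr hN)
    rwa [ENNReal.ofReal_zero, zero_mul] at h9
  have hkey : ∀ τ₁ τ₂ : ℝ, d ≤ τ₁ → τ₁ ≤ τ₂ → eLpNorm (heatConv τ₂ g - heatConv τ₁ g) b volume ≤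
      ENNReal.ofReal (4 * gaussBound * ((τ₂ - τ₁) * d ^ e)) * eLpNorm g a volume := by
    intro τ₁ τ₂ h1 h2
    refine (eLpNorm_heatConv_sub_le (hd0.trans_le h1) h2 ha hab hg).trans ?_
    refine mul_le_mul' (ENNReal.ofReal_le_ofReal ?_) le_rfl
    have h3 : τ₁ ^ e ≤ d ^ e := Real.rpow_le_rpow_of_nonpos hd0 h1 he0
    have h4 : 0 ≤ τ₂ - τ₁ := sub_nonneg.2 h2
    gcongr
  refine tendsto_of_tendsto_of_tendsto_of_le_of_le' tendsto_const_nhds h1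
    (Eventually.of_forall fun _ => zero_le) ?_
  have hnear : ∀ᶠ t in 𝓝 t₀, d ≤ t - τ := by
    filter_upwards [Ioi_mem_nhds (show t₀ - d < t₀ by linarith)] with t ht
    have : t₀ - d < t := ht
    linarith
  filter_upwards [hv, hnear] with t ht htd
  have e1 : eLpNorm (v t - v t₀) b volume =
      eLpNorm (heatConv (t - τ) g - heatConv (t₀ - τ) g) b volume :=
    eLpNorm_congr_ae (ht.sub hv.self_of_nhds)
  rw [e1]
  rcases le_total t₀ t with h | h
  · refine (hkey (t₀ - τ) (t - τ) (by linarith) (by linarith)).trans_eq ?_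
    rw [abs_of_nonneg (by linarith)]; congr 4; ring
  · rw [← eLpNorm_neg, neg_sub]
    refine (hkey (t - τ) (t₀ - τ) htd (by linarith)).trans_eq ?_
    rw [abs_of_nonpos (by linarith)]; congr 4; ring

variable {σ : ℝ} {r : ℝ≥0∞} {f : TDist F} {a : ℝ → E3 → F}

/-- The evolution is restarted at `t / 2`, where it lies in `L^r`, and the second half of the time
is spent on smoothing to `L^b`. -/
lemma IsHeatData.eLpNorm_le (h : IsHeatData σ r f a) (hr : 1 ≤ r) {b : ℝ≥0∞} (hrb : r ≤ b) {t : ℝ}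
    (ht : t ∈ Ioo (0 : ℝ) 1) : eLpNorm (a t) b volume ≤
      ENNReal.ofReal ((t / 2) ^ (-(3 / 2 * (r⁻¹.toReal - b⁻¹.toReal)))) *
        eLpNorm (a (t / 2)) r volume := by
  have ht0 := ht.1
  rw [eLpNorm_congr_ae (h.semigroup (t / 2) t (by positivity) (by linarith) ht.2), sub_half]
  exact eLpNorm_heatConv_le (by positivity) (h.measurable_slice _).aestronglyMeasurable hr hrb

lemma IsHeatData.memLp_of_le (h : IsHeatData σ r f a) (hr : 1 ≤ r) {b : ℝ≥0∞} (hrb : r ≤ b) {t : ℝ}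
    (ht : t ∈ Ioo (0 : ℝ) 1) : MemLp (a t) b := by
  refine ⟨(h.measurable_slice _).aestronglyMeasurable, (h.eLpNorm_le hr hrb ht).trans_lt ?_⟩
  have ht2 : t / 2 ∈ Ioo (0 : ℝ) 1 := ⟨by linarith [ht.1], by linarith [ht.1, ht.2]⟩
  exact ENNReal.mul_lt_top ENNReal.ofReal_lt_top (h.eLpNorm_lt_top _ ht2)

lemma IsHeatData.small_of_le (h : IsHeatData σ r f a) (hr : 1 ≤ r) {b : ℝ≥0∞} (hrb : r ≤ b) {ν : ℝ}
    (hν : ν = σ / 2 + 3 / 2 * (r⁻¹.toReal - b⁻¹.toReal)) {ε : ℝ≥0∞} (hε : 0 < ε) :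
    ∃ S : ℝ, 0 < S ∧ ∀ t ∈ Ioo 0 S, ENNReal.ofReal (t ^ ν) * eLpNorm (a t) b volume ≤ ε := by
  -- The estimate is applied at time `t / 2`, while the weight is taken at time `t`; the constant
  -- `2^ν` is the ratio of the two weights.
  set K := ENNReal.ofReal (2 ^ ν) with hK
  have hK0 : 0 < K := ENNReal.ofReal_pos.2 (by positivity)
  obtain ⟨S, hS, h1⟩ := h.small (ε / K) (ENNReal.div_pos hε.ne' ENNReal.ofReal_ne_top)
  refine ⟨min S 1, by positivity, fun t ht => ?_⟩
  have ht0 : 0 < t := ht.1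
  have ht1 : t ∈ Ioo (0 : ℝ) 1 := ⟨ht.1, ht.2.trans_le (min_le_right _ _)⟩
  have ht2 : t / 2 ∈ Ioo 0 S := ⟨by linarith, by linarith [ht.2.trans_le (min_le_left S 1)]⟩
  have h2 := (ofReal_rpow_mul_le_iff ht2.1).1 (h1 _ ht2)
  calc ENNReal.ofReal (t ^ ν) * eLpNorm (a t) b volume
      ≤ ENNReal.ofReal (t ^ ν) *
          (ENNReal.ofReal ((t / 2) ^ (-(3 / 2 * (r⁻¹.toReal - b⁻¹.toReal)))) *
        (ENNReal.ofReal ((t / 2) ^ (-(σ / 2))) * (ε / K))) := by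
        gcongr
        exact (h.eLpNorm_le hr hrb ht1).trans (by gcongr)
    _ = K * (ε / K) := by
        rw [← mul_assoc, ← mul_assoc, ← ENNReal.ofReal_mul (by positivity),
          ← ENNReal.ofReal_mul (by positivity), hK]
        congr 2
        rw [mul_assoc, ← Real.rpow_add (by positivity)]
        have e1 : -(3 / 2 * (r⁻¹.toReal - b⁻¹.toReal)) + -(σ / 2) = -ν := by rw [hν]; ring
        have e2 : t ^ ν = 2 ^ ν * (t / 2) ^ ν := by
          rw [← Real.mul_rpow (by norm_num) (by positivity)]; congr 1; ring
        rw [e1, e2, mul_assoc, ← Real.rpow_add (by positivity)]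
        simp
    _ = ε := ENNReal.mul_div_cancel hK0.ne' ENNReal.ofReal_ne_top

lemma IsHeatData.tendsto_sub (h : IsHeatData σ r f a) (hr : 1 ≤ r) {b : ℝ≥0∞} (hrb : r ≤ b) {t₀ : ℝ}
    (ht : t₀ ∈ Ioo (0 : ℝ) 1) :
    Tendsto (fun t => eLpNorm (a t - a t₀) b volume) (𝓝 t₀) (𝓝 0) := by
  have ht0 := ht.1
  have ht2 : t₀ / 2 ∈ Ioo (0 : ℝ) 1 := ⟨by linarith [ht.1], by linarith [ht.1, ht.2]⟩
  refine tendsto_eLpNorm_sub_of_heatConv hr hrb (h.memLp ht2) (τ := t₀ / 2) (by linarith) ?_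
  filter_upwards [Ioo_mem_nhds (show t₀ / 2 < t₀ by linarith) ht.2] with t ht'
  exact h.semigroup _ _ ht2.1 ht'.1 ht'.2

lemma IsHeatData.ae_eq_heatConv (h : IsHeatData σ r f a) {g : E3 → F} (hg : IsFunction f g) {t : ℝ}
    (ht : t ∈ Ioo (0 : ℝ) 1) : a t =ᵐ[volume] heatConv t g := by
  rw [← heatFlow_of_isFunction hg ht.1]
  exact h.ae_eq t ht

lemma IsHeatData.tendsto_sub_of_isFunction (h : IsHeatData σ r f a) {g : E3 → F}
    (hg : IsFunction f g) {c : ℝ≥0∞} (hc : 1 ≤ c) (hgc : MemLp g c) {t₀ : ℝ}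
    (ht : t₀ ∈ Ioo (0 : ℝ) 1) :
    Tendsto (fun t => eLpNorm (a t - a t₀) c volume) (𝓝 t₀) (𝓝 0) := by
  refine tendsto_eLpNorm_sub_of_heatConv hc le_rfl hgc (τ := 0) ht.1 ?_
  filter_upwards [Ioo_mem_nhds ht.1 ht.2] with t ht'
  rw [sub_zero]
  exact h.ae_eq_heatConv hg ht'

lemma IsHeatData.tendsto_zero_of_isFunction [CompleteSpace F] (h : IsHeatData σ r f a) {g : E3 → F}
    (hg : IsFunction f g) {c : ℝ≥0∞} (hc : 1 ≤ c) (hct : c ≠ ∞) (hgc : MemLp g c) :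
    Tendsto (fun t => eLpNorm (a t - g) c volume) (𝓝[>] 0) (𝓝 0) := by
  refine (tendsto_eLpNorm_heatConv_sub_self hc hct hgc).congr' ?_
  filter_upwards [Ioo_mem_nhdsGT (one_pos : (0 : ℝ) < 1)] with t ht
  exact eLpNorm_congr_ae ((h.ae_eq_heatConv hg ht).symm.sub EventuallyEq.rfl)

lemma IsHeatData.eLpNorm_le_of_isFunction (h : IsHeatData σ r f a) {g : E3 → F}
    (hg : IsFunction f g) {c : ℝ≥0∞} (hc : 1 ≤ c) (hgc : MemLp g c) {t : ℝ}
    (ht : t ∈ Ioo (0 : ℝ) 1) : eLpNorm (a t) c volume ≤ eLpNorm g c volume := by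
  rw [eLpNorm_congr_ae (h.ae_eq_heatConv hg ht)]
  exact eLpNorm_heatConv_le_self ht.1 hgc.1 hc

end HeatDataRegularity

/-! ### Vector-valued Duhamel integrals -/

lemma heatSup_mono {m : ℝ} {A : Set (ℝ × ℝ)} (hA : MeasurableSet A) {T : ℝ}
    (hAT : ∀ z ∈ A, z.1 ∈ Ioo 0 T) {f g : ℝ → E3 → ℝ≥0∞}
    (h : ∀ s ∈ Ioo 0 T, ∀ y, f s y ≤ g s y) (x : E3) : heatSup m A f x ≤ heatSup m A g x := by
  refine setLIntegral_mono' hA fun z hz => ?_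
  unfold heatAvg
  gcongr with y
  exact h _ (hAT z hz) y

section DuhamelSum

variable {ι : Type} [Fintype ι] {G : Type} [NormedAddCommGroup G] [NormedSpace ℝ G]

/-- A finite sum of Duhamel integrals with coefficients in `G`. -/
def duhamelSum (h : ι → ℝ → E3 → ℝ) (e : ι → G) (F : ι → ℝ → E3 → ℝ) (t : ℝ) (x : E3) : G :=
  ∑ i, duhamel (h i) (F i) t x • e i

/-- The densities `h i` are of order `m` with constant `C`, and the coefficients are of norm at
most one. -/
structure IsDuhamelSystem (m C : ℝ) (h : ι → ℝ → E3 → ℝ) (e : ι → G) : Prop where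
  order_nonneg : 0 ≤ m
  density : ∀ i, IsHeatDensity m C (h i)
  enorm_le : ∀ i, ‖e i‖ₑ ≤ 1

variable {m C : ℝ} {h : ι → ℝ → E3 → ℝ} {e : ι → G} {F F' : ι → ℝ → E3 → ℝ}
  {f g : ℝ → E3 → ℝ≥0∞} {t t' : ℝ} {x : E3}

lemma stronglyMeasurable_duhamelSum (hh : IsDuhamelSystem m C h e)
    (hF : ∀ i, Measurable fun w : ℝ × E3 => F i w.1 w.2) :
    StronglyMeasurable fun z : ℝ × E3 => duhamelSum h e F z.1 z.2 := by
  unfold duhamelSum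
  refine Finset.stronglyMeasurable_fun_sum _ fun i _ => ?_
  exact (measurable_duhamel (hh.density i) (hF i)).stronglyMeasurable.smul_const (e i)

lemma enorm_sum_smul_le {d : ι → ℝ} (he : ∀ i, ‖e i‖ₑ ≤ 1) {B : ℝ≥0∞} (hB : ∀ i, ‖d i‖ₑ ≤ B) :
    ‖∑ i, d i • e i‖ₑ ≤ Fintype.card ι * B := by
  refine (enorm_sum_le _ _).trans ?_
  calc ∑ i, ‖d i • e i‖ₑ ≤ ∑ _i : ι, B := by
        refine Finset.sum_le_sum fun i _ => ?_
        rw [enorm_smul]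
        calc _ ≤ B * 1 := mul_le_mul' (hB i) (he i)
          _ = B := mul_one B
    _ = _ := by simp

lemma regA_subset_Ioo (t : ℝ) : ∀ z ∈ regA t, z.1 ∈ Ioo 0 t := fun _ hz => hz.1

lemma regB_subset_Ioo {t t' : ℝ} (ht : 0 < t) (htt : t ≤ t') : ∀ z ∈ regB t t', z.1 ∈ Ioo 0 t' := by
  rintro z (hz | hz)
  · exact ⟨hz.1.1, hz.1.2.trans_le htt⟩
  · exact ⟨ht.trans_le hz.1.1, hz.1.2⟩

lemma heatSup_lt_top_of_le (hFf : ∀ i, ∀ s ∈ Ioo 0 t, ∀ y, ‖F i s y‖ₑ ≤ f s y)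
    (hfin : heatSup m (regA t) f x < ∞) (i : ι) :
    heatSup m (regA t) (fun s y => ‖F i s y‖ₑ) x < ∞ :=
  (heatSup_mono (measurableSet_regA t) (regA_subset_Ioo t) (hFf i) x).trans_lt hfin

lemma enorm_duhamelSum_le (hh : IsDuhamelSystem m C h e)
    (hF : ∀ i, Measurable fun w : ℝ × E3 => F i w.1 w.2)
    (hFf : ∀ i, ∀ s ∈ Ioo 0 t, ∀ y, ‖F i s y‖ₑ ≤ f s y) (x : E3) :
    ‖duhamelSum h e F t x‖ₑ ≤
      Fintype.card ι * (ENNReal.ofReal C * heatSup m (regA t) f x) := by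
  refine enorm_sum_smul_le hh.enorm_le fun i => ?_
  refine (enorm_duhamel_le (hh.density i) (hF i) t x).trans ?_
  gcongr
  exact heatSup_mono (measurableSet_regA t) (regA_subset_Ioo t) (hFf i) x

lemma enorm_duhamelSum_sub_le (hh : IsDuhamelSystem m C h e)
    (hF : ∀ i, Measurable fun w : ℝ × E3 => F i w.1 w.2)
    (hF' : ∀ i, Measurable fun w : ℝ × E3 => F' i w.1 w.2)
    (hfin : ∀ i, heatSup m (regA t) (fun s y => ‖F i s y‖ₑ) x < ∞)
    (hfin' : ∀ i, heatSup m (regA t) (fun s y => ‖F' i s y‖ₑ) x < ∞)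
    (hg : ∀ i, ∀ s ∈ Ioo 0 t, ∀ y, ‖F i s y - F' i s y‖ₑ ≤ g s y) :
    ‖duhamelSum h e F t x - duhamelSum h e F' t x‖ₑ ≤
      Fintype.card ι * (ENNReal.ofReal C * heatSup m (regA t) g x) := by
  unfold duhamelSum
  rw [← Finset.sum_sub_distrib]
  simp only [← sub_smul]
  refine enorm_sum_smul_le hh.enorm_le fun i => ?_
  refine (enorm_duhamel_sub_le (hh.density i) (hF i) (hF' i)
    (integrable_duhamel (hh.density i) (hF i) (hfin i))
    (integrable_duhamel (hh.density i) (hF' i) (hfin' i))).trans ?_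
  gcongr
  exact heatSup_mono (measurableSet_regA t) (regA_subset_Ioo t) (hg i) x

lemma enorm_duhamelSum_time_sub_le (hh : IsDuhamelSystem m C h e)
    (hF : ∀ i, Measurable fun w : ℝ × E3 => F i w.1 w.2) (ht : 0 < t) (htt : t ≤ t')
    (hFf : ∀ i, ∀ s ∈ Ioo 0 t', ∀ y, ‖F i s y‖ₑ ≤ f s y)
    (hfin : heatSup m (regA t) f x < ∞) (hfin' : heatSup m (regA t') f x < ∞) :
    ‖duhamelSum h e F t' x - duhamelSum h e F t x‖ₑ ≤
      Fintype.card ι * (ENNReal.ofReal C * heatSup m (regB t t') f x) := by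
  unfold duhamelSum
  rw [← Finset.sum_sub_distrib]
  simp only [← sub_smul]
  refine enorm_sum_smul_le hh.enorm_le fun i => ?_
  have hFt : ∀ i, ∀ s ∈ Ioo 0 t, ∀ y, ‖F i s y‖ₑ ≤ f s y := fun i s hs =>
    hFf i s ⟨hs.1, hs.2.trans_le htt⟩
  refine (enorm_duhamel_time_sub_le hh.order_nonneg (hh.density i) (hF i) htt
    (integrable_duhamel (hh.density i) (hF i) (heatSup_lt_top_of_le hFt hfin i))
    (integrable_duhamel (hh.density i) (hF i) (heatSup_lt_top_of_le hFf hfin' i))).trans ?_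
  gcongr
  exact heatSup_mono (measurableSet_regB t t') (regB_subset_Ioo ht htt) (hFf i) x

end DuhamelSum

/-! ### Sources in weighted Lebesgue spaces -/

/-- The Duhamel integrals of order `m` with the source `f` are in `C((0,T), L^b)`. -/
structure HeatSupRegular (m : ℝ) (b : ℝ≥0∞) (T : ℝ) (f : ℝ → E3 → ℝ≥0∞) : Prop where
  measurable : Measurable fun w : ℝ × E3 => f w.1 w.2
  lt_top : ∀ t ∈ Ioo 0 T, eLpNorm (heatSup m (regA t) f) b volume < ∞
  tendsto : ∀ t₀ ∈ Ioo 0 T, Tendsto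
    (fun t => eLpNorm (heatSup m (regB (min t t₀) (max t t₀)) f) b volume) (𝓝 t₀) (𝓝 0)

lemma ae_lt_top_of_eLpNorm_lt_top {f : E3 → ℝ≥0∞} (hf : Measurable f) {b : ℝ≥0∞} (hb : 1 ≤ b)
    (h : eLpNorm f b volume < ∞) : ∀ᵐ x, f x < ∞ := by
  have hb0 : b ≠ 0 := (zero_lt_one.trans_le hb).ne'
  rcases eq_or_ne b ∞ with rfl | hbt
  · rw [eLpNorm_exponent_top] at h
    filter_upwards [enorm_ae_le_eLpNormEssSup f volume] with x hx
    rw [enorm_eq_self] at hx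
    exact hx.trans_lt h
  · have h1 := lintegral_rpow_enorm_lt_top_of_eLpNorm_lt_top hb0 hbt h
    filter_upwards [ae_lt_top (hf.enorm.pow_const _) h1.ne] with x hx
    rw [enorm_eq_self] at hx
    exact (ENNReal.rpow_lt_top_iff_of_pos (ENNReal.toReal_pos hb0 hbt)).1 hx

lemma HeatSupRegular.ae_lt_top {m : ℝ} {b : ℝ≥0∞} (hb : 1 ≤ b) {T : ℝ} {f : ℝ → E3 → ℝ≥0∞}
    (h : HeatSupRegular m b T f) {t : ℝ} (ht : t ∈ Ioo 0 T) :
    ∀ᵐ x, heatSup m (regA t) f x < ∞ :=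
  ae_lt_top_of_eLpNorm_lt_top (measurable_heatSup m _ h.measurable) hb (h.lt_top t ht)

section Sources

variable {m : ℝ} {f : ℝ → E3 → ℝ≥0∞} {b c : ℝ≥0∞} {γ : ℝ} {J : Set ℝ} {φ : ℝ → ℝ≥0∞}

lemma eLpNorm_heatSup_regA_le (hf : Measurable fun w : ℝ × E3 => f w.1 w.2) (hc : 1 ≤ c)
    (hcb : c ≤ b) (hγ : γ = m / 2 + 3 / 2 * (c⁻¹.toReal - b⁻¹.toReal)) (hγ0 : 0 < γ)
    (hJ : MeasurableSet J) (hφ : Measurable φ)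
    {t : ℝ} (hfφ : ∀ᵐ s, s ∈ Ioo 0 t → s ∈ J → eLpNorm (f s) c volume ≤ φ s) :
    eLpNorm (heatSup m (regA t ∩ (J ×ˢ univ)) f) b volume ≤ ENNReal.ofReal (1 / γ) *
      ∫⁻ s in Ioo 0 t ∩ J, ENNReal.ofReal ((t - s) ^ (-γ)) * φ s := by
  rw [← lintegral_regA_le hγ0 hJ hφ]
  refine eLpNorm_heatSup_le ((measurableSet_regA t).inter (hJ.prod MeasurableSet.univ))
    (J := Ioo 0 t ∩ J) (fun z hz => ⟨regA_pos hz.1, hz.1.1, hz.2.1⟩) hf hc hcb hφ ?_ hγ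
  filter_upwards [hfφ] with s hs hs'
  exact hs hs'.1 hs'.2

/-- The estimate over `regB` is `|t - t₀|^ε` times integrals with the exponent `γ + ε`. It is enough
that these stay bounded for `t` near `t₀`, which leaves the choice of `ε` to each application. -/
lemma tendsto_heatSup_regB (hf : Measurable fun w : ℝ × E3 => f w.1 w.2) (hc : 1 ≤ c)
    (hcb : c ≤ b) (hγ : γ = m / 2 + 3 / 2 * (c⁻¹.toReal - b⁻¹.toReal)) (hγ0 : 0 < γ) {ε : ℝ}
    (hε : 0 < ε) (hε1 : ε ≤ 1) (hJ : MeasurableSet J) (hφ : Measurable φ) {T : ℝ}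
    (hfφ : ∀ᵐ s, s ∈ Ioo 0 T → s ∈ J → eLpNorm (f s) c volume ≤ φ s) {t₀ : ℝ} (ht : t₀ ∈ Ioo 0 T)
    {B : ℝ≥0∞} (hB : B ≠ ∞) (hBφ : ∀ᶠ t in 𝓝 t₀,
      ∫⁻ s in Ioo 0 t ∩ J, ENNReal.ofReal ((t - s) ^ (-(γ + ε))) * φ s ≤ B) :
    Tendsto (fun t => eLpNorm (heatSup m (regB (min t t₀) (max t t₀) ∩ (J ×ˢ univ)) f) b volume)
      (𝓝 t₀) (𝓝 0) := by
  have h1 : Tendsto (fun t => ENNReal.ofReal ((1 / ε + 1 / γ) * |t - t₀| ^ ε) * (B + B))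
      (𝓝 t₀) (𝓝 0) := by
    have h2 : Tendsto (fun t => (1 / ε + 1 / γ) * |t - t₀| ^ ε) (𝓝 t₀) (𝓝 0) := by
      have : Continuous fun t : ℝ => (1 / ε + 1 / γ) * |t - t₀| ^ ε :=
        continuous_const.mul ((Real.continuous_rpow_const hε.le).comp (by fun_prop))
      have h3 := this.tendsto t₀
      rwa [sub_self, abs_zero, Real.zero_rpow hε.ne', mul_zero] at h3
    have h9 := ENNReal.Tendsto.mul_const (b := B + B) (ENNReal.tendsto_ofReal h2)
      (Or.inr (ENNReal.add_ne_top.2 ⟨hB, hB⟩))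
    rwa [ENNReal.ofReal_zero, zero_mul] at h9
  refine tendsto_of_tendsto_of_tendsto_of_le_of_le' tendsto_const_nhds h1
    (Eventually.of_forall fun _ => zero_le) ?_
  have key : ∀ t t' : ℝ, 0 < t → t ≤ t' → t' < T →
      ∫⁻ s in Ioo 0 t ∩ J, ENNReal.ofReal ((t - s) ^ (-(γ + ε))) * φ s ≤ B →
      ∫⁻ s in Ioo 0 t' ∩ J, ENNReal.ofReal ((t' - s) ^ (-(γ + ε))) * φ s ≤ B →
      eLpNorm (heatSup m (regB t t' ∩ (J ×ˢ univ)) f) b volume ≤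
        ENNReal.ofReal ((1 / ε + 1 / γ) * (t' - t) ^ ε) * (B + B) := by
    intro t t' h0 h1 h2 h3 h4
    have h5 : eLpNorm (heatSup m (regB t t' ∩ (J ×ˢ univ)) f) b volume ≤
        ∫⁻ z in regB t t' ∩ (J ×ˢ univ), ENNReal.ofReal (z.2 ^ (-1 - γ)) * φ z.1 := by
      refine eLpNorm_heatSup_le ((measurableSet_regB t t').inter (hJ.prod MeasurableSet.univ))
        (J := Ioo 0 t' ∩ J) (fun z hz => ⟨regB_pos hz.1, regB_subset_Ioo h0 h1 z hz.1, hz.2.1⟩)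
        hf hc hcb hφ ?_ hγ
      filter_upwards [hfφ] with s hs hs'
      exact hs ⟨hs'.1.1, hs'.1.2.trans h2⟩ hs'.2
    refine h5.trans ((lintegral_regB_le h1 hγ0 hε hε1 hJ hφ h0).trans ?_)
    gcongr
  filter_upwards [hBφ, Ioo_mem_nhds ht.1 ht.2] with t h2 h3
  rcases le_total t t₀ with h | h
  · rw [min_eq_left h, max_eq_right h, abs_of_nonpos (by linarith), neg_sub]
    exact key t t₀ h3.1 h ht.2 h2 hBφ.self_of_nhds
  · rw [min_eq_right h, max_eq_left h, abs_of_nonneg (by linarith)]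
    exact key t₀ t ht.1 h h3.2 hBφ.self_of_nhds h2

/-- The general principle behind all the bounds except the one in `Y_∞`: a source of size `s^{-δ}`
against a kernel of size `(t-s)^{-γ}`, with both exponents below `1`, gives a Beta integral of size
`t^{1-γ-δ}`. The constant is independent of the length `T` and of the source. -/
lemma exists_heatSup_source_le (hc : 1 ≤ c) (hcb : c ≤ b)
    (hγ : γ = m / 2 + 3 / 2 * (c⁻¹.toReal - b⁻¹.toReal)) (hγ0 : 0 < γ) (hγ1 : γ < 1) {δ : ℝ}
    (hδ0 : 0 ≤ δ) (hδ1 : δ < 1) :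
    ∃ C : ℝ, 0 < C ∧ ∀ (T : ℝ) (f : ℝ → E3 → ℝ≥0∞) (M : ℝ≥0∞),
      (Measurable fun w : ℝ × E3 => f w.1 w.2) →
      (∀ᵐ s, s ∈ Ioo 0 T → eLpNorm (f s) c volume ≤ ENNReal.ofReal (s ^ (-δ)) * M) →
      (∀ t ∈ Ioo 0 T, ENNReal.ofReal (t ^ (γ + δ - 1)) *
        eLpNorm (heatSup m (regA t) f) b volume ≤ ENNReal.ofReal C * M) ∧
      (M ≠ ∞ → HeatSupRegular m b T f) := by
  obtain ⟨C, hC, hbeta⟩ := exists_lintegral_beta_le hγ0.le hγ1 hδ0 hδ1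
  have bound : ∀ (T : ℝ) (f : ℝ → E3 → ℝ≥0∞) (M : ℝ≥0∞),
      (Measurable fun w : ℝ × E3 => f w.1 w.2) →
      (∀ᵐ s, s ∈ Ioo 0 T → eLpNorm (f s) c volume ≤ ENNReal.ofReal (s ^ (-δ)) * M) →
      ∀ t ∈ Ioo 0 T, ENNReal.ofReal (t ^ (γ + δ - 1)) *
        eLpNorm (heatSup m (regA t) f) b volume ≤ ENNReal.ofReal (1 / γ * C) * M := by
    intro T f M hf hfM t ht
    rw [ofReal_rpow_mul_le_iff ht.1]
    have h1 := eLpNorm_heatSup_regA_le (t := t) (J := univ) (φ := fun s => ENNReal.ofReal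
        (s ^ (-δ)) * M)
      hf hc hcb hγ hγ0 MeasurableSet.univ (by fun_prop) (by
        filter_upwards [hfM] with s hs hs' _
        exact hs ⟨hs'.1, hs'.2.trans ht.2⟩)
    rw [univ_prod_univ, inter_univ, inter_univ] at h1
    refine h1.trans ?_
    have h2 : ∫⁻ s in Ioo 0 t, ENNReal.ofReal ((t - s) ^ (-γ)) * (ENNReal.ofReal (s ^ (-δ)) * M) ≤
        ENNReal.ofReal (C * t ^ (1 - γ - δ)) * M := by
      simp only [← mul_assoc]
      rw [lintegral_mul_const _ (by fun_prop)]
      gcongr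
      exact hbeta t ht.1
    calc _ ≤ ENNReal.ofReal (1 / γ) * (ENNReal.ofReal (C * t ^ (1 - γ - δ)) * M) := by gcongr
      _ = _ := by
        rw [← mul_assoc, ← mul_assoc, ← ENNReal.ofReal_mul (by positivity),
          ← ENNReal.ofReal_mul (Real.rpow_nonneg ht.1.le _)]
        congr 2
        rw [show -(γ + δ - 1) = 1 - γ - δ by ring]
        ring
  refine ⟨1 / γ * C, by positivity, fun T f M hf hfM => ⟨bound T f M hf hfM, fun hM => ?_⟩⟩
  refine ⟨hf, fun t ht => ?_, fun t₀ ht => ?_⟩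
  · refine ((ofReal_rpow_mul_le_iff ht.1).1 (bound T f M hf hfM t ht)).trans_lt ?_
    exact ENNReal.mul_lt_top ENNReal.ofReal_lt_top
      (ENNReal.mul_lt_top ENNReal.ofReal_lt_top hM.lt_top)
  -- Half of the gap between `γ` and `1` is spent on Hölder continuity in time, so the Beta integral
  -- still converges.
  · obtain ⟨C', hC', hbeta'⟩ := exists_lintegral_beta_le (γ := γ + (1 - γ) / 2) (by linarith)
      (by linarith) hδ0 hδ1
    have hcont : ContinuousAt (fun t : ℝ => C' * t ^ (1 - (γ + (1 - γ) / 2) - δ)) t₀ :=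
      continuousAt_const.mul (Real.continuousAt_rpow_const _ _ (Or.inl ht.1.ne'))
    have h3 := tendsto_heatSup_regB (J := univ) (φ := fun s => ENNReal.ofReal (s ^ (-δ)) * M)
      (ε := (1 - γ) / 2) (B := ENNReal.ofReal (C' * t₀ ^ (1 - (γ + (1 - γ) / 2) - δ) + 1) * M)
      hf hc hcb hγ hγ0 (by linarith) (by linarith) MeasurableSet.univ (by fun_prop) (by
        filter_upwards [hfM] with s hs hs' _
        exact hs hs') ht (ENNReal.mul_ne_top ENNReal.ofReal_ne_top hM) ?_
    · simpa only [univ_prod_univ, inter_univ] using h3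
    · filter_upwards [hcont.eventually_lt_const (lt_add_one _), Ioi_mem_nhds ht.1] with t h4 h5
      rw [inter_univ]
      simp only [← mul_assoc]
      rw [lintegral_mul_const _ (by fun_prop)]
      gcongr
      exact (hbeta' t h5).trans (ENNReal.ofReal_le_ofReal h4.le)

lemma eLpNorm_heatSup_le_split (hb : 1 ≤ b) (hf : Measurable fun w : ℝ × E3 => f w.1 w.2)
    (hJ : MeasurableSet J) (A : Set (ℝ × ℝ)) : eLpNorm (heatSup m A f) b volume ≤
      eLpNorm (heatSup m (A ∩ (J ×ˢ univ)) f) b volume +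
        eLpNorm (heatSup m (A ∩ (Jᶜ ×ˢ univ)) f) b volume := by
  have e : heatSup m A f = heatSup m (A ∩ (J ×ˢ univ)) f + heatSup m (A ∩ (Jᶜ ×ˢ univ)) f := by
    ext x
    rw [heatSup_split A (hJ.prod MeasurableSet.univ), Set.compl_prod_eq_union]
    simp
  rw [e]
  exact eLpNorm_add_le (measurable_heatSup m _ hf).aestronglyMeasurable
    (measurable_heatSup m _ hf).aestronglyMeasurable hb

/-- Needed when no single source bound is integrable against the kernel on the whole interval. The
splitting set may depend on the time `t₀` at which continuity is tested. -/
lemma HeatSupRegular.of_split {T : ℝ} (hb : 1 ≤ b) (hf : Measurable fun w : ℝ × E3 => f w.1 w.2)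
    (h : ∀ t₀ ∈ Ioo 0 T, ∃ J : Set ℝ, MeasurableSet J ∧
      eLpNorm (heatSup m (regA t₀ ∩ (J ×ˢ univ)) f) b volume < ∞ ∧
      eLpNorm (heatSup m (regA t₀ ∩ (Jᶜ ×ˢ univ)) f) b volume < ∞ ∧
      Tendsto (fun t => eLpNorm (heatSup m (regB (min t t₀) (max t t₀) ∩ (J ×ˢ univ)) f) b volume)
        (𝓝 t₀) (𝓝 0) ∧
      Tendsto (fun t => eLpNorm (heatSup m (regB (min t t₀) (max t t₀) ∩ (Jᶜ ×ˢ univ)) f) b volume)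
        (𝓝 t₀) (𝓝 0)) : HeatSupRegular m b T f := by
  refine ⟨hf, fun t ht => ?_, fun t ht => ?_⟩
  · obtain ⟨J, hJ, h1, h2, -, -⟩ := h t ht
    exact (eLpNorm_heatSup_le_split hb hf hJ _).trans_lt (ENNReal.add_lt_top.2 ⟨h1, h2⟩)
  · obtain ⟨J, hJ, -, -, h1, h2⟩ := h t ht
    have h3 := h1.add h2
    rw [add_zero] at h3
    exact tendsto_of_tendsto_of_tendsto_of_le_of_le tendsto_const_nhds h3 (fun _ => zero_le)
      fun t => eLpNorm_heatSup_le_split hb hf hJ _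

end Sources

/-! ### Quadratic and linear sources -/

section Products

variable {F F' : Type} [NormedAddCommGroup F] [NormedAddCommGroup F']

lemma eLpNorm_enorm_mul_enorm_le {u : E3 → F} {w : E3 → F'} (hu : AEStronglyMeasurable u)
    (hw : AEStronglyMeasurable w) (a b : ℝ≥0∞) :
    eLpNorm (fun y => ‖u y‖ₑ * ‖w y‖ₑ) (a⁻¹ + b⁻¹)⁻¹ volume ≤
      eLpNorm u a volume * eLpNorm w b volume := by
  have : ENNReal.HolderTriple a b (a⁻¹ + b⁻¹)⁻¹ := ⟨(inv_inv _).symm⟩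
  have h1 : eLpNorm (fun y => ‖u y‖ₑ * ‖w y‖ₑ) (a⁻¹ + b⁻¹)⁻¹ volume =
      eLpNorm ((fun y => ‖u y‖) • fun y => ‖w y‖) (a⁻¹ + b⁻¹)⁻¹ volume := by
    refine eLpNorm_congr_enorm_ae (ae_of_all _ fun y => ?_)
    simp [enorm_mul]
  rw [h1]
  refine (eLpNorm_smul_le_mul_eLpNorm (p := a) (q := b) hw.norm hu.norm).trans_eq ?_
  rw [eLpNorm_norm, eLpNorm_norm]

lemma measurable_enorm_mul {u : ℝ → E3 → F} {w : ℝ → E3 → F'}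
    (hu : StronglyMeasurable fun z : ℝ × E3 => u z.1 z.2)
    (hw : StronglyMeasurable fun z : ℝ × E3 => w z.1 z.2) :
    Measurable fun z : ℝ × E3 => ‖u z.1 z.2‖ₑ * ‖w z.1 z.2‖ₑ :=
  hu.enorm.mul hw.enorm

lemma stronglyMeasurable_slice {u : ℝ → E3 → F}
    (hu : StronglyMeasurable fun z : ℝ × E3 => u z.1 z.2) (t : ℝ) : StronglyMeasurable (u t) :=
  hu.comp_measurable (measurable_prodMk_left (x := t))

lemma ae_eLpNorm_mul_le {u : ℝ → E3 → F} {w : ℝ → E3 → F'}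
    (hu : StronglyMeasurable fun z : ℝ × E3 => u z.1 z.2)
    (hw : StronglyMeasurable fun z : ℝ × E3 => w z.1 z.2) (a b : ℝ≥0∞) (μ ν T : ℝ) :
    ∀ᵐ s, s ∈ Ioo 0 T → eLpNorm (fun y => ‖u s y‖ₑ * ‖w s y‖ₑ) (a⁻¹ + b⁻¹)⁻¹ volume ≤
      ENNReal.ofReal (s ^ (-(μ + ν))) * (wnorm μ a T u * wnorm ν b T w) := by
  filter_upwards [ae_le_wnorm μ a T u, ae_le_wnorm ν b T w] with s h1 h2 hs
  refine (eLpNorm_enorm_mul_enorm_le (stronglyMeasurable_slice hu s).aestronglyMeasurable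
    (stronglyMeasurable_slice hw s).aestronglyMeasurable a b).trans
    ((mul_le_mul' (h1 hs) (h2 hs)).trans_eq ?_)
  rw [mul_mul_mul_comm, ← ENNReal.ofReal_mul (Real.rpow_nonneg hs.1.le _), ← Real.rpow_add hs.1]
  congr 3; ring

end Products

section Exponents

variable {a b : ℝ≥0∞}

lemma one_le_inv_add_inv_inv (h : a⁻¹ + b⁻¹ ≤ 1) : 1 ≤ (a⁻¹ + b⁻¹)⁻¹ :=
  ENNReal.one_le_inv.2 h

lemma inv_add_inv_inv_le : (a⁻¹ + b⁻¹)⁻¹ ≤ b := by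
  conv_rhs => rw [← inv_inv b]
  exact ENNReal.inv_le_inv.2 le_add_self

lemma toReal_inv_add_inv (h : a⁻¹ + b⁻¹ ≤ 1) :
    ((a⁻¹ + b⁻¹)⁻¹)⁻¹.toReal = a⁻¹.toReal + b⁻¹.toReal := by
  rw [inv_inv, ENNReal.toReal_add]
  · exact ((le_self_add.trans h).trans_lt ENNReal.one_lt_top).ne
  · exact ((le_add_self.trans h).trans_lt ENNReal.one_lt_top).ne

lemma toReal_inv_lt_third (ha : 3 < a) : a⁻¹.toReal < 1 / 3 := by
  have h : a⁻¹ < 3⁻¹ := ENNReal.inv_lt_inv.2 ha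
  have := (ENNReal.toReal_lt_toReal h.ne_top (by simp)).2 h
  simpa using this

end Exponents

/-- The bound of the convective terms in terms of the norms of the two factors. -/
theorem exists_flux_le {a b : ℝ≥0∞} (ha : 3 < a) (hab : a⁻¹ + b⁻¹ ≤ 1) {ν : ℝ}
    (hν : 0 ≤ ν) (hνa : weightX a + ν < 1) :
    ∃ C : ℝ, 0 < C ∧ ∀ (F F' : Type) [NormedAddCommGroup F] [NormedAddCommGroup F'] (T : ℝ)
      (u : ℝ → E3 → F) (w : ℝ → E3 → F'), (StronglyMeasurable fun z : ℝ × E3 => u z.1 z.2) →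
      (StronglyMeasurable fun z : ℝ × E3 => w z.1 z.2) →
      (∀ t ∈ Ioo 0 T, ENNReal.ofReal (t ^ ν) *
        eLpNorm (heatSup 1 (regA t) fun s y => ‖u s y‖ₑ * ‖w s y‖ₑ) b volume ≤
          ENNReal.ofReal C * (wnorm (weightX a) a T u * wnorm ν b T w)) ∧
      (wnorm (weightX a) a T u < ∞ → wnorm ν b T w < ∞ →
        HeatSupRegular 1 b T fun s y => ‖u s y‖ₑ * ‖w s y‖ₑ) := by
  have h3 := toReal_inv_lt_third ha
  have h0 : 0 ≤ a⁻¹.toReal := ENNReal.toReal_nonneg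
  have hα : 0 ≤ weightX a := by unfold weightX; linarith
  -- By Hölder the product lies in `L^c` with `1/c = 1/a + 1/b`, so `γ` depends on `a` only and is
  -- below `1` because `a > 3`. As `weightX a` is `1/2 - 3/(2a)`, the outgoing weight `γ + δ - 1` is
  -- again `ν`.
  obtain ⟨C, hC, h⟩ := exists_heatSup_source_le (m := 1) (γ := 1 / 2 + 3 / 2 * a⁻¹.toReal)
    (δ := weightX a + ν) (one_le_inv_add_inv_inv hab) (inv_add_inv_inv_le (a := a) (b := b))
    (by rw [toReal_inv_add_inv hab]; ring) (by linarith) (by linarith) (by linarith) hνa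
  refine ⟨C, hC, fun F F' _ _ T u w hu hw => ?_⟩
  obtain ⟨h1, h2⟩ := h T (fun s y => ‖u s y‖ₑ * ‖w s y‖ₑ) _ (measurable_enorm_mul hu hw)
    (ae_eLpNorm_mul_le hu hw a b (weightX a) ν T)
  refine ⟨fun t ht => ?_, fun hA hN => h2 (ENNReal.mul_ne_top hA.ne hN.ne)⟩
  have h4 := h1 t ht
  rwa [show 1 / 2 + 3 / 2 * a⁻¹.toReal + (weightX a + ν) - 1 = ν by unfold weightX; ring] at h4

/-- The bound of the buoyancy term. -/
theorem exists_buoyancy_le {q b : ℝ≥0∞} (hq1 : 1 ≤ q) (hq : 3 / 2 < q) (hq3 : q < 3)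
    (hqb : 3 ≤ b) :
    ∃ C : ℝ, 0 < C ∧ ∀ (F : Type) [NormedAddCommGroup F] (T : ℝ)
      (θ : ℝ → E3 → F), (StronglyMeasurable fun z : ℝ × E3 => θ z.1 z.2) →
      (∀ t ∈ Ioo 0 T, ENNReal.ofReal (t ^ weightX b) *
        eLpNorm (heatSup 0 (regA t) fun s y => ‖θ s y‖ₑ) b volume ≤
          ENNReal.ofReal C * wnorm (weightY q) q T θ) ∧
      (wnorm (weightY q) q T θ < ∞ → HeatSupRegular 0 b T fun s y => ‖θ s y‖ₑ) := by
  have h1 : q⁻¹.toReal < 2 / 3 := by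
    have h : q⁻¹ < (3 / 2)⁻¹ := ENNReal.inv_lt_inv.2 hq
    have := (ENNReal.toReal_lt_toReal h.ne_top (by simp)).2 h
    rw [ENNReal.toReal_inv (3 / 2), ENNReal.toReal_div] at this
    norm_num at this ⊢
    exact this
  have h2 : 1 / 3 < q⁻¹.toReal := by
    have h : 3⁻¹ < q⁻¹ := ENNReal.inv_lt_inv.2 hq3
    have := (ENNReal.toReal_lt_toReal (by simp) (by
      simpa using (zero_lt_one.trans_le hq1).ne')).2 h
    simpa using this
  have h3 : b⁻¹.toReal ≤ 1 / 3 := by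
    have := inv_toReal_mono (by norm_num) hqb
    simpa using this
  have h0 : 0 ≤ b⁻¹.toReal := ENNReal.toReal_nonneg
  -- Here `γ` is positive since `q < 3 ≤ b`, and below `1` since `q > 3/2`; the weight of `Y_q` is
  -- below `1` since `q < 3`. The outgoing weight `γ + δ - 1` is `1/2 - 3/(2b)`, that of `X_b`.
  obtain ⟨C, hC, h⟩ := exists_heatSup_source_le (m := 0) (b := b)
    (γ := 3 / 2 * (q⁻¹.toReal - b⁻¹.toReal)) (δ := weightY q) hq1 (hq3.le.trans hqb)
    (by ring) (by linarith) (by linarith) (by unfold weightY; linarith)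
        (by unfold weightY; linarith)
  refine ⟨C, hC, fun F _ T θ hθ => ?_⟩
  obtain ⟨h4, h5⟩ := h T (fun s y => ‖θ s y‖ₑ) (wnorm (weightY q) q T θ) hθ.enorm (by
    filter_upwards [ae_le_wnorm (weightY q) q T θ] with s hs hs'
    rw [eLpNorm_enorm]
    exact hs hs')
  refine ⟨fun t ht => ?_, fun hN => h5 hN.ne⟩
  have h6 := h4 t ht
  rwa [show 3 / 2 * (q⁻¹.toReal - b⁻¹.toReal) + weightY q - 1 = weightX b by
    unfold weightX weightY; ring] at h6

/-- Only sources at a distance at least `d` from the final time contribute, so the kernel is bounded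
and `γ` may exceed `1`. -/
lemma lintegral_sub_rpow_mul_le_early {t τ γ δ d : ℝ} (hγ : 0 ≤ γ) (hδ : δ < 1) (hd : 0 < d)
    (hτ : 0 ≤ τ) (ht : τ + d ≤ t) (M : ℝ≥0∞) :
    ∫⁻ s in Ioo 0 t ∩ Iio τ, ENNReal.ofReal ((t - s) ^ (-γ)) * (ENNReal.ofReal (s ^ (-δ)) * M) ≤
      ENNReal.ofReal (d ^ (-γ) * (τ ^ (1 - δ) / (1 - δ))) * M := by
  have e : Ioo 0 t ∩ Iio τ = Ioo 0 τ := by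
    ext s
    simp only [mem_inter_iff, mem_Ioo, mem_Iio]
    constructor
    · rintro ⟨⟨h1, -⟩, h2⟩; exact ⟨h1, h2⟩
    · rintro ⟨h1, h2⟩; exact ⟨⟨h1, by linarith⟩, h2⟩
  rw [e]
  calc _ ≤ ∫⁻ s in Ioo 0 τ, ENNReal.ofReal (d ^ (-γ)) * (ENNReal.ofReal (s ^ (-δ)) * M) := by
        refine setLIntegral_mono' measurableSet_Ioo fun s hs => ?_
        refine mul_le_mul' (ENNReal.ofReal_le_ofReal ?_) le_rfl
        exact Real.rpow_le_rpow_of_nonpos hd (by linarith [hs.2]) (by linarith)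
    _ = _ := by
        rw [lintegral_const_mul _ (by fun_prop), lintegral_mul_const _ (by fun_prop),
          lintegral_Ioo_rpow hτ hδ, ← mul_assoc, ← ENNReal.ofReal_mul (by positivity)]

/-- Away from the initial time the weight of the source can be frozen in `M`, so that only the
singularity of the kernel is integrated. -/
lemma lintegral_sub_rpow_mul_le_late {t τ γ : ℝ} (hγ : γ < 1) (hτ : 0 < τ) (ht : τ ≤ t)
    (M : ℝ≥0∞) :
    ∫⁻ s in Ioo 0 t ∩ (Iio τ)ᶜ, ENNReal.ofReal ((t - s) ^ (-γ)) * M ≤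
      ENNReal.ofReal ((t - τ) ^ (1 - γ) / (1 - γ)) * M := by
  have e : (Ioo 0 t ∩ (Iio τ)ᶜ : Set ℝ) =ᵐ[volume] Ioo τ t := by
    have e1 : (Ioo 0 t ∩ (Iio τ)ᶜ : Set ℝ) = Ico τ t := by
      ext s
      simp only [mem_inter_iff, mem_Ioo, mem_compl_iff, mem_Iio, not_lt, mem_Ico]
      constructor
      · rintro ⟨⟨-, h1⟩, h2⟩; exact ⟨h2, h1⟩
      · rintro ⟨h1, h2⟩; exact ⟨⟨by linarith, h2⟩, h1⟩
    rw [e1]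
    exact Ioo_ae_eq_Ico.symm
  rw [setLIntegral_congr e, lintegral_mul_const _ (by fun_prop), lintegral_Ioo_sub_rpow ht hγ]

/-- The bound of the heat flux in `L^∞`: the recent past is estimated with the norm of the second
factor in `L^∞`, the distant past with its norm in `L^q`. -/
theorem exists_flux_top_le {p q : ℝ≥0∞} (hp : 3 < p) (hpq1 : p⁻¹ + q⁻¹ ≤ 1)
    (hpq : weightX p + weightY q < 1) :
    ∃ C : ℝ, 0 < C ∧ ∀ (F F' : Type) [NormedAddCommGroup F] [NormedAddCommGroup F'] (T : ℝ)
      (u : ℝ → E3 → F) (w : ℝ → E3 → F'), (StronglyMeasurable fun z : ℝ × E3 => u z.1 z.2) →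
      (StronglyMeasurable fun z : ℝ × E3 => w z.1 z.2) →
      (∀ t ∈ Ioo 0 T, ENNReal.ofReal (t ^ weightY ∞) *
        eLpNorm (heatSup 1 (regA t) fun s y => ‖u s y‖ₑ * ‖w s y‖ₑ) ∞ volume ≤
          ENNReal.ofReal C * (wnorm (weightX p) p T u *
            (wnorm (weightY q) q T w + wnorm (weightY ∞) ∞ T w))) ∧
      (wnorm (weightX p) p T u < ∞ → wnorm (weightY q) q T w < ∞ → wnorm (weightY ∞) ∞ T w < ∞ →
        HeatSupRegular 1 ∞ T fun s y => ‖u s y‖ₑ * ‖w s y‖ₑ) := by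
  have hp3 := toReal_inv_lt_third hp
  have hp0 : 0 ≤ p⁻¹.toReal := ENNReal.toReal_nonneg
  have hq0 : 0 ≤ q⁻¹.toReal := ENNReal.toReal_nonneg
  have hwt : weightY ∞ = 3 / 2 := by simp [weightY]
  have hα : 0 ≤ weightX p := by unfold weightX; linarith
  have hpt : p⁻¹ + (∞ : ℝ≥0∞)⁻¹ ≤ 1 := by
    rw [ENNReal.inv_top, add_zero]; exact le_self_add.trans hpq1
  set δ := weightX p + weightY q with hδ
  -- Neither estimate works on all of `(0,t)`. Measuring the second factor in `L^q` gives the kernel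
  -- exponent `γ₁`, which exceeds `1` and is not integrable at `s = t`. Measuring it in `L^∞` gives
  -- `γ₂ < 1`, but the source weight `s^{-(weightX p + 3/2)}` is not integrable at `s = 0`. Each is
  -- used on the half of the interval where it converges.
  set γ₁ := 1 / 2 + 3 / 2 * (p⁻¹.toReal + q⁻¹.toReal) with hγ₁
  set γ₂ := 1 / 2 + 3 / 2 * p⁻¹.toReal with hγ₂
  have hγ₁0 : 0 < γ₁ := by positivity
  have hγ₂0 : 0 < γ₂ := by positivity
  have hγ₂1 : γ₂ < 1 := by rw [hγ₂]; linarith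
  have hγ₁' : γ₁ = 1 / 2 + 3 / 2 * (((p⁻¹ + q⁻¹)⁻¹)⁻¹.toReal - (∞ : ℝ≥0∞)⁻¹.toReal) := by
    rw [toReal_inv_add_inv hpq1]; simp [hγ₁]
  have hγ₂' : γ₂ = 1 / 2 + 3 / 2 * (((p⁻¹ + (∞ : ℝ≥0∞)⁻¹)⁻¹)⁻¹.toReal - (∞ : ℝ≥0∞)⁻¹.toReal) := by
    rw [toReal_inv_add_inv hpt]; simp [hγ₂]
  set C₁ := 1 / γ₁ * ((1 / 2) ^ (-γ₁) * ((1 / 2) ^ (1 - δ) / (1 - δ))) with hC₁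
  set C₂ := 1 / γ₂ * ((1 / 2) ^ (1 - γ₂) / (1 - γ₂) * (1 / 2) ^ (-(weightX p + 3 / 2))) with hC₂
  have hC₁0 : 0 < C₁ := by have : 0 < 1 - δ := by linarith
                           positivity
  have hC₂0 : 0 < C₂ := by have : 0 < 1 - γ₂ := by linarith
                           positivity
  have hms : ∀ τ : ℝ, MeasurableSet (Iio τ) := fun τ => measurableSet_Iio
  -- the sources on the two time intervals
  have src2 : ∀ (F F' : Type) [NormedAddCommGroup F] [NormedAddCommGroup F'] (T τ : ℝ)
      (u : ℝ → E3 → F) (w : ℝ → E3 → F'), 0 < τ → (StronglyMeasurable fun z : ℝ × E3 => u z.1 z.2) →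
      (StronglyMeasurable fun z : ℝ × E3 => w z.1 z.2) → ∀ᵐ s, s ∈ Ioo 0 T → s ∈ (Iio τ)ᶜ →
      eLpNorm (fun y => ‖u s y‖ₑ * ‖w s y‖ₑ) (p⁻¹ + (∞ : ℝ≥0∞)⁻¹)⁻¹ volume ≤
        ENNReal.ofReal (τ ^ (-(weightX p + 3 / 2))) *
          (wnorm (weightX p) p T u * wnorm (weightY ∞) ∞ T w) := by
    intro F F' _ _ T τ u w hτ hu hw
    filter_upwards [ae_eLpNorm_mul_le hu hw p ∞ (weightX p) (weightY ∞) T] with s hs h1 h2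
    refine (hs h1).trans ?_
    rw [hwt]
    refine mul_le_mul' (ENNReal.ofReal_le_ofReal ?_) le_rfl
    exact Real.rpow_le_rpow_of_nonpos hτ (not_lt.1 h2) (by linarith)
  refine ⟨C₁ + C₂, by positivity, fun F F' _ _ T u w hu hw => ?_⟩
  set A := wnorm (weightX p) p T u with hA
  set Q := wnorm (weightY q) q T w with hQ
  set N := wnorm (weightY ∞) ∞ T w with hN
  set f : ℝ → E3 → ℝ≥0∞ := fun s y => ‖u s y‖ₑ * ‖w s y‖ₑ with hf
  have hfm : Measurable fun z : ℝ × E3 => f z.1 z.2 := measurable_enorm_mul hu hw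
  have hsrc1 := ae_eLpNorm_mul_le hu hw p q (weightX p) (weightY q) T
  have b1 : ∀ t ∈ Ioo 0 T, eLpNorm (heatSup 1 (regA t ∩ (Iio (t / 2) ×ˢ univ)) f) ∞ volume ≤
      ENNReal.ofReal (t ^ (-(3 / 2) : ℝ)) * (ENNReal.ofReal C₁ * (A * Q)) := by
    intro t ht
    have ht0 := ht.1
    refine (eLpNorm_heatSup_regA_le (φ := fun s => ENNReal.ofReal (s ^ (-δ)) * (A * Q)) hfm
      (one_le_inv_add_inv_inv hpq1) le_top hγ₁' hγ₁0 (hms _) (by fun_prop) (by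
        filter_upwards [hsrc1] with s hs hs' _
        exact hs ⟨hs'.1, hs'.2.trans ht.2⟩)).trans ?_
    calc _ ≤ ENNReal.ofReal (1 / γ₁) * (ENNReal.ofReal ((t / 2) ^ (-γ₁) *
          ((t / 2) ^ (1 - δ) / (1 - δ))) * (A * Q)) := by
          gcongr
          exact lintegral_sub_rpow_mul_le_early hγ₁0.le hpq (by positivity) (by positivity)
            (by linarith) _
      _ = _ := by
          generalize A * Q = M
          rw [← mul_assoc, ← mul_assoc, ← ENNReal.ofReal_mul (by positivity),
            ← ENNReal.ofReal_mul (by positivity)]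
          congr 2
          have e1 : t / 2 = t * (1 / 2) := by ring
          have e2 : t ^ (-(3 / 2) : ℝ) = t ^ (-γ₁) * t ^ (1 - δ) := by
            rw [← Real.rpow_add ht0]; congr 1; rw [hγ₁, hδ]; unfold weightX weightY; ring
          rw [e1, e2, Real.mul_rpow ht0.le (by norm_num), Real.mul_rpow ht0.le (by norm_num), hC₁]
          ring
  have b2 : ∀ t ∈ Ioo 0 T, eLpNorm (heatSup 1 (regA t ∩ ((Iio (t / 2))ᶜ ×ˢ univ)) f) ∞ volume ≤
      ENNReal.ofReal (t ^ (-(3 / 2) : ℝ)) * (ENNReal.ofReal C₂ * (A * N)) := by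
    intro t ht
    have ht0 := ht.1
    refine (eLpNorm_heatSup_regA_le
      (φ := fun s => ENNReal.ofReal ((t / 2) ^ (-(weightX p + 3 / 2))) * (A * N)) hfm
      (one_le_inv_add_inv_inv hpt) le_top hγ₂' hγ₂0 (hms _).compl (by fun_prop) (by
        filter_upwards [src2 F F' T (t / 2) u w (by positivity) hu hw] with s hs hs' hs2
        exact hs ⟨hs'.1, hs'.2.trans ht.2⟩ hs2)).trans ?_
    calc _ ≤ ENNReal.ofReal (1 / γ₂) * (ENNReal.ofReal ((t - t / 2) ^ (1 - γ₂) / (1 - γ₂)) *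
          (ENNReal.ofReal ((t / 2) ^ (-(weightX p + 3 / 2))) * (A * N))) := by
          gcongr
          exact lintegral_sub_rpow_mul_le_late hγ₂1 (by positivity) (by linarith) _
      _ = _ := by
          have h1 : 0 < 1 - γ₂ := by linarith
          generalize A * N = M
          rw [sub_half, ← mul_assoc, ← mul_assoc, ← mul_assoc, ← ENNReal.ofReal_mul (by positivity),
            ← ENNReal.ofReal_mul (by positivity), ← ENNReal.ofReal_mul (by positivity)]
          congr 2
          have e1 : t / 2 = t * (1 / 2) := by ring
          have e2 : t ^ (-(3 / 2) : ℝ) = t ^ (1 - γ₂) * t ^ (-(weightX p + 3 / 2)) := by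
            rw [← Real.rpow_add ht0]; congr 1; rw [hγ₂]; unfold weightX; ring
          rw [e1, e2, Real.mul_rpow ht0.le (by norm_num), Real.mul_rpow ht0.le (by norm_num), hC₂]
          ring
  have hsplit : ∀ t : ℝ, eLpNorm (heatSup 1 (regA t) f) ∞ volume ≤
      eLpNorm (heatSup 1 (regA t ∩ (Iio (t / 2) ×ˢ univ)) f) ∞ volume +
      eLpNorm (heatSup 1 (regA t ∩ ((Iio (t / 2))ᶜ ×ˢ univ)) f) ∞ volume := fun t =>
    eLpNorm_heatSup_le_split le_top hfm (hms _) _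
  refine ⟨fun t ht => ?_, fun hAt hQt hNt => ?_⟩
  · rw [hwt, ofReal_rpow_mul_le_iff ht.1]
    refine (hsplit t).trans ((add_le_add (b1 t ht) (b2 t ht)).trans ?_)
    rw [← mul_add, ENNReal.ofReal_add hC₁0.le hC₂0.le]
    gcongr
    rw [add_mul, mul_add]
    gcongr
    · exact le_self_add
    · exact le_add_self
  · have hAQ : A * Q ≠ ∞ := ENNReal.mul_ne_top hAt.ne hQt.ne
    have hAN : A * N ≠ ∞ := ENNReal.mul_ne_top hAt.ne hNt.ne
    refine HeatSupRegular.of_split le_top hfm fun t₀ ht => ⟨Iio (t₀ / 2), hms _, ?_, ?_, ?_, ?_⟩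
    · exact (b1 t₀ ht).trans_lt (ENNReal.mul_lt_top ENNReal.ofReal_lt_top
        (ENNReal.mul_lt_top ENNReal.ofReal_lt_top hAQ.lt_top))
    · exact (b2 t₀ ht).trans_lt (ENNReal.mul_lt_top ENNReal.ofReal_lt_top
        (ENNReal.mul_lt_top ENNReal.ofReal_lt_top hAN.lt_top))
    · have ht0 := ht.1
      -- The splitting time `t₀ / 2` is kept fixed while `t` varies. For `t > 3t₀/4` the early
      -- sources are at distance at least `t₀ / 4` from `t`, so the full power `ε = 1` is
      -- affordable; for the late ones only half of the gap `1 - γ₂` is.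
      refine tendsto_heatSup_regB (φ := fun s => ENNReal.ofReal (s ^ (-δ)) * (A * Q)) (ε := 1)
        (B := ENNReal.ofReal ((t₀ / 4) ^ (-(γ₁ + 1)) * ((t₀ / 2) ^ (1 - δ) / (1 - δ))) * (A * Q))
        hfm (one_le_inv_add_inv_inv hpq1) le_top hγ₁' hγ₁0 one_pos le_rfl (hms _) (by fun_prop) (by
          filter_upwards [hsrc1] with s hs hs' _
          exact hs hs') ht (ENNReal.mul_ne_top ENNReal.ofReal_ne_top hAQ) ?_
      filter_upwards [Ioi_mem_nhds (show t₀ * (3 / 4) < t₀ by linarith)] with t ht1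
      have ht1' : t₀ * (3 / 4) < t := ht1
      exact lintegral_sub_rpow_mul_le_early (by linarith) hpq (by positivity) (by positivity)
        (by linarith) _
    · have ht0 := ht.1
      refine tendsto_heatSup_regB
        (φ := fun s => ENNReal.ofReal ((t₀ / 2) ^ (-(weightX p + 3 / 2))) * (A * N))
        (ε := (1 - γ₂) / 2)
        (B := ENNReal.ofReal (t₀ ^ (1 - (γ₂ + (1 - γ₂) / 2)) / (1 - (γ₂ + (1 - γ₂) / 2))) *
          (ENNReal.ofReal ((t₀ / 2) ^ (-(weightX p + 3 / 2))) * (A * N)))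
        hfm (one_le_inv_add_inv_inv hpt) le_top hγ₂' hγ₂0 (by linarith) (by linarith)
        (hms _).compl (by fun_prop) (src2 F F' T (t₀ / 2) u w (by positivity) hu hw) ht
        (ENNReal.mul_ne_top ENNReal.ofReal_ne_top (ENNReal.mul_ne_top ENNReal.ofReal_ne_top hAN)) ?_
      filter_upwards [Ioo_mem_nhds (show t₀ / 2 < t₀ by linarith)
          (show t₀ < t₀ * (3 / 2) by linarith)]
        with t ht1
      have h1 : 0 < 1 - (γ₂ + (1 - γ₂) / 2) := by linarith
      refine (lintegral_sub_rpow_mul_le_late (by linarith) (by positivity) ht1.1.le _).trans ?_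
      gcongr
      · linarith [ht1.1]
      · linarith [ht1.2]

/-! ### The three terms of the integral equations -/

section Terms

/-- `∫₀ᵗ e^{(t-s)Δ} ℙ∇·(u⊗u)(s) ds`. -/
def momentumTerm (u : ℝ → E3 → E3) : ℝ → E3 → E3 :=
  duhamelSum (fun i : Fin 3 × Fin 3 × Fin 3 => densityLerayD i.2.2 i.1 i.2.1)
    (fun i => basisVec i.1) fun i s y => u s y i.2.1 * u s y i.2.2

/-- `∫₀ᵗ e^{(t-s)Δ} ∇·(θu)(s) ds`. -/
def fluxTerm (u : ℝ → E3 → E3) (θ : ℝ → E3 → ℝ) : ℝ → E3 → ℝ :=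
  duhamelSum densityHeatD (fun _ => (1 : ℝ)) fun l s y => θ s y * u s y l

/-- `∫₀ᵗ e^{(t-s)Δ} ℙ θ(s)e₃ ds`. -/
def buoyancyTerm (θ : ℝ → E3 → ℝ) : ℝ → E3 → E3 :=
  duhamelSum (fun j => densityLeray j 2) basisVec fun _ s y => θ s y

lemma enorm_basisVec (l : Fin 3) : ‖basisVec l‖ₑ = 1 := by
  rw [← ofReal_norm, basisVec, PiLp.norm_single]; simp

lemma isDuhamelSystem_momentum : IsDuhamelSystem 1 (5 * gaussBound)
    (fun i : Fin 3 × Fin 3 × Fin 3 => densityLerayD i.2.2 i.1 i.2.1) fun i => basisVec i.1 where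
  order_nonneg := zero_le_one
  density _ := isHeatDensity_lerayD _ _ _
  enorm_le _ := (enorm_basisVec _).le

lemma isDuhamelSystem_flux :
    IsDuhamelSystem 1 (5 * gaussBound) densityHeatD fun _ => (1 : ℝ) where
  order_nonneg := zero_le_one
  density i := (isHeatDensity_heatD i).mono (by linarith [gaussBound_pos])
  enorm_le i := by simp

lemma isDuhamelSystem_buoyancy : IsDuhamelSystem 0 (5 * gaussBound)
    (fun j => densityLeray j 2) basisVec where
  order_nonneg := le_rfl
  density _ := isHeatDensity_leray _ _
  enorm_le _ := (enorm_basisVec _).le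

/-- The constant that relates the three terms to superpositions of heat averages. -/
def kernelConst : ℝ≥0∞ := 27 * ENNReal.ofReal (5 * gaussBound)

lemma kernelConst_ne_top : kernelConst ≠ ∞ := ENNReal.mul_ne_top (by simp) ENNReal.ofReal_ne_top

/-- The number `27` counts the index triples in the momentum integral, the longest of the three
sums. -/
lemma card_mul_le_kernelConst {ι : Type} [Fintype ι] (h : Fintype.card ι ≤ 27) (B : ℝ≥0∞) :
    Fintype.card ι * (ENNReal.ofReal (5 * gaussBound) * B) ≤ kernelConst * B := by
  rw [kernelConst, mul_assoc]
  gcongr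
  exact_mod_cast h

end Terms

section TermBounds

variable {ι : Type} [Fintype ι] {G : Type} [NormedAddCommGroup G] [NormedSpace ℝ G]
  {m : ℝ} {h : ι → ℝ → E3 → ℝ} {e : ι → G} {F F' : ι → ℝ → E3 → ℝ}
  {f g : ℝ → E3 → ℝ≥0∞} {t T : ℝ} {b : ℝ≥0∞}

lemma eLpNorm_duhamelSum_le (hι : Fintype.card ι ≤ 27)
    (hh : IsDuhamelSystem m (5 * gaussBound) h e)
    (hF : ∀ i, Measurable fun w : ℝ × E3 => F i w.1 w.2)
    (hf : Measurable fun w : ℝ × E3 => f w.1 w.2)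
    (hFf : ∀ i, ∀ s ∈ Ioo 0 t, ∀ y, ‖F i s y‖ₑ ≤ f s y) (b : ℝ≥0∞) :
    eLpNorm (duhamelSum h e F t) b volume ≤
      kernelConst * eLpNorm (heatSup m (regA t) f) b volume := by
  refine le_trans ?_ (eLpNorm_const_mul_le_ennreal _ (measurable_heatSup m _ hf) b)
  refine eLpNorm_mono_enorm fun x => ?_
  rw [enorm_eq_self]
  exact (enorm_duhamelSum_le hh hF hFf x).trans (card_mul_le_kernelConst hι _)

lemma eLpNorm_duhamelSum_sub_le (hι : Fintype.card ι ≤ 27)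
    (hh : IsDuhamelSystem m (5 * gaussBound) h e)
    (hF : ∀ i, Measurable fun w : ℝ × E3 => F i w.1 w.2)
    (hF' : ∀ i, Measurable fun w : ℝ × E3 => F' i w.1 w.2)
    (hfin : ∀ i, ∀ᵐ x, heatSup m (regA t) (fun s y => ‖F i s y‖ₑ) x < ∞)
    (hfin' : ∀ i, ∀ᵐ x, heatSup m (regA t) (fun s y => ‖F' i s y‖ₑ) x < ∞)
    (hgm : Measurable fun w : ℝ × E3 => g w.1 w.2)
    (hg : ∀ i, ∀ s ∈ Ioo 0 t, ∀ y, ‖F i s y - F' i s y‖ₑ ≤ g s y) (b : ℝ≥0∞) :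
    eLpNorm (duhamelSum h e F t - duhamelSum h e F' t) b volume ≤
      kernelConst * eLpNorm (heatSup m (regA t) g) b volume := by
  refine le_trans ?_ (eLpNorm_const_mul_le_ennreal _ (measurable_heatSup m _ hgm) b)
  refine eLpNorm_mono_enorm_ae ?_
  filter_upwards [ae_all_iff.2 hfin, ae_all_iff.2 hfin'] with x h1 h2
  rw [enorm_eq_self]
  exact (enorm_duhamelSum_sub_le hh hF hF' h1 h2 hg).trans (card_mul_le_kernelConst hι _)

lemma tendsto_eLpNorm_duhamelSum_sub (hι : Fintype.card ι ≤ 27)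
    (hh : IsDuhamelSystem m (5 * gaussBound) h e)
    (hF : ∀ i, Measurable fun w : ℝ × E3 => F i w.1 w.2) (hb : 1 ≤ b)
    (hf : HeatSupRegular m b T f) (hFf : ∀ i, ∀ s y, ‖F i s y‖ₑ ≤ f s y) {t₀ : ℝ}
    (ht : t₀ ∈ Ioo 0 T) :
    Tendsto (fun t => eLpNorm (duhamelSum h e F t - duhamelSum h e F t₀) b volume)
      (𝓝 t₀) (𝓝 0) := by
  have h1 := ENNReal.Tendsto.const_mul (a := kernelConst) (hf.tendsto t₀ ht)
    (Or.inr kernelConst_ne_top)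
  rw [mul_zero] at h1
  refine tendsto_of_tendsto_of_tendsto_of_le_of_le' tendsto_const_nhds h1
    (Eventually.of_forall fun _ => zero_le) ?_
  have key : ∀ t t' : ℝ, 0 < t → t ≤ t' → t' < T →
      eLpNorm (duhamelSum h e F t' - duhamelSum h e F t) b volume ≤
        kernelConst * eLpNorm (heatSup m (regB t t') f) b volume := by
    intro t t' h0 h1 h2
    refine le_trans ?_ (eLpNorm_const_mul_le_ennreal _ (measurable_heatSup m _ hf.measurable) b)
    refine eLpNorm_mono_enorm_ae ?_
    filter_upwards [hf.ae_lt_top hb ⟨h0, h1.trans_lt h2⟩, hf.ae_lt_top hb ⟨h0.trans_le h1, h2⟩]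
      with x h3 h4
    rw [enorm_eq_self]
    exact (enorm_duhamelSum_time_sub_le hh hF h0 h1 (fun i s _ y => hFf i s y) h3 h4).trans
      (card_mul_le_kernelConst hι _)
  filter_upwards [Ioo_mem_nhds ht.1 ht.2] with t h3
  rcases le_total t t₀ with h | h
  · rw [min_eq_left h, max_eq_right h, ← eLpNorm_neg, neg_sub]
    exact key t t₀ h3.1 h ht.2
  · rw [min_eq_right h, max_eq_left h]
    exact key t₀ t ht.1 h h3.2

end TermBounds

/-! ### Relation with the integrals over the slab -/

section Slab

lemma slab_eq (t : ℝ) : slab t = (volume : Measure (ℝ × E3)).restrict (Ioo 0 t ×ˢ univ) := by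
  rw [slab, Measure.volume_eq_prod, ← Measure.prod_restrict, Measure.restrict_univ]

lemma duhamelKernel_mul_eq_indicator (h F : ℝ → E3 → ℝ) (t : ℝ) (x : E3) :
    (fun z : ℝ × E3 => duhamelKernel h t z.1 (x - z.2) * F z.1 z.2) =
      (Ioo 0 t ×ˢ univ).indicator fun z => heatPot h (t - z.1) (x - z.2) * F z.1 z.2 := by
  ext z
  simp only [duhamelKernel, indicator, mem_prod, mem_univ, and_true]
  split_ifs <;> simp

lemma measurableSet_slab (t : ℝ) : MeasurableSet (Ioo 0 t ×ˢ (univ : Set E3)) :=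
  measurableSet_Ioo.prod MeasurableSet.univ

lemma duhamel_eq_slab (h F : ℝ → E3 → ℝ) (t : ℝ) (x : E3) :
    duhamel h F t x = ∫ z, heatPot h (t - z.1) (x - z.2) * F z.1 z.2 ∂(slab t) := by
  rw [duhamel, duhamelKernel_mul_eq_indicator, integral_indicator (measurableSet_slab t), slab_eq]

lemma integrable_slab {m C : ℝ} {h : ℝ → E3 → ℝ} (hh : IsHeatDensity m C h) {F : ℝ → E3 → ℝ}
    (hF : Measurable fun w : ℝ × E3 => F w.1 w.2) {t : ℝ} {x : E3}
    (hfin : heatSup m (regA t) (fun s y => ‖F s y‖ₑ) x < ∞) :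
    Integrable (fun z => heatPot h (t - z.1) (x - z.2) * F z.1 z.2) (slab t) := by
  have h1 := integrable_duhamel hh hF hfin
  rw [duhamelKernel_mul_eq_indicator, integrable_indicator_iff (measurableSet_slab t)] at h1
  rw [slab_eq]
  exact h1

lemma ae_slab_mem (t : ℝ) : ∀ᵐ z ∂(slab t), z.1 ∈ Ioo 0 t := by
  rw [slab_eq]
  filter_upwards [ae_restrict_mem (measurableSet_slab t)] with z hz
  exact hz.1

variable {u : ℝ → E3 → E3} {θ : ℝ → E3 → ℝ}

lemma measurable_component (hu : StronglyMeasurable fun z : ℝ × E3 => u z.1 z.2) (k : Fin 3) :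
    Measurable fun z : ℝ × E3 => u z.1 z.2 k :=
  (measurable_coord k).comp hu.measurable

lemma enorm_component_le (v : E3) (k : Fin 3) : ‖v k‖ₑ ≤ ‖v‖ₑ := by
  rw [← ofReal_norm, ← ofReal_norm]
  exact ENNReal.ofReal_le_ofReal (by simpa using abs_coord_le v k)

lemma enorm_component_mul_le (v w : E3) (k l : Fin 3) : ‖v k * w l‖ₑ ≤ ‖v‖ₑ * ‖w‖ₑ := by
  rw [enorm_mul]
  exact mul_le_mul' (enorm_component_le v k) (enorm_component_le w l)

lemma enorm_mul_component_le (c : ℝ) (w : E3) (l : Fin 3) : ‖c * w l‖ₑ ≤ ‖w‖ₑ * ‖c‖ₑ := by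
  rw [enorm_mul, mul_comm]
  exact mul_le_mul' (enorm_component_le w l) le_rfl

/-- At points where the dominating superposition is finite, the absolute convergence required of a
mild solution holds and the slab integral is a sum of Duhamel integrals. The regularity estimates
make this superposition finite for almost every `x`, at every time. -/
theorem integral_heatFlux (hu : StronglyMeasurable fun z : ℝ × E3 => u z.1 z.2)
    (hθ : StronglyMeasurable fun z : ℝ × E3 => θ z.1 z.2) {t : ℝ} {x : E3}
    (hfin : heatSup 1 (regA t) (fun s y => ‖u s y‖ₑ * ‖θ s y‖ₑ) x < ∞) :
    Integrable (heatFlux u θ t x) (slab t) ∧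
      ∫ z, heatFlux u θ t x z ∂(slab t) = fluxTerm u θ t x := by
  have hm : ∀ l, Measurable fun w : ℝ × E3 => θ w.1 w.2 * u w.1 w.2 l := fun l =>
    hθ.measurable.mul (measurable_component hu l)
  have hi : ∀ l, Integrable (fun z : ℝ × E3 =>
      heatPot (densityHeatD l) (t - z.1) (x - z.2) * (θ z.1 z.2 * u z.1 z.2 l)) (slab t) := fun l =>
    integrable_slab (isHeatDensity_heatD l) (F := fun s y => θ s y * u s y l) (hm l)
      (heatSup_lt_top_of_le (F := fun l s y => θ s y * u s y l)
        (fun l s _ y => enorm_mul_component_le _ _ _) hfin l)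
  have e : heatFlux u θ t x =ᵐ[slab t] fun z => ∑ l : Fin 3,
      heatPot (densityHeatD l) (t - z.1) (x - z.2) * (θ z.1 z.2 * u z.1 z.2 l) := by
    filter_upwards [ae_slab_mem t] with z hz
    refine Finset.sum_congr rfl fun l _ => ?_
    rw [heatPot_densityHeatD (sub_pos.2 hz.2)]
  refine ⟨(integrable_finsetSum _ fun l _ => hi l).congr e.symm, ?_⟩
  rw [integral_congr_ae e, integral_finsetSum _ fun l _ => hi l]
  simp only [fluxTerm, duhamelSum, smul_eq_mul, mul_one, duhamel_eq_slab]

theorem integral_momentumFlux (hu : StronglyMeasurable fun z : ℝ × E3 => u z.1 z.2) {t : ℝ} {x : E3}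
    (hfin : heatSup 1 (regA t) (fun s y => ‖u s y‖ₑ * ‖u s y‖ₑ) x < ∞) (j : Fin 3) :
    Integrable (momentumFlux u j t x) (slab t) ∧
      ∫ z, momentumFlux u j t x z ∂(slab t) = momentumTerm u t x j := by
  have hm : ∀ k l, Measurable fun w : ℝ × E3 => u w.1 w.2 k * u w.1 w.2 l := fun k l =>
    (measurable_component hu k).mul (measurable_component hu l)
  have hi : ∀ k l, Integrable (fun z : ℝ × E3 =>
      heatPot (densityLerayD l j k) (t - z.1) (x - z.2) * (u z.1 z.2 k * u z.1 z.2 l)) (slab t) :=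
    fun k l => integrable_slab (isHeatDensity_lerayD l j k) (F := fun s y => u s y k * u s y l)
      (hm k l) (heatSup_lt_top_of_le (ι := Fin 3 × Fin 3) (F := fun i s y => u s y i.1 * u s y i.2)
        (fun i s _ y => enorm_component_mul_le _ _ _ _) hfin (k, l))
  have e : momentumFlux u j t x =ᵐ[slab t] fun z => ∑ k : Fin 3, ∑ l : Fin 3,
      heatPot (densityLerayD l j k) (t - z.1) (x - z.2) * (u z.1 z.2 k * u z.1 z.2 l) := by
    filter_upwards [ae_slab_mem t] with z hz
    refine Finset.sum_congr rfl fun k _ => Finset.sum_congr rfl fun l _ => ?_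
    rw [heatPot_densityLerayD (sub_pos.2 hz.2)]
  refine ⟨(integrable_finsetSum _ fun k _ => integrable_finsetSum _ fun l _ => hi k l).congr
    e.symm, ?_⟩
  rw [integral_congr_ae e, integral_finsetSum _ fun k _ => integrable_finsetSum _ fun l _ => hi k l]
  simp only [integral_finsetSum _ fun l _ => hi _ l]
  simp only [momentumTerm, duhamelSum, Fintype.sum_prod_type, WithLp.ofLp_sum, WithLp.ofLp_smul,
    Finset.sum_apply, Pi.smul_apply, basisVec, PiLp.single_apply, smul_eq_mul, mul_ite,
    mul_one, mul_zero, duhamel_eq_slab]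
  refine Eq.symm ?_
  rw [Finset.sum_eq_single j]
  · simp
  · intro i _ hij
    simp [Ne.symm hij]
  · simp

theorem integral_buoyancy (hθ : StronglyMeasurable fun z : ℝ × E3 => θ z.1 z.2) {t : ℝ} {x : E3}
    (hfin : heatSup 0 (regA t) (fun s y => ‖θ s y‖ₑ) x < ∞) (j : Fin 3) :
    Integrable (buoyancy θ j t x) (slab t) ∧
      ∫ z, buoyancy θ j t x z ∂(slab t) = buoyancyTerm θ t x j := by
  have hi := integrable_slab (isHeatDensity_leray j 2) hθ.measurable hfin
  have e : buoyancy θ j t x =ᵐ[slab t] fun z =>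
      heatPot (densityLeray j 2) (t - z.1) (x - z.2) * θ z.1 z.2 := by
    filter_upwards [ae_slab_mem t] with z hz
    rw [buoyancy, heatPot_densityLeray (sub_pos.2 hz.2)]
  refine ⟨hi.congr e.symm, ?_⟩
  rw [integral_congr_ae e]
  simp only [buoyancyTerm, duhamelSum, WithLp.ofLp_sum, WithLp.ofLp_smul,
    Finset.sum_apply, Pi.smul_apply, basisVec, PiLp.single_apply, smul_eq_mul, mul_ite,
    mul_one, mul_zero, duhamel_eq_slab]
  simp

end Slab

/-! ### Bounds of the three terms in the weighted spaces -/

section Bounds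

/-- A field that is measurable in `(t,x)`. -/
def IsField {F : Type} [NormedAddCommGroup F] (u : ℝ → E3 → F) : Prop :=
  StronglyMeasurable fun z : ℝ × E3 => u z.1 z.2

lemma IsField.slice {F : Type} [NormedAddCommGroup F] {u : ℝ → E3 → F} (hu : IsField u) (t : ℝ) :
    AEStronglyMeasurable (u t) :=
  (stronglyMeasurable_slice hu t).aestronglyMeasurable

lemma IsField.sub {F : Type} [NormedAddCommGroup F] {u v : ℝ → E3 → F} (hu : IsField u)
    (hv : IsField v) : IsField (u - v) :=
  StronglyMeasurable.sub hu hv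

/-- A bound of convective sources in `L^b` with the weight `ν`. -/
def FluxBound (a b : ℝ≥0∞) (ν : ℝ) (K : ℝ≥0∞) : Prop :=
  ∀ (F F' : Type) [NormedAddCommGroup F] [NormedAddCommGroup F'] (T : ℝ)
    (u : ℝ → E3 → F) (w : ℝ → E3 → F'), IsField u → IsField w →
    (∀ t ∈ Ioo 0 T, ENNReal.ofReal (t ^ ν) *
      (kernelConst * eLpNorm (heatSup 1 (regA t) fun s y => ‖u s y‖ₑ * ‖w s y‖ₑ) b volume) ≤
        K * (wnorm (weightX a) a T u * wnorm ν b T w)) ∧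
    (wnorm (weightX a) a T u < ∞ → wnorm ν b T w < ∞ →
      HeatSupRegular 1 b T fun s y => ‖u s y‖ₑ * ‖w s y‖ₑ)

/-- A bound of convective sources in `L^∞` with the weight of `Y_∞`. -/
def FluxTopBound (p q : ℝ≥0∞) (K : ℝ≥0∞) : Prop :=
  ∀ (F F' : Type) [NormedAddCommGroup F] [NormedAddCommGroup F'] (T : ℝ)
    (u : ℝ → E3 → F) (w : ℝ → E3 → F'), IsField u → IsField w →
    (∀ t ∈ Ioo 0 T, ENNReal.ofReal (t ^ weightY ∞) *
      (kernelConst * eLpNorm (heatSup 1 (regA t) fun s y => ‖u s y‖ₑ * ‖w s y‖ₑ) ∞ volume) ≤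
        K * (wnorm (weightX p) p T u * (wnorm (weightY q) q T w + wnorm (weightY ∞) ∞ T w))) ∧
    (wnorm (weightX p) p T u < ∞ → wnorm (weightY q) q T w < ∞ → wnorm (weightY ∞) ∞ T w < ∞ →
      HeatSupRegular 1 ∞ T fun s y => ‖u s y‖ₑ * ‖w s y‖ₑ)

/-- A bound of the buoyancy in `L^b` with the weight of `X_b`. -/
def BuoyancyBound (q b : ℝ≥0∞) (K : ℝ≥0∞) : Prop :=
  ∀ (F : Type) [NormedAddCommGroup F] (T : ℝ) (θ : ℝ → E3 → F), IsField θ →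
    (∀ t ∈ Ioo 0 T, ENNReal.ofReal (t ^ weightX b) *
      (kernelConst * eLpNorm (heatSup 0 (regA t) fun s y => ‖θ s y‖ₑ) b volume) ≤
        K * wnorm (weightY q) q T θ) ∧
    (wnorm (weightY q) q T θ < ∞ → HeatSupRegular 0 b T fun s y => ‖θ s y‖ₑ)

lemma FluxBound.mono {a b : ℝ≥0∞} {ν : ℝ} {K K' : ℝ≥0∞} (h : FluxBound a b ν K) (hK : K ≤ K') :
    FluxBound a b ν K' := fun F F' _ _ T u w hu hw =>
  ⟨fun t ht => ((h F F' T u w hu hw).1 t ht).trans (by gcongr), (h F F' T u w hu hw).2⟩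

lemma FluxTopBound.mono {p q : ℝ≥0∞} {K K' : ℝ≥0∞} (h : FluxTopBound p q K) (hK : K ≤ K') :
    FluxTopBound p q K' := fun F F' _ _ T u w hu hw =>
  ⟨fun t ht => ((h F F' T u w hu hw).1 t ht).trans (by gcongr), (h F F' T u w hu hw).2⟩

lemma BuoyancyBound.mono {q b : ℝ≥0∞} {K K' : ℝ≥0∞} (h : BuoyancyBound q b K) (hK : K ≤ K') :
    BuoyancyBound q b K' := fun F _ T θ hθ =>
  ⟨fun t ht => ((h F T θ hθ).1 t ht).trans (by gcongr), (h F T θ hθ).2⟩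

lemma exists_fluxBound {a b : ℝ≥0∞} (ha : 3 < a) (hab : a⁻¹ + b⁻¹ ≤ 1) {ν : ℝ}
    (hν : 0 ≤ ν) (hνa : weightX a + ν < 1) : ∃ K, K ≠ ∞ ∧ FluxBound a b ν K := by
  obtain ⟨C, -, h⟩ := exists_flux_le ha hab hν hνa
  refine ⟨kernelConst * ENNReal.ofReal C,
    ENNReal.mul_ne_top kernelConst_ne_top ENNReal.ofReal_ne_top,
    fun F F' _ _ T u w hu hw => ⟨fun t ht => ?_, (h F F' T u w hu hw).2⟩⟩
  rw [mul_left_comm, mul_assoc]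
  exact mul_le_mul' le_rfl ((h F F' T u w hu hw).1 t ht)

lemma exists_fluxTopBound {p q : ℝ≥0∞} (hp : 3 < p) (hpq1 : p⁻¹ + q⁻¹ ≤ 1)
    (hpq : weightX p + weightY q < 1) : ∃ K, K ≠ ∞ ∧ FluxTopBound p q K := by
  obtain ⟨C, -, h⟩ := exists_flux_top_le hp hpq1 hpq
  refine ⟨kernelConst * ENNReal.ofReal C,
    ENNReal.mul_ne_top kernelConst_ne_top ENNReal.ofReal_ne_top,
    fun F F' _ _ T u w hu hw => ⟨fun t ht => ?_, (h F F' T u w hu hw).2⟩⟩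
  rw [mul_left_comm, mul_assoc]
  exact mul_le_mul' le_rfl ((h F F' T u w hu hw).1 t ht)

lemma exists_buoyancyBound {q b : ℝ≥0∞} (hq1 : 1 ≤ q) (hq : 3 / 2 < q) (hq3 : q < 3)
    (hqb : 3 ≤ b) : ∃ K, K ≠ ∞ ∧ BuoyancyBound q b K := by
  obtain ⟨C, -, h⟩ := exists_buoyancy_le hq1 hq hq3 hqb
  refine ⟨kernelConst * ENNReal.ofReal C,
    ENNReal.mul_ne_top kernelConst_ne_top ENNReal.ofReal_ne_top,
    fun F _ T θ hθ => ⟨fun t ht => ?_, (h F T θ hθ).2⟩⟩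
  rw [mul_left_comm, mul_assoc]
  exact mul_le_mul' le_rfl ((h F T θ hθ).1 t ht)

/-- The exponents of the velocity spaces. -/
def IsVelocityExponent (p b : ℝ≥0∞) : Prop := b = p ∨ b = 3 ∨ b = ∞

/-- All the bounds of the three terms, with a common constant. -/
structure SourceBounds (p q K : ℝ≥0∞) : Prop where
  one_le_q : 1 ≤ q
  three_lt_p : 3 < p
  one_le : 1 ≤ K
  ne_top : K ≠ ∞
  velocity : ∀ b, IsVelocityExponent p b → FluxBound p b (weightX b) K
  temperature : FluxBound p q (weightY q) K
  temperature_one : FluxBound ∞ 1 (weightY 1) K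
  temperature_top : FluxTopBound p q K
  buoyancy : ∀ b, IsVelocityExponent p b → BuoyancyBound q b K

/-- All the hypotheses on the exponents are consumed here: `p > 3` for the kernel of the convective
terms, `2/3 < 1/p + 1/q` for the integrability at time zero of the product of the weights of `X_p`
and `Y_q`, and `3/2 < q < 3` for the buoyancy. The constant is a sum of all those that occur, so
that a single `K` serves everywhere. -/
theorem exists_sourceBounds {p q : ℝ≥0∞} (hq : 3 / 2 < q) (hq' : q < 3) (hp : 3 < p)
    (hpq : 2 / 3 < p⁻¹ + q⁻¹) : ∃ K, SourceBounds p q K := by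
  have hq1 : 1 ≤ q := by
    refine le_trans ?_ hq.le
    rw [ENNReal.le_div_iff_mul_le (by simp) (by simp)]; norm_num
  have hqi : q⁻¹ ≤ 2 / 3 := by
    have h := ENNReal.inv_le_inv.2 hq.le
    rwa [ENNReal.inv_div (by simp) (by simp)] at h
  have hpi : p⁻¹ ≤ 3⁻¹ := ENNReal.inv_le_inv.2 hp.le
  have hsum : (3 : ℝ≥0∞)⁻¹ + 2 / 3 = 1 := by
    rw [← one_div, ENNReal.div_add_div_same, show (1 : ℝ≥0∞) + 2 = 3 by norm_num,
      ENNReal.div_self (by simp) (by simp)]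
  have hpq1 : p⁻¹ + q⁻¹ ≤ 1 := hsum ▸ add_le_add hpi hqi
  have hp3 := toReal_inv_lt_third hp
  have hp0 : 0 ≤ p⁻¹.toReal := ENNReal.toReal_nonneg
  have hq0 : 0 ≤ q⁻¹.toReal := ENNReal.toReal_nonneg
  have hq1' : q⁻¹.toReal ≤ 1 := by simpa using inv_toReal_mono le_rfl hq1
  have hpqr : 2 / 3 < p⁻¹.toReal + q⁻¹.toReal := by
    rw [← ENNReal.toReal_add ((le_self_add.trans hpq1).trans_lt ENNReal.one_lt_top).ne
      ((le_add_self.trans hpq1).trans_lt ENNReal.one_lt_top).ne]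
    have := (ENNReal.toReal_lt_toReal (hpq.trans_le hpq1).ne_top
      (hpq1.trans_lt ENNReal.one_lt_top).ne).2 hpq
    simpa using this
  have hw : weightX p + weightY q < 1 := by unfold weightX weightY; linarith
  have hwp : 0 ≤ weightX p := by unfold weightX; linarith
  have hpb : ∀ b, 3 ≤ b → p⁻¹ + b⁻¹ ≤ 1 := by
    intro b hb
    refine (add_le_add hpi (ENNReal.inv_le_inv.2 hb)).trans ?_
    rw [← hsum]
    gcongr
    rw [← one_div]
    gcongr
    norm_num
  have hvel : ∀ b, 3 ≤ b → ∃ K, K ≠ ∞ ∧ FluxBound p b (weightX b) K := by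
    intro b hb
    have hb3 : b⁻¹.toReal ≤ 1 / 3 := by simpa using inv_toReal_mono (by norm_num) hb
    have hb0 : 0 ≤ b⁻¹.toReal := ENNReal.toReal_nonneg
    -- The weights of `X_p` and `X_∞` add up to `1 - 3/(2p)`, which is below `1` only for finite
    -- `p`. The case `p = ∞` is excluded, because `1/q` would have to exceed `2/3`.
    by_cases hpt : p⁻¹.toReal = 0
    · exfalso
      have : q⁻¹.toReal ≤ 2 / 3 := by
        have := ENNReal.toReal_mono (by finiteness) hqi
        simpa using this
      linarith
    have hp0' : 0 < p⁻¹.toReal := lt_of_le_of_ne hp0 (Ne.symm hpt)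
    exact exists_fluxBound hp (hpb b hb) (by unfold weightX; linarith)
      (by unfold weightX; linarith)
  obtain ⟨K₁, h₁, k₁⟩ := hvel p hp.le
  obtain ⟨K₂, h₂, k₂⟩ := hvel 3 le_rfl
  obtain ⟨K₃, h₃, k₃⟩ := hvel ∞ le_top
  obtain ⟨K₄, h₄, k₄⟩ := exists_fluxBound hp hpq1 (ν := weightY q)
    (by unfold weightY; linarith) hw
  -- In `L¹` the Hölder partner is `L^∞`, so the velocity is measured in `X_∞`, whose weight `1/2`
  -- is integrable; the weight of `Y_1` is zero.
  obtain ⟨K₅, h₅, k₅⟩ := exists_fluxBound (a := ∞) (b := 1) (ν := weightY 1) (by simp)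
    (by simp) (by simp [weightY]) (by simp [weightX, weightY]; norm_num)
  obtain ⟨K₆, h₆, k₆⟩ := exists_fluxTopBound hp hpq1 hw
  obtain ⟨K₇, h₇, k₇⟩ := exists_buoyancyBound hq1 hq hq' hp.le
  obtain ⟨K₈, h₈, k₈⟩ := exists_buoyancyBound hq1 hq hq' (le_refl 3)
  obtain ⟨K₉, h₉, k₉⟩ := exists_buoyancyBound hq1 hq hq' (b := ∞) le_top
  refine ⟨1 + K₁ + K₂ + K₃ + K₄ + K₅ + K₆ + K₇ + K₈ + K₉, ?_⟩
  refine ⟨hq1, hp, ?_, by finiteness, ?_, k₄.mono ?_, k₅.mono ?_, k₆.mono ?_, ?_⟩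
  · simp only [add_assoc]; exact le_self_add
  · rintro b (rfl | rfl | rfl)
    · exact k₁.mono (by simp only [add_assoc]; exact le_add_left le_self_add)
    · exact k₂.mono (by simp only [add_assoc]; exact le_add_left (le_add_left le_self_add))
    · exact k₃.mono (by
        simp only [add_assoc]; exact le_add_left (le_add_left (le_add_left le_self_add)))
  · simp only [add_assoc]
    exact le_add_left (le_add_left (le_add_left (le_add_left le_self_add)))
  · simp only [add_assoc]
    exact le_add_left (le_add_left (le_add_left (le_add_left (le_add_left le_self_add))))
  · exact le_add_right (le_add_right (le_add_right le_add_self))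
  · rintro b (rfl | rfl | rfl)
    · exact k₇.mono (le_add_right (le_add_right le_add_self))
    · exact k₈.mono (le_add_right le_add_self)
    · exact k₉.mono le_add_self

end Bounds

/-! ### The maps of the fixed point problem -/

section Maps

lemma heatSup_add {m : ℝ} {A : Set (ℝ × ℝ)} {f g : ℝ → E3 → ℝ≥0∞}
    (hf : Measurable fun w : ℝ × E3 => f w.1 w.2) (x : E3) : heatSup m A
        (fun s y => f s y + g s y) x = heatSup m A f x + heatSup m A g x := by
  have hm : Measurable fun z : ℝ × ℝ =>
      ENNReal.ofReal (z.2 ^ (-1 - m / 2)) * heatAvg (2 * z.2) (f z.1) x :=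
    (measurable_heatSup_integrand m hf).comp (measurable_prodMk_left (x := x))
  unfold heatSup
  rw [← lintegral_add_left hm]
  refine lintegral_congr fun z => ?_
  have h1 : Measurable (f z.1) := hf.comp measurable_prodMk_left
  have h2 : Measurable fun y => ENNReal.ofReal (heatKernel (2 * z.2) (x - y)) * f z.1 y :=
    (measurable_ofReal_heatKernel_sub _ x).mul h1
  rw [← mul_add]
  congr 1
  unfold heatAvg
  rw [← lintegral_add_left h2]
  simp only [mul_add]

lemma eLpNorm_heatSup_add_le {m : ℝ} {A : Set (ℝ × ℝ)} {f g : ℝ → E3 → ℝ≥0∞}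
    (hf : Measurable fun w : ℝ × E3 => f w.1 w.2) (hg : Measurable fun w : ℝ × E3 => g w.1 w.2)
    {b : ℝ≥0∞} (hb : 1 ≤ b) : eLpNorm (heatSup m A fun s y => f s y + g s y) b volume ≤
      eLpNorm (heatSup m A f) b volume + eLpNorm (heatSup m A g) b volume := by
  have e : (heatSup m A fun s y => f s y + g s y) = heatSup m A f + heatSup m A g := by
    ext x; exact heatSup_add hf x
  rw [e]
  exact eLpNorm_add_le (measurable_heatSup m _ hf).aestronglyMeasurable
    (measurable_heatSup m _ hg).aestronglyMeasurable hb

/-- The right-hand side of the integral equation for the velocity. -/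
def velocityMap (a : ℝ → E3 → E3) (u : ℝ → E3 → E3) (θ : ℝ → E3 → ℝ) (t : ℝ) (x : E3) : E3 :=
  a t x - momentumTerm u t x + buoyancyTerm θ t x

/-- The right-hand side of the integral equation for the temperature. -/
def temperatureMap (b : ℝ → E3 → ℝ) (u : ℝ → E3 → E3) (θ : ℝ → E3 → ℝ) (t : ℝ) (x : E3) : ℝ :=
  b t x - fluxTerm u θ t x

variable {p q K : ℝ≥0∞} {a u v : ℝ → E3 → E3} {b θ η : ℝ → E3 → ℝ}

lemma measurable_momentum_source (hu : IsField u) (i : Fin 3 × Fin 3 × Fin 3) :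
    Measurable fun w : ℝ × E3 => u w.1 w.2 i.2.1 * u w.1 w.2 i.2.2 :=
  (measurable_component hu _).mul (measurable_component hu _)

lemma measurable_flux_source (hu : IsField u) (hθ : IsField θ) (l : Fin 3) :
    Measurable fun w : ℝ × E3 => θ w.1 w.2 * u w.1 w.2 l :=
  hθ.measurable.mul (measurable_component hu _)

lemma isField_momentumTerm (hu : IsField u) : IsField (momentumTerm u) :=
  stronglyMeasurable_duhamelSum isDuhamelSystem_momentum (measurable_momentum_source hu)

lemma isField_fluxTerm (hu : IsField u) (hθ : IsField θ) : IsField (fluxTerm u θ) :=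
  stronglyMeasurable_duhamelSum isDuhamelSystem_flux (measurable_flux_source hu hθ)

lemma isField_buoyancyTerm (hθ : IsField θ) : IsField (buoyancyTerm θ) :=
  stronglyMeasurable_duhamelSum isDuhamelSystem_buoyancy fun _ => hθ.measurable

lemma isField_velocityMap (ha : IsField a) (hu : IsField u) (hθ : IsField θ) :
    IsField (velocityMap a u θ) :=
  (StronglyMeasurable.sub ha (isField_momentumTerm hu)).add (isField_buoyancyTerm hθ)

lemma isField_temperatureMap (hb : IsField b) (hu : IsField u) (hθ : IsField θ) :
    IsField (temperatureMap b u θ) :=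
  StronglyMeasurable.sub hb (isField_fluxTerm hu hθ)

lemma eLpNorm_momentumTerm_le (hu : IsField u) (t : ℝ) (r : ℝ≥0∞) :
    eLpNorm (momentumTerm u t) r volume ≤
      kernelConst * eLpNorm (heatSup 1 (regA t) fun s y => ‖u s y‖ₑ * ‖u s y‖ₑ) r volume := by
  have h := eLpNorm_duhamelSum_le (t := t)
    (F := fun (i : Fin 3 × Fin 3 × Fin 3) s y => u s y i.2.1 * u s y i.2.2)
    (f := fun s y => ‖u s y‖ₑ * ‖u s y‖ₑ) (by simp) isDuhamelSystem_momentum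
    (measurable_momentum_source hu) (measurable_enorm_mul hu hu)
    (fun i s _ y => enorm_component_mul_le (u s y) (u s y) i.2.1 i.2.2) r
  exact h

lemma eLpNorm_fluxTerm_le (hu : IsField u) (hθ : IsField θ) (t : ℝ) (r : ℝ≥0∞) :
    eLpNorm (fluxTerm u θ t) r volume ≤
      kernelConst * eLpNorm (heatSup 1 (regA t) fun s y => ‖u s y‖ₑ * ‖θ s y‖ₑ) r volume :=
  eLpNorm_duhamelSum_le (F := fun l s y => θ s y * u s y l)
    (f := fun s y => ‖u s y‖ₑ * ‖θ s y‖ₑ) (by simp) isDuhamelSystem_flux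
    (measurable_flux_source hu hθ) (measurable_enorm_mul hu hθ)
        (fun _ _ _ _ => enorm_mul_component_le _ _ _) r

lemma eLpNorm_buoyancyTerm_le (hθ : IsField θ) (t : ℝ) (r : ℝ≥0∞) :
    eLpNorm (buoyancyTerm θ t) r volume ≤
      kernelConst * eLpNorm (heatSup 0 (regA t) fun s y => ‖θ s y‖ₑ) r volume :=
  eLpNorm_duhamelSum_le (F := fun _ s y => θ s y) (f := fun s y => ‖θ s y‖ₑ) (by simp)
    isDuhamelSystem_buoyancy (fun _ => hθ.measurable) hθ.enorm (fun _ _ _ _ => le_rfl) r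

lemma one_le_of_isVelocityExponent (hp : 3 < p) {r : ℝ≥0∞} (hr : IsVelocityExponent p r) :
    1 ≤ r := by
  rcases hr with rfl | rfl | rfl
  · exact le_trans (by norm_num) hp.le
  · norm_num
  · exact le_top

lemma heatSupRegular_momentum (hK : SourceBounds p q K) {T : ℝ} (hu : IsField u)
    (huT : normX T p u < ∞) {r : ℝ≥0∞} (hr : IsVelocityExponent p r) (hur : normX T r u < ∞) :
    HeatSupRegular 1 r T fun s y => ‖u s y‖ₑ * ‖u s y‖ₑ :=
  (hK.velocity r hr E3 E3 T u u hu hu).2 huT hur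

lemma ae_heatSup_momentum_lt_top (hK : SourceBounds p q K) {T : ℝ} (hu : IsField u)
    (huT : normX T p u < ∞) {t : ℝ} (ht : t ∈ Ioo 0 T) :
    ∀ᵐ x, heatSup 1 (regA t) (fun s y => ‖u s y‖ₑ * ‖u s y‖ₑ) x < ∞ :=
  (heatSupRegular_momentum hK hu huT (Or.inl rfl) huT).ae_lt_top
    (one_le_of_isVelocityExponent hK.three_lt_p (Or.inl rfl)) ht

lemma ae_heatSup_flux_lt_top (hK : SourceBounds p q K) {T : ℝ} (hu : IsField u) (hθ : IsField θ)
    (huT : normX T p u < ∞) (hθT : normY T q θ < ∞) {t : ℝ} (ht : t ∈ Ioo 0 T) :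
    ∀ᵐ x, heatSup 1 (regA t) (fun s y => ‖u s y‖ₑ * ‖θ s y‖ₑ) x < ∞ :=
  ((hK.temperature E3 ℝ T u θ hu hθ).2 huT hθT).ae_lt_top hK.one_le_q ht

lemma ae_heatSup_buoyancy_lt_top (hK : SourceBounds p q K) {T : ℝ} (hθ : IsField θ)
    (hθT : normY T q θ < ∞) {t : ℝ} (ht : t ∈ Ioo 0 T) :
    ∀ᵐ x, heatSup 0 (regA t) (fun s y => ‖θ s y‖ₑ) x < ∞ :=
  ((hK.buoyancy p (Or.inl rfl) ℝ T θ hθ).2 hθT).ae_lt_top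
    (one_le_of_isVelocityExponent hK.three_lt_p (Or.inl rfl)) ht

lemma momentumTerm_le (hK : SourceBounds p q K) {T : ℝ} (hu : IsField u) {r : ℝ≥0∞}
    (hr : IsVelocityExponent p r) {t : ℝ} (ht : t ∈ Ioo 0 T) :
    ENNReal.ofReal (t ^ weightX r) * eLpNorm (momentumTerm u t) r volume ≤
      K * (normX T p u * normX T r u) :=
  (mul_le_mul' le_rfl (eLpNorm_momentumTerm_le hu t r)).trans
    ((hK.velocity r hr E3 E3 T u u hu hu).1 t ht)

lemma buoyancyTerm_le (hK : SourceBounds p q K) {T : ℝ} (hθ : IsField θ) {r : ℝ≥0∞}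
    (hr : IsVelocityExponent p r) {t : ℝ} (ht : t ∈ Ioo 0 T) :
    ENNReal.ofReal (t ^ weightX r) * eLpNorm (buoyancyTerm θ t) r volume ≤ K * normY T q θ :=
  (mul_le_mul' le_rfl (eLpNorm_buoyancyTerm_le hθ t r)).trans
    ((hK.buoyancy r hr ℝ T θ hθ).1 t ht)

lemma fluxTerm_le (hK : SourceBounds p q K) {T : ℝ} (hu : IsField u) (hθ : IsField θ) {t : ℝ}
    (ht : t ∈ Ioo 0 T) : ENNReal.ofReal (t ^ weightY q) * eLpNorm (fluxTerm u θ t) q volume ≤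
      K * (normX T p u * normY T q θ) :=
  (mul_le_mul' le_rfl (eLpNorm_fluxTerm_le hu hθ t q)).trans
    ((hK.temperature E3 ℝ T u θ hu hθ).1 t ht)

lemma fluxTerm_one_le (hK : SourceBounds p q K) {T : ℝ} (hu : IsField u) (hθ : IsField θ) {t : ℝ}
    (ht : t ∈ Ioo 0 T) : ENNReal.ofReal (t ^ weightY 1) * eLpNorm (fluxTerm u θ t) 1 volume ≤
      K * (normX T ∞ u * normY T 1 θ) :=
  (mul_le_mul' le_rfl (eLpNorm_fluxTerm_le hu hθ t 1)).trans
    ((hK.temperature_one E3 ℝ T u θ hu hθ).1 t ht)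

lemma fluxTerm_top_le (hK : SourceBounds p q K) {T : ℝ} (hu : IsField u) (hθ : IsField θ) {t : ℝ}
    (ht : t ∈ Ioo 0 T) : ENNReal.ofReal (t ^ weightY ∞) * eLpNorm (fluxTerm u θ t) ∞ volume ≤
      K * (normX T p u * (normY T q θ + normY T ∞ θ)) :=
  (mul_le_mul' le_rfl (eLpNorm_fluxTerm_le hu hθ t ∞)).trans
    ((hK.temperature_top E3 ℝ T u θ hu hθ).1 t ht)

/-- The bound of the velocity map in `X_r`, at every time. -/
lemma velocityMap_le (hK : SourceBounds p q K) {T : ℝ} (ha : IsField a) (hu : IsField u)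
    (hθ : IsField θ) {r : ℝ≥0∞} (hr : IsVelocityExponent p r) {t : ℝ} (ht : t ∈ Ioo 0 T) :
    ENNReal.ofReal (t ^ weightX r) * eLpNorm (velocityMap a u θ t) r volume ≤
      ENNReal.ofReal (t ^ weightX r) * eLpNorm (a t) r volume +
        K * (normX T p u * normX T r u) + K * normY T q θ := by
  have hr1 := one_le_of_isVelocityExponent hK.three_lt_p hr
  have e : velocityMap a u θ t = (a t - momentumTerm u t) + buoyancyTerm θ t := rfl
  have hM := (isField_momentumTerm hu).slice t
  have hB := (isField_buoyancyTerm hθ).slice t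
  rw [e]
  calc _ ≤ ENNReal.ofReal (t ^ weightX r) * (eLpNorm (a t) r volume +
        eLpNorm (momentumTerm u t) r volume + eLpNorm (buoyancyTerm θ t) r volume) := by
        refine mul_le_mul' le_rfl ((eLpNorm_add_le ((ha.slice t).sub hM) hB hr1).trans ?_)
        exact add_le_add (eLpNorm_sub_le (ha.slice t) hM hr1) le_rfl
    _ ≤ _ := by
        rw [mul_add, mul_add]
        exact add_le_add (add_le_add le_rfl (momentumTerm_le hK hu hr ht))
          (buoyancyTerm_le hK hθ hr ht)

lemma temperatureMap_le_of_fluxTerm_le {t ν : ℝ} (hb : IsField b) (hu : IsField u) (hθ : IsField θ)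
    {r : ℝ≥0∞} (hr : 1 ≤ r) {B : ℝ≥0∞}
    (h : ENNReal.ofReal (t ^ ν) * eLpNorm (fluxTerm u θ t) r volume ≤ B) :
    ENNReal.ofReal (t ^ ν) * eLpNorm (temperatureMap b u θ t) r volume ≤
      ENNReal.ofReal (t ^ ν) * eLpNorm (b t) r volume + B := by
  have e : temperatureMap b u θ t = b t - fluxTerm u θ t := rfl
  rw [e]
  calc _ ≤ ENNReal.ofReal (t ^ ν) * (eLpNorm (b t) r volume +
        eLpNorm (fluxTerm u θ t) r volume) :=
        mul_le_mul' le_rfl (eLpNorm_sub_le (hb.slice t) ((isField_fluxTerm hu hθ).slice t) hr)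
    _ ≤ _ := by
        rw [mul_add]
        exact add_le_add le_rfl h

lemma wnorm_add_le_of_forall {F F' : Type} [NormedAddCommGroup F] [NormedAddCommGroup F']
    {ν T : ℝ} {r B : ℝ≥0∞} {w : ℝ → E3 → F} {a : ℝ → E3 → F'}
    (h : ∀ t ∈ Ioo 0 T, ENNReal.ofReal (t ^ ν) * eLpNorm (w t) r volume ≤
      ENNReal.ofReal (t ^ ν) * eLpNorm (a t) r volume + B) :
    wnorm ν r T w ≤ wnorm ν r T a + B := by
  refine wnorm_le_ae ?_
  filter_upwards [ae_mul_le_wnorm ν r T a, ae_restrict_mem measurableSet_Ioo] with t h1 h2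
  exact (h t h2).trans (add_le_add h1 le_rfl)

lemma normX_velocityMap_le (hK : SourceBounds p q K) {T : ℝ} (ha : IsField a) (hu : IsField u)
    (hθ : IsField θ) {r : ℝ≥0∞} (hr : IsVelocityExponent p r) :
    normX T r (velocityMap a u θ) ≤
      normX T r a + (K * (normX T p u * normX T r u) + K * normY T q θ) :=
  wnorm_add_le_of_forall fun t ht => by
    rw [← add_assoc]; exact velocityMap_le hK ha hu hθ hr ht

lemma normY_temperatureMap_le (hK : SourceBounds p q K) {T : ℝ} (hb : IsField b) (hu : IsField u)
    (hθ : IsField θ) : normY T q (temperatureMap b u θ) ≤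
      normY T q b + K * (normX T p u * normY T q θ) :=
  wnorm_add_le_of_forall fun _ ht =>
    temperatureMap_le_of_fluxTerm_le hb hu hθ hK.one_le_q (fluxTerm_le hK hu hθ ht)

lemma normY_one_temperatureMap_le (hK : SourceBounds p q K) {T : ℝ} (hb : IsField b)
    (hu : IsField u) (hθ : IsField θ) : normY T 1 (temperatureMap b u θ) ≤
      normY T 1 b + K * (normX T ∞ u * normY T 1 θ) :=
  wnorm_add_le_of_forall fun _ ht =>
    temperatureMap_le_of_fluxTerm_le hb hu hθ le_rfl (fluxTerm_one_le hK hu hθ ht)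

lemma normY_top_temperatureMap_le (hK : SourceBounds p q K) {T : ℝ} (hb : IsField b)
    (hu : IsField u) (hθ : IsField θ) : normY T ∞ (temperatureMap b u θ) ≤
      normY T ∞ b + K * (normX T p u * (normY T q θ + normY T ∞ θ)) :=
  wnorm_add_le_of_forall fun _ ht =>
    temperatureMap_le_of_fluxTerm_le hb hu hθ le_top (fluxTerm_top_le hK hu hθ ht)

/-! ### Differences -/

lemma enorm_mul_sub_mul_le (a b c d : ℝ) :
    ‖a * b - c * d‖ₑ ≤ ‖a - c‖ₑ * ‖b‖ₑ + ‖c‖ₑ * ‖b - d‖ₑ := by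
  rw [show a * b - c * d = (a - c) * b + c * (b - d) by ring, ← enorm_mul, ← enorm_mul]
  exact enorm_add_le _ _

lemma enorm_momentum_source_sub_le (v w : E3) (k l : Fin 3) : ‖v k * v l - w k * w l‖ₑ ≤
    ‖v - w‖ₑ * ‖v‖ₑ + ‖w‖ₑ * ‖v - w‖ₑ := by
  refine (enorm_mul_sub_mul_le _ _ _ _).trans ?_
  exact add_le_add (mul_le_mul' (enorm_component_le (v - w) k) (enorm_component_le v l))
    (mul_le_mul' (enorm_component_le w k) (enorm_component_le (v - w) l))

lemma enorm_flux_source_sub_le (c d : ℝ) (v w : E3) (l : Fin 3) : ‖c * v l - d * w l‖ₑ ≤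
    ‖v‖ₑ * ‖c - d‖ₑ + ‖v - w‖ₑ * ‖d‖ₑ := by
  refine (enorm_mul_sub_mul_le _ _ _ _).trans ?_
  rw [mul_comm ‖v‖ₑ, mul_comm ‖v - w‖ₑ]
  exact add_le_add (mul_le_mul' le_rfl (enorm_component_le v l))
    (mul_le_mul' le_rfl (enorm_component_le (v - w) l))

lemma momentumTerm_sub_le (hK : SourceBounds p q K) {T : ℝ} (hu : IsField u) (hv : IsField v)
    (huT : normX T p u < ∞) (hvT : normX T p v < ∞) {t : ℝ} (ht : t ∈ Ioo 0 T) :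
    ENNReal.ofReal (t ^ weightX p) * eLpNorm (momentumTerm u t - momentumTerm v t) p volume ≤
      K * (normX T p (u - v) * normX T p u + normX T p v * normX T p (u - v)) := by
  have hp : IsVelocityExponent p p := Or.inl rfl
  have hd := hu.sub hv
  have h1 := measurable_enorm_mul hd hu
  have h2 := measurable_enorm_mul hv hd
  have hfin : ∀ w : ℝ → E3 → E3, IsField w → normX T p w < ∞ → ∀ i : Fin 3 × Fin 3 × Fin 3,
      ∀ᵐ x, heatSup 1 (regA t) (fun s y => ‖w s y i.2.1 * w s y i.2.2‖ₑ) x < ∞ := by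
    intro w hw hwT i
    filter_upwards [ae_heatSup_momentum_lt_top hK hw hwT ht] with x hx
    exact heatSup_lt_top_of_le (F := fun (i : Fin 3 × Fin 3 × Fin 3) s y => w s y i.2.1 * w s y
        i.2.2)
      (fun i s _ y => enorm_component_mul_le _ _ _ _) hx i
  have h3 := eLpNorm_duhamelSum_sub_le (t := t)
    (F := fun (i : Fin 3 × Fin 3 × Fin 3) s y => u s y i.2.1 * u s y i.2.2)
    (F' := fun (i : Fin 3 × Fin 3 × Fin 3) s y => v s y i.2.1 * v s y i.2.2)
    (g := fun s y => ‖(u - v) s y‖ₑ * ‖u s y‖ₑ + ‖v s y‖ₑ * ‖(u - v) s y‖ₑ)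
    (by simp) isDuhamelSystem_momentum (measurable_momentum_source hu)
    (measurable_momentum_source hv) (hfin u hu huT) (hfin v hv hvT) (h1.add h2)
    (fun i s _ y => enorm_momentum_source_sub_le _ _ _ _) p
  have h4 := eLpNorm_heatSup_add_le (m := 1) (A := regA t)
    (f := fun s y => ‖(u - v) s y‖ₑ * ‖u s y‖ₑ) (g := fun s y => ‖v s y‖ₑ * ‖(u - v) s y‖ₑ) h1 h2
    (one_le_of_isVelocityExponent hK.three_lt_p hp)
  have h5 := (hK.velocity p hp E3 E3 T (u - v) u hd hu).1 t ht
  have h6 := (hK.velocity p hp E3 E3 T v (u - v) hv hd).1 t ht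
  calc _ ≤ ENNReal.ofReal (t ^ weightX p) * (kernelConst * (_ + _)) :=
        mul_le_mul' le_rfl (h3.trans (mul_le_mul' le_rfl h4))
    _ ≤ _ := by
        rw [mul_add, mul_add, mul_add]
        exact add_le_add h5 h6

lemma fluxTerm_sub_le (hK : SourceBounds p q K) {T : ℝ} (hu : IsField u) (hv : IsField v)
    (hθ : IsField θ) (hη : IsField η) (huT : normX T p u < ∞) (hvT : normX T p v < ∞)
    (hθT : normY T q θ < ∞) (hηT : normY T q η < ∞) {t : ℝ} (ht : t ∈ Ioo 0 T) :
    ENNReal.ofReal (t ^ weightY q) * eLpNorm (fluxTerm u θ t - fluxTerm v η t) q volume ≤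
      K * (normX T p u * normY T q (θ - η) + normX T p (u - v) * normY T q η) := by
  have hd := hu.sub hv
  have hd' := hθ.sub hη
  have h1 := measurable_enorm_mul hu hd'
  have h2 := measurable_enorm_mul hd hη
  have hfin : ∀ (w : ℝ → E3 → E3) (ζ : ℝ → E3 → ℝ), IsField w → IsField ζ → normX T p w < ∞ →
      normY T q ζ < ∞ → ∀ l : Fin 3,
      ∀ᵐ x, heatSup 1 (regA t) (fun s y => ‖ζ s y * w s y l‖ₑ) x < ∞ := by
    intro w ζ hw hζ hwT hζT l
    filter_upwards [ae_heatSup_flux_lt_top hK hw hζ hwT hζT ht] with x hx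
    exact heatSup_lt_top_of_le (F := fun (l : Fin 3) s y => ζ s y * w s y l)
      (fun i s _ y => enorm_mul_component_le _ _ _) hx l
  have h3 := eLpNorm_duhamelSum_sub_le (t := t)
    (F := fun (l : Fin 3) s y => θ s y * u s y l) (F' := fun (l : Fin 3) s y => η s y * v s y l)
    (g := fun s y => ‖u s y‖ₑ * ‖(θ - η) s y‖ₑ + ‖(u - v) s y‖ₑ * ‖η s y‖ₑ)
    (by simp) isDuhamelSystem_flux (measurable_flux_source hu hθ)
    (measurable_flux_source hv hη) (hfin u θ hu hθ huT hθT) (hfin v η hv hη hvT hηT) (h1.add h2)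
    (fun i s _ y => enorm_flux_source_sub_le _ _ _ _ _) q
  have h4 := eLpNorm_heatSup_add_le (m := 1) (A := regA t)
    (f := fun s y => ‖u s y‖ₑ * ‖(θ - η) s y‖ₑ) (g := fun s y => ‖(u - v) s y‖ₑ * ‖η s y‖ₑ) h1 h2
    hK.one_le_q
  have h5 := (hK.temperature E3 ℝ T u (θ - η) hu hd').1 t ht
  have h6 := (hK.temperature E3 ℝ T (u - v) η hd hη).1 t ht
  calc _ ≤ ENNReal.ofReal (t ^ weightY q) * (kernelConst * (_ + _)) :=
        mul_le_mul' le_rfl (h3.trans (mul_le_mul' le_rfl h4))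
    _ ≤ _ := by
        rw [mul_add, mul_add, mul_add]
        exact add_le_add h5 h6

lemma buoyancyTerm_sub_le (hK : SourceBounds p q K) {T : ℝ} (hθ : IsField θ) (hη : IsField η)
    (hθT : normY T q θ < ∞) (hηT : normY T q η < ∞) {t : ℝ} (ht : t ∈ Ioo 0 T) :
    ENNReal.ofReal (t ^ weightX p) * eLpNorm (buoyancyTerm θ t - buoyancyTerm η t) p volume ≤
      K * normY T q (θ - η) := by
  have hd := hθ.sub hη
  have h3 := eLpNorm_duhamelSum_sub_le (t := t)
    (F := fun (_ : Fin 3) s y => θ s y) (F' := fun (_ : Fin 3) s y => η s y)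
    (g := fun s y => ‖(θ - η) s y‖ₑ)
    (by simp) isDuhamelSystem_buoyancy (fun _ => hθ.measurable) (fun _ => hη.measurable)
    (fun _ => ae_heatSup_buoyancy_lt_top hK hθ hθT ht)
    (fun _ => ae_heatSup_buoyancy_lt_top hK hη hηT ht) hd.enorm
    (fun i s _ y => le_rfl) p
  exact (mul_le_mul' le_rfl h3).trans ((hK.buoyancy p (Or.inl rfl) ℝ T (θ - η) hd).1 t ht)

lemma normX_velocityMap_sub_le (hK : SourceBounds p q K) {T : ℝ} (hu : IsField u) (hv : IsField v)
    (hθ : IsField θ) (hη : IsField η) (huT : normX T p u < ∞) (hvT : normX T p v < ∞)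
    (hθT : normY T q θ < ∞) (hηT : normY T q η < ∞) :
    normX T p (velocityMap a u θ - velocityMap a v η) ≤
      K * (normX T p (u - v) * normX T p u + normX T p v * normX T p (u - v)) +
        K * normY T q (θ - η) := by
  refine wnorm_le fun t ht => ?_
  have e : (velocityMap a u θ - velocityMap a v η) t =
      (buoyancyTerm θ t - buoyancyTerm η t) - (momentumTerm u t - momentumTerm v t) := by
    ext1 x
    simp only [Pi.sub_apply, velocityMap]
    abel
  have hp1 := one_le_of_isVelocityExponent hK.three_lt_p (Or.inl rfl)
  rw [e, add_comm]
  calc _ ≤ ENNReal.ofReal (t ^ weightX p) * (eLpNorm (buoyancyTerm θ t - buoyancyTerm η t) p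
      volume +
        eLpNorm (momentumTerm u t - momentumTerm v t) p volume) :=
        mul_le_mul' le_rfl (eLpNorm_sub_le
          (((isField_buoyancyTerm hθ).slice t).sub ((isField_buoyancyTerm hη).slice t))
          (((isField_momentumTerm hu).slice t).sub ((isField_momentumTerm hv).slice t)) hp1)
    _ ≤ _ := by
        rw [mul_add]
        exact add_le_add (buoyancyTerm_sub_le hK hθ hη hθT hηT ht)
          (momentumTerm_sub_le hK hu hv huT hvT ht)

lemma normY_temperatureMap_sub_le (hK : SourceBounds p q K) {T : ℝ} (hu : IsField u)
    (hv : IsField v) (hθ : IsField θ) (hη : IsField η) (huT : normX T p u < ∞)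
    (hvT : normX T p v < ∞) (hθT : normY T q θ < ∞) (hηT : normY T q η < ∞) :
    normY T q (temperatureMap b u θ - temperatureMap b v η) ≤
      K * (normX T p u * normY T q (θ - η) + normX T p (u - v) * normY T q η) := by
  refine wnorm_le fun t ht => ?_
  have e : (temperatureMap b u θ - temperatureMap b v η) t =
      -(fluxTerm u θ t - fluxTerm v η t) := by
    ext1 x
    simp only [Pi.sub_apply, Pi.neg_apply, temperatureMap]
    abel
  rw [e, eLpNorm_neg]
  exact fluxTerm_sub_le hK hu hv hθ hη huT hvT hθT hηT ht

/-- The distance in which the integral equations are contractive. -/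
def energy (p q K : ℝ≥0∞) (T : ℝ) (u : ℝ → E3 → E3) (θ : ℝ → E3 → ℝ) : ℝ≥0∞ :=
  normX T p u + 4 * K * normY T q θ

/-- The term `K * y` comes from the buoyancy and has no small factor. With the weight `4 * K` in
front of `y` it is a quarter of the corresponding part of the distance, leaving another quarter for
the quadratic term, since `4K²R ≤ 1/4 ≤ K`. The coefficient of `x` is at most `6K²R ≤ 1/2`. -/
lemma contraction_arith {K R x y : ℝ≥0∞} (hK : 1 ≤ K) (hR : 16 * (K * K * R) ≤ 1) :
    K * (x * R + R * x) + K * y + 4 * K * (K * (R * y + x * R)) ≤ 2⁻¹ * (x + 4 * K * y) := by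
  set X := K * K * R with hX
  have h1 : K * R ≤ X := by
    rw [hX, mul_assoc]
    calc K * R = 1 * (K * R) := (one_mul _).symm
      _ ≤ _ := by gcongr
  have h8 : 8 * X ≤ 2⁻¹ := by
    rw [ENNReal.le_inv_iff_mul_le]
    calc 8 * X * 2 = 16 * X := by ring
      _ ≤ 1 := hR
  have h2 : 2 * (K * R) + 4 * X ≤ 2⁻¹ := by
    calc 2 * (K * R) + 4 * X ≤ 2 * X + 4 * X := by gcongr
      _ = 6 * X := by ring
      _ ≤ 8 * X := by gcongr; norm_num
      _ ≤ _ := h8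
  have h3 : K + 4 * X ≤ 2⁻¹ * (4 * K) := by
    have h4 : 4 * X ≤ K := by
      calc 4 * X ≤ 16 * X := by gcongr; norm_num
        _ ≤ 1 := hR
        _ ≤ K := hK
    calc K + 4 * X ≤ K + K := by gcongr
      _ = (2⁻¹ * 2) * (2 * K) := by rw [ENNReal.inv_mul_cancel (by simp) (by simp)]; ring
      _ = _ := by ring
  calc _ = (2 * (K * R) + 4 * X) * x + (K + 4 * X) * y := by rw [hX]; ring
    _ ≤ 2⁻¹ * x + 2⁻¹ * (4 * K) * y := by gcongr
    _ = _ := by ring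

/-- The free evolutions cancel in the differences, so neither their size nor their regularity
matters; only the norms of the two pairs do. -/
theorem energy_maps_sub_le (hK : SourceBounds p q K) {R : ℝ≥0∞} (hR : 16 * (K * K * R) ≤ 1) {T : ℝ}
    (hu : IsField u) (hv : IsField v) (hθ : IsField θ) (hη : IsField η)
    (huT : normX T p u ≤ R) (hvT : normX T p v ≤ R) (hθT : normY T q θ ≤ R)
    (hηT : normY T q η ≤ R) (hRt : R < ∞) :
    energy p q K T (velocityMap a u θ - velocityMap a v η)
      (temperatureMap b u θ - temperatureMap b v η) ≤ 2⁻¹ * energy p q K T (u - v) (θ - η) := by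
  have h1 := normX_velocityMap_sub_le (a := a) hK hu hv hθ hη (huT.trans_lt hRt) (hvT.trans_lt hRt)
    (hθT.trans_lt hRt) (hηT.trans_lt hRt)
  have h2 := normY_temperatureMap_sub_le (b := b) hK hu hv hθ hη (huT.trans_lt hRt)
    (hvT.trans_lt hRt) (hθT.trans_lt hRt) (hηT.trans_lt hRt)
  refine le_trans ?_ (contraction_arith hK.one_le hR)
  unfold energy
  refine add_le_add (h1.trans ?_) (mul_le_mul' le_rfl (h2.trans ?_))
  · gcongr
  · gcongr

end Maps

/-! ### The fixed point -/

section FixedPoint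

/-- `(u,θ)` satisfies the integral equations on `(0,T)` with the free evolutions `a` and `b`. -/
structure IsFixedPoint (T : ℝ) (a : ℝ → E3 → E3) (b : ℝ → E3 → ℝ) (u : ℝ → E3 → E3)
    (θ : ℝ → E3 → ℝ) : Prop where
  field_u : IsField u
  field_θ : IsField θ
  velocity : ∀ᵐ t ∂(volume.restrict (Ioo 0 T)), u t =ᵐ[volume] velocityMap a u θ t
  temperature : ∀ᵐ t ∂(volume.restrict (Ioo 0 T)), θ t =ᵐ[volume] temperatureMap b u θ t

variable {p q K R : ℝ≥0∞} {a : ℝ → E3 → E3} {b : ℝ → E3 → ℝ}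

lemma energy_sub_le (hK : SourceBounds p q K) {T : ℝ} {u v : ℝ → E3 → E3} {θ η : ℝ → E3 → ℝ}
    (hu : IsField u) (hv : IsField v) (hθ : IsField θ) (hη : IsField η) :
    energy p q K T (u - v) (θ - η) ≤ energy p q K T u θ + energy p q K T v η := by
  have h1 : normX T p (u - v) ≤ normX T p u + normX T p v :=
    wnorm_sub_le (one_le_of_isVelocityExponent hK.three_lt_p (Or.inl rfl)) hu.slice hv.slice
  have h2 : normY T q (θ - η) ≤ normY T q θ + normY T q η :=
    wnorm_sub_le hK.one_le_q hθ.slice hη.slice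
  calc energy p q K T (u - v) (θ - η) ≤ (normX T p u + normX T p v) +
        4 * K * (normY T q θ + normY T q η) := add_le_add h1 (mul_le_mul' le_rfl h2)
    _ = _ := by unfold energy; ring

lemma normX_le_energy (T : ℝ) (u : ℝ → E3 → E3) (θ : ℝ → E3 → ℝ) :
    normX T p u ≤ energy p q K T u θ := le_self_add

lemma normY_le_energy (hK : SourceBounds p q K) (T : ℝ) (u : ℝ → E3 → E3) (θ : ℝ → E3 → ℝ) :
    normY T q θ ≤ energy p q K T u θ := by
  refine le_trans ?_ le_add_self
  calc normY T q θ = 1 * 1 * normY T q θ := by simp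
    _ ≤ 4 * K * normY T q θ := by
      gcongr
      · norm_num
      · exact hK.one_le

/-- Uniqueness of fixed points with norms at most `R`. -/
theorem IsFixedPoint.ae_eq (hK : SourceBounds p q K) (hR : 16 * (K * K * R) ≤ 1) (hRt : R < ∞)
    {T : ℝ} {u v : ℝ → E3 → E3} {θ η : ℝ → E3 → ℝ}
    (h : IsFixedPoint T a b u θ) (h' : IsFixedPoint T a b v η)
    (huT : normX T p u ≤ R) (hvT : normX T p v ≤ R) (hθT : normY T q θ ≤ R)
    (hηT : normY T q η ≤ R) :
    ∀ᵐ t ∂(volume.restrict (Ioo 0 T)), v t =ᵐ[volume] u t ∧ η t =ᵐ[volume] θ t := by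
  have hu := h.field_u
  have hv := h'.field_u
  have hθ := h.field_θ
  have hη := h'.field_θ
  have e1 : normX T p (u - v) = normX T p (velocityMap a u θ - velocityMap a v η) := by
    refine wnorm_congr ?_
    filter_upwards [h.velocity, h'.velocity] with t h1 h2
    exact h1.sub h2
  have e2 : normY T q (θ - η) = normY T q (temperatureMap b u θ - temperatureMap b v η) := by
    refine wnorm_congr ?_
    filter_upwards [h.temperature, h'.temperature] with t h1 h2
    exact h1.sub h2
  set e := energy p q K T (u - v) (θ - η) with he
  have h1 : e ≤ 2⁻¹ * e := by
    conv_lhs => rw [he]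
    unfold energy
    rw [e1, e2]
    exact energy_maps_sub_le hK hR hu hv hθ hη huT hvT hθT hηT hRt
  have hKt := hK.ne_top
  -- The inequality `e ≤ e/2` would also hold for `e = ∞`; the bounds by `R` exclude this and leave
  -- `e = 0`.
  have hfin : e ≠ ∞ := by
    refine ((energy_sub_le hK hu hv hθ hη).trans_lt ?_).ne
    unfold energy
    have := huT.trans_lt hRt
    have := hvT.trans_lt hRt
    have := hθT.trans_lt hRt
    have := hηT.trans_lt hRt
    finiteness
  have h0 : e = 0 := by
    by_contra hne
    have : 2⁻¹ * e < e := by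
      conv_rhs => rw [← one_mul e]
      exact ENNReal.mul_lt_mul_left hne hfin (ENNReal.inv_lt_one.2 ENNReal.one_lt_two)
    exact absurd h1 (not_le.2 this)
  have hp0 : p ≠ 0 := (zero_lt_one.trans_le
    (one_le_of_isVelocityExponent hK.three_lt_p (Or.inl rfl))).ne'
  have hq0 : q ≠ 0 := (zero_lt_one.trans_le hK.one_le_q).ne'
  have h3 := ae_eq_of_wnorm_eq_zero (ν := weightX p) hp0 (hu.sub hv).slice
    (le_zero_iff.1 ((normX_le_energy T (u - v) (θ - η)).trans_eq h0))
  have h4 := ae_eq_of_wnorm_eq_zero (ν := weightY q) hq0 (hθ.sub hη).slice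
    (le_zero_iff.1 ((normY_le_energy hK T (u - v) (θ - η)).trans_eq h0))
  filter_upwards [h3, h4] with t h5 h6
  constructor
  · filter_upwards [h5] with x hx
    exact (sub_eq_zero.1 hx).symm
  · filter_upwards [h6] with x hx
    exact (sub_eq_zero.1 hx).symm

/-- The successive approximations. -/
def picard (a : ℝ → E3 → E3) (b : ℝ → E3 → ℝ) : ℕ → (ℝ → E3 → E3) × (ℝ → E3 → ℝ)
  | 0 => (0, 0)
  | n + 1 => (velocityMap a (picard a b n).1 (picard a b n).2,
      temperatureMap b (picard a b n).1 (picard a b n).2)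

lemma isField_picard (ha : IsField a) (hb : IsField b) (n : ℕ) :
    IsField (picard a b n).1 ∧ IsField (picard a b n).2 := by
  induction n with
  | zero => exact ⟨stronglyMeasurable_const, stronglyMeasurable_const⟩
  | succ n ih =>
    exact ⟨isField_velocityMap ha ih.1 ih.2, isField_temperatureMap hb ih.1 ih.2⟩

/-- The affine recursion has the fixed point `2 * A` and starts below it. If `A` is infinite the
claim is empty, so the auxiliary norms of the free evolution need not be known to be finite. -/
lemma le_two_mul_of_recursion {N : ℕ → ℝ≥0∞} {A : ℝ≥0∞} (h0 : N 0 = 0)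
    (h : ∀ n, N (n + 1) ≤ A + 2⁻¹ * N n) (n : ℕ) : N n ≤ 2 * A := by
  induction n with
  | zero => rw [h0]; exact zero_le
  | succ n ih =>
    calc N (n + 1) ≤ A + 2⁻¹ * (2 * A) := (h n).trans (by gcongr)
      _ = 2 * A := by
        rw [← mul_assoc, ENNReal.inv_mul_cancel (by simp) (by simp), one_mul, two_mul]

/-- The bound of the successive approximations in `X_p`. -/
def velocityRadius (p q K : ℝ≥0∞) (a : ℝ → E3 → E3) (b : ℝ → E3 → ℝ) (S : ℝ) : ℝ≥0∞ :=
  2 * (normX S p a + 2 * K * normY S q b)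

/-- Writing `A` and `B` for the norms of the free evolutions and `r = 2(A + 2KB)`, the assumption `K
r ≤ 1/2` gives `B + K r (2B) ≤ 2B` for the temperature and `A + K r² + 2KB ≤ r` for the velocity,
and the bounds propagate. -/
lemma picard_le (hK : SourceBounds p q K) (ha : IsField a) (hb : IsField b) {S : ℝ}
    (hr : K * velocityRadius p q K a b S ≤ 2⁻¹) (n : ℕ) :
    normX S p (picard a b n).1 ≤ velocityRadius p q K a b S ∧
      normY S q (picard a b n).2 ≤ 2 * normY S q b := by
  set r := velocityRadius p q K a b S with hrdef
  set B := normY S q b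
  have h2 : (2⁻¹ : ℝ≥0∞) * 2 = 1 := ENNReal.inv_mul_cancel (by simp) (by simp)
  induction n with
  | zero =>
    have h1 : normX S p (picard a b 0).1 = 0 := wnorm_zero
    have h2 : normY S q (picard a b 0).2 = 0 := wnorm_zero
    rw [h1, h2]
    exact ⟨zero_le, zero_le⟩
  | succ n ih =>
    obtain ⟨hu, hθ⟩ := isField_picard ha hb n
    constructor
    · refine (normX_velocityMap_le hK ha hu hθ (Or.inl rfl)).trans ?_
      calc _ ≤ normX S p a + (K * (r * r) + K * (2 * B)) := by gcongr <;> first | exact ih.1 |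
          exact ih.2
        _ = normX S p a + ((K * r) * r + K * (2 * B)) := by rw [mul_assoc]
        _ ≤ normX S p a + (2⁻¹ * r + K * (2 * B)) := by gcongr
        _ = (2⁻¹ * 2) * (normX S p a + 2 * K * B) + (normX S p a + 2 * K * B) := by
          rw [hrdef, velocityRadius]; ring
        _ = r := by rw [h2, hrdef, velocityRadius]; ring
    · refine (normY_temperatureMap_le hK hb hu hθ).trans ?_
      calc _ ≤ B + K * (r * (2 * B)) := by gcongr <;> first | exact ih.1 | exact ih.2
        _ = B + (K * r) * (2 * B) := by rw [mul_assoc]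
        _ ≤ B + 2⁻¹ * (2 * B) := by gcongr
        _ = 2 * B := by rw [← mul_assoc, h2, one_mul, two_mul]

/-- The convective term is bounded by the product of the norms in `X_p` and in `X_r`. It is
therefore linear in the latter with factor at most `1/2`, and no smallness in `X_r` is required. -/
lemma picard_velocity_le (hK : SourceBounds p q K) (ha : IsField a) (hb : IsField b) {S : ℝ}
    (hr : K * velocityRadius p q K a b S ≤ 2⁻¹) {r : ℝ≥0∞} (hre : IsVelocityExponent p r) (n : ℕ) :
    normX S r (picard a b n).1 ≤ 2 * (normX S r a + 2 * K * normY S q b) := by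
  refine le_two_mul_of_recursion (N := fun n => normX S r (picard a b n).1) wnorm_zero
      (fun n => ?_) n
  obtain ⟨hu, hθ⟩ := isField_picard ha hb n
  obtain ⟨h1, h2⟩ := picard_le hK ha hb hr n
  refine (normX_velocityMap_le hK ha hu hθ hre).trans ?_
  calc _ ≤ normX S r a + (K * (velocityRadius p q K a b S * normX S r (picard a b n).1) +
        K * (2 * normY S q b)) := by gcongr
    _ = normX S r a + ((K * velocityRadius p q K a b S) * normX S r (picard a b n).1 +
        K * (2 * normY S q b)) := by rw [mul_assoc]
    _ ≤ normX S r a + (2⁻¹ * normX S r (picard a b n).1 + K * (2 * normY S q b)) := by gcongr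
    _ = _ := by ring

lemma picard_temperature_top_le (hK : SourceBounds p q K) (ha : IsField a) (hb : IsField b) {S : ℝ}
    (hr : K * velocityRadius p q K a b S ≤ 2⁻¹) (n : ℕ) :
    normY S ∞ (picard a b n).2 ≤ 2 * (normY S ∞ b + normY S q b) := by
  refine le_two_mul_of_recursion (N := fun n => normY S ∞ (picard a b n).2) wnorm_zero
      (fun n => ?_) n
  obtain ⟨hu, hθ⟩ := isField_picard ha hb n
  obtain ⟨h1, h2⟩ := picard_le hK ha hb hr n
  have h3 : (2⁻¹ : ℝ≥0∞) * 2 = 1 := ENNReal.inv_mul_cancel (by simp) (by simp)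
  refine (normY_top_temperatureMap_le hK hb hu hθ).trans ?_
  calc _ ≤ normY S ∞ b + K * (velocityRadius p q K a b S * (2 * normY S q b +
        normY S ∞ (picard a b n).2)) := by gcongr
    _ = normY S ∞ b + (K * velocityRadius p q K a b S) * (2 * normY S q b +
        normY S ∞ (picard a b n).2) := by rw [mul_assoc]
    _ ≤ normY S ∞ b + 2⁻¹ * (2 * normY S q b + normY S ∞ (picard a b n).2) := by gcongr
    _ = _ := by rw [mul_add, ← mul_assoc, h3]; ring

/-- In `L¹` the flux is controlled by the velocity in `X_∞`, not in `X_p`; the second smallness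
condition provides the factor `1/2` through the bound of the iterates in `X_∞`. -/
lemma picard_temperature_one_le (hK : SourceBounds p q K) (ha : IsField a) (hb : IsField b) {S : ℝ}
    (hr : K * velocityRadius p q K a b S ≤ 2⁻¹)
    (hr' : K * (2 * (normX S ∞ a + 2 * K * normY S q b)) ≤ 2⁻¹) (n : ℕ) :
    normY S 1 (picard a b n).2 ≤ 2 * normY S 1 b := by
  refine le_two_mul_of_recursion (N := fun n => normY S 1 (picard a b n).2) wnorm_zero
      (fun n => ?_) n
  obtain ⟨hu, hθ⟩ := isField_picard ha hb n
  have h1 := picard_velocity_le hK ha hb hr (Or.inr (Or.inr rfl)) n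
  refine (normY_one_temperatureMap_le hK hb hu hθ).trans ?_
  rw [← mul_assoc]
  gcongr
  exact le_trans (by gcongr) hr'

/-- By Fatou's lemma at almost every time, uniform bounds in any weighted norm pass to the pointwise
limit, even when the sequence is not known to converge in that norm. -/
lemma wnorm_limit_le {F : Type} [NormedAddCommGroup F] {ν S T : ℝ} {r M : ℝ≥0∞} (hST : S ≤ T)
    {v : ℕ → ℝ → E3 → F} {w : ℝ → E3 → F} (hv : ∀ n, IsField (v n))
    (hw : ∀ᵐ t ∂(volume.restrict (Ioo 0 T)), ∀ᵐ x, Tendsto (fun n => v n t x) atTop (𝓝 (w t x)))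
    (h : ∀ n, wnorm ν r S (v n) ≤ M) : wnorm ν r S w ≤ M := by
  refine wnorm_le_ae ?_
  have h1 := ae_all_iff.2 fun n => ae_mul_le_wnorm ν r S (v n)
  filter_upwards [ae_restrict_of_ae_restrict_of_subset (Ioo_subset_Ioo_right hST) hw, h1,
    ae_restrict_mem measurableSet_Ioo] with t h2 h3 ht
  rw [ofReal_rpow_mul_le_iff ht.1]
  refine eLpNorm_limit_le (fun n => (hv n).slice t) (fun n => ?_) h2
  exact (ofReal_rpow_mul_le_iff ht.1).1 ((h3 n).trans (h n))

lemma exists_wnorm_limit {F : Type} [NormedAddCommGroup F] [CompleteSpace F] {ν T : ℝ}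
    {r c : ℝ≥0∞} (hr : 1 ≤ r) (hc : c ≠ ∞) {v : ℕ → ℝ → E3 → F} (hv : ∀ n, IsField (v n))
    (h : ∀ n, wnorm ν r T (v (n + 1) - v n) ≤ c * 2⁻¹ ^ n) :
    ∃ w : ℝ → E3 → F, IsField w ∧
      (∀ᵐ t ∂(volume.restrict (Ioo 0 T)), ∀ᵐ x, Tendsto (fun n => v n t x) atTop (𝓝 (w t x))) ∧
      ∀ n, wnorm ν r T (w - v n) ≤ 2 * c * 2⁻¹ ^ n := by
  have h1 : ∀ᵐ t ∂(volume.restrict (Ioo 0 T)), t ∈ Ioo 0 T ∧ ∀ n,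
      eLpNorm (v (n + 1) t - v n t) r volume ≤ (ENNReal.ofReal (t ^ (-ν)) * c) * 2⁻¹ ^ n := by
    have h2 := ae_all_iff.2 fun n => ae_mul_le_wnorm ν r T (v (n + 1) - v n)
    filter_upwards [h2, ae_restrict_mem measurableSet_Ioo] with t h3 ht
    refine ⟨ht, fun n => ?_⟩
    rw [mul_assoc]
    exact (ofReal_rpow_mul_le_iff ht.1).1 ((h3 n).trans (h n))
  have hlim : ∀ᵐ t ∂(volume.restrict (Ioo 0 T)), ∀ᵐ x,
      Tendsto (fun n => v n t x) atTop (𝓝 (limUnder atTop fun n => v n t x)) := by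
    filter_upwards [h1] with t ht
    exact ae_tendsto_limUnder (fun n => (hv n).slice t) hr
      (ENNReal.mul_ne_top ENNReal.ofReal_ne_top hc) ht.2
  have hm : StronglyMeasurable fun z : ℝ × E3 => limUnder atTop fun n => v n z.1 z.2 :=
    StronglyMeasurable.limUnder (f := fun n (z : ℝ × E3) => v n z.1 z.2) fun n => hv n
  refine ⟨fun t x => limUnder atTop fun n => v n t x, hm, hlim, fun n => wnorm_le_ae ?_⟩
  filter_upwards [h1, hlim] with t ht h2
  rw [ofReal_rpow_mul_le_iff ht.1.1]
  refine (eLpNorm_sub_limit_le (fun n => (hv n).slice t) hr ht.2 h2 n).trans_eq ?_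
  ring

lemma mul_le_half {x y : ℝ≥0∞} (hK : SourceBounds p q K) (hR : 16 * (K * K * y) ≤ 1)
    (hxy : x ≤ y) : K * x ≤ 2⁻¹ := by
  rw [ENNReal.le_inv_iff_mul_le]
  calc K * x * 2 = 2 * (1 * (K * x)) := by ring
    _ ≤ 16 * (K * (K * y)) := by
      gcongr
      · norm_num
      · exact hK.one_le
    _ = 16 * (K * K * y) := by ring
    _ ≤ 1 := hR

/-- The iterates do not depend on the interval, so each bound is proved for all `S ≤ T` at once. The
solution then inherits the vanishing of the norms of the free evolutions as `S → 0`, as well as the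
auxiliary norms in `X_3`, `X_∞`, `Y_1` and `Y_∞`. -/
theorem exists_isFixedPoint (hK : SourceBounds p q K) (hR : 16 * (K * K * R) ≤ 1) (hRt : R < ∞)
    (ha : IsField a) (hb : IsField b) {T : ℝ} (hrT : velocityRadius p q K a b T ≤ R)
    (hBT : 2 * normY T q b ≤ R) :
    ∃ u θ, IsFixedPoint T a b u θ ∧ ∀ S ≤ T,
      (∀ r, IsVelocityExponent p r → normX S r u ≤ 2 * (normX S r a + 2 * K * normY S q b)) ∧
      normY S q θ ≤ 2 * normY S q b ∧ normY S ∞ θ ≤ 2 * (normY S ∞ b + normY S q b) ∧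
      (K * (2 * (normX S ∞ a + 2 * K * normY S q b)) ≤ 2⁻¹ → normY S 1 θ ≤ 2 * normY S 1 b) := by
  have hp1 := one_le_of_isVelocityExponent hK.three_lt_p (Or.inl rfl)
  have hKt := hK.ne_top
  have hrS : ∀ S ≤ T, K * velocityRadius p q K a b S ≤ 2⁻¹ := by
    intro S hS
    refine mul_le_half hK hR (le_trans ?_ hrT)
    unfold velocityRadius
    gcongr
    · exact wnorm_mono hS
    · exact wnorm_mono hS
  set U := fun n => (picard a b n).1 with hU
  set Θ := fun n => (picard a b n).2 with hΘ
  have hUf : ∀ n, IsField (U n) := fun n => (isField_picard ha hb n).1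
  have hΘf : ∀ n, IsField (Θ n) := fun n => (isField_picard ha hb n).2
  have hUR : ∀ n, normX T p (U n) ≤ R := fun n => (picard_le hK ha hb (hrS T le_rfl) n).1.trans hrT
  have hΘR : ∀ n, normY T q (Θ n) ≤ R := fun n => (picard_le hK ha hb (hrS T le_rfl) n).2.trans hBT
  -- A crude bound of the distance between the first two iterates, each of energy at most `R + 4KR`.
  set c := (R + 4 * K * R) + (R + 4 * K * R) with hc
  have hct : c ≠ ∞ := by rw [hc]; finiteness
  have hE : ∀ n, energy p q K T (U (n + 1) - U n) (Θ (n + 1) - Θ n) ≤ c * 2⁻¹ ^ n := by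
    intro n
    induction n with
    | zero =>
      refine (energy_sub_le hK (hUf 1) (hUf 0) (hΘf 1) (hΘf 0)).trans ?_
      rw [pow_zero, mul_one, hc]
      unfold energy
      exact add_le_add (add_le_add (hUR 1) (mul_le_mul' le_rfl (hΘR 1)))
        (add_le_add (hUR 0) (mul_le_mul' le_rfl (hΘR 0)))
    | succ n ih =>
      refine (energy_maps_sub_le hK hR (hUf (n + 1)) (hUf n) (hΘf (n + 1)) (hΘf n) (hUR _) (hUR _)
        (hΘR _) (hΘR _) hRt).trans ?_
      calc _ ≤ 2⁻¹ * (c * 2⁻¹ ^ n) := by gcongr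
        _ = _ := by ring
  obtain ⟨u, huf, hulim, hun⟩ := exists_wnorm_limit (ν := weightX p) hp1 hct hUf fun n =>
    (normX_le_energy T _ _).trans (hE n)
  obtain ⟨θ, hθf, hθlim, hθn⟩ := exists_wnorm_limit (ν := weightY q) hK.one_le_q hct hΘf fun n =>
    (normY_le_energy hK T _ _).trans (hE n)
  have huR : normX T p u ≤ R := wnorm_limit_le le_rfl hUf hulim hUR
  have hθR : normY T q θ ≤ R := wnorm_limit_le le_rfl hΘf hθlim hΘR
  set d := 2 * c + 4 * K * (2 * c) with hd
  have hdt : d ≠ ∞ := by rw [hd]; finiteness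
  have hen : ∀ n, energy p q K T (u - U n) (θ - Θ n) ≤ d * 2⁻¹ ^ n := by
    intro n
    calc _ ≤ 2 * c * 2⁻¹ ^ n + 4 * K * (2 * c * 2⁻¹ ^ n) :=
          add_le_add (hun n) (mul_le_mul' le_rfl (hθn n))
      _ = _ := by rw [hd]; ring
  have hmu := isField_velocityMap ha huf hθf
  have hmθ := isField_temperatureMap hb huf hθf
  -- The limit and its image under the maps are compared with the same iterate `n + 1`: the first
  -- distance decays by construction, the second by contraction from iterate `n`.
  have hzero : energy p q K T (u - velocityMap a u θ) (θ - temperatureMap b u θ) = 0 := by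
    refine eq_zero_of_forall_le_mul_inv_two_pow (c := 2 * d) (by finiteness) fun n => ?_
    have e1 : u - velocityMap a u θ = (u - U (n + 1)) - (velocityMap a u θ - U (n + 1)) := by abel
    have e2 : θ - temperatureMap b u θ = (θ - Θ (n + 1)) - (temperatureMap b u θ - Θ (n + 1)) := by
      abel
    rw [e1, e2]
    refine (energy_sub_le hK (huf.sub (hUf _)) (hmu.sub (hUf _)) (hθf.sub (hΘf _))
      (hmθ.sub (hΘf _))).trans ?_
    have h1 : energy p q K T (velocityMap a u θ - U (n + 1)) (temperatureMap b u θ - Θ (n + 1)) ≤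
        2⁻¹ * (d * 2⁻¹ ^ n) :=
      (energy_maps_sub_le hK hR huf (hUf n) hθf (hΘf n) huR (hUR _) hθR (hΘR _) hRt).trans
        (mul_le_mul' le_rfl (hen n))
    have h2 : (2⁻¹ : ℝ≥0∞) ≤ 1 := ENNReal.inv_le_one.2 one_le_two
    calc _ ≤ d * 2⁻¹ ^ (n + 1) + 2⁻¹ * (d * 2⁻¹ ^ n) := add_le_add (hen _) h1
      _ = 2⁻¹ * (2 * d * 2⁻¹ ^ n) := by ring
      _ ≤ 1 * (2 * d * 2⁻¹ ^ n) := by gcongr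
      _ = _ := one_mul _
  refine ⟨u, θ, ⟨huf, hθf, ?_, ?_⟩, fun S hS => ⟨fun r hr => ?_, ?_, ?_, fun hS1 => ?_⟩⟩
  · have h3 := ae_eq_of_wnorm_eq_zero (ν := weightX p) (zero_lt_one.trans_le hp1).ne'
      (huf.sub hmu).slice (le_zero_iff.1 ((normX_le_energy T _ _).trans_eq hzero))
    filter_upwards [h3] with t h5
    filter_upwards [h5] with x hx
    exact sub_eq_zero.1 hx
  · have h4 := ae_eq_of_wnorm_eq_zero (ν := weightY q) (zero_lt_one.trans_le hK.one_le_q).ne'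
      (hθf.sub hmθ).slice (le_zero_iff.1 ((normY_le_energy hK T _ _).trans_eq hzero))
    filter_upwards [h4] with t h5
    filter_upwards [h5] with x hx
    exact sub_eq_zero.1 hx
  · exact wnorm_limit_le hS hUf hulim fun n => picard_velocity_le hK ha hb (hrS S hS) hr n
  · exact wnorm_limit_le hS hΘf hθlim fun n => (picard_le hK ha hb (hrS S hS) n).2
  · exact wnorm_limit_le hS hΘf hθlim fun n => picard_temperature_top_le hK ha hb (hrS S hS) n
  · exact wnorm_limit_le hS hΘf hθlim fun n =>
      picard_temperature_one_le hK ha hb (hrS S hS) hS1 n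

end FixedPoint

/-! ### Continuity in time -/

section Continuity

variable {F : Type} [NormedAddCommGroup F]

lemma tendsto_eLpNorm_sub_add {v w : ℝ → E3 → F} {r : ℝ≥0∞} (hr : 1 ≤ r) {l : Filter ℝ}
    {v₀ w₀ : E3 → F} (hv : ∀ t, AEStronglyMeasurable (v t)) (hv₀ : AEStronglyMeasurable v₀)
    (hw : ∀ t, AEStronglyMeasurable (w t)) (hw₀ : AEStronglyMeasurable w₀)
    (h : Tendsto (fun t => eLpNorm (v t - v₀) r volume) l (𝓝 0))
    (h' : Tendsto (fun t => eLpNorm (w t - w₀) r volume) l (𝓝 0)) :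
    Tendsto (fun t => eLpNorm ((v t + w t) - (v₀ + w₀)) r volume) l (𝓝 0) := by
  have h2 := h.add h'
  rw [add_zero] at h2
  refine tendsto_of_tendsto_of_tendsto_of_le_of_le tendsto_const_nhds h2 (fun _ => zero_le)
    fun t => ?_
  have e : (v t + w t) - (v₀ + w₀) = (v t - v₀) + (w t - w₀) := by abel
  simp only [e]
  exact eLpNorm_add_le ((hv t).sub hv₀) ((hw t).sub hw₀) hr

lemma tendsto_eLpNorm_sub_sub {v w : ℝ → E3 → F} {r : ℝ≥0∞} (hr : 1 ≤ r) {l : Filter ℝ}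
    {v₀ w₀ : E3 → F} (hv : ∀ t, AEStronglyMeasurable (v t)) (hv₀ : AEStronglyMeasurable v₀)
    (hw : ∀ t, AEStronglyMeasurable (w t)) (hw₀ : AEStronglyMeasurable w₀)
    (h : Tendsto (fun t => eLpNorm (v t - v₀) r volume) l (𝓝 0))
    (h' : Tendsto (fun t => eLpNorm (w t - w₀) r volume) l (𝓝 0)) :
    Tendsto (fun t => eLpNorm ((v t - w t) - (v₀ - w₀)) r volume) l (𝓝 0) := by
  have h2 := h.add h'
  rw [add_zero] at h2
  refine tendsto_of_tendsto_of_tendsto_of_le_of_le tendsto_const_nhds h2 (fun _ => zero_le)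
    fun t => ?_
  have e : (v t - w t) - (v₀ - w₀) = (v t - v₀) - (w t - w₀) := by abel
  simp only [e]
  exact eLpNorm_sub_le ((hv t).sub hv₀) ((hw t).sub hw₀) hr

/-- Continuity into `L^r` on the open interval gives Bochner local integrability. The solution
itself is known only for almost every time, so continuity is tested on a representative `w`, in
practice the image of the solution under the integral maps, which is defined at every time. -/
lemma memL1loc_of_tendsto [NormedSpace ℝ F] {r : ℝ≥0∞} (hr : 1 ≤ r) {T : ℝ} {v w : ℝ → E3 → F}
    (hw : ∀ t ∈ Ioo 0 T, MemLp (w t) r)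
    (hc : ∀ t₀ ∈ Ioo 0 T, Tendsto (fun t => eLpNorm (w t - w t₀) r volume) (𝓝 t₀) (𝓝 0))
    (h : ∀ᵐ t ∂(volume.restrict (Ioo 0 T)), v t =ᵐ[volume] w t) : MemL1loc T r v := by
  classical
  have : Fact (1 ≤ r) := ⟨hr⟩
  set V : ℝ → Lp F r (volume : Measure E3) := fun t =>
    if ht : t ∈ Ioo 0 T then (hw t ht).toLp else 0 with hV
  have hVt : ∀ t (ht : t ∈ Ioo 0 T), V t = (hw t ht).toLp := fun t ht => by simp only
      [hV, ht, dif_pos]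
  refine ⟨⟨hr⟩, V, ?_, ?_⟩
  · refine ContinuousOn.locallyIntegrableOn ?_ measurableSet_Ioo
    intro t₀ ht₀
    refine ContinuousAt.continuousWithinAt ?_
    rw [ContinuousAt, tendsto_iff_edist_tendsto_0]
    refine (hc t₀ ht₀).congr' ?_
    filter_upwards [isOpen_Ioo.mem_nhds ht₀] with t ht
    rw [hVt t ht, hVt t₀ ht₀, Lp.edist_toLp_toLp]
  · filter_upwards [h, ae_restrict_mem measurableSet_Ioo] with t h1 ht
    rw [hVt t ht]
    exact (hw t ht).coeFn_toLp.trans h1.symm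

lemma eLpNorm_lt_top_of_mul_le {t ν : ℝ} (ht : 0 < t) {x B : ℝ≥0∞} (hB : B < ∞)
    (h : ENNReal.ofReal (t ^ ν) * x ≤ B) : x < ∞ :=
  ((ofReal_rpow_mul_le_iff ht).1 h).trans_lt (ENNReal.mul_lt_top ENNReal.ofReal_lt_top hB)

variable {p q K r : ℝ≥0∞} {a u : ℝ → E3 → E3} {b θ : ℝ → E3 → ℝ} {T t₀ : ℝ}

lemma tendsto_velocityMap_sub (hK : SourceBounds p q K) (ha : IsField a) (hu : IsField u)
    (hθ : IsField θ) (hr : IsVelocityExponent p r) (huT : normX T p u < ∞)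
    (hur : normX T r u < ∞) (hθT : normY T q θ < ∞) (ht : t₀ ∈ Ioo 0 T)
    (hat : Tendsto (fun t => eLpNorm (a t - a t₀) r volume) (𝓝 t₀) (𝓝 0)) :
    Tendsto (fun t => eLpNorm (velocityMap a u θ t - velocityMap a u θ t₀) r volume)
      (𝓝 t₀) (𝓝 0) := by
  have hr1 := one_le_of_isVelocityExponent hK.three_lt_p hr
  have h1 := tendsto_eLpNorm_duhamelSum_sub
    (F := fun (i : Fin 3 × Fin 3 × Fin 3) s y => u s y i.2.1 * u s y i.2.2)
    (f := fun s y => ‖u s y‖ₑ * ‖u s y‖ₑ) (by simp) isDuhamelSystem_momentum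
    (measurable_momentum_source hu) hr1 (heatSupRegular_momentum hK hu huT hr hur)
    (fun i s y => enorm_component_mul_le (u s y) (u s y) i.2.1 i.2.2) ht
  have h2 := tendsto_eLpNorm_duhamelSum_sub
    (F := fun (_ : Fin 3) s y => θ s y) (f := fun s y => ‖θ s y‖ₑ) (by simp)
    isDuhamelSystem_buoyancy (fun _ => hθ.measurable) hr1 ((hK.buoyancy r hr ℝ T θ hθ).2 hθT)
    (fun _ _ _ => le_rfl) ht
  exact tendsto_eLpNorm_sub_add (v := fun t => a t - momentumTerm u t)
    (v₀ := a t₀ - momentumTerm u t₀) (w := buoyancyTerm θ) (w₀ := buoyancyTerm θ t₀) hr1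
    (fun t => (ha.slice t).sub ((isField_momentumTerm hu).slice t))
    ((ha.slice t₀).sub ((isField_momentumTerm hu).slice t₀))
    (isField_buoyancyTerm hθ).slice ((isField_buoyancyTerm hθ).slice t₀)
    (tendsto_eLpNorm_sub_sub hr1 ha.slice (ha.slice t₀) (isField_momentumTerm hu).slice
      ((isField_momentumTerm hu).slice t₀) hat h1) h2

lemma tendsto_temperatureMap_sub (hb : IsField b) (hu : IsField u)
    (hθ : IsField θ) (hr : 1 ≤ r) (h : HeatSupRegular 1 r T fun s y => ‖u s y‖ₑ * ‖θ s y‖ₑ)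
    (ht : t₀ ∈ Ioo 0 T)
    (hbt : Tendsto (fun t => eLpNorm (b t - b t₀) r volume) (𝓝 t₀) (𝓝 0)) :
    Tendsto (fun t => eLpNorm (temperatureMap b u θ t - temperatureMap b u θ t₀) r volume)
      (𝓝 t₀) (𝓝 0) := by
  have h1 := tendsto_eLpNorm_duhamelSum_sub (F := fun (l : Fin 3) s y => θ s y * u s y l)
    (f := fun s y => ‖u s y‖ₑ * ‖θ s y‖ₑ) (by simp) isDuhamelSystem_flux
    (measurable_flux_source hu hθ) hr h
    (fun i s y => enorm_mul_component_le _ _ _) ht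
  exact tendsto_eLpNorm_sub_sub (v := b) (w := fluxTerm u θ) hr hb.slice (hb.slice t₀)
    (isField_fluxTerm hu hθ).slice ((isField_fluxTerm hu hθ).slice t₀) hbt h1

end Continuity

/-! ### The divergence of the velocity -/

section Divergence

/-- The partial derivative of a Schwartz function. -/
def schwartzD (l : Fin 3) (φ : 𝓢(E3, ℝ)) : 𝓢(E3, ℝ) := ∂_{basisVec l} φ

lemma schwartzD_apply (l : Fin 3) (φ : 𝓢(E3, ℝ)) (x : E3) : schwartzD l φ x = pderiv l φ x := rfl

lemma schwartzD_comm (j l : Fin 3) (φ : 𝓢(E3, ℝ)) :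
    schwartzD j (schwartzD l φ) = schwartzD l (schwartzD j φ) := by
  have key : ∀ (i m : Fin 3) (x : E3), schwartzD i (schwartzD m φ) x =
      fderiv ℝ (fderiv ℝ φ) x (basisVec i) (basisVec m) := by
    intro i m x
    have hd : DifferentiableAt ℝ (fderiv ℝ φ) x :=
      ((φ.smooth ⊤).fderiv_right (m := 1) (by norm_cast)).differentiable (by norm_num) x
    have h := (hd.hasFDerivAt.clm_apply (hasFDerivAt_const (basisVec m) x)).fderiv
    have e : schwartzD i (schwartzD m φ) x =
        fderiv ℝ (fun y => fderiv ℝ φ y (basisVec m)) x (basisVec i) := rfl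
    rw [e, h]
    simp
  ext x
  rw [key, key]
  exact ((φ.smooth 2).contDiffAt.isSymmSndFDerivAt (by simp)) _ _

lemma exists_abs_heatPot_le {m C : ℝ} (hm : 0 ≤ m) {h : ℝ → E3 → ℝ} (hh : IsHeatDensity m C h)
    {t : ℝ} (ht : 0 < t) : ∃ B, ∀ x, ‖heatPot h t x‖ ≤ B := by
  refine ⟨∫ s in Ioi t, C * s ^ (-(5 / 2) - m / 2), fun x => ?_⟩
  refine norm_integral_le_of_norm_le
    ((integrableOn_Ioi_rpow_of_lt (by linarith : -(5 / 2) - m / 2 < -1) ht).const_mul C) ?_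
  filter_upwards [ae_restrict_mem measurableSet_Ioi] with s hs
  exact hh.abs_le_rpow (ht.trans hs) x

lemma integrable_heatPot_mul {m C : ℝ} (hm : 0 ≤ m) {h : ℝ → E3 → ℝ} (hh : IsHeatDensity m C h)
    {t : ℝ} (ht : 0 < t) (y : E3) (φ : 𝓢(E3, ℝ)) :
    Integrable fun x => heatPot h t (x - y) * φ x := by
  obtain ⟨B, hB⟩ := exists_abs_heatPot_le hm hh ht
  refine φ.integrable.bdd_mul (c := B) ?_ (ae_of_all _ fun x => hB _)
  exact ((measurable_heatPot hh).comp
    (by fun_prop : Measurable fun x : E3 => (t, x - y))).aestronglyMeasurable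

lemma hasFDerivAt_heatPot_sub {t : ℝ} (ht : 0 < t) (j k : Fin 3) (x y : E3) :
    HasFDerivAt (fun x => heatPot (densityLeray j k) t (x - y))
      (∑ l : Fin 3, heatPot (densityLerayD l j k) t (x - y) •
        (EuclideanSpace.proj l : E3 →L[ℝ] ℝ)) x :=
  (hasFDerivAt_comp_sub y).2 (hasFDerivAt_heatPot_densityLeray ht j k (x - y))

lemma fderiv_heatPot_sub {t : ℝ} (ht : 0 < t) (l j k : Fin 3) (x y : E3) :
    fderiv ℝ (fun x => heatPot (densityLeray j k) t (x - y)) x (basisVec l) =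
      heatPot (densityLerayD l j k) t (x - y) := by
  rw [(hasFDerivAt_heatPot_sub ht j k x y).fderiv]
  simp [proj_basisVec]

lemma integral_heatPot_mul_schwartzD {t : ℝ} (ht : 0 < t) (l j k : Fin 3) (y : E3)
    (φ : 𝓢(E3, ℝ)) : ∫ x, heatPot (densityLeray j k) t (x - y) * schwartzD l φ x =
      -∫ x, heatPot (densityLerayD l j k) t (x - y) * φ x := by
  have h := integral_mul_fderiv_eq_neg_fderiv_mul_of_integrable (μ := (volume : Measure E3))
    (f := fun x => heatPot (densityLeray j k) t (x - y)) (g := φ) (v := basisVec l) ?_ ?_ ?_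
    (fun x _ => (hasFDerivAt_heatPot_sub ht j k x y).differentiableAt)
    (fun x _ => φ.differentiableAt)
  · simp only [fderiv_heatPot_sub ht] at h
    exact h
  · simp only [fderiv_heatPot_sub ht]
    exact integrable_heatPot_mul zero_le_one (isHeatDensity_lerayD l j k) ht y φ
  · exact integrable_heatPot_mul le_rfl (isHeatDensity_leray j k) ht y (schwartzD l φ)
  · exact integrable_heatPot_mul le_rfl (isHeatDensity_leray j k) ht y φ

/-- A family of densities whose kernels form divergence free fields. -/
def IsSolenoidal (h : Fin 3 → ℝ → E3 → ℝ) : Prop :=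
  ∀ (t : ℝ), 0 < t → ∀ (y : E3) (φ : 𝓢(E3, ℝ)),
    ∑ j : Fin 3, ∫ x, heatPot (h j) t (x - y) * schwartzD j φ x = 0

lemma isSolenoidal_leray (k : Fin 3) : IsSolenoidal fun j => densityLeray j k := by
  intro t ht y φ
  simp only [integral_heatPot_mul_schwartzD ht]
  rw [Finset.sum_neg_distrib, ← integral_finsetSum _ fun j _ =>
    integrable_heatPot_mul zero_le_one (isHeatDensity_lerayD j j k) ht y φ]
  simp only [← Finset.sum_mul, sum_heatPot_densityLerayD t ht k]
  simp

/-- An integration by parts moves `∂_l` from the kernel to the test function, and mixed derivatives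
commute; the claim becomes that for the undifferentiated kernel, tested with `∂_l φ`. -/
lemma isSolenoidal_lerayD (l k : Fin 3) : IsSolenoidal fun j => densityLerayD l j k := by
  intro t ht y φ
  have h := isSolenoidal_leray k t ht y (schwartzD l φ)
  rw [← neg_eq_zero, ← Finset.sum_neg_distrib, ← h]
  refine Finset.sum_congr rfl fun j _ => ?_
  rw [← integral_heatPot_mul_schwartzD ht, schwartzD_comm]

variable {m C : ℝ} {h : ℝ → E3 → ℝ} {F : ℝ → E3 → ℝ} {t : ℝ} {ψ : E3 → ℝ}

lemma integrable_duhamel_mul (hh : IsHeatDensity m C h)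
    (hF : Measurable fun w : ℝ × E3 => F w.1 w.2) (hψ : Measurable ψ)
    (hfin : ∫⁻ x, heatSup m (regA t) (fun s y => ‖F s y‖ₑ) x * ‖ψ x‖ₑ < ∞) :
    Integrable (fun w : E3 × (ℝ × E3) =>
      duhamelKernel h t w.2.1 (w.1 - w.2.2) * F w.2.1 w.2.2 * ψ w.1) (volume.prod volume) := by
  have hm : Measurable fun w : E3 × (ℝ × E3) =>
      duhamelKernel h t w.2.1 (w.1 - w.2.2) * F w.2.1 w.2.2 * ψ w.1 :=
    ((measurable_duhamel_integrand hh hF).comp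
      (by fun_prop : Measurable fun w : E3 × (ℝ × E3) => ((t, w.1), w.2))).mul
      (hψ.comp measurable_fst)
  refine ⟨hm.aestronglyMeasurable, ?_⟩
  rw [hasFiniteIntegral_iff_enorm, lintegral_prod _ hm.enorm.aemeasurable]
  refine lt_of_le_of_lt (b := ∫⁻ x, ENNReal.ofReal C *
    (heatSup m (regA t) (fun s y => ‖F s y‖ₑ) x * ‖ψ x‖ₑ)) (lintegral_mono fun x => ?_) ?_
  · simp only [enorm_mul (_ * _ : ℝ) (ψ _)]
    rw [lintegral_mul_const' _ _ enorm_ne_top, ← mul_assoc]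
    exact mul_le_mul' (lintegral_duhamel_le hh hF t x) le_rfl
  · rw [lintegral_const_mul' _ _ ENNReal.ofReal_ne_top]
    exact ENNReal.mul_lt_top ENNReal.ofReal_lt_top hfin

lemma integral_duhamel_mul (hh : IsHeatDensity m C h)
    (hF : Measurable fun w : ℝ × E3 => F w.1 w.2) (hψ : Measurable ψ)
    (hfin : ∫⁻ x, heatSup m (regA t) (fun s y => ‖F s y‖ₑ) x * ‖ψ x‖ₑ < ∞) :
    Integrable (fun x => duhamel h F t x * ψ x) ∧
      Integrable (fun z : ℝ × E3 =>
        F z.1 z.2 * ∫ x, duhamelKernel h t z.1 (x - z.2) * ψ x) ∧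
      ∫ x, duhamel h F t x * ψ x =
        ∫ z : ℝ × E3, F z.1 z.2 * ∫ x, duhamelKernel h t z.1 (x - z.2) * ψ x := by
  have hi := integrable_duhamel_mul hh hF hψ hfin
  have e1 : ∀ x, duhamel h F t x * ψ x =
      ∫ z : ℝ × E3, duhamelKernel h t z.1 (x - z.2) * F z.1 z.2 * ψ x :=
    fun x => (integral_mul_const _ _).symm
  have e2 : ∀ z : ℝ × E3, F z.1 z.2 * ∫ x, duhamelKernel h t z.1 (x - z.2) * ψ x =
      ∫ x, duhamelKernel h t z.1 (x - z.2) * F z.1 z.2 * ψ x := by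
    intro z
    rw [← integral_const_mul]
    refine integral_congr_ae (ae_of_all _ fun x => ?_)
    simp only
    ring
  simp only [e1, e2]
  exact ⟨hi.integral_prod_left, hi.integral_prod_right, integral_integral_swap hi⟩

/-- Fubini's theorem moves the test function inside the Duhamel integral. For each source point the
kernels, a divergence-free field, are then paired with the gradient of `φ`. The finiteness
assumption supplies absolute convergence. -/
lemma sum_integral_duhamel_mul_eq_zero {h : Fin 3 → ℝ → E3 → ℝ} (hs : IsSolenoidal h)
    (hh : ∀ j, IsHeatDensity m C (h j)) (hF : Measurable fun w : ℝ × E3 => F w.1 w.2)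
    (φ : 𝓢(E3, ℝ))
    (hfin : ∀ j, ∫⁻ x, heatSup m (regA t) (fun s y => ‖F s y‖ₑ) x * ‖schwartzD j φ x‖ₑ < ∞) :
    ∑ j : Fin 3, ∫ x, duhamel (h j) F t x * schwartzD j φ x = 0 := by
  have hψ : ∀ j, Measurable (schwartzD j φ) := fun j => (schwartzD j φ).continuous.measurable
  rw [Finset.sum_congr rfl fun j _ => (integral_duhamel_mul (hh j) hF (hψ j) (hfin j)).2.2,
    ← integral_finsetSum _ fun j _ => (integral_duhamel_mul (hh j) hF (hψ j) (hfin j)).2.1]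
  refine (integral_congr_ae (ae_of_all _ fun z => ?_)).trans (integral_zero _ _)
  simp only [← Finset.mul_sum]
  by_cases hz : z.1 ∈ Ioo 0 t
  · simp only [duhamelKernel, hz, if_true]
    rw [hs (t - z.1) (sub_pos.2 hz.2) z.2 φ, mul_zero]
  · simp [duhamelKernel, hz]

lemma lintegral_mul_schwartz_lt_top {f g : E3 → ℝ≥0∞} (hg : eLpNorm g ∞ volume < ∞)
    (hfg : ∀ x, f x ≤ g x) (φ : 𝓢(E3, ℝ)) : ∫⁻ x, f x * ‖φ x‖ₑ < ∞ := by
  calc ∫⁻ x, f x * ‖φ x‖ₑ ≤ ∫⁻ x, eLpNorm g ∞ volume * ‖φ x‖ₑ := by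
        refine lintegral_mono_ae ?_
        rw [eLpNorm_exponent_top]
        filter_upwards [enorm_ae_le_eLpNormEssSup g volume] with x hx
        rw [enorm_eq_self] at hx
        exact mul_le_mul' ((hfg x).trans hx) le_rfl
    _ = eLpNorm g ∞ volume * ∫⁻ x, ‖φ x‖ₑ := lintegral_const_mul' _ _ hg.ne
    _ < ∞ := ENNReal.mul_lt_top hg φ.integrable.2

variable {u : ℝ → E3 → E3} {θ : ℝ → E3 → ℝ}

lemma divFree_buoyancyTerm (hθ : IsField θ)
    (hfin : eLpNorm (heatSup 0 (regA t) fun s y => ‖θ s y‖ₑ) ∞ volume < ∞) :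
    DivFree (buoyancyTerm θ t) := by
  intro φ
  have hf : ∀ j, ∫⁻ x, heatSup 0 (regA t) (fun s y => ‖θ s y‖ₑ) x * ‖schwartzD j φ x‖ₑ < ∞ :=
    fun j => lintegral_mul_schwartz_lt_top hfin (fun _ => le_rfl) _
  rw [← sum_integral_duhamel_mul_eq_zero (isSolenoidal_leray 2) (fun j => isHeatDensity_leray j 2)
    hθ.measurable φ hf, ← integral_finsetSum _ fun j _ => (integral_duhamel_mul
      (isHeatDensity_leray j 2) hθ.measurable (schwartzD j φ).continuous.measurable (hf j)).1]
  refine integral_congr_ae (ae_of_all _ fun x => Finset.sum_congr rfl fun l _ => ?_)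
  rw [schwartzD_apply]
  congr 1
  simp [buoyancyTerm, duhamelSum, proj_basisVec]

lemma momentumTerm_apply (t : ℝ) (x : E3) (j : Fin 3) : momentumTerm u t x j =
    ∑ k : Fin 3, ∑ l : Fin 3,
      duhamel (densityLerayD l j k) (fun s y => u s y k * u s y l) t x := by
  simp only [momentumTerm, duhamelSum, Fintype.sum_prod_type, WithLp.ofLp_sum, Finset.sum_apply,
    PiLp.smul_apply, proj_basisVec, smul_eq_mul, mul_ite, mul_one, mul_zero]
  simp

lemma divFree_momentumTerm (hu : IsField u)
    (hfin : eLpNorm (heatSup 1 (regA t) fun s y => ‖u s y‖ₑ * ‖u s y‖ₑ) ∞ volume < ∞) :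
    DivFree (momentumTerm u t) := by
  intro φ
  have hF : ∀ k l, Measurable fun w : ℝ × E3 => u w.1 w.2 k * u w.1 w.2 l := fun k l =>
    (measurable_component hu k).mul (measurable_component hu l)
  have hf : ∀ k l j, ∫⁻ x, heatSup 1 (regA t) (fun s y => ‖u s y k * u s y l‖ₑ) x *
      ‖schwartzD j φ x‖ₑ < ∞ := fun k l j =>
    lintegral_mul_schwartz_lt_top hfin (heatSup_mono (measurableSet_regA t) (regA_subset_Ioo t)
      fun s _ y => enorm_component_mul_le (u s y) (u s y) k l) _
  have hi : ∀ k l j, Integrable fun x =>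
      duhamel (densityLerayD l j k) (fun s y => u s y k * u s y l) t x * schwartzD j φ x :=
    fun k l j => (integral_duhamel_mul (isHeatDensity_lerayD l j k) (hF k l)
      (schwartzD j φ).continuous.measurable (hf k l j)).1
  have h0 : ∀ k l, ∑ j : Fin 3, ∫ x,
      duhamel (densityLerayD l j k) (fun s y => u s y k * u s y l) t x * schwartzD j φ x = 0 :=
    fun k l => sum_integral_duhamel_mul_eq_zero (isSolenoidal_lerayD l k)
      (fun j => isHeatDensity_lerayD l j k) (hF k l) φ (hf k l)
  calc _ = ∫ x, ∑ k : Fin 3, ∑ l : Fin 3, ∑ j : Fin 3,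
        duhamel (densityLerayD l j k) (fun s y => u s y k * u s y l) t x * schwartzD j φ x := by
        refine integral_congr_ae (ae_of_all _ fun x => ?_)
        simp only [momentumTerm_apply, Finset.sum_mul, schwartzD_apply]
        rw [Finset.sum_comm]
        exact Finset.sum_congr rfl fun k _ => Finset.sum_comm
    _ = 0 := by
        rw [integral_finsetSum _ fun k _ => integrable_finsetSum _ fun l _ =>
          integrable_finsetSum _ fun j _ => hi k l j]
        refine Finset.sum_eq_zero fun k _ => ?_
        rw [integral_finsetSum _ fun l _ => integrable_finsetSum _ fun j _ => hi k l j]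
        refine Finset.sum_eq_zero fun l _ => ?_
        rw [integral_finsetSum _ fun j _ => hi k l j]
        exact h0 k l

lemma DivFree.congr_ae {v w : E3 → E3} (hv : DivFree v) (h : v =ᵐ[volume] w) : DivFree w := by
  intro φ
  rw [← hv φ]
  refine integral_congr_ae ?_
  filter_upwards [h] with x hx
  rw [hx]

lemma integrable_component_mul_schwartz {v : E3 → E3} {c : ℝ≥0∞} (hc : 1 ≤ c) (hv : MemLp v c)
    (l : Fin 3) (φ : 𝓢(E3, ℝ)) : Integrable fun x => v x l * φ x := by
  have : Fact (1 ≤ c) := ⟨hc⟩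
  have h1 : MemLp (fun x => v x l) c :=
    hv.of_le ((measurable_coord l).comp_aemeasurable hv.1.aemeasurable).aestronglyMeasurable
      (ae_of_all _ fun x => PiLp.norm_apply_le _ _)
  exact h1.integrable_mul (φ.memLp c.conjExponent)

lemma integrable_sum_component_mul {v : E3 → E3} {c : ℝ≥0∞} (hc : 1 ≤ c) (hv : MemLp v c)
    (φ : 𝓢(E3, ℝ)) : Integrable fun x => ∑ l : Fin 3, v x l * pderiv l φ x :=
  integrable_finsetSum _ fun l _ => integrable_component_mul_schwartz hc hv l (schwartzD l φ)

/-- The two fields must be in Lebesgue spaces: divergence freeness is expressed by integrals that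
are additive only for integrable functions. -/
lemma DivFree.add {v w : E3 → E3} {c d : ℝ≥0∞} (hc : 1 ≤ c) (hd : 1 ≤ d) (hv : MemLp v c)
    (hw : MemLp w d) (hv' : DivFree v) (hw' : DivFree w) : DivFree (v + w) := by
  intro φ
  calc _ = ∫ x, (∑ l : Fin 3, v x l * pderiv l φ x) + ∑ l : Fin 3, w x l * pderiv l φ x := by
        simp only [Pi.add_apply, PiLp.add_apply, add_mul, Finset.sum_add_distrib]
    _ = 0 := by
        rw [integral_add (integrable_sum_component_mul hc hv φ)
          (integrable_sum_component_mul hd hw φ), hv' φ, hw' φ, add_zero]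

lemma DivFree.neg {v : E3 → E3} (hv : DivFree v) : DivFree (-v) := by
  intro φ
  rw [← neg_eq_zero, ← integral_neg, ← hv φ]
  simp

lemma divFree_of_isFunction {f : TDist E3} {g : E3 → E3} {c : ℝ≥0∞} (hc : 1 ≤ c)
    (hg : MemLp g c) (hfg : IsFunction f g) (hf : DivFreeDist f) : DivFree g := by
  intro φ
  have : Fact (1 ≤ c) := ⟨hc⟩
  have hi : ∀ l, Integrable fun x => schwartzD l φ x • g x := fun l =>
    memLp_one_iff_integrable.1 (hg.smul ((schwartzD l φ).memLp c.conjExponent))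
  have hi' : ∀ l, Integrable fun x => g x l * pderiv l φ x := fun l =>
    integrable_component_mul_schwartz hc hg l (schwartzD l φ)
  rw [← hf φ, integral_finsetSum _ fun l _ => hi' l]
  refine Finset.sum_congr rfl fun l _ => ?_
  have e : f (∂_{basisVec l} φ) = ∫ x, schwartzD l φ x • g x := hfg _
  rw [e]
  have h := (EuclideanSpace.proj l : E3 →L[ℝ] ℝ).integral_comp_comm (hi l)
  refine Eq.trans ?_ h
  refine integral_congr_ae (ae_of_all _ fun x => ?_)
  simp [schwartzD_apply, mul_comm]

lemma divFree_translate {v : E3 → E3} (hv : DivFree v) (z : E3) : DivFree fun x => v (x - z) := by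
  intro φ
  rw [← hv (SchwartzMap.compSubConstCLM ℝ (-z) φ),
    ← integral_sub_right_eq_self (fun x => ∑ l : Fin 3, v x l *
      pderiv l (SchwartzMap.compSubConstCLM ℝ (-z) φ) x) z]
  refine integral_congr_ae (ae_of_all _ fun x => Finset.sum_congr rfl fun l _ => ?_)
  congr 1
  have e : (SchwartzMap.compSubConstCLM ℝ (-z) φ : E3 → ℝ) = fun y => φ (y + z) := by
    ext y; simp
  unfold pderiv
  rw [e, fderiv_comp_add_right, sub_add_cancel]

/-- The heat flow is an average over `z` of the translates of `g` by `z`, each of which is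
divergence free; Fubini's theorem exchanges the average with the test integral. -/
lemma divFree_heatConv_of_measurable {t : ℝ} (ht : 0 < t) {g : E3 → E3} (hgm : StronglyMeasurable g)
    {c : ℝ≥0∞} (hc : 1 ≤ c) (hg : MemLp g c) (hd : DivFree g) : DivFree (heatConv t g) := by
  intro φ
  have htop : eLpNorm (heatAvg t fun y => ‖g y‖ₑ) ∞ volume < ∞ :=
    (eLpNorm_heatAvg_enorm_le ht hg.1 hc le_top).trans_lt
      (ENNReal.mul_lt_top ENNReal.ofReal_lt_top hg.2)
  have hmK : Measurable fun w : E3 × E3 => heatKernel t w.2 :=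
    (continuous_heatKernel t).measurable.comp measurable_snd
  have hmg : Measurable fun w : E3 × E3 => g (w.1 - w.2) :=
    hgm.measurable.comp (by fun_prop)
  have hi : ∀ l, Integrable (fun w : E3 × E3 =>
      heatKernel t w.2 * (g (w.1 - w.2) l * schwartzD l φ w.1)) (volume.prod volume) := by
    intro l
    have hm : Measurable fun w : E3 × E3 =>
        heatKernel t w.2 * (g (w.1 - w.2) l * schwartzD l φ w.1) :=
      hmK.mul (((measurable_coord l).comp hmg).mul
        ((schwartzD l φ).continuous.measurable.comp measurable_fst))
    refine ⟨hm.aestronglyMeasurable, ?_⟩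
    rw [hasFiniteIntegral_iff_enorm, lintegral_prod _ hm.enorm.aemeasurable]
    refine lt_of_le_of_lt (lintegral_mono fun x => ?_)
      (lintegral_mul_schwartz_lt_top htop (fun _ => le_rfl) (schwartzD l φ))
    have e : heatAvg t (fun y => ‖g y‖ₑ) x =
        ∫⁻ z, ENNReal.ofReal (heatKernel t z) * ‖g (x - z)‖ₑ := by
      unfold heatAvg
      rw [← lintegral_sub_left_eq_self _ x]
      simp
    rw [e, ← lintegral_mul_const' _ _ enorm_ne_top]
    refine lintegral_mono fun z => ?_
    rw [enorm_mul, enorm_mul, ← mul_assoc, Real.enorm_of_nonneg (heatKernel_nonneg t ht z)]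
    exact mul_le_mul' (mul_le_mul' le_rfl (enorm_component_le _ _)) le_rfl
  have hsum := integrable_finsetSum (Finset.univ : Finset (Fin 3)) fun l _ => hi l
  have hx : ∀ᵐ x, heatAvg t (fun y => ‖g y‖ₑ) x < ∞ := heatAvg_lt_top_ae ht hc hg
  calc _ = ∫ x, ∫ z, ∑ l : Fin 3, heatKernel t z * (g (x - z) l * schwartzD l φ x) := by
        refine integral_congr_ae ?_
        filter_upwards [hx] with x hx
        have hK := integrable_heatConv ht hg.1 hx
        have hK' : Integrable fun z => heatKernel t z • g (x - z) := by
          have := hK.comp_sub_left x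
          simpa using this
        have e : heatConv t g x = ∫ z, heatKernel t z • g (x - z) := by
          unfold heatConv
          rw [← integral_sub_left_eq_self _ volume x]
          simp
        have hl : ∀ l, Integrable fun z => heatKernel t z * (g (x - z) l * schwartzD l φ x) := by
          intro l
          have := ((EuclideanSpace.proj l : E3 →L[ℝ] ℝ).integrable_comp hK').mul_const
            (schwartzD l φ x)
          refine this.congr (ae_of_all _ fun z => ?_)
          simp [mul_assoc]
        rw [integral_finsetSum _ fun l _ => hl l]
        refine Finset.sum_congr rfl fun l _ => ?_
        have h := (EuclideanSpace.proj l : E3 →L[ℝ] ℝ).integral_comp_comm hK'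
        rw [← e] at h
        have h' : heatConv t g x l = ∫ z, heatKernel t z * g (x - z) l := by
          refine h.symm.trans (integral_congr_ae (ae_of_all _ fun z => ?_))
          simp
        rw [h', ← integral_mul_const]
        refine integral_congr_ae (ae_of_all _ fun z => ?_)
        simp only [schwartzD_apply]
        ring
    _ = ∫ z, ∫ x, ∑ l : Fin 3, heatKernel t z * (g (x - z) l * schwartzD l φ x) := by
        refine integral_integral_swap (f := fun x z =>
          ∑ l : Fin 3, heatKernel t z * (g (x - z) l * schwartzD l φ x)) ?_
        exact hsum
    _ = 0 := by
        refine (integral_congr_ae (ae_of_all _ fun z => ?_)).trans (integral_zero _ _)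
        simp only [← Finset.mul_sum]
        rw [integral_const_mul]
        have h := divFree_translate hd z φ
        simp only [schwartzD_apply]
        rw [h, mul_zero]

lemma divFree_heatConv {t : ℝ} (ht : 0 < t) {g : E3 → E3} {c : ℝ≥0∞} (hc : 1 ≤ c)
    (hg : MemLp g c) (hd : DivFree g) : DivFree (heatConv t g) := by
  rw [heatConv_congr_ae t hg.1.ae_eq_mk]
  exact divFree_heatConv_of_measurable ht hg.1.stronglyMeasurable_mk hc
    ((memLp_congr_ae hg.1.ae_eq_mk).1 hg) (hd.congr_ae hg.1.ae_eq_mk)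

end Divergence

/-! ### Mild solutions and fixed points -/

section Mild

variable {p q K : ℝ≥0∞} {a u v : ℝ → E3 → E3} {b θ η : ℝ → E3 → ℝ} {T σ τ : ℝ}
  {u₀ : TDist E3} {θ₀ : TDist ℝ}

lemma slab_mono {t : ℝ} (h : t ≤ T) : slab t ≤ slab T := by
  rw [slab_eq, slab_eq]
  exact Measure.restrict_mono (prod_mono (Ioo_subset_Ioo_right h) Subset.rfl) le_rfl

theorem IsFixedPoint.isMildSolution (hK : SourceBounds p q K) (h : IsFixedPoint T a b u θ)
    (ha : IsHeatData σ p u₀ a) (hb : IsHeatData τ q θ₀ b) (hT : T ≤ 1) (hd : DivFreeDist u₀)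
    (huT : normX T p u < ∞) (hθT : normY T q θ < ∞) : IsMildSolution T u₀ θ₀ u θ where
  divFree := hd
  measurable_u := h.field_u.aestronglyMeasurable
  measurable_θ := h.field_θ.aestronglyMeasurable
  temperature := by
    filter_upwards [h.temperature, ae_restrict_mem measurableSet_Ioo] with t h1 ht
    filter_upwards [h1, hb.ae_eq t ⟨ht.1, ht.2.trans_le hT⟩,
      ae_heatSup_flux_lt_top hK h.field_u h.field_θ huT hθT ht] with x h2 h3 h4
    obtain ⟨h5, h6⟩ := integral_heatFlux h.field_u h.field_θ h4
    refine ⟨h5, ?_⟩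
    rw [h6, h2, ← h3]
    rfl
  velocity := by
    filter_upwards [h.velocity, ae_restrict_mem measurableSet_Ioo] with t h1 ht
    filter_upwards [h1, ha.ae_eq t ⟨ht.1, ht.2.trans_le hT⟩,
      ae_heatSup_momentum_lt_top hK h.field_u huT ht,
      ae_heatSup_buoyancy_lt_top hK h.field_θ hθT ht] with x h2 h3 h4 h5 j
    obtain ⟨h6, h7⟩ := integral_momentumFlux h.field_u h4 j
    obtain ⟨h8, h9⟩ := integral_buoyancy h.field_θ h5 j
    refine ⟨h6, h8, ?_⟩
    rw [h7, h9, h2, ← h3]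
    rfl

lemma exists_isField {F : Type} [NormedAddCommGroup F] {v : ℝ → E3 → F}
    (hv : AEStronglyMeasurable (fun z : ℝ × E3 => v z.1 z.2) (slab T)) :
    ∃ w : ℝ → E3 → F, IsField w ∧ (∀ᵐ z ∂(slab T), v z.1 z.2 = w z.1 z.2) ∧
      ∀ᵐ t ∂(volume.restrict (Ioo 0 T)), v t =ᵐ[volume] w t :=
  ⟨fun t x => hv.mk _ (t, x), hv.stronglyMeasurable_mk, hv.ae_eq_mk,
    Measure.ae_ae_of_ae_prod hv.ae_eq_mk⟩

/-- A mild solution is measurable only up to null sets of the slab. A jointly measurable version has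
the same integrals and satisfies the fixed point equations, so the uniqueness for fixed points
applies to every mild solution with finite norms. -/
theorem IsMildSolution.exists_isFixedPoint (hK : SourceBounds p q K)
    (h : IsMildSolution T u₀ θ₀ v η) (ha : IsHeatData σ p u₀ a) (hb : IsHeatData τ q θ₀ b)
    (hT : T ≤ 1) (hvT : normX T p v < ∞) (hηT : normY T q η < ∞) :
    ∃ v' η', IsFixedPoint T a b v' η' ∧
      (∀ᵐ t ∂(volume.restrict (Ioo 0 T)), v t =ᵐ[volume] v' t) ∧
      ∀ᵐ t ∂(volume.restrict (Ioo 0 T)), η t =ᵐ[volume] η' t := by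
  obtain ⟨v', hv', hvs, hvv⟩ := exists_isField h.measurable_u
  obtain ⟨η', hη', hηs, hηη⟩ := exists_isField h.measurable_θ
  have hvT' : normX T p v' < ∞ := by
    have e : normX T p v = normX T p v' := wnorm_congr hvv
    rwa [← e]
  have hηT' : normY T q η' < ∞ := by
    have e : normY T q η = normY T q η' := wnorm_congr hηη
    rwa [← e]
  refine ⟨v', η', ⟨hv', hη', ?_, ?_⟩, hvv, hηη⟩
  · filter_upwards [h.velocity, hvv, ae_restrict_mem measurableSet_Ioo] with t h1 h2 ht
    -- The two versions agree almost everywhere on the large slab, hence on the slab over which the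
    -- integral at time `t` is taken.
    have hs : slab t ≪ slab T := (slab_mono ht.2.le).absolutelyContinuous
    filter_upwards [h1, h2, ha.ae_eq t ⟨ht.1, ht.2.trans_le hT⟩,
      ae_heatSup_momentum_lt_top hK hv' hvT' ht,
      ae_heatSup_buoyancy_lt_top hK hη' hηT' ht] with x h1 h2 h3 h4 h5
    ext j
    obtain ⟨-, -, h6⟩ := h1 j
    have e1 : ∫ z, momentumFlux v j t x z ∂(slab t) = momentumTerm v' t x j := by
      rw [← (integral_momentumFlux hv' h4 j).2]
      refine integral_congr_ae ?_
      filter_upwards [hs.ae_le hvs] with z hz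
      simp only [momentumFlux, hz]
    have e2 : ∫ z, buoyancy η j t x z ∂(slab t) = buoyancyTerm η' t x j := by
      rw [← (integral_buoyancy hη' h5 j).2]
      refine integral_congr_ae ?_
      filter_upwards [hs.ae_le hηs] with z hz
      simp only [buoyancy, hz]
    rw [← h2, h6, e1, e2, ← h3]
    rfl
  · filter_upwards [h.temperature, hηη, ae_restrict_mem measurableSet_Ioo] with t h1 h2 ht
    have hs : slab t ≪ slab T := (slab_mono ht.2.le).absolutelyContinuous
    filter_upwards [h1, h2, hb.ae_eq t ⟨ht.1, ht.2.trans_le hT⟩,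
      ae_heatSup_flux_lt_top hK hv' hη' hvT' hηT' ht] with x h1 h2 h3 h4
    have e1 : ∫ z, heatFlux v η t x z ∂(slab t) = fluxTerm v' η' t x := by
      rw [← (integral_heatFlux hv' hη' h4).2]
      refine integral_congr_ae ?_
      filter_upwards [hs.ae_le hvs, hs.ae_le hηs] with z hz hz'
      simp only [heatFlux, hz, hz']
    rw [← h2, h1.2, e1, ← h3]
    rfl

lemma IsFixedPoint.mono (h : IsFixedPoint T a b u θ) {S : ℝ} (hS : S ≤ T) :
    IsFixedPoint S a b u θ where
  field_u := h.field_u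
  field_θ := h.field_θ
  velocity := ae_restrict_of_ae_restrict_of_subset (Ioo_subset_Ioo_right hS) h.velocity
  temperature := ae_restrict_of_ae_restrict_of_subset (Ioo_subset_Ioo_right hS) h.temperature

/-- Uniqueness of mild solutions with norms at most `R`. -/
theorem IsFixedPoint.ae_eq_of_isMildSolution {R : ℝ≥0∞} (hK : SourceBounds p q K)
    (hR : 16 * (K * K * R) ≤ 1) (hRt : R < ∞) (h : IsFixedPoint T a b u θ)
    (ha : IsHeatData σ p u₀ a) (hb : IsHeatData τ q θ₀ b) (hT : T ≤ 1)
    (huT : normX T p u ≤ R) (hθT : normY T q θ ≤ R) {S : ℝ} (hS : S ≤ T)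
    (h' : IsMildSolution S u₀ θ₀ v η) (hvS : normX S p v ≤ R) (hηS : normY S q η ≤ R) :
    ∀ᵐ t ∂(volume.restrict (Ioo 0 S)), v t =ᵐ[volume] u t ∧ η t =ᵐ[volume] θ t := by
  obtain ⟨v', η', h1, h2, h3⟩ := h'.exists_isFixedPoint hK ha hb (hS.trans hT)
    (hvS.trans_lt hRt) (hηS.trans_lt hRt)
  have e1 : normX S p v = normX S p v' := wnorm_congr h2
  have e2 : normY S q η = normY S q η' := wnorm_congr h3
  filter_upwards [(h.mono hS).ae_eq hK hR hRt h1 ((wnorm_mono hS).trans huT) (e1 ▸ hvS)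
    ((wnorm_mono hS).trans hθT) (e2 ▸ hηS), h2, h3] with t h4 h5 h6
  exact ⟨h5.trans h4.1, h6.trans h4.2⟩

end Mild

/-! ### Smallness of the data near the initial time -/

section Small

variable {F : Type} [NormedAddCommGroup F] [NormedSpace ℝ F] {σ ν : ℝ} {r c : ℝ≥0∞} {f : TDist F}
  {a : ℝ → E3 → F}

lemma IsHeatData.eventually_le (h : IsHeatData σ r f a) (hr : 1 ≤ r) (hrc : r ≤ c)
    (hν : ν = σ / 2 + 3 / 2 * (r⁻¹.toReal - c⁻¹.toReal)) {ε : ℝ≥0∞} (hε : 0 < ε) :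
    ∀ᶠ S in 𝓝[>] (0 : ℝ), ∀ t ∈ Ioo 0 S, ENNReal.ofReal (t ^ ν) * eLpNorm (a t) c volume ≤ ε := by
  obtain ⟨S, hS, h1⟩ := h.small_of_le hr hrc hν hε
  filter_upwards [Ioc_mem_nhdsGT hS] with S' hS' t ht
  exact h1 t ⟨ht.1, ht.2.trans_le hS'.2⟩

lemma IsHeatData.tendsto_mul (h : IsHeatData σ r f a) (hr : 1 ≤ r) (hrc : r ≤ c)
    (hν : ν = σ / 2 + 3 / 2 * (r⁻¹.toReal - c⁻¹.toReal)) :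
    Tendsto (fun t => ENNReal.ofReal (t ^ ν) * eLpNorm (a t) c volume) (𝓝[>] 0) (𝓝 0) := by
  rw [ENNReal.tendsto_nhds_zero]
  intro ε hε
  obtain ⟨S, hS, h1⟩ := h.small_of_le hr hrc hν hε
  filter_upwards [Ioo_mem_nhdsGT hS] with t ht using h1 t ht

lemma IsHeatData.tendsto_wnorm (h : IsHeatData σ r f a) (hr : 1 ≤ r) (hrc : r ≤ c)
    (hν : ν = σ / 2 + 3 / 2 * (r⁻¹.toReal - c⁻¹.toReal)) :
    Tendsto (fun S => wnorm ν c S a) (𝓝[>] 0) (𝓝 0) := by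
  rw [ENNReal.tendsto_nhds_zero]
  intro ε hε
  filter_upwards [h.eventually_le hr hrc hν hε] with S hS using wnorm_le hS

/-- The estimates at time `t` use norms over an open interval containing `t`; the interval `(0, 2t)`
serves, and its length still tends to zero. -/
lemma tendsto_two_mul_nhdsGT : Tendsto (fun t : ℝ => 2 * t) (𝓝[>] 0) (𝓝[>] 0) := by
  refine tendsto_nhdsWithin_of_tendsto_nhds_of_eventually_within _ ?_ ?_
  · have h : Tendsto (fun t : ℝ => 2 * t) (𝓝 0) (𝓝 (2 * 0)) := tendsto_id.const_mul 2
    rw [mul_zero] at h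
    exact h.mono_left nhdsWithin_le_nhds
  · filter_upwards [self_mem_nhdsWithin] with t ht
    exact mul_pos two_pos (mem_Ioi.1 ht)

end Small

/-! ### Continuity up to the initial time -/

section Initial

variable {F : Type} {g : E3 → F} {w : ℝ → E3 → F}

/-- The field `w`, with the value `g` at the initial time. -/
def withInitial (g : E3 → F) (w : ℝ → E3 → F) (t : ℝ) : E3 → F := if t = 0 then g else w t

lemma withInitial_zero (g : E3 → F) (w : ℝ → E3 → F) : withInitial g w 0 = g := if_pos rfl

lemma withInitial_of_pos {t : ℝ} (ht : 0 < t) : withInitial g w t = w t := if_neg ht.ne'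

variable [NormedAddCommGroup F] {r : ℝ≥0∞} {S T : ℝ}

/-- The field is controlled on the larger interval `(0,S)`, which makes the endpoint `T` an interior
time; only continuity at zero is a separate assumption. -/
lemma continuousInto_withInitial (hTS : T < S) (hg : MemLp g r) (hw : ∀ t ∈ Ioo 0 S, MemLp (w t) r)
    (hc : ∀ t₀ ∈ Ioo 0 S, Tendsto (fun t => eLpNorm (w t - w t₀) r volume) (𝓝 t₀) (𝓝 0))
    (h0 : Tendsto (fun t => eLpNorm (w t - g) r volume) (𝓝[>] 0) (𝓝 0)) :
    ContinuousInto T r (withInitial g w) := by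
  constructor
  · intro t ht
    rcases ht.1.eq_or_lt with rfl | h
    · rwa [withInitial_zero]
    · rw [withInitial_of_pos h]
      exact hw t ⟨h, ht.2.trans_lt hTS⟩
  · intro t ht
    rcases ht.1.eq_or_lt with rfl | h
    · refine Tendsto.mono_left ?_ (nhdsWithin_mono 0 fun s hs => mem_Ici.2 hs.1)
      rw [← Ioi_insert, nhdsWithin_insert, withInitial_zero]
      refine Tendsto.sup ?_ (h0.congr' ?_)
      · rw [tendsto_pure_left]
        intro s hs
        rw [withInitial_zero, sub_self, eLpNorm_zero]
        exact mem_of_mem_nhds hs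
      · filter_upwards [self_mem_nhdsWithin] with t ht
        rw [withInitial_of_pos ht]
    · refine ((hc t ⟨h, ht.2.trans_lt hTS⟩).congr' ?_).mono_left nhdsWithin_le_nhds
      filter_upwards [lt_mem_nhds h] with s hs
      rw [withInitial_of_pos hs, withInitial_of_pos h]

lemma iSup_withInitial_lt_top (hTS : T < S) {A : ℝ≥0∞} (hA : A < ∞) (hg : MemLp g r)
    (h : ∀ t ∈ Ioo 0 S, eLpNorm (w t) r volume ≤ A) :
    (⨆ t ∈ Icc 0 T, eLpNorm (withInitial g w t) r volume) < ∞ := by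
  refine lt_of_le_of_lt (iSup₂_le fun t ht => ?_) (max_lt hg.2 hA)
  rcases ht.1.eq_or_lt with rfl | h'
  · rw [withInitial_zero]
    exact le_max_left _ _
  · rw [withInitial_of_pos h']
    exact (h t ⟨h', ht.2.trans_lt hTS⟩).trans (le_max_right _ _)

lemma iSup_mul_withInitial_lt_top (hTS : T < S) {A : ℝ≥0∞} (hA : A < ∞) {ρ : ℝ → ℝ≥0∞}
    (h : ∀ t ∈ Ioo 0 S, ρ t * eLpNorm (w t) r volume ≤ A) :
    (⨆ t ∈ Ioc 0 T, ρ t * eLpNorm (withInitial g w t) r volume) < ∞ := by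
  refine lt_of_le_of_lt (iSup₂_le fun t ht => ?_) hA
  rw [withInitial_of_pos ht.1]
  exact h t ⟨ht.1, ht.2.trans_lt hTS⟩

end Initial

/-! ### Regularity of the solution -/

section Regularity

lemma weightX_three : weightX 3 = 0 := by
  simp [weightX]

lemma weightX_top : weightX ∞ = 1 / 2 := by simp [weightX]

lemma weightY_one : weightY 1 = 0 := by simp [weightY]

lemma weightY_top : weightY ∞ = 3 / 2 := by simp [weightY]

/-- A fixed point with finite norms. -/
structure IsLocalSolution (p q K : ℝ≥0∞) (T : ℝ) (a : ℝ → E3 → E3) (b : ℝ → E3 → ℝ)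
    (u : ℝ → E3 → E3) (θ : ℝ → E3 → ℝ) : Prop extends IsFixedPoint T a b u θ where
  bounds : SourceBounds p q K
  field_a : IsField a
  field_b : IsField b
  normX_lt_top : normX T p u < ∞
  normX_top_lt_top : normX T ∞ u < ∞
  normY_lt_top : normY T q θ < ∞
  normY_top_lt_top : normY T ∞ θ < ∞
  tendsto_normX : Tendsto (fun S => normX S p u) (𝓝[>] 0) (𝓝 0)
  tendsto_normX_top : Tendsto (fun S => normX S ∞ u) (𝓝[>] 0) (𝓝 0)
  tendsto_normY : Tendsto (fun S => normY S q θ) (𝓝[>] 0) (𝓝 0)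
  tendsto_normY_top : Tendsto (fun S => normY S ∞ θ) (𝓝[>] 0) (𝓝 0)

namespace IsLocalSolution

variable {p q K r : ℝ≥0∞} {a u : ℝ → E3 → E3} {b θ : ℝ → E3 → ℝ} {S T t : ℝ}

lemma memLp_velocityMap (h : IsLocalSolution p q K T a b u θ) (hr : IsVelocityExponent p r)
    (hur : normX T r u < ∞) (ht : t ∈ Ioo 0 T) (hat : MemLp (a t) r) :
    MemLp (velocityMap a u θ t) r := by
  have hK := h.bounds.ne_top.lt_top
  refine ⟨(isField_velocityMap h.field_a h.field_u h.field_θ).slice t, eLpNorm_lt_top_of_mul_le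
    (ν := weightX r) ht.1 ?_ (velocityMap_le h.bounds h.field_a h.field_u h.field_θ hr ht)⟩
  refine ENNReal.add_lt_top.2 ⟨ENNReal.add_lt_top.2 ⟨ENNReal.mul_lt_top ENNReal.ofReal_lt_top hat.2,
    ENNReal.mul_lt_top hK (ENNReal.mul_lt_top h.normX_lt_top hur)⟩,
    ENNReal.mul_lt_top hK h.normY_lt_top⟩

lemma memXr (h : IsLocalSolution p q K T a b u θ) (hr : IsVelocityExponent p r)
    (hur : normX T r u < ∞) (hST : S ≤ T) (ha : ∀ t ∈ Ioo 0 T, MemLp (a t) r)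
    (hat : ∀ t₀ ∈ Ioo 0 T, Tendsto (fun t => eLpNorm (a t - a t₀) r volume) (𝓝 t₀) (𝓝 0)) :
    MemXr S r u := by
  have hsub : Ioo 0 S ⊆ Ioo 0 T := Ioo_subset_Ioo_right hST
  refine ⟨memL1loc_of_tendsto (one_le_of_isVelocityExponent h.bounds.three_lt_p hr)
    (fun t ht => h.memLp_velocityMap hr hur (hsub ht) (ha t (hsub ht)))
    (fun t₀ ht => tendsto_velocityMap_sub h.bounds h.field_a h.field_u h.field_θ hr
      h.normX_lt_top hur h.normY_lt_top (hsub ht) (hat t₀ (hsub ht)))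
    (h.toIsFixedPoint.mono hST).velocity, (wnorm_mono hST).trans_lt hur⟩

lemma memLp_temperatureMap (h : IsLocalSolution p q K T a b u θ)
    (hf : HeatSupRegular 1 r T fun s y => ‖u s y‖ₑ * ‖θ s y‖ₑ) (ht : t ∈ Ioo 0 T)
    (hbt : MemLp (b t) r) : MemLp (temperatureMap b u θ t) r :=
  hbt.sub ⟨(isField_fluxTerm h.field_u h.field_θ).slice t,
    (eLpNorm_fluxTerm_le h.field_u h.field_θ t r).trans_lt
      (ENNReal.mul_lt_top kernelConst_ne_top.lt_top (hf.lt_top t ht))⟩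

lemma memYr (h : IsLocalSolution p q K T a b u θ) (hr : 1 ≤ r)
    (hf : HeatSupRegular 1 r T fun s y => ‖u s y‖ₑ * ‖θ s y‖ₑ)
    (hθr : normY T r θ < ∞) (hST : S ≤ T) (hb : ∀ t ∈ Ioo 0 T, MemLp (b t) r)
    (hbt : ∀ t₀ ∈ Ioo 0 T, Tendsto (fun t => eLpNorm (b t - b t₀) r volume) (𝓝 t₀) (𝓝 0)) :
    MemYr S r θ := by
  have hsub : Ioo 0 S ⊆ Ioo 0 T := Ioo_subset_Ioo_right hST
  refine ⟨memL1loc_of_tendsto hr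
    (fun t ht => h.memLp_temperatureMap hf (hsub ht) (hb t (hsub ht)))
    (fun t₀ ht => tendsto_temperatureMap_sub h.field_b h.field_u h.field_θ hr hf (hsub ht)
      (hbt t₀ (hsub ht)))
    (h.toIsFixedPoint.mono hST).temperature, (wnorm_mono hST).trans_lt hθr⟩

lemma heatSupRegular_flux (h : IsLocalSolution p q K T a b u θ) :
    HeatSupRegular 1 q T fun s y => ‖u s y‖ₑ * ‖θ s y‖ₑ :=
  (h.bounds.temperature E3 ℝ T u θ h.field_u h.field_θ).2 h.normX_lt_top h.normY_lt_top

lemma heatSupRegular_flux_top (h : IsLocalSolution p q K T a b u θ) :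
    HeatSupRegular 1 ∞ T fun s y => ‖u s y‖ₑ * ‖θ s y‖ₑ :=
  (h.bounds.temperature_top E3 ℝ T u θ h.field_u h.field_θ).2 h.normX_lt_top h.normY_lt_top
    h.normY_top_lt_top

lemma heatSupRegular_flux_one (h : IsLocalSolution p q K T a b u θ) (h1 : normY T 1 θ < ∞) :
    HeatSupRegular 1 1 T fun s y => ‖u s y‖ₑ * ‖θ s y‖ₑ :=
  (h.bounds.temperature_one E3 ℝ T u θ h.field_u h.field_θ).2 h.normX_top_lt_top h1

/-- The velocity map converges to its initial value in the weighted norm. -/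
lemma tendsto_mul_momentumTerm (h : IsLocalSolution p q K T a b u θ) (hT : 0 < T)
    (hr : IsVelocityExponent p r) (hur : normX T r u < ∞) :
    Tendsto (fun t => ENNReal.ofReal (t ^ weightX r) * eLpNorm (momentumTerm u t) r volume)
      (𝓝[>] 0) (𝓝 0) := by
  have h1 : Tendsto (fun t => K * (normX (2 * t) p u * normX T r u)) (𝓝[>] 0) (𝓝 0) := by
    have h2 := (ENNReal.Tendsto.mul_const (h.tendsto_normX.comp tendsto_two_mul_nhdsGT)
      (Or.inr hur.ne))
    have h3 := ENNReal.Tendsto.const_mul h2 (Or.inr h.bounds.ne_top)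
    rwa [zero_mul, mul_zero] at h3
  refine tendsto_of_tendsto_of_tendsto_of_le_of_le' tendsto_const_nhds h1
    (Eventually.of_forall fun _ => zero_le) ?_
  filter_upwards [Ioo_mem_nhdsGT (half_pos hT)] with t ht
  refine (momentumTerm_le h.bounds h.field_u hr (T := 2 * t) ⟨ht.1, by linarith [ht.1]⟩).trans ?_
  refine mul_le_mul' le_rfl (mul_le_mul' le_rfl (wnorm_mono ?_))
  linarith [ht.2]

lemma tendsto_mul_buoyancyTerm (h : IsLocalSolution p q K T a b u θ)
    (hr : IsVelocityExponent p r) :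
    Tendsto (fun t => ENNReal.ofReal (t ^ weightX r) * eLpNorm (buoyancyTerm θ t) r volume)
      (𝓝[>] 0) (𝓝 0) := by
  have h1 : Tendsto (fun t => K * normY (2 * t) q θ) (𝓝[>] 0) (𝓝 0) := by
    have h3 := ENNReal.Tendsto.const_mul (h.tendsto_normY.comp tendsto_two_mul_nhdsGT)
      (Or.inr h.bounds.ne_top)
    rwa [mul_zero] at h3
  refine tendsto_of_tendsto_of_tendsto_of_le_of_le' tendsto_const_nhds h1
    (Eventually.of_forall fun _ => zero_le) ?_
  filter_upwards [self_mem_nhdsWithin] with t ht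
  have ht0 : 0 < t := ht
  exact buoyancyTerm_le h.bounds h.field_θ hr (T := 2 * t) ⟨ht0, by linarith⟩

lemma tendsto_mul_velocityMap (h : IsLocalSolution p q K T a b u θ) (hT : 0 < T)
    (hr : IsVelocityExponent p r) (hur : normX T r u < ∞)
    (ha : Tendsto (fun t => ENNReal.ofReal (t ^ weightX r) * eLpNorm (a t) r volume)
      (𝓝[>] 0) (𝓝 0)) :
    Tendsto (fun t => ENNReal.ofReal (t ^ weightX r) * eLpNorm (velocityMap a u θ t) r volume)
      (𝓝[>] 0) (𝓝 0) := by
  have hr1 := one_le_of_isVelocityExponent h.bounds.three_lt_p hr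
  have h1 := (ha.add (h.tendsto_mul_momentumTerm hT hr hur)).add (h.tendsto_mul_buoyancyTerm hr)
  simp only [add_zero] at h1
  refine tendsto_of_tendsto_of_tendsto_of_le_of_le tendsto_const_nhds h1 (fun _ => zero_le)
    fun t => ?_
  have hM := (isField_momentumTerm h.field_u).slice t
  simp only [← mul_add]
  refine mul_le_mul' le_rfl ?_
  have e : velocityMap a u θ t = (a t - momentumTerm u t) + buoyancyTerm θ t := rfl
  rw [e]
  exact (eLpNorm_add_le ((h.field_a.slice t).sub hM) ((isField_buoyancyTerm h.field_θ).slice t)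
    hr1).trans (add_le_add (eLpNorm_sub_le (h.field_a.slice t) hM hr1) le_rfl)

/-- The weight of `X_3` is zero, so the weighted vanishing of the momentum and buoyancy terms is
their convergence to zero in `L³`, and only the free evolution has to be followed. -/
lemma tendsto_velocityMap_sub_initial (h : IsLocalSolution p q K T a b u θ) (hT : 0 < T)
    {g : E3 → E3} (hg : AEStronglyMeasurable g) (hu3 : normX T 3 u < ∞)
    (ha : Tendsto (fun t => eLpNorm (a t - g) 3 volume) (𝓝[>] 0) (𝓝 0)) :
    Tendsto (fun t => eLpNorm (velocityMap a u θ t - g) 3 volume) (𝓝[>] 0) (𝓝 0) := by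
  have hr : IsVelocityExponent p 3 := Or.inr (Or.inl rfl)
  have hr1 := one_le_of_isVelocityExponent h.bounds.three_lt_p hr
  have hM := h.tendsto_mul_momentumTerm hT hr hu3
  have hB := h.tendsto_mul_buoyancyTerm (r := 3) hr
  simp only [weightX_three, Real.rpow_zero, ENNReal.ofReal_one, one_mul] at hM hB
  have h1 := (ha.add hM).add hB
  simp only [add_zero] at h1
  refine tendsto_of_tendsto_of_tendsto_of_le_of_le tendsto_const_nhds h1 (fun _ => zero_le)
    fun t => ?_
  have hMm := (isField_momentumTerm h.field_u).slice t
  have e : velocityMap a u θ t - g = ((a t - g) - momentumTerm u t) + buoyancyTerm θ t := by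
    ext1 x
    simp only [Pi.sub_apply, Pi.add_apply, velocityMap]
    abel
  simp only [e]
  have hag := (h.field_a.slice t).sub hg
  exact (eLpNorm_add_le (hag.sub hMm) ((isField_buoyancyTerm h.field_θ).slice t)
    hr1).trans (add_le_add (eLpNorm_sub_le hag hMm hr1) le_rfl)

lemma divFree_velocityMap (h : IsLocalSolution p q K T a b u θ) (ht : t ∈ Ioo 0 T)
    (hat : MemLp (a t) ∞) (hd : DivFree (a t)) : DivFree (velocityMap a u θ t) := by
  have hr : IsVelocityExponent p ∞ := Or.inr (Or.inr rfl)
  have h1 := (heatSupRegular_momentum h.bounds h.field_u h.normX_lt_top hr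
    h.normX_top_lt_top).lt_top t ht
  have h2 := ((h.bounds.buoyancy ∞ hr ℝ T θ h.field_θ).2 h.normY_lt_top).lt_top t ht
  have hM : MemLp (momentumTerm u t) ∞ := ⟨(isField_momentumTerm h.field_u).slice t,
    (eLpNorm_momentumTerm_le h.field_u t ∞).trans_lt
      (ENNReal.mul_lt_top kernelConst_ne_top.lt_top h1)⟩
  have hB : MemLp (buoyancyTerm θ t) ∞ := ⟨(isField_buoyancyTerm h.field_θ).slice t,
    (eLpNorm_buoyancyTerm_le h.field_θ t ∞).trans_lt
      (ENNReal.mul_lt_top kernelConst_ne_top.lt_top h2)⟩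
  have e : velocityMap a u θ t = (a t + -momentumTerm u t) + buoyancyTerm θ t := by
    ext1 x
    simp only [Pi.neg_apply, Pi.add_apply, velocityMap]
    abel
  rw [e]
  exact (hd.add le_top le_top hat hM.neg (divFree_momentumTerm h.field_u h1).neg).add le_top le_top
    (hat.add hM.neg) hB (divFree_buoyancyTerm h.field_θ h2)

lemma tendsto_mul_temperatureMap_top (h : IsLocalSolution p q K T a b u θ)
    (hb : Tendsto (fun t => ENNReal.ofReal (t ^ weightY ∞) * eLpNorm (b t) ∞ volume)
      (𝓝[>] 0) (𝓝 0)) :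
    Tendsto (fun t => ENNReal.ofReal (t ^ weightY ∞) * eLpNorm (temperatureMap b u θ t) ∞ volume)
      (𝓝[>] 0) (𝓝 0) := by
  have h1 : Tendsto (fun t => K * (normX (2 * t) p u * (normY (2 * t) q θ + normY (2 * t) ∞ θ)))
      (𝓝[>] 0) (𝓝 0) := by
    have h2 := ENNReal.Tendsto.mul (h.tendsto_normX.comp tendsto_two_mul_nhdsGT)
      (Or.inr (by simp)) ((h.tendsto_normY.comp tendsto_two_mul_nhdsGT).add
        (h.tendsto_normY_top.comp tendsto_two_mul_nhdsGT)) (Or.inr ENNReal.zero_ne_top)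
    have h3 := ENNReal.Tendsto.const_mul h2 (Or.inr h.bounds.ne_top)
    rwa [zero_mul, mul_zero] at h3
  have h4 := hb.add h1
  rw [add_zero] at h4
  refine tendsto_of_tendsto_of_tendsto_of_le_of_le' tendsto_const_nhds h4
    (Eventually.of_forall fun _ => zero_le) ?_
  filter_upwards [self_mem_nhdsWithin] with t ht
  have ht0 : 0 < t := ht
  exact temperatureMap_le_of_fluxTerm_le h.field_b h.field_u h.field_θ le_top
    (fluxTerm_top_le h.bounds h.field_u h.field_θ (T := 2 * t) ⟨ht0, by linarith⟩)

lemma tendsto_temperatureMap_sub_initial (h : IsLocalSolution p q K T a b u θ) (hT : 0 < T)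
    {g : E3 → ℝ} (hg : AEStronglyMeasurable g) (hθ1 : normY T 1 θ < ∞)
    (hb : Tendsto (fun t => eLpNorm (b t - g) 1 volume) (𝓝[>] 0) (𝓝 0)) :
    Tendsto (fun t => eLpNorm (temperatureMap b u θ t - g) 1 volume) (𝓝[>] 0) (𝓝 0) := by
  have h1 : Tendsto (fun t => K * (normX (2 * t) ∞ u * normY T 1 θ)) (𝓝[>] 0) (𝓝 0) := by
    have h2 := (ENNReal.Tendsto.mul_const (h.tendsto_normX_top.comp tendsto_two_mul_nhdsGT)
      (Or.inr hθ1.ne))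
    have h3 := ENNReal.Tendsto.const_mul h2 (Or.inr h.bounds.ne_top)
    rwa [zero_mul, mul_zero] at h3
  have h4 := hb.add h1
  rw [add_zero] at h4
  refine tendsto_of_tendsto_of_tendsto_of_le_of_le' tendsto_const_nhds h4
    (Eventually.of_forall fun _ => zero_le) ?_
  filter_upwards [Ioo_mem_nhdsGT (half_pos hT)] with t ht
  have e : temperatureMap b u θ t - g = (b t - g) - fluxTerm u θ t := by
    ext1 x
    simp only [Pi.sub_apply, temperatureMap]
    ring
  rw [e]
  refine (eLpNorm_sub_le ((h.field_b.slice t).sub hg)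
    ((isField_fluxTerm h.field_u h.field_θ).slice t) le_rfl).trans (add_le_add le_rfl ?_)
  have h5 := fluxTerm_one_le h.bounds h.field_u h.field_θ (T := 2 * t) ⟨ht.1, by linarith [ht.1]⟩
  rw [weightY_one, Real.rpow_zero, ENNReal.ofReal_one, one_mul] at h5
  refine h5.trans (mul_le_mul' le_rfl (mul_le_mul' le_rfl (wnorm_mono ?_)))
  linarith [ht.2]

end IsLocalSolution

end Regularity

/-! ### Existence of local solutions -/

section Existence

variable {p q K R : ℝ≥0∞} {a u : ℝ → E3 → E3} {b θ : ℝ → E3 → ℝ} {u₀ : TDist E3} {θ₀ : TDist ℝ}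
  {S T : ℝ}

/-- The right-hand side is independent of `p`: smoothing from `L^p` to `L^r` changes the weight by
exactly the difference of the scaling exponents. This is the form in which the decay of heat data is
stated. -/
lemma weightX_eq_of_le {r : ℝ≥0∞} : weightX r =
    (1 - 3 * (p⁻¹).toReal) / 2 + 3 / 2 * (p⁻¹.toReal - r⁻¹.toReal) := by
  unfold weightX; ring

lemma weightY_eq_of_le {r : ℝ≥0∞} : weightY r =
    (3 * (1 - (q⁻¹).toReal)) / 2 + 3 / 2 * (q⁻¹.toReal - r⁻¹.toReal) := by
  unfold weightY; ring

lemma tendsto_two_mul_add {ι : Type*} {l : Filter ι} {A B : ι → ℝ≥0∞} (hK : K ≠ ∞)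
    (hA : Tendsto A l (𝓝 0)) (hB : Tendsto B l (𝓝 0)) :
    Tendsto (fun i => 2 * (A i + 2 * K * B i)) l (𝓝 0) := by
  have h1 := ENNReal.Tendsto.const_mul hB (a := 2 * K) (Or.inr (by finiteness))
  rw [mul_zero] at h1
  have h2 := hA.add h1
  rw [add_zero] at h2
  have h3 := ENNReal.Tendsto.const_mul h2 (a := 2) (Or.inr (by simp))
  rwa [mul_zero] at h3

/-- Every smallness condition needed on `T` concerns a quantity that tends to zero with the length
of the interval, so all hold together for some `T`. The restriction `T < 1` comes from the Besov
norm, which controls the heat flow only for times below one. -/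
theorem exists_isLocalSolution (hK : SourceBounds p q K) (hR : 16 * (K * K * R) ≤ 1) (hR0 : 0 < R)
    (hRt : R < ∞) (ha : IsHeatData (1 - 3 * (p⁻¹).toReal) p u₀ a)
    (hb : IsHeatData (3 * (1 - (q⁻¹).toReal)) q θ₀ b) :
    ∃ T : ℝ, 0 < T ∧ T < 1 ∧ ∃ u θ, IsLocalSolution p q K T a b u θ ∧
      normX T p u < R ∧ normY T q θ < R ∧
      (∀ t ∈ Ioo 0 T, ENNReal.ofReal (t ^ weightX ∞) * eLpNorm (a t) ∞ volume ≤ 1) ∧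
      (∀ t ∈ Ioo 0 T, ENNReal.ofReal (t ^ weightY ∞) * eLpNorm (b t) ∞ volume ≤ 1) ∧
      (normX T 3 a < ∞ → normX T 3 u < ∞) ∧ (normY T 1 b < ∞ → normY T 1 θ < ∞) := by
  have hp1 := one_le_of_isVelocityExponent hK.three_lt_p (Or.inl rfl)
  have hq1 := hK.one_le_q
  have hKt := hK.ne_top
  have hA : Tendsto (fun S => normX S p a) (𝓝[>] 0) (𝓝 0) :=
    ha.tendsto_wnorm hp1 le_rfl (weightX_eq_of_le (p := p))
  have hA' : Tendsto (fun S => normX S ∞ a) (𝓝[>] 0) (𝓝 0) :=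
    ha.tendsto_wnorm hp1 le_top (weightX_eq_of_le (p := p))
  have hB : Tendsto (fun S => normY S q b) (𝓝[>] 0) (𝓝 0) :=
    hb.tendsto_wnorm hq1 le_rfl (weightY_eq_of_le (q := q))
  have hB' : Tendsto (fun S => normY S ∞ b) (𝓝[>] 0) (𝓝 0) :=
    hb.tendsto_wnorm hq1 le_top (weightY_eq_of_le (q := q))
  have hr : Tendsto (fun S => velocityRadius p q K a b S) (𝓝[>] 0) (𝓝 0) :=
    tendsto_two_mul_add hKt hA hB
  have hr' := tendsto_two_mul_add hKt hA' hB
  have hB2 := ENNReal.Tendsto.const_mul hB (a := 2) (Or.inr (by simp))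
  rw [mul_zero] at hB2
  have hBB := ENNReal.Tendsto.const_mul (hB'.add hB) (a := 2) (Or.inr (by simp))
  rw [add_zero, mul_zero] at hBB
  have hr'' := ENNReal.Tendsto.const_mul hr' (a := K) (Or.inr hKt)
  rw [mul_zero] at hr''
  -- The thresholds equal to `1` here and in `h2`, `h6`, `h7` are arbitrary and only ensure
  -- finiteness. Those in `h3` and `h4` enforce the radius `R`, and the one in `h5` gives the factor
  -- `1/2` needed for the bound in `L¹`.
  have h1 := ha.eventually_le hp1 le_top (weightX_eq_of_le (p := p) (r := ∞)) zero_lt_one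
  have h2 := hb.eventually_le hq1 le_top (weightY_eq_of_le (q := q) (r := ∞)) zero_lt_one
  have h3 := hr.eventually (gt_mem_nhds hR0)
  have h4 := hB2.eventually (gt_mem_nhds hR0)
  have h5 := hr''.eventually (gt_mem_nhds (ENNReal.inv_pos.2 (by simp : (2 : ℝ≥0∞) ≠ ∞)))
  have h6 := hr'.eventually (gt_mem_nhds zero_lt_one)
  have h7 := hBB.eventually (gt_mem_nhds zero_lt_one)
  obtain ⟨T, h1, h2, h3, h4, h5, h6, h7, hT⟩ := (h1.and (h2.and (h3.and (h4.and (h5.and (h6.and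
    (h7.and (Ioo_mem_nhdsGT (zero_lt_one (α := ℝ))))))))) ).exists
  obtain ⟨u, θ, hf, hle⟩ := exists_isFixedPoint hK hR hRt ha.measurable hb.measurable h3.le h4.le
  obtain ⟨hX, hY, hY', hY1⟩ := hle T le_rfl
  have hsmall : ∀ᶠ S in 𝓝[>] (0 : ℝ), S ≤ T := by
    filter_upwards [Ioo_mem_nhdsGT hT.1] with S hS using hS.2.le
  have hpE : IsVelocityExponent p p := Or.inl rfl
  have htE : IsVelocityExponent p ∞ := Or.inr (Or.inr rfl)
  have hBlt : normY T q b < ∞ := by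
    refine lt_of_le_of_lt ?_ (h4.trans hRt)
    calc normY T q b = 1 * normY T q b := (one_mul _).symm
      _ ≤ _ := by gcongr; exact one_le_two
  refine ⟨T, hT.1, hT.2, u, θ, ⟨hf, hK, ha.measurable, hb.measurable, ?_, ?_, ?_, ?_, ?_, ?_, ?_,
    ?_⟩, (hX p hpE).trans_lt h3, hY.trans_lt h4, h1, h2, fun h => ?_, fun h => ?_⟩
  · exact ((hX p hpE).trans_lt h3).trans hRt
  · exact ((hX ∞ htE).trans_lt h6).trans ENNReal.one_lt_top
  · exact (hY.trans_lt h4).trans hRt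
  · exact (hY'.trans_lt h7).trans ENNReal.one_lt_top
  · exact tendsto_of_tendsto_of_tendsto_of_le_of_le' tendsto_const_nhds hr
      (Eventually.of_forall fun _ => zero_le) (hsmall.mono fun S hS => (hle S hS).1 p hpE)
  · exact tendsto_of_tendsto_of_tendsto_of_le_of_le' tendsto_const_nhds hr'
      (Eventually.of_forall fun _ => zero_le) (hsmall.mono fun S hS => (hle S hS).1 ∞ htE)
  · exact tendsto_of_tendsto_of_tendsto_of_le_of_le' tendsto_const_nhds hB2
      (Eventually.of_forall fun _ => zero_le) (hsmall.mono fun S hS => (hle S hS).2.1)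
  · exact tendsto_of_tendsto_of_tendsto_of_le_of_le' tendsto_const_nhds hBB
      (Eventually.of_forall fun _ => zero_le) (hsmall.mono fun S hS => (hle S hS).2.2.1)
  · refine (hX 3 (Or.inr (Or.inl rfl))).trans_lt ?_
    finiteness
  · exact (hY1 h5.le).trans_lt (ENNReal.mul_lt_top (by simp) h)

variable {σ : ℝ}

/-- Regularity of the velocity for data in `L³`. -/
theorem IsLocalSolution.velocity_regularity (h : IsLocalSolution p q K T a b u θ) (hS : 0 < S)
    (hST : S < T) (hT : T < 1) (ha : IsHeatData σ p u₀ a) (hσ : σ = 1 - 3 * (p⁻¹).toReal)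
    (ha1 : ∀ t ∈ Ioo 0 T, ENNReal.ofReal (t ^ weightX ∞) * eLpNorm (a t) ∞ volume ≤ 1)
    (hd : DivFreeDist u₀) {g : E3 → E3} (hg : MemLp g 3) (hgu : IsFunction u₀ g)
    (hu3 : normX T 3 a < ∞ → normX T 3 u < ∞) :
    MemXr S 3 u ∧ ∃ U : ℝ → E3 → E3, MemX S U ∧ U 0 =ᵐ[volume] g ∧
      ∀ᵐ t ∂(volume.restrict (Ioo 0 S)), U t =ᵐ[volume] u t := by
  have hT1 : ∀ t ∈ Ioo 0 T, t ∈ Ioo (0 : ℝ) 1 := fun t ht => ⟨ht.1, ht.2.trans hT⟩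
  have h3 : (1 : ℝ≥0∞) ≤ 3 := by norm_num
  have hp1 := one_le_of_isVelocityExponent h.bounds.three_lt_p (Or.inl rfl)
  have hE3 : IsVelocityExponent p 3 := Or.inr (Or.inl rfl)
  have htE : IsVelocityExponent p ∞ := Or.inr (Or.inr rfl)
  have hKt := h.bounds.ne_top.lt_top
  have ha3 : ∀ t ∈ Ioo 0 T, eLpNorm (a t) 3 volume ≤ eLpNorm g 3 volume := fun t ht =>
    ha.eLpNorm_le_of_isFunction hgu h3 hg (hT1 t ht)
  have ham : ∀ t ∈ Ioo 0 T, MemLp (a t) 3 := fun t ht =>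
    ⟨h.field_a.slice t, (ha3 t ht).trans_lt hg.2⟩
  have hac : ∀ t₀ ∈ Ioo 0 T, Tendsto (fun t => eLpNorm (a t - a t₀) 3 volume) (𝓝 t₀) (𝓝 0) :=
    fun t ht => ha.tendsto_sub_of_isFunction hgu h3 hg (hT1 t ht)
  have hnu : normX T 3 u < ∞ := by
    refine hu3 (lt_of_le_of_lt (wnorm_le (ν := weightX 3) fun t ht => ?_) hg.2)
    rw [weightX_three, Real.rpow_zero, ENNReal.ofReal_one, one_mul]
    exact ha3 t ht
  have hbd : ∀ r, IsVelocityExponent p r → ∀ B : ℝ≥0∞,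
      (∀ t ∈ Ioo 0 T, ENNReal.ofReal (t ^ weightX r) * eLpNorm (a t) r volume ≤ B) →
      ∀ t ∈ Ioo 0 T, ENNReal.ofReal (t ^ weightX r) * eLpNorm (velocityMap a u θ t) r volume ≤
        B + K * (normX T p u * normX T r u) + K * normY T q θ := fun r hr B hB t ht =>
    (velocityMap_le h.bounds h.field_a h.field_u h.field_θ hr ht).trans
      (add_le_add (add_le_add (hB t ht) le_rfl) le_rfl)
  have hfin : ∀ r, normX T r u < ∞ → ∀ B : ℝ≥0∞, B < ∞ →
      B + K * (normX T p u * normX T r u) + K * normY T q θ < ∞ := by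
    intro r hr B hB
    have := h.normX_lt_top
    have := h.normY_lt_top
    finiteness
  have hsqrt : ∀ t : ℝ, √t = t ^ weightX ∞ := fun t => by rw [Real.sqrt_eq_rpow, weightX_top]
  -- The continuous representative is the right-hand side of the integral equation, regular at every
  -- positive time, completed by the datum at time zero.
  refine ⟨h.memXr hE3 hnu hST.le ham hac, withInitial g (velocityMap a u θ),
    ⟨?_, ?_, ENNReal.add_lt_top.2 ⟨?_, ?_⟩, ?_⟩, ?_, ?_⟩
  · exact continuousInto_withInitial hST hg
      (fun t ht => h.memLp_velocityMap hE3 hnu ht (ham t ht))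
      (fun t ht => tendsto_velocityMap_sub h.bounds h.field_a h.field_u h.field_θ hE3
        h.normX_lt_top hnu h.normY_lt_top ht (hac t ht))
      (h.tendsto_velocityMap_sub_initial (hS.trans hST) hg.1 hnu
        (ha.tendsto_zero_of_isFunction hgu h3 (by simp) hg))
  · intro t ht
    have hgd := divFree_of_isFunction h3 hg hgu hd
    rcases ht.1.eq_or_lt with rfl | h0
    · rwa [withInitial_zero]
    · have htT : t ∈ Ioo 0 T := ⟨h0, ht.2.trans_lt hST⟩
      rw [withInitial_of_pos h0]
      exact h.divFree_velocityMap htT (ha.memLp_of_le hp1 le_top (hT1 t htT))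
        ((divFree_heatConv h0 h3 hg hgd).congr_ae (ha.ae_eq_heatConv hgu (hT1 t htT)).symm)
  · refine iSup_withInitial_lt_top hST (hfin 3 hnu _ hg.2) hg fun t ht => ?_
    have h5 := hbd 3 hE3 (eLpNorm g 3 volume)
      (fun t ht => by simpa [weightX_three] using ha3 t ht) t ht
    simpa [weightX_three] using h5
  · simp only [hsqrt]
    exact iSup_mul_withInitial_lt_top hST (hfin ∞ h.normX_top_lt_top 1 ENNReal.one_lt_top)
      (hbd ∞ htE 1 ha1)
  · refine (h.tendsto_mul_velocityMap (hS.trans hST) htE h.normX_top_lt_top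
      (ha.tendsto_mul hp1 le_top (hσ ▸ weightX_eq_of_le))).congr' ?_
    filter_upwards [self_mem_nhdsWithin] with t ht
    rw [hsqrt, withInitial_of_pos ht]
  · rw [withInitial_zero]
  · filter_upwards [(h.toIsFixedPoint.mono hST.le).velocity, ae_restrict_mem measurableSet_Ioo]
      with t h5 ht
    rw [withInitial_of_pos ht.1]
    exact h5.symm

/-- Regularity of the temperature for data in `L¹`. -/
theorem IsLocalSolution.temperature_regularity (h : IsLocalSolution p q K T a b u θ) (hS : 0 < S)
    (hST : S < T) (hT : T < 1) (hb : IsHeatData σ q θ₀ b) (hσ : σ = 3 * (1 - (q⁻¹).toReal))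
    (hb1 : ∀ t ∈ Ioo 0 T, ENNReal.ofReal (t ^ weightY ∞) * eLpNorm (b t) ∞ volume ≤ 1)
    {g : E3 → ℝ} (hg : MemLp g 1) (hgθ : IsFunction θ₀ g)
    (hθ1 : normY T 1 b < ∞ → normY T 1 θ < ∞) :
    MemYr S 1 θ ∧ ∃ Θ : ℝ → E3 → ℝ, MemY S Θ ∧ Θ 0 =ᵐ[volume] g ∧
      ∀ᵐ t ∂(volume.restrict (Ioo 0 S)), Θ t =ᵐ[volume] θ t := by
  have hT1 : ∀ t ∈ Ioo 0 T, t ∈ Ioo (0 : ℝ) 1 := fun t ht => ⟨ht.1, ht.2.trans hT⟩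
  have hKt := h.bounds.ne_top.lt_top
  have hb3 : ∀ t ∈ Ioo 0 T, eLpNorm (b t) 1 volume ≤ eLpNorm g 1 volume := fun t ht =>
    hb.eLpNorm_le_of_isFunction hgθ le_rfl hg (hT1 t ht)
  have hbm : ∀ t ∈ Ioo 0 T, MemLp (b t) 1 := fun t ht =>
    ⟨h.field_b.slice t, (hb3 t ht).trans_lt hg.2⟩
  have hbc : ∀ t₀ ∈ Ioo 0 T, Tendsto (fun t => eLpNorm (b t - b t₀) 1 volume) (𝓝 t₀) (𝓝 0) :=
    fun t ht => hb.tendsto_sub_of_isFunction hgθ le_rfl hg (hT1 t ht)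
  have hnθ : normY T 1 θ < ∞ := by
    refine hθ1 (lt_of_le_of_lt (wnorm_le (ν := weightY 1) fun t ht => ?_) hg.2)
    rw [weightY_one, Real.rpow_zero, ENNReal.ofReal_one, one_mul]
    exact hb3 t ht
  have hreg := h.heatSupRegular_flux_one hnθ
  have hfin1 : eLpNorm g 1 volume + K * (normX T ∞ u * normY T 1 θ) < ∞ := by
    have := h.normX_top_lt_top
    have := hg.2
    finiteness
  have hfin2 : 1 + K * (normX T p u * (normY T q θ + normY T ∞ θ)) < ∞ := by
    have := h.normX_lt_top
    have := h.normY_lt_top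
    have := h.normY_top_lt_top
    finiteness
  refine ⟨h.memYr le_rfl hreg hnθ hST.le hbm hbc, withInitial g (temperatureMap b u θ),
    ⟨?_, ENNReal.add_lt_top.2 ⟨?_, ?_⟩, ?_⟩, ?_, ?_⟩
  · exact continuousInto_withInitial hST hg
      (fun t ht => h.memLp_temperatureMap hreg ht (hbm t ht))
      (fun t ht => tendsto_temperatureMap_sub h.field_b h.field_u h.field_θ le_rfl hreg ht
        (hbc t ht))
      (h.tendsto_temperatureMap_sub_initial (hS.trans hST) hg.1 hnθ
        (hb.tendsto_zero_of_isFunction hgθ le_rfl (by simp) hg))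
  · refine iSup_withInitial_lt_top hST hfin1 hg fun t ht => ?_
    have h5 := temperatureMap_le_of_fluxTerm_le h.field_b h.field_u h.field_θ le_rfl
      (fluxTerm_one_le h.bounds h.field_u h.field_θ ht)
    simp only [weightY_one, Real.rpow_zero, ENNReal.ofReal_one, one_mul] at h5
    exact h5.trans (add_le_add (hb3 t ht) le_rfl)
  · rw [← weightY_top]
    exact iSup_mul_withInitial_lt_top (ρ := fun t => ENNReal.ofReal (t ^ weightY ∞)) hST hfin2
      fun t ht => (temperatureMap_le_of_fluxTerm_le h.field_b h.field_u h.field_θ le_top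
        (fluxTerm_top_le h.bounds h.field_u h.field_θ ht)).trans
        (add_le_add (hb1 t ht) le_rfl)
  · rw [← weightY_top]
    refine (h.tendsto_mul_temperatureMap_top
      (hb.tendsto_mul h.bounds.one_le_q le_top (hσ ▸ weightY_eq_of_le))).congr' ?_
    filter_upwards [self_mem_nhdsWithin] with t ht
    rw [withInitial_of_pos ht]
  · rw [withInitial_zero]
  · filter_upwards [(h.toIsFixedPoint.mono hST.le).temperature, ae_restrict_mem measurableSet_Ioo]
      with t h5 ht
    rw [withInitial_of_pos ht.1]
    exact h5.symm

end Existence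

end Boussinesq

end

/-! ### Proof of the main theorem. -/

theorem theorem2p3 (p q : ℝ≥0∞) (hq : 3 / 2 < q) (hq' : q < 3) (hp : 3 < p)
    (hpq : 2 / 3 < p⁻¹ + q⁻¹) :
    ∃ R : ℝ≥0∞, 0 < R ∧ R < ∞ ∧
      ∀ (u₀ : TDist E3) (θ₀ : TDist ℝ),
        DivFreeDist u₀ →
        MemBesovClosure (1 - 3 * (p⁻¹).toReal) p u₀ →
        MemBesovClosure (3 * (1 - (q⁻¹).toReal)) q θ₀ →
        ∃ T : ℝ, 0 < T ∧ ∃ (u : ℝ → E3 → E3) (θ : ℝ → E3 → ℝ),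
          -- existence and smallness for short times
          (IsMildSolution T u₀ θ₀ u θ ∧ MemXr T p u ∧ MemYr T q θ ∧
            Tendsto (fun S => normX S p u) (𝓝[>] 0) (𝓝 0) ∧
            Tendsto (fun S => normY S q θ) (𝓝[>] 0) (𝓝 0)) ∧
          -- uniqueness in the ball of radius `R`
          (normX T p u < R ∧ normY T q θ < R ∧
            ∀ (S : ℝ) (v : ℝ → E3 → E3) (η : ℝ → E3 → ℝ), 0 < S → S ≤ T →
              IsMildSolution S u₀ θ₀ v η → MemXr S p v → MemYr S q η →
              normX S p v < R → normY S q η < R →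
              ∀ᵐ t ∂(volume.restrict (Ioo 0 S)),
                v t =ᵐ[volume] u t ∧ η t =ᵐ[volume] θ t) ∧
          -- regularity
          (MemXr T ∞ u ∧ MemYr T ∞ θ ∧
            Tendsto (fun S => normX S ∞ u) (𝓝[>] 0) (𝓝 0) ∧
            Tendsto (fun S => normY S ∞ θ) (𝓝[>] 0) (𝓝 0)) ∧
          -- data in `L³`
          (∀ g : E3 → E3, MemLp g 3 volume → IsFunction u₀ g →
            MemXr T 3 u ∧ ∃ U : ℝ → E3 → E3, MemX T U ∧ U 0 =ᵐ[volume] g ∧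
              ∀ᵐ t ∂(volume.restrict (Ioo 0 T)), U t =ᵐ[volume] u t) ∧
          -- data in `L¹`
          (∀ g : E3 → ℝ, MemLp g 1 volume → IsFunction θ₀ g →
            MemYr T 1 θ ∧ ∃ Θ : ℝ → E3 → ℝ, MemY T Θ ∧ Θ 0 =ᵐ[volume] g ∧
              ∀ᵐ t ∂(volume.restrict (Ioo 0 T)), Θ t =ᵐ[volume] θ t) := by
  obtain ⟨K, hK⟩ := exists_sourceBounds hq hq' hp hpq
  have hK0 : 16 * (K * K) ≠ 0 := by
    have := (zero_lt_one.trans_le hK.one_le).ne'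
    simp [this]
  have hKt : 16 * (K * K) ≠ ∞ := by
    have := hK.ne_top
    finiteness
  have hp1 := one_le_of_isVelocityExponent hK.three_lt_p (Or.inl rfl)
  have hq1 := hK.one_le_q
  -- The largest radius allowed by the contraction estimate. It depends only on `K`, which was
  -- chosen from `p` and `q` before the data.
  set R := (16 * (K * K))⁻¹ with hRdef
  have hR0 : 0 < R := ENNReal.inv_pos.2 hKt
  have hRt : R < ∞ := (ENNReal.inv_ne_top.2 hK0).lt_top
  have hR : 16 * (K * K * R) ≤ 1 := by
    rw [← mul_assoc, hRdef, ENNReal.mul_inv_cancel hK0 hKt]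
  refine ⟨R, hR0, hRt, fun u₀ θ₀ hd hu₀ hθ₀ => ?_⟩
  have hσ : 0 < 1 - 3 * (p⁻¹).toReal := by linarith [toReal_inv_lt_third hp]
  have hτ : 0 < 3 * (1 - (q⁻¹).toReal) := by
    have h1 : q⁻¹.toReal < 1 := by
      have h2 : q⁻¹ < 1 := by
        refine ENNReal.inv_lt_one.2 (lt_of_le_of_lt ?_ hq)
        rw [ENNReal.le_div_iff_mul_le (by simp) (by simp)]
        norm_num
      have h3 := (ENNReal.toReal_lt_toReal (h2.trans ENNReal.one_lt_top).ne ENNReal.one_ne_top).2 h2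
      simpa using h3
    linarith
  obtain ⟨a, ha⟩ := exists_isHeatData hσ hp1 hu₀
  obtain ⟨b, hb⟩ := exists_isHeatData hτ hq1 hθ₀
  obtain ⟨T, hT0, hT1, u, θ, h, huR, hθR, ha1, hb1, hu3, hθ1⟩ :=
    exists_isLocalSolution hK hR hR0 hRt ha hb
  -- The solution is built on `(0,T)` and the theorem is stated on `(0,T/2)`, so that continuity and
  -- bounds up to the closed endpoint are interior statements.
  have hS : 0 < T / 2 := half_pos hT0
  have hST : T / 2 < T := half_lt_self hT0
  have hTm : ∀ t ∈ Ioo 0 T, t ∈ Ioo (0 : ℝ) 1 := fun t ht => ⟨ht.1, ht.2.trans hT1⟩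
  have hf := h.toIsFixedPoint.mono hST.le
  have huS : normX (T / 2) p u ≤ normX T p u := wnorm_mono hST.le
  have hθS : normY (T / 2) q θ ≤ normY T q θ := wnorm_mono hST.le
  refine ⟨T / 2, hS, u, θ, ⟨?_, ?_, ?_, h.tendsto_normX, h.tendsto_normY⟩,
    ⟨huS.trans_lt huR, hθS.trans_lt hθR, fun S v η _ hS' hm _ _ hv hη => ?_⟩,
    ⟨?_, ?_, h.tendsto_normX_top, h.tendsto_normY_top⟩, fun g hg hgu => ?_, fun g hg hgθ => ?_⟩
  · exact hf.isMildSolution hK ha hb (hST.trans hT1).le hd (huS.trans_lt h.normX_lt_top)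
      (hθS.trans_lt h.normY_lt_top)
  · exact h.memXr (Or.inl rfl) h.normX_lt_top hST.le (fun t ht => ha.memLp (hTm t ht))
      fun t ht => ha.tendsto_sub hp1 le_rfl (hTm t ht)
  · exact h.memYr hq1 h.heatSupRegular_flux h.normY_lt_top hST.le
      (fun t ht => hb.memLp (hTm t ht)) fun t ht => hb.tendsto_sub hq1 le_rfl (hTm t ht)
  · exact hf.ae_eq_of_isMildSolution hK hR hRt ha hb (hST.trans hT1).le (huS.trans huR.le)
      (hθS.trans hθR.le) hS' hm hv.le hη.le
  · exact h.memXr (Or.inr (Or.inr rfl)) h.normX_top_lt_top hST.le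
      (fun t ht => ha.memLp_of_le hp1 le_top (hTm t ht))
      fun t ht => ha.tendsto_sub hp1 le_top (hTm t ht)
  · exact h.memYr le_top h.heatSupRegular_flux_top h.normY_top_lt_top hST.le
      (fun t ht => hb.memLp_of_le hq1 le_top (hTm t ht))
      fun t ht => hb.tendsto_sub hq1 le_top (hTm t ht)
  · exact h.velocity_regularity hS hST hT1 ha rfl ha1 hd hg hgu hu3
  · exact h.temperature_regularity hS hST hT1 hb rfl hb1 hg hgθ hθ1
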